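/- **Setting.** Let $n\ge 0$ be an integer and $d=n+1$; the ground field is $\mathbb R$. *Graph complex.* $\mathsf{Gra}_d(N)$ is the graded vector space spanned by directed multigraphs (tadpoles allowed) with vertices labelled $1,\dots,N$ and ordered edges, of degree $1-d$ per edge, modulo: reversing an edge gives the sign $(-1)^d$, and a permutation $\sigma$ of the edges gives the sign $\mathrm{sgn}(\sigma)$ for $d$ even and no sign for $d$ odd. These spaces form an operad: $\gamma\circ_i\gamma'$ replaces the vertex $i$ of $\gamma$ by $\gamma'$ and sums over all ways of reconnecting the half-edges of $\gamma$ at $i$ to vertices of $\gamma'$. The full graph complex is the convolution Lie algebra $\mathsf{fGC}_d=\prod_{N\ge1}\big(\mathsf{Gra}_d(N)\otimes\mathrm{sgn}_N^{\otimes d}[d(1-N)]\big)^{\mathbb S_N}$, in which a graph with $N$ vertices and $k$ edges has degree $d(N-1)+k(1-d)$, with the graded commutator of the pre-Lie product $\gamma\circ\gamma'=\sum\pm\,\gamma\circ_1\gamma'$ (sum over unshuffles) as bracket, and with the differential $\delta=[\bullet\!\!-\!\!\bullet,\,\cdot\,]$. Let $Z^0$ and $B^0$ be the cocycles and coboundaries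 of degree $0$ and $H^0(\mathsf{fGC}_d)=Z^0/B^0$. *$n$-Schouten algebra.* Let $\mathcal V$ be an NP-manifold (graded symplectic manifold) of degree $n$ in homogeneous Darboux coordinates over an open set $U$: coordinates $x^\mu,p_\mu$ of degrees $0,n$; for $1\le i\le (n-1)/2$, coordinates $\psi^{\alpha_i},\chi_{\alpha_i}$ of degrees $i,n-i$; and, for $n$ even, $\xi^a$ of degree $n/2$ with a constant nondegenerate form $\kappa$ (symmetric if $n/2$ is odd, skew if $n/2$ is even); $U$ is an open subset of the space of the degree-$0$ coordinates. Functions on $\mathcal V$ are smooth on $U$ and polynomial in the coordinates of positive degree, and $\{f,g\}=\sum_{I,J}(-1)^{|J||f|}\Omega^{IJ}\,\partial_If\,\partial_Jg$ is the Poisson bracket, of degree $-n$, where the nonzero coefficients are $\Omega^{x^\mu p_\mu}=1$, $\Omega^{p_\mu x^\mu}=(-1)^{n+1}$, $\Omega^{\psi^{\alpha_i}\chi_{\alpha_i}}=1$, $\Omega^{\chi_{\alpha_i}\psi^{\alpha_i}}=-(-1)^i$ for $n$ even and $1$ for $n$ odd, and $\Omega^{\xi^a\xi^b}=\kappa^{ab}$.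 The $n$-Schouten algebra is $\mathcal T=\mathcal T^{(n)}_{\rm poly}=\mathscr C^\infty(\mathcal V)[n]$ with the bracket $[\cdot,\cdot]_S=s^{-1}\circ\{\cdot,\cdot\}\circ(s\otimes s)$, where $s:\mathcal T\to\mathscr C^\infty(\mathcal V)$ is the suspension of degree $n$. *Representation.* For a graph $\gamma$ with $N$ vertices put $\mathsf{Rep}^{(d)}(\gamma)(f_1\otimes\cdots\otimes f_N)=\mu_N\big(\prod_{(i,j)}\Delta_{ij}(f_1\otimes\cdots\otimes f_N)\big)$, the product over the edges $(i,j)$ of $\gamma$, with $\Delta_{ij}=\sum_{I,J}\Omega^{IJ}\partial_I^{(i)}\partial_J^{(j)}$ and $\mu_N$ the multiplication; $s^*\mathsf{Rep}^{(d)}(\gamma)$ is the pullback by $s$. For $\gamma$ of degree $0$ this is a Chevalley–Eilenberg cochain of degree $0$ on $\mathcal T$, i.e. a coderivation of the coalgebra $S(\mathcal T[1])$, and $\exp(s^*\mathsf{Rep}^{(d)}(\gamma))$ denotes its exponential. **Statement.** 1. For $\gamma_1,\gamma_2\in Z^0$ the Baker–Campbell–Hausdorff series $\mathrm{BCH}(\gamma_1,\gamma_2)$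 has only finitely many nonzero terms in each number of vertices and edges, and its sum lies in $Z^0$. The product $[\gamma_1]\cdot[\gamma_2]=[\mathrm{BCH}(\gamma_1,\gamma_2)]$ is well defined and makes the set $H^0(\mathsf{fGC}_d)$ a group, with unit $0$ and inverse $\gamma\mapsto-\gamma$: the pro-unipotent group $\exp(H^0(\mathsf{fGC}_d))$. 2. This group acts, up to homotopy, by $\mathsf{Lie}_\infty$-automorphisms on the $n$-Schouten algebra of every such $\mathcal V$, the class of a cocycle $\gamma$ acting by $\exp(s^*\mathsf{Rep}^{(d)}(\gamma))$. That is: * for each $\gamma\in Z^0$ the series $\exp(s^*\mathsf{Rep}^{(d)}(\gamma))$ has in each arity only finitely many nonzero terms, and it is a $\mathsf{Lie}_\infty$-automorphism of $(\mathcal T,[\cdot,\cdot]_S)$; * $\exp(s^*\mathsf{Rep}^{(d)}(0))=\mathrm{id}$ and $\exp(s^*\mathsf{Rep}^{(d)}(\mathrm{BCH}(\gamma_1,\gamma_2)))=\exp(s^*\mathsf{Rep}^{(d)}(\gamma_1))\circ\exp(s^*\mathsf{Rep}^{(d)}(\gamma_2))$ for all $\gamma_1,\gamma_2\in Z^0$;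 * cohomologous $\gamma_1,\gamma_2\in Z^0$ give homotopic $\mathsf{Lie}_\infty$-automorphisms: there are families $\mathcal U_t$ of $\mathsf{Lie}_\infty$-morphisms and $h_t$ of coderivations of degree $-1$ along $\mathcal U_t$, polynomial in $t$ in each arity, with $\mathcal U_0=\exp(s^*\mathsf{Rep}^{(d)}(\gamma_1))$, $\mathcal U_1=\exp(s^*\mathsf{Rep}^{(d)}(\gamma_2))$ and $\frac{d}{dt}\mathcal U_t=Q\circ h_t+h_t\circ Q$, where $Q$ is the codifferential of $S(\mathcal T[1])$ given by $[\cdot,\cdot]_S$. -/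

import Mathlib

open scoped TensorProduct ContDiff
noncomputable section

namespace GraphCx

/-- Directed multigraphs (tadpoles allowed) with vertex set `Fin N` and edges ordered by `Fin k`. -/
abbrev LGraph (N k : ℕ) : Type := Fin k → Fin N × Fin N

/-- Reversing an edge gives the sign `(-1)^d`; permuting the edges by `σ` gives `sgn(σ)^(d+1)`, that is,
the sign of `σ` for even `d` and no sign for odd `d`. -/
def edgeRel (d N k : ℕ) : Submodule ℝ (LGraph N k →₀ ℝ) :=
  Submodule.span ℝ
    ({r | ∃ (γ : LGraph N k) (e : Fin k),
        r = Finsupp.single (Function.update γ e (γ e).swap) 1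
          - (-1 : ℝ) ^ d • Finsupp.single γ 1} ∪
     {r | ∃ (γ : LGraph N k) (σ : Equiv.Perm (Fin k)),
        r = Finsupp.single (γ ∘ σ) 1
          - (((Equiv.Perm.sign σ : ℤˣ) : ℤ) : ℝ) ^ (d + 1) • Finsupp.single γ 1})

/-- The part with `N` vertices and `k` edges of the operad of graphs; its degree is `k * (1 - d)`. -/
def Gra (d N k : ℕ) : Type := (LGraph N k →₀ ℝ) ⧸ edgeRel d N k

instance (d N k : ℕ) : AddCommGroup (Gra d N k) :=
  inferInstanceAs (AddCommGroup ((LGraph N k →₀ ℝ) ⧸ edgeRel d N k))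

instance (d N k : ℕ) : Module ℝ (Gra d N k) :=
  inferInstanceAs (Module ℝ ((LGraph N k →₀ ℝ) ⧸ edgeRel d N k))

def graMk (d N k : ℕ) : (LGraph N k →₀ ℝ) →ₗ[ℝ] Gra d N k := (edgeRel d N k).mkQ

def graphClass (d : ℕ) {N k : ℕ} (γ : LGraph N k) : Gra d N k :=
  graMk d N k (Finsupp.single γ 1)

theorem graphClass_update (d : ℕ) {N k : ℕ} (γ : LGraph N k) (e : Fin k) :
    graphClass d (Function.update γ e (γ e).swap) = (-1 : ℝ) ^ d • graphClass d γ := by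
  rw [graphClass, graphClass, ← map_smul, ← sub_eq_zero, ← map_sub]
  exact (Submodule.Quotient.mk_eq_zero _).2 (Submodule.subset_span (Or.inl ⟨γ, e, rfl⟩))

theorem graphClass_perm (d : ℕ) {N k : ℕ} (γ : LGraph N k) (σ : Equiv.Perm (Fin k)) :
    graphClass d (γ ∘ σ)
      = (((Equiv.Perm.sign σ : ℤˣ) : ℤ) : ℝ) ^ (d + 1) • graphClass d γ := by
  rw [graphClass, graphClass, ← map_smul, ← sub_eq_zero, ← map_sub]
  exact (Submodule.Quotient.mk_eq_zero _).2 (Submodule.subset_span (Or.inr ⟨γ, σ, rfl⟩))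

/-- The universal property of `Gra d N k`. -/
def graLift (d : ℕ) {N k : ℕ} {M : Type*} [AddCommGroup M] [Module ℝ M] (F : LGraph N k → M)
    (h₁ : ∀ γ e, F (Function.update γ e (γ e).swap) = (-1 : ℝ) ^ d • F γ)
    (h₂ : ∀ γ (σ : Equiv.Perm (Fin k)),
      F (γ ∘ σ) = (((Equiv.Perm.sign σ : ℤˣ) : ℤ) : ℝ) ^ (d + 1) • F γ) :
    Gra d N k →ₗ[ℝ] M :=
  (edgeRel d N k).liftQ (Finsupp.linearCombination ℝ F) (by
    rw [edgeRel, Submodule.span_le]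
    rintro r (⟨γ, e, rfl⟩ | ⟨γ, σ, rfl⟩)
    · simp [h₁]
    · simp [h₂])

theorem graLift_class (d : ℕ) {N k : ℕ} {M : Type*} [AddCommGroup M] [Module ℝ M]
    (F : LGraph N k → M) (h₁ h₂) (γ : LGraph N k) :
    graLift d F h₁ h₂ (graphClass d γ) = F γ := by
  change (edgeRel d N k).liftQ (Finsupp.linearCombination ℝ F) _
    ((edgeRel d N k).mkQ (Finsupp.single γ 1)) = F γ
  simp

theorem gra_hom_ext {d N k : ℕ} {M : Type*} [AddCommGroup M] [Module ℝ M]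
    {f g : Gra d N k →ₗ[ℝ] M} (h : ∀ γ, f (graphClass d γ) = g (graphClass d γ)) : f = g := by
  refine Submodule.linearMap_qext (edgeRel d N k) (Finsupp.lhom_ext' fun γ => ?_)
  exact LinearMap.ext_ring (h γ)

def mapVertices {N N' k : ℕ} (f : Fin N → Fin N') (γ : LGraph N k) : LGraph N' k :=
  fun e => (f (γ e).1, f (γ e).2)

theorem mapVertices_update {N N' k : ℕ} (f : Fin N → Fin N') (γ : LGraph N k) (e : Fin k) :
    mapVertices f (Function.update γ e (γ e).swap)
      = Function.update (mapVertices f γ) e (mapVertices f γ e).swap := by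
  funext i
  by_cases hi : i = e
  · subst hi; simp [mapVertices]
  · simp [mapVertices, Function.update_of_ne hi]

/-- Relabelling of the vertices, `i ↦ σ⁻¹ i`. -/
def relabel (d : ℕ) {N k : ℕ} (σ : Equiv.Perm (Fin N)) : Gra d N k →ₗ[ℝ] Gra d N k :=
  graLift d (fun γ => graphClass d (mapVertices (σ⁻¹ : Equiv.Perm (Fin N)) γ))
    (fun γ e => by rw [mapVertices_update, graphClass_update])
    (fun γ τ => by rw [← graphClass_perm]; rfl)

/-- `Fin L → (Fin L)/B`: the vertices in `B` become the vertex `0`, the others follow in increasing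
order. -/
def collapse {L : ℕ} (B : Finset (Fin L)) (i : Fin L) : Fin (Bᶜ.card + 1) :=
  if h : i ∈ B then 0 else ((Bᶜ.orderIsoOfFin rfl).symm ⟨i, by simpa using h⟩).succ

/-- The edges of `h` followed by those of `γ'`, whose vertices are placed on `B` in increasing order. -/
def glue {L j k K : ℕ} (B : Finset (Fin L)) (hK : j + k = K) (h : LGraph L j)
    (γ' : LGraph B.card k) : LGraph L K :=
  Fin.append h (fun e => (B.orderEmbOfFin rfl (γ' e).1, B.orderEmbOfFin rfl (γ' e).2))
    ∘ Fin.cast hK.symm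

theorem glue_update_right {L j k K : ℕ} (B : Finset (Fin L)) (hK : j + k = K) (h : LGraph L j)
    (γ' : LGraph B.card k) (e : Fin k) :
    glue B hK h (Function.update γ' e (γ' e).swap)
      = Function.update (glue B hK h γ') (Fin.cast hK (Fin.natAdd j e))
          (glue B hK h γ' (Fin.cast hK (Fin.natAdd j e))).swap := by
  subst hK
  funext i
  refine Fin.addCases (fun i => ?_) (fun i => ?_) i
  · have : Fin.castAdd k i ≠ Fin.natAdd j e := by
      intro hh; have := congrArg Fin.val hh; simp at this; omega
    simp [glue, Function.update_of_ne this]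
  · by_cases hi : i = e
    · subst hi; simp [glue]
    · have : Fin.natAdd j i ≠ Fin.natAdd j e := by simpa using hi
      simp [glue, Function.update_of_ne this, Function.update_of_ne hi]

theorem glue_update_left {L j k K : ℕ} (B : Finset (Fin L)) (hK : j + k = K) (h : LGraph L j)
    (γ' : LGraph B.card k) (e : Fin j) :
    glue B hK (Function.update h e (h e).swap) γ'
      = Function.update (glue B hK h γ') (Fin.cast hK (Fin.castAdd k e))
          (glue B hK h γ' (Fin.cast hK (Fin.castAdd k e))).swap := by
  subst hK
  funext i
  refine Fin.addCases (fun i => ?_) (fun i => ?_) i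
  · by_cases hi : i = e
    · subst hi; simp [glue]
    · have : Fin.castAdd k i ≠ Fin.castAdd k e := by simpa using hi
      simp [glue, Function.update_of_ne this, Function.update_of_ne hi]
  · have : Fin.natAdd j i ≠ Fin.castAdd k e := by
      intro hh; have := congrArg Fin.val hh; simp at this; omega
    simp [glue, Function.update_of_ne this]

/-- The block sum of two permutations. -/
def sumPerm {j k K : ℕ} (hK : j + k = K) (σ : Equiv.Perm (Fin j)) (τ : Equiv.Perm (Fin k)) :
    Equiv.Perm (Fin K) :=
  (finSumFinEquiv.trans (finCongr hK)).permCongr (Equiv.Perm.sumCongr σ τ)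

theorem glue_perm {L j k K : ℕ} (B : Finset (Fin L)) (hK : j + k = K) (h : LGraph L j)
    (γ' : LGraph B.card k) (σ : Equiv.Perm (Fin j)) (τ : Equiv.Perm (Fin k)) :
    glue B hK (h ∘ σ) (γ' ∘ τ) = glue B hK h γ' ∘ sumPerm hK σ τ := by
  subst hK
  funext i
  refine Fin.addCases (fun i => ?_) (fun i => ?_) i
  · simp [glue, sumPerm]
  · simp [glue, sumPerm]

theorem sign_sumPerm {j k K : ℕ} (hK : j + k = K) (σ : Equiv.Perm (Fin j))
    (τ : Equiv.Perm (Fin k)) :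
    Equiv.Perm.sign (sumPerm hK σ τ) = Equiv.Perm.sign σ * Equiv.Perm.sign τ := by
  simp [sumPerm, Equiv.Perm.sign_permCongr]

/-- Operadic insertion of `γ'` at vertex `0` of `γ`; the vertices of `γ'` receive the labels in `B`, the other
vertices of `γ` the remaining labels. The half-edges of `γ` at vertex `0` are reconnected to the
vertices of `γ'` in all possible ways, and the edges of `γ` come before those of `γ'`. -/
def insertGraph (d : ℕ) {L j k K : ℕ} (B : Finset (Fin L)) (hK : j + k = K) :
    Gra d (Bᶜ.card + 1) j →ₗ[ℝ] Gra d B.card k →ₗ[ℝ] Gra d L K :=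
  graLift d
    (fun γ => graLift d
      (fun γ' => ∑ h : LGraph L j with mapVertices (collapse B) h = γ, graphClass d (glue B hK h γ'))
      (fun γ' e => by
        rw [Finset.smul_sum]
        refine Finset.sum_congr rfl fun h _ => ?_
        rw [glue_update_right, graphClass_update])
      (fun γ' τ => by
        rw [Finset.smul_sum]
        refine Finset.sum_congr rfl fun h _ => ?_
        have := glue_perm B hK h γ' 1 τ
        rw [Equiv.Perm.coe_one, Function.comp_id] at this
        rw [this, graphClass_perm, sign_sumPerm]
        simp))
    (fun γ e => by
      refine gra_hom_ext fun γ' => ?_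
      rw [graLift_class, LinearMap.smul_apply, graLift_class, Finset.smul_sum]
      refine Finset.sum_bij' (fun h _ => Function.update h e (h e).swap)
        (fun h _ => Function.update h e (h e).swap) ?_ ?_ ?_ ?_ ?_
      · intro h hh
        simp only [Finset.mem_filter, Finset.mem_univ, true_and] at hh ⊢
        rw [mapVertices_update, hh]; simp
      · intro h hh
        simp only [Finset.mem_filter, Finset.mem_univ, true_and] at hh ⊢
        rw [mapVertices_update, hh]
      · intro h _; simp
      · intro h _; simp
      · intro h _
        rw [glue_update_left, graphClass_update, smul_smul, ← mul_pow]
        simp)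
    (fun γ σ => by
      refine gra_hom_ext fun γ' => ?_
      rw [graLift_class, LinearMap.smul_apply, graLift_class, Finset.smul_sum]
      refine Finset.sum_bij' (fun h _ => h ∘ σ.symm) (fun h _ => h ∘ σ) ?_ ?_ ?_ ?_ ?_
      · intro h hh
        simp only [Finset.mem_filter, Finset.mem_univ, true_and] at hh ⊢
        have : mapVertices (collapse B) (h ∘ σ.symm) = mapVertices (collapse B) h ∘ σ.symm := rfl
        rw [this, hh]
        funext i; simp
      · intro h hh
        simp only [Finset.mem_filter, Finset.mem_univ, true_and] at hh ⊢
        have : mapVertices (collapse B) (h ∘ σ) = mapVertices (collapse B) h ∘ σ := rfl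
        rw [this, hh]
      · intro h _; funext i; simp
      · intro h _; funext i; simp
      · intro h _
        have h1 := glue_perm B hK (h ∘ σ.symm) γ' σ 1
        rw [Equiv.Perm.coe_one, Function.comp_id] at h1
        have h2 : (h ∘ σ.symm) ∘ σ = h := by funext i; simp
        rw [h2] at h1
        rw [h1, graphClass_perm, sign_sumPerm]
        simp)


/-- Families of graphs, one for each number `N` of vertices and `k` of edges: the product
`∏ N, ∏ k, Gra d N k`. -/
abbrev Fam (d : ℕ) : Type := ∀ N k : ℕ, Gra d N k

/-- Degree `p` of the full graph complex `∏ N ≥ 1, (Gra_d(N) ⊗ sgn^d [d(1 - N)])` (invariants): a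
graph with `N` vertices and `k` edges has degree `d (N - 1) + k (1 - d)`. -/
def fGC (d : ℕ) (p : ℤ) : Submodule ℝ (Fam d) where
  carrier := {c | (∀ k, c 0 k = 0) ∧
    (∀ N k, c N k ≠ 0 → (d : ℤ) * ((N : ℤ) - 1) + (k : ℤ) * (1 - (d : ℤ)) = p) ∧
    ∀ (N k : ℕ) (σ : Equiv.Perm (Fin N)),
      relabel d σ (c N k) = (((Equiv.Perm.sign σ : ℤˣ) : ℤ) : ℝ) ^ d • c N k}
  add_mem' := by
    rintro a b ⟨ha0, ha1, ha2⟩ ⟨hb0, hb1, hb2⟩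
    refine ⟨fun k => by simp [ha0, hb0], fun N k h => ?_, fun N k σ => ?_⟩
    · by_cases h' : a N k = 0
      · exact hb1 N k fun h'' => h (by simp [h', h''])
      · exact ha1 N k h'
    · simp only [Pi.add_apply, map_add, ha2, hb2, smul_add]
  zero_mem' := ⟨fun _ => rfl, fun N k h => absurd rfl h, fun N k σ => by simp⟩
  smul_mem' := by
    rintro r a ⟨ha0, ha1, ha2⟩
    refine ⟨fun k => by simp [ha0], fun N k h => ha1 N k fun h' => h (by simp [h']),
      fun N k σ => ?_⟩
    simp only [Pi.smul_apply, map_smul, ha2, smul_comm r]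

/-- The Koszul sign for moving letters of parities `e a` to positions ordered by `c a` (letters with
the same `c` keep their order). -/
def koszul {N : ℕ} (c : Fin N → ℕ) (e : Fin N → ZMod 2) : ℝ :=
  ∏ a : Fin N, ∏ b : Fin N, if a < b ∧ c b < c a ∧ e a = 1 ∧ e b = 1 then -1 else 1

/-- Puts the letters in `B` before those not in `B`. -/
def blockOf {N : ℕ} (B : Finset (Fin N)) (i : Fin N) : ℕ := if i ∈ B then 0 else 1

/-- The pre-Lie product of the convolution Lie algebra: the sum over unshuffles, that is over nonempty
subsets `B`, of the insertions of the second graph in the first. Vertices have parity `d`. -/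
def preLie (d : ℕ) : Fam d →ₗ[ℝ] Fam d →ₗ[ℝ] Fam d :=
  LinearMap.mk₂ ℝ
    (fun c c' L K => ∑ B : Finset (Fin L) with B.Nonempty,
      koszul (blockOf B) (fun _ => (d : ZMod 2)) • ∑ j : Fin (K + 1),
        insertGraph d B (show (j : ℕ) + (K - j) = K by omega)
          (c (Bᶜ.card + 1) j) (c' B.card (K - j)))
    (fun a b c => by
      funext L K
      simp only [Pi.add_apply, map_add, LinearMap.add_apply, Finset.sum_add_distrib, smul_add])
    (fun r a b => by
      funext L K
      simp only [Pi.smul_apply, map_smul, LinearMap.smul_apply, Finset.smul_sum, smul_comm r])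
    (fun a b c => by
      funext L K
      simp only [Pi.add_apply, map_add, Finset.sum_add_distrib, smul_add])
    (fun r a b => by
      funext L K
      simp only [Pi.smul_apply, map_smul, Finset.smul_sum, smul_comm r])

/-- The graded commutator, on elements of degrees `p` and `q`. -/
def bracket (d : ℕ) (p q : ℤ) : Fam d →ₗ[ℝ] Fam d →ₗ[ℝ] Fam d :=
  preLie d - ((Int.negOnePow (p * q) : ℤˣ) : ℤ) • (preLie d).flip

/-- The graph with two vertices joined by one edge. -/
def edgeGraph (d : ℕ) : Fam d
  | 2, 1 => graphClass d fun _ => (0, 1)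
  | _, _ => 0

/-- The differential `[edge, ·]` on degree `p` (the graph `edge` has degree `1`). -/
def differential (d : ℕ) (p : ℤ) : Fam d →ₗ[ℝ] Fam d := bracket d 1 p (edgeGraph d)

/-- Cocycles of degree `0`. -/
def cocycles (d : ℕ) : Submodule ℝ (Fam d) := fGC d 0 ⊓ LinearMap.ker (differential d 0)

/-- Coboundaries of degree `0`. -/
def coboundaries (d : ℕ) : Submodule ℝ (Fam d) := (fGC d (-1)).map (differential d (-1))

/-- `H⁰(fGC_d)`. -/
abbrev H0 (d : ℕ) : Type := cocycles d ⧸ (coboundaries d).submoduleOf (cocycles d)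

/-- The class of a cocycle. -/
def H0.mk {d : ℕ} (γ : cocycles d) : H0 d := Submodule.Quotient.mk γ


section extend
variable {E : Type*} [NormedAddCommGroup E] {U : TopologicalSpace.Opens E}

/-- Extension by zero. -/
def extZero (f : U → ℝ) : E → ℝ := Function.extend Subtype.val f (fun _ => 0)

theorem extZero_apply (f : U → ℝ) (u : U) : extZero f u = f u :=
  Subtype.val_injective.extend_apply _ _ u

theorem extZero_add (f g : U → ℝ) : extZero (f + g) = extZero f + extZero g := by
  funext y
  simp only [extZero, Function.extend, Pi.add_apply]
  split_ifs <;> simp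

theorem extZero_smul (r : ℝ) (f : U → ℝ) : extZero (r • f) = r • extZero f := by
  funext y
  simp only [extZero, Function.extend, Pi.smul_apply]
  split_ifs <;> simp

end extend

section smooth
variable {E : Type*} [NormedAddCommGroup E] [NormedSpace ℝ E]

/-- Smooth functions on an open set `U` (smoothness on `U` of the extension by zero). -/
def smoothFun (U : TopologicalSpace.Opens E) : Subalgebra ℝ (U → ℝ) where
  carrier := {f | ContDiffOn ℝ ∞ (Function.extend Subtype.val f (fun _ => 0)) U}
  mul_mem' {f g} hf hg := (ContDiffOn.mul hf hg).congr fun y hy => by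
    have h := fun f : U → ℝ => Subtype.val_injective.extend_apply f (fun _ => 0) (⟨y, hy⟩ : U)
    simp only at h
    simp [h]
  add_mem' {f g} hf hg := (ContDiffOn.add hf hg).congr fun y hy => by
    have h := fun f : U → ℝ => Subtype.val_injective.extend_apply f (fun _ => 0) (⟨y, hy⟩ : U)
    simp only at h
    simp [h]
  algebraMap_mem' r := (contDiffOn_const (c := r)).congr fun y hy => by
    have h := fun f : U → ℝ => Subtype.val_injective.extend_apply f (fun _ => 0) (⟨y, hy⟩ : U)
    simp only at h
    simp [h]

variable {U : TopologicalSpace.Opens E}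

theorem extZero_contDiffAt (f : smoothFun U) (u : U) :
    ContDiffAt ℝ ∞ (extZero (f : U → ℝ)) u :=
  ContDiffOn.contDiffAt f.2 (U.isOpen.mem_nhds u.2)

/-- The directional derivative along `v`. -/
def smoothDeriv (v : E) : smoothFun U →ₗ[ℝ] smoothFun U where
  toFun f := ⟨fun u => fderiv ℝ (extZero (f : U → ℝ)) u v, by
    have h : ContDiffOn ℝ ∞ (fun y => fderiv ℝ (extZero (f : U → ℝ)) y v) U :=
      (ContDiffOn.fderiv_of_isOpen (m := ∞) f.2 U.isOpen (by simp)).clm_apply contDiffOn_const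
    refine h.congr fun y hy => ?_
    exact Subtype.val_injective.extend_apply _ _ (⟨y, hy⟩ : U)⟩
  map_add' f g := by
    ext u
    have hf := (extZero_contDiffAt f u).differentiableAt (by simp)
    have hg := (extZero_contDiffAt g u).differentiableAt (by simp)
    simp [extZero_add, fderiv_add hf hg]
  map_smul' r f := by
    ext u
    have hf := (extZero_contDiffAt f u).differentiableAt (by simp)
    simp [extZero_smul, fderiv_const_smul hf]

theorem smoothDeriv_comm (v w : E) (f : smoothFun U) :
    smoothDeriv v (smoothDeriv w f) = smoothDeriv w (smoothDeriv v f) := by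
  have key : ∀ (v w : E) (u : U), (smoothDeriv v (smoothDeriv w f) : U → ℝ) u
      = fderiv ℝ (fderiv ℝ (extZero (f : U → ℝ))) u v w := by
    intro v w u
    have h1 : extZero (smoothDeriv w f : U → ℝ) =ᶠ[nhds (u : E)]
        fun y => fderiv ℝ (extZero (f : U → ℝ)) y w := by
      filter_upwards [U.isOpen.mem_nhds u.2] with y hy
      exact extZero_apply _ (⟨y, hy⟩ : U)
    have h2 : DifferentiableAt ℝ (fderiv ℝ (extZero (f : U → ℝ))) u :=
      ((extZero_contDiffAt f u).fderiv_right (m := 1)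
        (WithTop.coe_le_coe.2 (le_top (a := (2 : ℕ∞))))).differentiableAt (by simp)
    change fderiv ℝ (extZero (smoothDeriv w f : U → ℝ)) u v = _
    rw [h1.fderiv_eq, fderiv_clm_apply h2 (differentiableAt_const w)]
    simp
  ext u
  rw [key, key]
  exact ((extZero_contDiffAt f u).isSymmSndFDerivAt (by
    rw [minSmoothness_of_isRCLikeNormedField]
    exact WithTop.coe_le_coe.2 (le_top (a := (2 : ℕ∞))))).eq v w

end smooth

theorem ofFn_prod_swap {R : Type*} [Ring R] [Algebra ℝ R] (ε : ℝ) : ∀ (k : ℕ) (f : Fin (k + 1) → R)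
    (_ : ∀ a b, f a * f b = ε • (f b * f a)) (i : Fin k),
    (List.ofFn (f ∘ Equiv.swap i.castSucc i.succ)).prod = ε • (List.ofFn f).prod := by
  intro k
  induction k with
  | zero => intro f _ i; exact i.elim0
  | succ k ih =>
    intro f hf i
    refine Fin.cases ?_ (fun i => ?_) i
    · have h2 : ∀ j : Fin k, Equiv.swap (0 : Fin (k+2)) (1 : Fin (k+2)) j.succ.succ = j.succ.succ := by
        intro j
        apply Equiv.swap_apply_of_ne_of_ne
        · exact Fin.succ_ne_zero _
        · intro h; have := congrArg Fin.val h; simp at this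
      simp only [List.ofFn_succ, List.prod_cons, Function.comp_apply, ← mul_assoc]
      simp only [Fin.castSucc_zero, Fin.succ_zero_eq_one, Equiv.swap_apply_left, h2, Equiv.swap_apply_right]
      rw [hf 1 0, smul_mul_assoc]
    · have := ih (fun j => f j.succ) (fun a b => hf _ _) i
      have e0 : (f ∘ Equiv.swap i.succ.castSucc i.succ.succ) 0 = f 0 := by
        refine congrArg f (Equiv.swap_apply_of_ne_of_ne ?_ (Fin.succ_ne_zero _).symm)
        intro h; have := congrArg Fin.val h; simp at this
      have e1 : (fun j : Fin (k + 1) => (f ∘ Equiv.swap i.succ.castSucc i.succ.succ) j.succ)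
          = (fun j => f j.succ) ∘ Equiv.swap i.castSucc i.succ := by
        funext j
        simp only [Function.comp_apply]
        congr 1
        rw [← Fin.succ_castSucc]
        exact ((Fin.succ_injective _).map_swap _ _ _).symm
      rw [List.ofFn_succ, e0, e1, List.prod_cons, this, List.ofFn_succ (f := f), List.prod_cons,
        mul_smul_comm]

theorem ofFn_prod_perm {R : Type*} [Ring R] [Algebra ℝ R] (ε : ℝ) {k : ℕ} (f : Fin k → R)
    (hf : ∀ a b, f a * f b = ε • (f b * f a)) (F : Equiv.Perm (Fin k) →* ℝ)
    (hF : ∀ a b, a ≠ b → F (Equiv.swap a b) = ε) (σ : Equiv.Perm (Fin k)) :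
    (List.ofFn (f ∘ σ)).prod = F σ • (List.ofFn f).prod := by
  cases k with
  | zero =>
    have : σ = 1 := Subsingleton.elim _ _
    subst this; simp
  | succ k =>
    have hσ : σ ∈ Submonoid.closure (Set.range fun i : Fin k => Equiv.swap i.castSucc i.succ) := by
      rw [Equiv.Perm.mclosure_swap_castSucc_succ]; trivial
    induction hσ using Submonoid.closure_induction_right with
    | one => simp
    | mul_right σ hσ τ hτ ih =>
      obtain ⟨i, rfl⟩ := hτ
      have h := ofFn_prod_swap ε k (f ∘ σ) (fun a b => hf _ _) i
      rw [Equiv.Perm.coe_mul, ← Function.comp_assoc, h, ih, map_mul, hF _ _ (Fin.castSucc_lt_succ).ne, smul_smul, mul_comm]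


/-- Homogeneous Darboux coordinates for a symplectic form of degree `n`: pairs `x^μ`, `p_μ` of degrees
`0`, `n`; for `1 ≤ i ≤ (n-1)/2` pairs `ψ^α`, `χ_α` of degrees `i`, `n - i`, in number `r (i-1)`; and,
for even `n`, `q` coordinates `ξ^a` of degree `n/2` with a nondegenerate constant bilinear form `κ`,
symmetric if `n/2` is odd and skew-symmetric if `n/2` is even. -/
structure DarbouxShape (n : ℕ) where
  m : ℕ
  r : Fin ((n - 1) / 2) → ℕ
  q : ℕ
  q_eq_zero : Odd n → q = 0
  κ : Matrix (Fin q) (Fin q) ℝ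
  κ_symm : ∀ a b, κ a b = -(-1) ^ (n / 2) * κ b a
  κ_nondeg : IsUnit κ.det

/-- The coordinates. -/
inductive Coord {n : ℕ} (S : DarbouxShape n) : Type
  | x (μ : Fin S.m)
  | psi (α : Σ i, Fin (S.r i))
  | xi (a : Fin S.q)
  | chi (α : Σ i, Fin (S.r i))
  | p (μ : Fin S.m)
  deriving DecidableEq, Fintype

/-- The degree of a coordinate. -/
def Coord.deg {n : ℕ} {S : DarbouxShape n} : Coord S → ℕ
  | .x _ => 0
  | .psi α => (α.1 : ℕ) + 1
  | .xi _ => n / 2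
  | .chi α => n - ((α.1 : ℕ) + 1)
  | .p _ => n

/-- A graded symplectic (NP-) domain of degree `n` in Darboux coordinates: the body is an open set `U` in the
space of the coordinates of degree `0`. -/
structure NPDomain (n : ℕ) extends DarbouxShape n where
  U : TopologicalSpace.Opens ({I : Coord toDarbouxShape // I.deg = 0} → ℝ)

namespace NPDomain
variable {n : ℕ} (V : NPDomain n)

/-- All coordinates. -/
abbrev Crd : Type := Coord V.toDarbouxShape
/-- Coordinates of degree zero. -/
abbrev ZeroCrd : Type := {I : V.Crd // I.deg = 0}
/-- Coordinates of positive even degree. -/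
abbrev EvenCrd : Type := {I : V.Crd // 0 < I.deg ∧ Even I.deg}
/-- Coordinates of odd degree. -/
abbrev OddCrd : Type := {I : V.Crd // Odd I.deg}

/-- The algebra of functions: smooth functions on `U`, tensored with polynomials in the coordinates of
positive even degree and with the exterior algebra on the coordinates of odd degree. -/
def Fn : Type :=
  smoothFun V.U ⊗[ℝ] (MvPolynomial V.EvenCrd ℝ ⊗[ℝ] ExteriorAlgebra ℝ (V.OddCrd → ℝ))

instance : Ring V.Fn := inferInstanceAs (Ring
  (smoothFun V.U ⊗[ℝ] (MvPolynomial V.EvenCrd ℝ ⊗[ℝ] ExteriorAlgebra ℝ (V.OddCrd → ℝ))))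

instance : Algebra ℝ V.Fn := inferInstanceAs (Algebra ℝ
  (smoothFun V.U ⊗[ℝ] (MvPolynomial V.EvenCrd ℝ ⊗[ℝ] ExteriorAlgebra ℝ (V.OddCrd → ℝ))))


/-- The product `f P η`. -/
def pureFn (f : smoothFun V.U) (P : MvPolynomial V.EvenCrd ℝ)
    (η : ExteriorAlgebra ℝ (V.OddCrd → ℝ)) : V.Fn := f ⊗ₜ (P ⊗ₜ η)

/-- The tensor product of linear maps on the three factors. -/
def tensorMap (a : smoothFun V.U →ₗ[ℝ] smoothFun V.U)
    (b : MvPolynomial V.EvenCrd ℝ →ₗ[ℝ] MvPolynomial V.EvenCrd ℝ)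
    (c : ExteriorAlgebra ℝ (V.OddCrd → ℝ) →ₗ[ℝ] ExteriorAlgebra ℝ (V.OddCrd → ℝ)) :
    Module.End ℝ V.Fn :=
  TensorProduct.map a (TensorProduct.map b c)

theorem tensorMap_pureFn (a b c f P η) :
    V.tensorMap a b c (V.pureFn f P η) = V.pureFn (a f) (b P) (c η) := by
  rfl

theorem end_ext {M : Type*} [AddCommGroup M] [Module ℝ M] {F G : V.Fn →ₗ[ℝ] M}
    (h : ∀ f P η, F (V.pureFn f P η) = G (V.pureFn f P η)) : F = G := by
  refine TensorProduct.ext' fun f y => ?_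
  have : ∀ z, F (f ⊗ₜ z) = G (f ⊗ₜ z) := by
    intro z
    induction z using TensorProduct.induction_on with
    | zero => rw [TensorProduct.tmul_zero]; exact (map_zero F).trans (map_zero G).symm
    | tmul P η => exact h f P η
    | add z w hz hw => rw [TensorProduct.tmul_add]; exact (map_add F _ _).trans (by rw [hz, hw]; exact (map_add G _ _).symm)
  exact this y

/-- The parity operator: `f ↦ (-1)^f f`. -/
def par : Module.End ℝ V.Fn :=
  V.tensorMap LinearMap.id LinearMap.id
    (CliffordAlgebra.involute (Q := (0 : QuadraticForm ℝ (V.OddCrd → ℝ)))).toLinearMap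

/-- The left partial derivative with respect to the coordinate `I`. -/
def deriv (I : V.Crd) : Module.End ℝ V.Fn :=
  if h0 : I.deg = 0 then V.tensorMap (smoothDeriv (Pi.single ⟨I, h0⟩ 1)) LinearMap.id LinearMap.id
  else if h1 : Odd I.deg then
    V.tensorMap LinearMap.id LinearMap.id
      (CliffordAlgebra.contractLeft (Q := (0 : QuadraticForm ℝ (V.OddCrd → ℝ)))
        (LinearMap.proj ⟨I, h1⟩))
  else
    V.tensorMap LinearMap.id
      (MvPolynomial.pderiv (⟨I, Nat.pos_of_ne_zero h0, Nat.not_odd_iff_even.1 h1⟩ :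
        V.EvenCrd)).toLinearMap LinearMap.id


theorem par_pureFn (f P η) : V.par (V.pureFn f P η) = V.pureFn f P (CliffordAlgebra.involute η) :=
  rfl

theorem pureFn_neg (f P) (η : ExteriorAlgebra ℝ (V.OddCrd → ℝ)) :
    V.pureFn f P (-η) = -V.pureFn f P η := by
  change f ⊗ₜ (P ⊗ₜ (-η)) = -(f ⊗ₜ[ℝ] (P ⊗ₜ[ℝ] η))
  rw [TensorProduct.tmul_neg, TensorProduct.tmul_neg]

theorem involute_contractLeft {M : Type*} [AddCommGroup M] [Module ℝ M]
    (φ : Module.Dual ℝ M) (η : ExteriorAlgebra ℝ M) :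
    CliffordAlgebra.contractLeft φ (CliffordAlgebra.involute η)
      = -CliffordAlgebra.involute (CliffordAlgebra.contractLeft (Q := (0 : QuadraticForm ℝ M)) φ η) := by
  induction η using CliffordAlgebra.left_induction with
  | algebraMap r => simp [CliffordAlgebra.contractLeft_algebraMap]
  | add x y hx hy => simp only [map_add, hx, hy, neg_add]
  | ι_mul x m hx =>
    rw [map_mul, CliffordAlgebra.involute_ι, neg_mul, map_neg, CliffordAlgebra.contractLeft_ι_mul,
      CliffordAlgebra.contractLeft_ι_mul, hx]
    simp [CliffordAlgebra.involute_ι]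

theorem par_mul_par : V.par * V.par = 1 := by
  refine V.end_ext fun f P η => ?_
  rw [Module.End.mul_apply, par_pureFn, par_pureFn]
  simp

theorem deriv_mul_par (I : V.Crd) :
    V.deriv I * V.par = (-1 : ℝ) ^ I.deg • (V.par * V.deriv I) := by
  refine V.end_ext fun f P η => ?_
  rw [LinearMap.smul_apply, Module.End.mul_apply, Module.End.mul_apply, par_pureFn]
  unfold deriv
  split_ifs with h0 h1
  · simp [tensorMap_pureFn, par_pureFn, h0]
  · simp only [tensorMap_pureFn, par_pureFn, involute_contractLeft, pureFn_neg, h1.neg_one_pow]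
    simp
  · simp [tensorMap_pureFn, par_pureFn, (Nat.not_odd_iff_even.1 h1).neg_one_pow]

theorem pderiv_pderiv {σ : Type*} (i j : σ) (P : MvPolynomial σ ℝ) :
    MvPolynomial.pderiv i (MvPolynomial.pderiv j P)
      = MvPolynomial.pderiv j (MvPolynomial.pderiv i P) := by
  classical
  ext m
  simp only [MvPolynomial.coeff_pderiv, add_right_comm m]
  by_cases h : i = j
  · subst h; rfl
  · simp [h, Ne.symm h]; ring

theorem deriv_mul_deriv (I J : V.Crd) :
    V.deriv I * V.deriv J = (-1 : ℝ) ^ (I.deg * J.deg) • (V.deriv J * V.deriv I) := by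
  refine V.end_ext fun f P η => ?_
  rw [LinearMap.smul_apply, Module.End.mul_apply, Module.End.mul_apply]
  unfold deriv
  split_ifs with h0 h1 h2 h3 h4 h5 h6 h7
  · simp only [tensorMap_pureFn, h0]
    rw [smoothDeriv_comm]; simp
  · simp [tensorMap_pureFn, h0]
  · simp [tensorMap_pureFn, h0]
  · simp [tensorMap_pureFn, h4]
  · simp only [tensorMap_pureFn, (Odd.mul h3 h5).neg_one_pow, LinearMap.id_apply]
    rw [CliffordAlgebra.contractLeft_comm, pureFn_neg]; simp
  · simp [tensorMap_pureFn, ((Nat.not_odd_iff_even.1 h5).mul_left _).neg_one_pow]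
  · simp [tensorMap_pureFn, h6]
  · simp [tensorMap_pureFn, ((Nat.not_odd_iff_even.1 h3).mul_right _).neg_one_pow]
  · simp only [tensorMap_pureFn, ((Nat.not_odd_iff_even.1 h3).mul_right _).neg_one_pow,
      LinearMap.id_apply, one_smul]
    exact congrArg (fun P => V.pureFn f P η) (pderiv_pderiv _ _ P)

/-- The coefficients `Ω^{IJ}` of the Poisson tensor, which is also the coefficient of
`∂_I ⊗ ∂_J` in the bidifferential operator attached to an edge. -/
def poissonTensor : V.Crd → V.Crd → ℝ
  | .x μ, .p ν => if μ = ν then 1 else 0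
  | .p μ, .x ν => if μ = ν then (-1) ^ (n + 1) else 0
  | .psi α, .chi β => if α = β then 1 else 0
  | .chi α, .psi β => if α = β then (if Even n then -(-1) ^ ((α.1 : ℕ) + 1) else 1) else 0
  | .xi a, .xi b => V.κ⁻¹ a b
  | _, _ => 0

theorem κ_inv_symm (a b : Fin V.q) : V.κ⁻¹ a b = -(-1) ^ (n / 2) * V.κ⁻¹ b a := by
  have h : V.κ = (-(-1 : ℝ) ^ (n / 2)) • V.κ.transpose := by
    ext a b; simpa using V.κ_symm a b
  have h1 : (-(-1 : ℝ) ^ (n / 2)) * (-(-1 : ℝ) ^ (n / 2)) = 1 := by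
    rw [neg_mul_neg, ← mul_pow]; simp
  have h2 : V.κ⁻¹ = (-(-1 : ℝ) ^ (n / 2)) • (V.κ⁻¹).transpose := by
    apply Matrix.inv_eq_right_inv
    nth_rewrite 1 [h]
    rw [Matrix.smul_mul, Matrix.mul_smul, smul_smul, h1, one_smul, ← Matrix.transpose_mul,
      Matrix.nonsing_inv_mul _ V.κ_nondeg, Matrix.transpose_one]
  conv_lhs => rw [h2]
  simp

theorem deg_add_deg {I J : V.Crd} (h : V.poissonTensor I J ≠ 0) : I.deg + J.deg = n := by
  cases I <;> cases J <;> simp only [poissonTensor, ne_eq, not_true_eq_false] at h <;>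
    simp only [Coord.deg]
  · omega
  · rename_i α β
    have : α = β := by by_contra h'; simp [h'] at h
    subst this
    have := α.1.2; omega
  · rename_i a b
    rcases Nat.even_or_odd n with hn | hn
    · have := Nat.div_two_mul_two_of_even hn; omega
    · have := V.q_eq_zero hn; have := a.2; omega
  · rename_i α β
    have : α = β := by by_contra h'; simp [h'] at h
    subst this
    have := α.1.2; omega
  · omega

theorem poissonTensor_symm (I J : V.Crd) :
    V.poissonTensor J I = (-1 : ℝ) ^ (n + 1) * (-1) ^ (I.deg * J.deg) * V.poissonTensor I J := by
  have two : ((-1 : ℝ) ^ n) * (-1) ^ n = 1 := by rw [← mul_pow]; simp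
  cases I <;> cases J <;> simp only [poissonTensor, mul_zero]
  · rename_i μ ν
    by_cases h : μ = ν
    · simp [h, Coord.deg]
    · simp [h, Ne.symm h]
  · rename_i α β
    by_cases h : α = β
    · subst h
      simp only [if_true, Coord.deg, mul_one]
      have := α.1.2
      split_ifs with hn
      · rw [pow_succ _ n, hn.neg_one_pow]
        have : (-1 : ℝ) ^ (((α.1 : ℕ) + 1) * (n - ((α.1 : ℕ) + 1))) = (-1) ^ ((α.1 : ℕ) + 1) := by
          rcases Nat.even_or_odd ((α.1 : ℕ) + 1) with h | h
          · rw [(h.mul_right _).neg_one_pow, h.neg_one_pow]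
          · rw [(h.mul (Nat.Even.sub_odd (by omega) hn h)).neg_one_pow, h.neg_one_pow]
        rw [this]; ring
      · have hn := Nat.not_even_iff_odd.1 hn
        rw [pow_succ, hn.neg_one_pow]
        have : (-1 : ℝ) ^ (((α.1 : ℕ) + 1) * (n - ((α.1 : ℕ) + 1))) = 1 := by
          rcases Nat.even_or_odd ((α.1 : ℕ) + 1) with h | h
          · rw [(h.mul_right _).neg_one_pow]
          · rw [((Nat.Odd.sub_odd hn h).mul_left _).neg_one_pow]
        rw [this]; ring
    · simp [h, Ne.symm h]
  · rename_i a b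
    rcases Nat.even_or_odd n with hn | hn
    · rw [V.κ_inv_symm, pow_succ, hn.neg_one_pow]
      have : (-1 : ℝ) ^ ((Coord.xi (S := V.toDarbouxShape) a).deg * (Coord.xi (S := V.toDarbouxShape) b).deg) = (-1) ^ (n / 2) := by
        simp only [Coord.deg]
        rcases Nat.even_or_odd (n / 2) with h | h
        · rw [(h.mul_right _).neg_one_pow, h.neg_one_pow]
        · rw [(h.mul h).neg_one_pow, h.neg_one_pow]
      rw [this]; ring
    · have := V.q_eq_zero hn; have := a.2; omega
  · rename_i α β
    by_cases h : α = β
    · subst h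
      simp only [if_true, Coord.deg]
      have := α.1.2
      split_ifs with hn
      · rw [pow_succ, hn.neg_one_pow]
        have : (-1 : ℝ) ^ ((n - ((α.1 : ℕ) + 1)) * ((α.1 : ℕ) + 1)) = (-1) ^ ((α.1 : ℕ) + 1) := by
          rcases Nat.even_or_odd ((α.1 : ℕ) + 1) with h | h
          · rw [(h.mul_left _).neg_one_pow, h.neg_one_pow]
          · rw [((Nat.Even.sub_odd (by omega) hn h).mul h).neg_one_pow, h.neg_one_pow]
        rw [this]
        have : (-1 : ℝ) ^ ((α.1 : ℕ) + 1) * (-1) ^ ((α.1 : ℕ) + 1) = 1 := by rw [← mul_pow]; simp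
        linear_combination -this
      · have hn := Nat.not_even_iff_odd.1 hn
        rw [pow_succ, hn.neg_one_pow]
        have : (-1 : ℝ) ^ ((n - ((α.1 : ℕ) + 1)) * ((α.1 : ℕ) + 1)) = 1 := by
          rcases Nat.even_or_odd ((α.1 : ℕ) + 1) with h | h
          · rw [(h.mul_left _).neg_one_pow]
          · rw [((Nat.Odd.sub_odd hn h).mul_right _).neg_one_pow]
        rw [this]; ring
    · simp [h, Ne.symm h]
  · rename_i μ ν
    by_cases h : μ = ν
    · subst h
      simp only [if_true, Coord.deg]
      rw [pow_succ]
      linear_combination -two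
    · simp [h, Ne.symm h]

/-- The derivative along `I` in the tensor factor `v`, with the Koszul sign for passing the factors on its
left. -/
def slotDeriv {N : ℕ} (I : V.Crd) (v : Fin N) : Module.End ℝ (⨂[ℝ] _ : Fin N, V.Fn) :=
  PiTensorProduct.map fun u =>
    if u < v then V.par ^ I.deg else if u = v then V.deriv I else LinearMap.id

/-- `Δ_{ij} = ∑ Ω^{IJ} ∂_I^{(i)} ∂_J^{(j)}`. -/
def edgeOp {N : ℕ} (i j : Fin N) : Module.End ℝ (⨂[ℝ] _ : Fin N, V.Fn) :=
  ∑ I : V.Crd, ∑ J : V.Crd, V.poissonTensor I J • (V.slotDeriv I i * V.slotDeriv J j)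

theorem deriv_mul_par_pow (I : V.Crd) (k : ℕ) :
    V.deriv I * V.par ^ k = (-1 : ℝ) ^ (I.deg * k) • (V.par ^ k * V.deriv I) := by
  induction k with
  | zero => simp
  | succ k ih =>
    rw [pow_succ, ← mul_assoc, ih, smul_mul_assoc, mul_assoc, deriv_mul_par, mul_smul_comm, smul_smul, ← pow_add, mul_assoc, Nat.mul_succ]

theorem map_smul_slot {N : ℕ} (F G : Fin N → Module.End ℝ V.Fn) (v : Fin N) (r : ℝ)
    (hv : F v = r • G v) (h : ∀ u, u ≠ v → F u = G u) :
    PiTensorProduct.map F = r • PiTensorProduct.map G := by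
  have : F = Function.update G v (r • G v) := by
    funext u
    by_cases hu : u = v
    · subst hu; rw [hv, Function.update_self]
    · simp [hu, h u hu]
  rw [this, PiTensorProduct.map_update_smul, Function.update_eq_self]

theorem slotDeriv_comm {N : ℕ} (I J : V.Crd) (v w : Fin N) :
    V.slotDeriv I v * V.slotDeriv J w
      = (-1 : ℝ) ^ (I.deg * J.deg) • (V.slotDeriv J w * V.slotDeriv I v) := by
  have main : ∀ (I J : V.Crd) (v w : Fin N), v ≤ w → V.slotDeriv I v * V.slotDeriv J w
      = (-1 : ℝ) ^ (I.deg * J.deg) • (V.slotDeriv J w * V.slotDeriv I v) := by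
    intro I J v w hvw
    unfold slotDeriv
    rw [← PiTensorProduct.map_mul, ← PiTensorProduct.map_mul]
    refine V.map_smul_slot _ _ v _ ?_ ?_
    · rcases hvw.lt_or_eq with h | h
      · simp only [lt_self_iff_false, if_false, if_true, h]
        exact V.deriv_mul_par_pow I J.deg
      · subst h
        simp only [lt_self_iff_false, if_false, if_true]
        exact V.deriv_mul_deriv I J
    · intro u hu
      by_cases h1 : u < v
      · simp [h1, h1.trans_le hvw, ← pow_add, add_comm]
      · simp only [h1, hu, if_false]
        exact (one_mul _).trans (mul_one _).symm
  rcases le_total v w with h | h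
  · exact main I J v w h
  · rw [main J I w v h, smul_smul, mul_comm J.deg, ← mul_pow]
    simp

theorem edgeOp_flip {N : ℕ} (i j : Fin N) :
    (V.edgeOp j i : Module.End ℝ (⨂[ℝ] _ : Fin N, V.Fn)) = (-1 : ℝ) ^ (n + 1) • V.edgeOp i j := by
  unfold edgeOp
  rw [Finset.sum_comm, Finset.smul_sum]
  refine Finset.sum_congr rfl fun I _ => ?_
  rw [Finset.smul_sum]
  refine Finset.sum_congr rfl fun J _ => ?_
  rw [V.poissonTensor_symm I J, V.slotDeriv_comm J I, smul_smul, smul_smul]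
  congr 1
  have : ((-1 : ℝ) ^ (I.deg * J.deg)) * (-1) ^ (I.deg * J.deg) = 1 := by rw [← mul_pow]; simp
  rw [mul_comm J.deg]
  linear_combination ((-1 : ℝ) ^ (n + 1) * V.poissonTensor I J) * this

theorem edgeOp_comm {N : ℕ} (i j k l : Fin N) :
    (V.edgeOp i j * V.edgeOp k l : Module.End ℝ (⨂[ℝ] _ : Fin N, V.Fn))
      = (-1 : ℝ) ^ n • (V.edgeOp k l * V.edgeOp i j) := by
  have sum_eq : ∀ i j : Fin N, (V.edgeOp i j : Module.End ℝ (⨂[ℝ] _ : Fin N, V.Fn))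
      = ∑ P : V.Crd × V.Crd, V.poissonTensor P.1 P.2 • (V.slotDeriv P.1 i * V.slotDeriv P.2 j) :=
    fun i j => by rw [Fintype.sum_prod_type]; rfl
  rw [sum_eq i j, sum_eq k l, Finset.sum_mul_sum, Finset.sum_mul_sum, Finset.sum_comm]
  rw [Finset.smul_sum (r := (-1 : ℝ) ^ n)]
  refine Finset.sum_congr rfl fun Q _ => ?_
  rw [Finset.smul_sum (r := (-1 : ℝ) ^ n)]
  refine Finset.sum_congr rfl fun P _ => ?_
  by_cases hP : V.poissonTensor P.1 P.2 = 0
  · simp [hP]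
  by_cases hQ : V.poissonTensor Q.1 Q.2 = 0
  · simp [hQ]
  have key : ∀ (A B C D : Module.End ℝ (⨂[ℝ] _ : Fin N, V.Fn)) (a b c d : ℕ),
      A * C = (-1 : ℝ) ^ (a * c) • (C * A) → A * D = (-1 : ℝ) ^ (a * d) • (D * A) →
      B * C = (-1 : ℝ) ^ (b * c) • (C * B) → B * D = (-1 : ℝ) ^ (b * d) • (D * B) →
      A * B * (C * D) = (-1 : ℝ) ^ ((a + b) * (c + d)) • (C * D * (A * B)) := by
    intro A B C D a b c d h1 h2 h3 h4
    calc A * B * (C * D) = A * (B * C) * D := by simp only [mul_assoc]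
      _ = (-1 : ℝ) ^ (b * c) • (A * C * (B * D)) := by
          rw [h3, mul_smul_comm, smul_mul_assoc]; simp only [mul_assoc]
      _ = (-1 : ℝ) ^ (b * c) • (-1 : ℝ) ^ (a * c) • (-1 : ℝ) ^ (b * d) • (C * (A * D) * B) := by
          rw [h1, h4, smul_mul_assoc, mul_smul_comm]; simp only [mul_assoc]
      _ = _ := by
          rw [h2, mul_smul_comm, smul_mul_assoc, smul_smul, smul_smul, smul_smul, ← pow_add,
            ← pow_add, ← pow_add]
          have h5 : C * (D * A) * B = C * D * (A * B) := by simp only [mul_assoc]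
          rw [h5]
          congr 2
          ring
  have h := key _ _ _ _ _ _ _ _ (V.slotDeriv_comm P.1 Q.1 i k) (V.slotDeriv_comm P.1 Q.2 i l)
    (V.slotDeriv_comm P.2 Q.1 j k) (V.slotDeriv_comm P.2 Q.2 j l)
  have hn : (-1 : ℝ) ^ (n * n) = (-1) ^ n := by
    rcases Nat.even_or_odd n with hn | hn
    · rw [(hn.mul_left _).neg_one_pow, hn.neg_one_pow]
    · rw [(hn.mul hn).neg_one_pow, hn.neg_one_pow]
  rw [V.deg_add_deg hP, V.deg_add_deg hQ, hn] at h
  rw [smul_mul_smul_comm, smul_mul_smul_comm, h, mul_comm, smul_comm]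

/-- The multiplication of `N` functions. -/
def mulN (N : ℕ) : (⨂[ℝ] _ : Fin N, V.Fn) →ₗ[ℝ] V.Fn :=
  PiTensorProduct.lift (MultilinearMap.mkPiAlgebraFin ℝ N V.Fn)

/-- `f_1 ⊗ … ⊗ f_N ↦ μ_N (∏_{(i,j)} Δ_{ij} (f_1 ⊗ … ⊗ f_N))`, the product over the edges in their order. -/
def repRaw {N k : ℕ} (γ : Fin k → Fin N × Fin N) : (⨂[ℝ] _ : Fin N, V.Fn) →ₗ[ℝ] V.Fn :=
  V.mulN N ∘ₗ (List.ofFn fun e => V.edgeOp (γ e).1 (γ e).2).prod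

theorem repRaw_update {N k : ℕ} (γ : Fin k → Fin N × Fin N) (e : Fin k) :
    V.repRaw (Function.update γ e (γ e).swap) = (-1 : ℝ) ^ (n + 1) • V.repRaw γ := by
  have key : ∀ (k : ℕ) (f g : Fin k → Module.End ℝ (⨂[ℝ] _ : Fin N, V.Fn)) (e : Fin k)
      (r : ℝ), g e = r • f e → (∀ i, i ≠ e → g i = f i) →
      (List.ofFn g).prod = r • (List.ofFn f).prod := by
    intro k
    induction k with
    | zero => intro f g e; exact e.elim0
    | succ k ih =>
      intro f g e r he h
      rw [List.ofFn_succ, List.ofFn_succ, List.prod_cons, List.prod_cons]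
      refine Fin.cases (motive := fun e => g e = r • f e → (∀ i, i ≠ e → g i = f i) → _)
        (fun he h => ?_) (fun e he h => ?_) e he h
      · have : (fun i : Fin k => g i.succ) = fun i => f i.succ :=
          funext fun i => h _ (Fin.succ_ne_zero i)
        rw [this, he, smul_mul_assoc]
      · rw [h 0 (Fin.succ_ne_zero e).symm,
          ih (fun i => f i.succ) (fun i => g i.succ) e r he
            (fun i hi => h _ fun h' => hi (Fin.succ_injective _ h')), mul_smul_comm]
  unfold repRaw
  rw [key k (fun e => V.edgeOp (γ e).1 (γ e).2) _ e ((-1 : ℝ) ^ (n + 1))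
    (by simp [← V.edgeOp_flip]) (fun i hi => by simp [Function.update_of_ne hi]),
    LinearMap.comp_smul]

theorem repRaw_perm {N k : ℕ} (γ : Fin k → Fin N × Fin N) (σ : Equiv.Perm (Fin k)) :
    V.repRaw (γ ∘ σ) = (((Equiv.Perm.sign σ : ℤˣ) : ℤ) : ℝ) ^ (n + 1 + 1) • V.repRaw γ := by
  have h := ofFn_prod_perm ((-1 : ℝ) ^ n) (fun e => V.edgeOp (γ e).1 (γ e).2)
    (fun a b => V.edgeOp_comm _ _ _ _)
    ((powMonoidHom (n + 1 + 1)).comp (((Int.castRingHom ℝ : ℤ →* ℝ).comp (Units.coeHom ℤ)).comp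
      Equiv.Perm.sign)) (fun a b hab => by simp [Equiv.Perm.sign_swap hab, pow_succ]) σ
  unfold repRaw
  rw [← LinearMap.comp_smul]
  exact congrArg _ h


/-- The action `Rep^{(d)}`, `d = n + 1`, of the graph operad on functions. -/
def rep (N k : ℕ) : Gra (n + 1) N k →ₗ[ℝ] ((⨂[ℝ] _ : Fin N, V.Fn) →ₗ[ℝ] V.Fn) :=
  graLift (n + 1) (fun γ => V.repRaw γ) (fun γ e => V.repRaw_update γ e)
    (fun γ σ => V.repRaw_perm γ σ)

/-- The Poisson bracket of degree `-n`,
`{f, g} = ∑ Ω^{IJ} (-1)^{|J| |f|} (∂_I f) (∂_J g)` on homogeneous `f`. -/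
def poisson (f g : V.Fn) : V.Fn :=
  ∑ I : V.Crd, ∑ J : V.Crd,
    V.poissonTensor I J • (V.deriv I ((V.par ^ J.deg) f) * V.deriv J g)

/-- Products of odd coordinates. -/
def oddProd (L : List V.OddCrd) : ExteriorAlgebra ℝ (V.OddCrd → ℝ) :=
  (L.map fun i => ExteriorAlgebra.ι ℝ (Pi.single i 1)).prod

/-- The degree of a monomial. -/
def monDeg (m : V.EvenCrd →₀ ℕ) (L : List V.OddCrd) : ℕ :=
  (m.sum fun i a => a * i.1.deg) + (L.map fun i => i.1.deg).sum

/-- The functions of degree `k`: the span of the monomials of degree `k` times functions on `U`. -/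
def piece (k : ℤ) : Submodule ℝ V.Fn :=
  Submodule.span ℝ {y | ∃ (f : smoothFun V.U) (m : V.EvenCrd →₀ ℕ) (L : List V.OddCrd),
    (V.monDeg m L : ℤ) = k ∧ y = V.pureFn f (MvPolynomial.monomial m 1) (V.oddProd L)}

theorem involute_oddProd (L : List V.OddCrd) :
    CliffordAlgebra.involute (V.oddProd L) = (-1 : ℝ) ^ L.length • V.oddProd L := by
  induction L with
  | nil => simp [oddProd]
  | cons i L ih =>
    have : V.oddProd (i :: L) = ExteriorAlgebra.ι ℝ (Pi.single i 1) * V.oddProd L := by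
      simp [oddProd]
    rw [this, map_mul, ih, List.length_cons, pow_succ]
    erw [CliffordAlgebra.involute_ι]
    rw [neg_mul, mul_smul_comm, mul_neg_one, neg_smul]

theorem pow_monDeg (m : V.EvenCrd →₀ ℕ) (L : List V.OddCrd) :
    (-1 : ℝ) ^ V.monDeg m L = (-1) ^ L.length := by
  have h1 : Even (m.sum fun i a => a * i.1.deg) :=
    Finset.even_sum _ fun i _ => (i.2.2).mul_left _
  have h2 : (-1 : ℝ) ^ (L.map fun i => i.1.deg).sum = (-1) ^ L.length := by
    induction L with
    | nil => simp
    | cons i L ih =>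
      rw [List.map_cons, List.sum_cons, pow_add, ih, i.2.neg_one_pow, List.length_cons, pow_succ,
        mul_comm]
  rw [monDeg, pow_add, h1.neg_one_pow, one_mul, h2]

theorem par_piece (k : ℤ) (y : V.Fn) (hy : y ∈ V.piece k) : V.par y = (-1 : ℝ) ^ k • y := by
  induction hy using Submodule.span_induction with
  | mem y hy =>
    obtain ⟨f, m, L, rfl, rfl⟩ := hy
    rw [par_pureFn, involute_oddProd, zpow_natCast, pow_monDeg]
    exact map_smul ((TensorProduct.mk ℝ _ _ f).comp (TensorProduct.mk ℝ _ _ _)) _ _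
  | zero => simp
  | add y z _ _ hy hz => rw [map_add, hy, hz, smul_add]
  | smul r y _ hy => rw [map_smul, hy, smul_comm]

theorem iSup_piece : ⨆ k, V.piece k = ⊤ := by
  rw [eq_top_iff]
  have key : ∀ f P η, V.pureFn f P η ∈ ⨆ k, V.piece k := by
    intro f P η
    have hP : P ∈ Submodule.span ℝ (Set.range fun m : V.EvenCrd →₀ ℕ => MvPolynomial.monomial m (1 : ℝ)) := by
      have := (MvPolynomial.basisMonomials V.EvenCrd ℝ).span_eq
      rw [MvPolynomial.coe_basisMonomials] at this
      rw [this]; trivial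
    have hη : η ∈ Submodule.span ℝ (Set.range V.oddProd) := by
      induction η using CliffordAlgebra.left_induction with
      | algebraMap r =>
        rw [Algebra.algebraMap_eq_smul_one]
        exact Submodule.smul_mem _ _ (Submodule.subset_span ⟨[], rfl⟩)
      | add x y hx hy => exact add_mem hx hy
      | ι_mul x v hx =>
        induction hx using Submodule.span_induction with
        | mem x hx =>
          obtain ⟨L, rfl⟩ := hx
          have : v = ∑ i, v i • Pi.single i (1 : ℝ) := by
            funext j; simp [Finset.sum_apply, Pi.single_apply]
          rw [this, map_sum, Finset.sum_mul]
          refine Submodule.sum_mem _ fun i _ => ?_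
          rw [map_smul, smul_mul_assoc]
          refine Submodule.smul_mem _ _ (Submodule.subset_span ⟨i :: L, ?_⟩)
          simp [oddProd]
        | zero => simp
        | add x y _ _ hx hy => rw [mul_add]; exact add_mem hx hy
        | smul r x _ hx => rw [mul_smul_comm]; exact Submodule.smul_mem _ _ hx
    induction hP using Submodule.span_induction with
    | mem P hP =>
      obtain ⟨m, rfl⟩ := hP
      induction hη using Submodule.span_induction with
      | mem η hη =>
        obtain ⟨L, rfl⟩ := hη
        exact Submodule.mem_iSup_of_mem _ (Submodule.subset_span ⟨f, m, L, rfl, rfl⟩)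
      | zero =>
        have : V.pureFn f (MvPolynomial.monomial m 1) 0 = 0 :=
          map_zero ((TensorProduct.mk ℝ _ _ f).comp (TensorProduct.mk ℝ _ _ _))
        rw [this]; exact zero_mem _
      | add x y _ _ hx hy =>
        have : V.pureFn f (MvPolynomial.monomial m 1) (x + y) = _ + _ :=
          map_add ((TensorProduct.mk ℝ _ _ f).comp (TensorProduct.mk ℝ _ _ _)) _ _
        rw [this]; exact add_mem hx hy
      | smul r x _ hx =>
        have : V.pureFn f (MvPolynomial.monomial m 1) (r • x) = r • _ :=
          map_smul ((TensorProduct.mk ℝ _ _ f).comp (TensorProduct.mk ℝ _ _ _)) _ _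
        rw [this]; exact Submodule.smul_mem _ _ hx
    | zero =>
      have : V.pureFn f 0 η = 0 :=
        map_zero ((TensorProduct.mk ℝ _ _ f).comp ((TensorProduct.mk ℝ _ _).flip η))
      rw [this]; exact zero_mem _
    | add x y _ _ hx hy =>
      have : V.pureFn f (x + y) η = _ + _ :=
        map_add ((TensorProduct.mk ℝ _ _ f).comp ((TensorProduct.mk ℝ _ _).flip η)) _ _
      rw [this]; exact add_mem hx hy
    | smul r x _ hx =>
      have : V.pureFn f (r • x) η = r • _ :=
        map_smul ((TensorProduct.mk ℝ _ _ f).comp ((TensorProduct.mk ℝ _ _).flip η)) _ _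
      rw [this]; exact Submodule.smul_mem _ _ hx
  have h0 : (⨆ k, V.piece k).mkQ = 0 := V.end_ext fun f P η => by
    rw [LinearMap.zero_apply, Submodule.mkQ_apply, Submodule.Quotient.mk_eq_zero]
    exact key f P η
  intro y _
  rw [← Submodule.Quotient.mk_eq_zero, ← Submodule.mkQ_apply, h0, LinearMap.zero_apply]

/-- The Euler vector field; it shows that the degrees are independent. -/
def euler : Module.End ℝ V.Fn :=
  V.tensorMap LinearMap.id
    (∑ i : V.EvenCrd, (i.1.deg : ℝ) • (LinearMap.mulLeft ℝ (MvPolynomial.X i) ∘ₗ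
      (MvPolynomial.pderiv i).toLinearMap)) LinearMap.id +
  V.tensorMap LinearMap.id LinearMap.id
    (∑ i : V.OddCrd, (i.1.deg : ℝ) • (LinearMap.mulLeft ℝ (ExteriorAlgebra.ι ℝ (Pi.single i 1)) ∘ₗ
      CliffordAlgebra.contractLeft (Q := (0 : QuadraticForm ℝ (V.OddCrd → ℝ)))
        (LinearMap.proj i)))

theorem euler_odd (L : List V.OddCrd) :
    (∑ i : V.OddCrd, (i.1.deg : ℝ) • (LinearMap.mulLeft ℝ (ExteriorAlgebra.ι ℝ (Pi.single i 1)) ∘ₗ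
      CliffordAlgebra.contractLeft (Q := (0 : QuadraticForm ℝ (V.OddCrd → ℝ)))
        (LinearMap.proj i))) (V.oddProd L)
      = (((L.map fun i => i.1.deg).sum : ℕ) : ℝ) • V.oddProd L := by
  simp only [LinearMap.sum_apply, LinearMap.smul_apply, LinearMap.comp_apply,
    LinearMap.mulLeft_apply]
  induction L with
  | nil => simp [oddProd, CliffordAlgebra.contractLeft_one]
  | cons j L ih =>
    have hc : V.oddProd (j :: L) = ExteriorAlgebra.ι ℝ (Pi.single j 1) * V.oddProd L := by
      simp [oddProd]
    have step : ∀ i : V.OddCrd,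
        (ExteriorAlgebra.ι ℝ (Pi.single i (1 : ℝ)) : ExteriorAlgebra ℝ (V.OddCrd → ℝ)) *
          CliffordAlgebra.contractLeft (Q := (0 : QuadraticForm ℝ (V.OddCrd → ℝ)))
            (LinearMap.proj i) (V.oddProd (j :: L))
        = (if i = j then V.oddProd (j :: L) else 0) +
          ExteriorAlgebra.ι ℝ (Pi.single j (1 : ℝ)) *
            (ExteriorAlgebra.ι ℝ (Pi.single i (1 : ℝ)) *
              CliffordAlgebra.contractLeft (Q := (0 : QuadraticForm ℝ (V.OddCrd → ℝ)))
                (LinearMap.proj i) (V.oddProd L)) := by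
      intro i
      have h1 := CliffordAlgebra.contractLeft_ι_mul (Q := (0 : QuadraticForm ℝ (V.OddCrd → ℝ)))
        (d := (LinearMap.proj i : (V.OddCrd → ℝ) →ₗ[ℝ] ℝ)) (Pi.single j 1) (V.oddProd L)
      have h2 : (ExteriorAlgebra.ι ℝ (Pi.single i (1 : ℝ)) : ExteriorAlgebra ℝ (V.OddCrd → ℝ)) *
          ExteriorAlgebra.ι ℝ (Pi.single j (1 : ℝ)) =
          - (ExteriorAlgebra.ι ℝ (Pi.single j (1 : ℝ)) * ExteriorAlgebra.ι ℝ (Pi.single i (1 : ℝ))) :=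
        eq_neg_of_add_eq_zero_left (ExteriorAlgebra.ι_add_mul_swap _ _)
      rw [hc]
      refine (congrArg _ h1).trans ?_
      rw [mul_sub, mul_smul_comm]
      have h3 : ∀ z : ExteriorAlgebra ℝ (V.OddCrd → ℝ),
          ExteriorAlgebra.ι ℝ (Pi.single i (1 : ℝ)) *
          (ExteriorAlgebra.ι ℝ (Pi.single j (1 : ℝ)) * z) =
          - (ExteriorAlgebra.ι ℝ (Pi.single j (1 : ℝ)) * (ExteriorAlgebra.ι ℝ (Pi.single i (1 : ℝ)) * z)) := by
        intro z; rw [← mul_assoc, h2, neg_mul, mul_assoc]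
      refine (congrArg₂ (· - ·) rfl (h3 _)).trans ?_
      rw [sub_neg_eq_add]
      congr 1
      by_cases h : i = j
      · subst h; simp
      · simp [h]
    simp only [step, smul_add, Finset.sum_add_distrib]
    have h4 : ∀ i : V.OddCrd, (i.1.deg : ℝ) • (ExteriorAlgebra.ι ℝ (Pi.single j (1 : ℝ)) *
        (ExteriorAlgebra.ι ℝ (Pi.single i (1 : ℝ)) *
          CliffordAlgebra.contractLeft (Q := (0 : QuadraticForm ℝ (V.OddCrd → ℝ)))
            (LinearMap.proj i) (V.oddProd L)))
        = ExteriorAlgebra.ι ℝ (Pi.single j (1 : ℝ)) * ((i.1.deg : ℝ) •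
        (ExteriorAlgebra.ι ℝ (Pi.single i (1 : ℝ)) *
          CliffordAlgebra.contractLeft (Q := (0 : QuadraticForm ℝ (V.OddCrd → ℝ)))
            (LinearMap.proj i) (V.oddProd L))) := fun i => (mul_smul_comm _ _ _).symm
    rw [Finset.sum_congr rfl fun i _ => h4 i, ← Finset.mul_sum, ih]
    rw [List.map_cons, List.sum_cons, Nat.cast_add, add_smul, mul_smul_comm, ← hc]
    congr 1
    simp

theorem euler_piece (k : ℤ) : V.piece k ≤ V.euler.eigenspace (k : ℝ) := by
  refine Submodule.span_le.2 ?_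
  rintro y ⟨f, m, L, rfl, rfl⟩
  rw [SetLike.mem_coe, Module.End.mem_eigenspace_iff]
  have h1 : (∑ i : V.EvenCrd, (i.1.deg : ℝ) • (LinearMap.mulLeft ℝ (MvPolynomial.X i) ∘ₗ
      (MvPolynomial.pderiv i).toLinearMap)) (MvPolynomial.monomial m (1 : ℝ))
      = ((m.sum fun i a => a * i.1.deg : ℕ) : ℝ) • MvPolynomial.monomial m (1 : ℝ) := by
    rw [LinearMap.sum_apply, Finsupp.sum_fintype _ _ (by simp), Nat.cast_sum, Finset.sum_smul]
    refine Finset.sum_congr rfl fun i _ => ?_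
    have := MvPolynomial.X_mul_pderiv_monomial (R := ℝ) (i := i) (m := m) (r := 1)
    rw [LinearMap.smul_apply, LinearMap.comp_apply, LinearMap.mulLeft_apply]
    refine (congrArg _ this).trans ?_
    rw [← Nat.cast_smul_eq_nsmul ℝ, smul_smul]
    push_cast; rw [mul_comm]
  unfold euler
  rw [LinearMap.add_apply, tensorMap_pureFn, tensorMap_pureFn, h1, euler_odd]
  simp only [LinearMap.id_apply]
  have e1 : ∀ (r : ℝ) P η, V.pureFn f (r • P) η = r • V.pureFn f P η := fun r P η =>
    map_smul ((TensorProduct.mk ℝ _ _ f).comp ((TensorProduct.mk ℝ _ _).flip η)) _ _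
  have e2 : ∀ (r : ℝ) P η, V.pureFn f P (r • η) = r • V.pureFn f P η := fun r P η =>
    map_smul ((TensorProduct.mk ℝ _ _ f).comp (TensorProduct.mk ℝ _ _ P)) _ _
  rw [e1, e2, ← add_smul, monDeg, Int.cast_natCast, Nat.cast_add]

theorem piece_indep : iSupIndep V.piece :=
  ((V.euler.eigenspaces_iSupIndep).comp (f := fun k : ℤ => (k : ℝ)) Int.cast_injective).mono
    V.euler_piece

end NPDomain

/-- A `ℤ`-grading of `W`, with its parity operator `w ↦ (-1)^w w`. -/
structure GradedSpace (W : Type*) [AddCommGroup W] [Module ℝ W] where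
  piece : ℤ → Submodule ℝ W
  indep : iSupIndep piece
  iSup_eq_top : ⨆ k, piece k = ⊤
  par : Module.End ℝ W
  par_apply : ∀ (k : ℤ) (w : W), w ∈ piece k → par w = (-1 : ℝ) ^ k • w

namespace GradedSpace
variable {W : Type*} [AddCommGroup W] [Module ℝ W] (G : GradedSpace W)

/-- The shift `W[k]`, with `W[k]^i = W^(i+k)`. -/
def shift (k : ℤ) : GradedSpace W where
  piece i := G.piece (i + k)
  indep := G.indep.comp (f := fun i : ℤ => i + k) (add_left_injective k)
  iSup_eq_top := ((Equiv.addRight k).iSup_comp (g := G.piece)).trans G.iSup_eq_top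
  par := (-1 : ℝ) ^ k • G.par
  par_apply i w hw := by
    have h0 : (-1 : ℝ) ≠ 0 := by norm_num
    have h1 : (-1 : ℝ) ^ k * (-1) ^ k = 1 := by rw [← mul_zpow]; simp
    rw [LinearMap.smul_apply, G.par_apply _ _ hw, smul_smul, zpow_add₀ h0]
    congr 1
    linear_combination ((-1 : ℝ) ^ i) * h1

/-- The even (`e = 0`) or odd (`e = 1`) part of `w`. -/
def component (e : ZMod 2) (w : W) : W :=
  (1 / 2 : ℝ) • (w + (if e = 0 then (1 : ℝ) else -1) • G.par w)

/-- The parts of the given parities of several vectors. -/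
def parts {N : ℕ} (e : Fin N → ZMod 2) (w : Fin N → W) : Fin N → W :=
  fun i => G.component (e i) (w i)

end GradedSpace

/-- Families of operations, one in each arity. Graded symmetric multilinear ones are the Taylor
coefficients of maps out of the symmetric coalgebra `S(W)`; for a graded Lie (or Lie-infinity) algebra `T` one takes
`W = T[1]`, and all signs below are the Koszul signs of `W`. -/
abbrev Cochain (W : Type*) : Type _ := ∀ N : ℕ, (Fin N → W) → W

namespace Cochain
variable {W : Type*} [AddCommGroup W] [Module ℝ W] (G : GradedSpace W)

/-- Multilinear, graded symmetric of degree `q`, without part of arity zero. -/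
structure IsCochain (q : ℤ) (f : Cochain W) : Prop where
  multilinear : ∀ N, ∃ F : MultilinearMap ℝ (fun _ : Fin N => W) W, ∀ w, F w = f N w
  zero_arity : ∀ w, f 0 w = 0
  symmetric : ∀ (N : ℕ) (σ : Equiv.Perm (Fin N)) (p : Fin N → ℤ) (w : Fin N → W),
    (∀ i, w i ∈ G.piece (p i)) →
      f N (w ∘ σ) = koszul (fun i => (σ⁻¹ i : Fin N)) (fun i => (p i : ZMod 2)) • f N w
  degree : ∀ (N : ℕ) (p : Fin N → ℤ) (w : Fin N → W),
    (∀ i, w i ∈ G.piece (p i)) → f N w ∈ G.piece (∑ i, p i + q)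

/-- The Taylor coefficients of the identity. -/
def identity : Cochain W
  | 1, w => w 0
  | _, _ => 0

/-- The Nijenhuis-Richardson product: the Taylor coefficients of `f` composed with the coderivation `g`,
`∑_B ± f (g (w_B), w_{Bᶜ})` (by multilinearity, a sum over the parities `e` of the arguments). -/
def preLie (f g : Cochain W) : Cochain W := fun N w =>
  ∑ e : Fin N → ZMod 2, ∑ B : Finset (Fin N) with B.Nonempty,
    koszul (blockOf B) e • f (Bᶜ.card + 1)
      (Fin.cons (g B.card (G.parts e w ∘ B.orderEmbOfFin rfl))
        (G.parts e w ∘ Bᶜ.orderEmbOfFin rfl))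

/-- The composition of Lie-infinity morphisms,
`∑ (1/k!) ∑_{B_1 ⊔ … ⊔ B_k} ± f_k (g (w_{B_1}), …, g (w_{B_k}))`, with nonempty blocks `B_i`. -/
def comp (f g : Cochain W) : Cochain W := fun N w =>
  ∑ e : Fin N → ZMod 2, ∑ k ∈ Finset.range (N + 1),
    ∑ c : Fin N → Fin k with Function.Surjective c,
      (koszul (fun a => (c a : ℕ)) e / (k.factorial : ℝ)) • f k (fun i =>
        g (Finset.univ.filter fun a => c a = i).card
          (G.parts e w ∘ (Finset.univ.filter fun a => c a = i).orderEmbOfFin rfl))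

/-- For a binary bracket `Q`: the Taylor coefficients `∑_B ± Q (h (w_B), u (w_{Bᶜ}))` of `Q` composed with the
coderivation along the coalgebra morphism `u` with Taylor coefficients `h`. -/
def bracketAlong (Q h u : Cochain W) : Cochain W := fun N w =>
  ∑ e : Fin N → ZMod 2, ∑ B : Finset (Fin N) with B.Nonempty ∧ Bᶜ.Nonempty,
    koszul (blockOf B) e • Q 2 ![h B.card (G.parts e w ∘ B.orderEmbOfFin rfl),
      u Bᶜ.card (G.parts e w ∘ Bᶜ.orderEmbOfFin rfl)]

/-- The Taylor coefficients of the `k`-th power of the coderivation `D`. -/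
def expTerm (D : Cochain W) (k : ℕ) : Cochain W := (fun f => preLie G f D)^[k] identity

/-- The Taylor coefficients of `exp D = ∑ D^k / k!`. -/
def exp (D : Cochain W) : Cochain W := fun N w =>
  ∑ᶠ k : ℕ, (1 / (k.factorial : ℝ)) • expTerm G D k N w

/-- A Lie-infinity morphism from `(W[-1], Q)` to itself: the coalgebra morphism `u` commutes with the
coderivation `Q`. -/
def IsMorphism (Q u : Cochain W) : Prop :=
  IsCochain G 0 u ∧ preLie G u Q = comp G Q u

/-- A Lie-infinity automorphism. -/
def IsAut (Q u : Cochain W) : Prop :=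
  IsMorphism G Q u ∧ ∃ v, IsMorphism G Q v ∧ comp G u v = identity ∧ comp G v u = identity

/-- The value at `t` of the polynomial family `∑ t^j c_j`. -/
def evalAt (c : ℕ → Cochain W) (t : ℝ) : Cochain W := fun N w => ∑ᶠ j : ℕ, t ^ j • c j N w

/-- Homotopy of Lie-infinity morphisms of `(W[-1], Q)`, `Q` a binary bracket: a polynomial path `c` of
morphisms (in each arity polynomial in `t`) and a polynomial path `h` of degree `-1` along it with
`dc/dt = Q ∘ h + h ∘ Q`. -/
def Homotopic (Q u v : Cochain W) : Prop :=
  ∃ c h : ℕ → Cochain W,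
    (∀ N, {j | c j N ≠ 0}.Finite) ∧ (∀ N, {j | h j N ≠ 0}.Finite) ∧
    evalAt c 0 = u ∧ evalAt c 1 = v ∧
    ∀ t : ℝ, IsMorphism G Q (evalAt c t) ∧ IsCochain G (-1) (evalAt h t) ∧
      evalAt (fun j => ((j : ℝ) + 1) • c (j + 1)) t
        = bracketAlong G Q (evalAt h t) (evalAt c t) + preLie G (evalAt h t) Q

/-- Operations on `W = T` seen as operations on `T[1]`: the sign is that of moving the `N` shifts past the
arguments, `(-1)^{∑ (N-1-i) |w_i|}`, `0 ≤ i < N`. -/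
def decalage (f : Cochain W) : Cochain W := fun N w =>
  ∑ e : Fin N → ZMod 2,
    (∏ i : Fin N, if e i = 1 then (-1 : ℝ) ^ (N - 1 - (i : ℕ)) else 1) • f N (G.parts e w)

/-- The pullback `s⁻¹ ∘ f ∘ (s ⊗ … ⊗ s)` along the suspension `s : T = A[n] → A` of degree `n`; the
parities are those of `T`. -/
def suspend (n : ℕ) (f : Cochain W) : Cochain W := fun N w =>
  ∑ e : Fin N → ZMod 2,
    (∏ i : Fin N, if e i = 1 then (-1 : ℝ) ^ (n * (N - 1 - (i : ℕ))) else 1) •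
      f N (G.parts e w)

end Cochain

/-- `[x_1, [x_2, …, [x_{r-1}, x_r]…]]`. -/
def rightNested {M : Type*} [Zero M] (br : M → M → M) : List M → M
  | [] => 0
  | [x] => x
  | x :: y :: l => br x (rightNested br (y :: l))

/-- The part of degree `m` of the Baker-Campbell-Hausdorff series, in the form of Dynkin:
`∑_k (-1)^{k-1}/k ∑ (1/m) [x^{r_1} y^{s_1} … x^{r_k} y^{s_k}] / (r_1! s_1! … r_k! s_k!)`, the inner sum
over `r_i + s_i > 0` with total `m`. -/
def dynkin {M : Type*} [AddCommGroup M] [Module ℝ M] (br : M → M → M) (x y : M) (m : ℕ) : M :=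
  ∑ k ∈ Finset.Icc 1 m,
    ∑ f : Fin k → Fin (m + 1) × Fin (m + 1) with
        (∀ i, 0 < ((f i).1 : ℕ) + (f i).2) ∧ ∑ i, (((f i).1 : ℕ) + (f i).2) = m,
      (((-1 : ℝ) ^ (k - 1) / k) * (1 / m) *
          ∏ i, 1 / ((((f i).1 : ℕ).factorial : ℝ) * ((f i).2 : ℕ).factorial)) •
        rightNested br
          (List.ofFn fun i => List.replicate (f i).1 x ++ List.replicate (f i).2 y).flatten

/-- The part of degree `m` of the BCH series of two graph cochains of degree `0`. -/
def bchTerm (d : ℕ) (a b : Fam d) (m : ℕ) : Fam d := dynkin (fun x y => bracket d 0 0 x y) a b m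

/-- The BCH series; in each number of vertices and edges only finitely many terms contribute. -/
def bch (d : ℕ) (a b : Fam d) : Fam d := fun N k => ∑ᶠ m : ℕ, bchTerm d a b m N k

namespace NPDomain
variable {n : ℕ} (V : NPDomain n)

/-- The grading of the functions. -/
def grading : GradedSpace V.Fn := ⟨V.piece, V.piece_indep, V.iSup_piece, V.par, V.par_piece⟩

/-- The grading of `T = A[n]`, the `n`-Schouten algebra, `A` the algebra of functions. -/
def schoutenGrading : GradedSpace V.Fn := V.grading.shift n

/-- The grading of `T[1]`. -/
def barGrading : GradedSpace V.Fn := V.schoutenGrading.shift 1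

/-- The Poisson bracket as an operation of arity two. -/
def poissonCochain : Cochain V.Fn
  | 2, f => V.poisson (f 0) (f 1)
  | _, _ => 0

/-- The Schouten bracket on `T = A[n]`. -/
def schouten : Cochain V.Fn := Cochain.suspend V.schoutenGrading n V.poissonCochain

/-- The Schouten bracket as a bracket of degree `1` on `T[1]`. -/
def Q : Cochain V.Fn := Cochain.decalage V.schoutenGrading V.schouten

/-- The operations on functions given by a family of graphs. -/
def repCochain (γ : Fam (n + 1)) : Cochain V.Fn := fun N f =>
  ∑ᶠ k : ℕ, V.rep N k (γ N k) (PiTensorProduct.tprod ℝ f)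

/-- `s^* Rep^{(d)} (γ)`, as Taylor coefficients of a coderivation of `S(T[1])`. -/
def sRep (γ : Fam (n + 1)) : Cochain V.Fn :=
  Cochain.decalage V.schoutenGrading
    (Cochain.suspend V.schoutenGrading n (V.repCochain γ))

/-- `exp (s^* Rep^{(d)} (γ))`. -/
def expRep (γ : Fam (n + 1)) : Cochain V.Fn := Cochain.exp V.barGrading (V.sRep γ)

end NPDomain
end GraphCx
end

open GraphCx

noncomputable section

namespace GraphCx

/-! ### Exponential and logarithm of nilpotent elements -/
section nilexp

theorem log_subst_exp : (PowerSeries.log ℝ).subst (PowerSeries.exp ℝ - 1 : PowerSeries ℝ)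
    = PowerSeries.X := by
  have hs : PowerSeries.HasSubst (PowerSeries.exp ℝ - 1 : PowerSeries ℝ) :=
    PowerSeries.HasSubst.exp_sub_one
  refine PowerSeries.derivative.ext ?_ ?_
  · rw [PowerSeries.derivative_subst hs, PowerSeries.deriv_log, map_sub,
      PowerSeries.derivative_exp, PowerSeries.derivative_X]
    have h1 : (1 + PowerSeries.X : PowerSeries ℝ) *
        (PowerSeries.mk fun n => algebraMap ℚ ℝ ((-1 : ℚ) ^ n)) = 1 := by
      ext n
      rw [add_mul, one_mul, map_add]
      cases n with
      | zero => simp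
      | succ n => rw [PowerSeries.coeff_succ_X_mul]; simp [pow_succ, PowerSeries.coeff_one]
    have h2 := congrArg (PowerSeries.subst (PowerSeries.exp ℝ - 1 : PowerSeries ℝ)) h1
    rw [PowerSeries.subst_mul hs, PowerSeries.subst_add hs, PowerSeries.subst_X hs] at h2
    have h3 : (1 : PowerSeries ℝ).subst (PowerSeries.exp ℝ - 1 : PowerSeries ℝ)
        = (1 : PowerSeries ℝ) := by
      rw [← PowerSeries.coe_substAlgHom hs, map_one]
    rw [h3] at h2
    have h4 : (PowerSeries.derivative ℝ) (1 : PowerSeries ℝ) = 0 := PowerSeries.derivative_one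
    rw [h4, sub_zero, mul_comm]
    simpa using h2
  · have := PowerSeries.constantCoeff_subst_eq_zero (R := ℝ) (a := (PowerSeries.exp ℝ - 1 : PowerSeries ℝ))
      (by
        have : PowerSeries.constantCoeff (PowerSeries.exp ℝ - 1 : PowerSeries ℝ) = 0 := by
          rw [map_sub, PowerSeries.constantCoeff_exp]; simp
        exact this) (PowerSeries.log ℝ) PowerSeries.constantCoeff_log
    exact this.trans (by simp)

theorem exp_subst_log : (PowerSeries.exp ℝ).subst (PowerSeries.log ℝ : PowerSeries ℝ)
    = 1 + PowerSeries.X := by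
  have hs : PowerSeries.HasSubst (PowerSeries.log ℝ : PowerSeries ℝ) := PowerSeries.HasSubst.log
  set h : PowerSeries ℝ := PowerSeries.mk fun n => algebraMap ℚ ℝ ((-1 : ℚ) ^ n) with hh
  set g := (PowerSeries.exp ℝ).subst (PowerSeries.log ℝ : PowerSeries ℝ) with hg
  have h1 : (1 + PowerSeries.X : PowerSeries ℝ) * h = 1 := by
    ext n
    rw [add_mul, one_mul, map_add]
    cases n with
    | zero => simp [hh]
    | succ n => rw [PowerSeries.coeff_succ_X_mul]; simp [hh, pow_succ, PowerSeries.coeff_one]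
  have dg : PowerSeries.derivative ℝ g = g * h := by
    rw [hg, PowerSeries.derivative_subst hs, PowerSeries.derivative_exp, PowerSeries.deriv_log]
  have dh : PowerSeries.derivative ℝ h = -(h * h) := by
    have := congrArg (PowerSeries.derivative ℝ) h1
    rw [Derivation.leibniz, map_add, PowerSeries.derivative_one, PowerSeries.derivative_X] at this
    simp only [smul_eq_mul, zero_add, mul_one] at this
    linear_combination h * this - (PowerSeries.derivative ℝ h) * h1
  have c : g * h = 1 := by
    refine PowerSeries.derivative.ext ?_ ?_
    · rw [Derivation.leibniz, dg, dh, PowerSeries.derivative_one]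
      simp only [smul_eq_mul]; ring
    · have e : ∀ d : ℕ, d ≠ 0 → (PowerSeries.coeff d (PowerSeries.exp ℝ)) •
          (MvPowerSeries.constantCoeff (PowerSeries.log ℝ ^ d : PowerSeries ℝ)) = 0 := by
        intro d hd
        have : MvPowerSeries.constantCoeff (PowerSeries.log ℝ : PowerSeries ℝ) = 0 :=
          PowerSeries.constantCoeff_log
        rw [map_pow, this, zero_pow hd, smul_zero]
      have e1 : PowerSeries.constantCoeff g = 1 :=
        ((PowerSeries.constantCoeff_subst hs _).trans (finsum_eq_single _ 0 e)).trans (by simp)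
      rw [map_mul, e1]
      simp [hh]
  linear_combination (1 + PowerSeries.X : PowerSeries ℝ) * c - g * h1

variable {A : Type*} [Ring A] [Algebra ℝ A]

/-- The truncated exponential series; the exponential of `x` if `x ^ n = 0`. -/
def nexp (n : ℕ) (x : A) : A := ∑ i ∈ Finset.range n, ((i.factorial : ℝ)⁻¹) • x ^ i

/-- The truncated series of `log (1 + x)`. -/
def nlog (n : ℕ) (x : A) : A :=
  ∑ i ∈ Finset.range n, (PowerSeries.coeff i (PowerSeries.log ℝ)) • x ^ i

/-- The value of a power series at a nilpotent element. -/
def nilEval (n : ℕ) (x : A) (f : PowerSeries ℝ) : A := Polynomial.aeval x (f.trunc n)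

theorem nilEval_eq_sum (n : ℕ) (x : A) (f : PowerSeries ℝ) :
    nilEval n x f = ∑ i ∈ Finset.range n, PowerSeries.coeff i f • x ^ i := by
  unfold nilEval
  rw [Polynomial.aeval_def, PowerSeries.eval₂_trunc_eq_sum_range]
  simp [Algebra.smul_def]

theorem nexp_eq_nilEval (n : ℕ) (x : A) : nexp n x = nilEval n x (PowerSeries.exp ℝ) := by
  rw [nilEval_eq_sum]; simp [nexp, PowerSeries.coeff_exp]

theorem nlog_eq_nilEval (n : ℕ) (x : A) : nlog n x = nilEval n x (PowerSeries.log ℝ) := by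
  rw [nilEval_eq_sum]; rfl

theorem aeval_trunc_coe {n : ℕ} {x : A} (hx : x ^ n = 0) (p : Polynomial ℝ) :
    Polynomial.aeval x ((p : PowerSeries ℝ).trunc n) = Polynomial.aeval x p := by
  have h : (Polynomial.X ^ n : Polynomial ℝ) ∣ p - (p : PowerSeries ℝ).trunc n := by
    rw [Polynomial.X_pow_dvd_iff]
    intro d hd
    simp [PowerSeries.coeff_trunc, hd]
  obtain ⟨q, hq⟩ := h
  have := congrArg (Polynomial.aeval x) hq
  rw [map_sub, map_mul, map_pow, Polynomial.aeval_X, hx, zero_mul, sub_eq_zero] at this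
  exact this.symm

theorem nilEval_mul {n : ℕ} {x : A} (hx : x ^ n = 0) (f g : PowerSeries ℝ) :
    nilEval n x (f * g) = nilEval n x f * nilEval n x g := by
  unfold nilEval
  rw [← map_mul, ← aeval_trunc_coe hx (f.trunc n * g.trunc n), Polynomial.coe_mul,
    PowerSeries.trunc_trunc_mul_trunc]

theorem nilEval_add (n : ℕ) (x : A) (f g : PowerSeries ℝ) :
    nilEval n x (f + g) = nilEval n x f + nilEval n x g := by
  simp [nilEval]

theorem nilEval_one {n : ℕ} {x : A} (hx : x ^ n = 0) : nilEval n x 1 = 1 := by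
  have := aeval_trunc_coe hx (1 : Polynomial ℝ)
  simpa [nilEval] using this

theorem nilEval_X {n : ℕ} {x : A} (hx : x ^ n = 0) : nilEval n x PowerSeries.X = x := by
  have := aeval_trunc_coe hx (Polynomial.X : Polynomial ℝ)
  simpa [nilEval] using this

theorem nilEval_pow {n : ℕ} {x : A} (hx : x ^ n = 0) (f : PowerSeries ℝ) (k : ℕ) :
    nilEval n x (f ^ k) = nilEval n x f ^ k := by
  induction k with
  | zero => simp [nilEval_one hx]
  | succ k ih => rw [pow_succ, nilEval_mul hx, ih, pow_succ]

theorem nilEval_X_pow_mul {n : ℕ} {x : A} (hx : x ^ n = 0) (f : PowerSeries ℝ) :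
    nilEval n x (PowerSeries.X ^ n * f) = 0 := by
  rw [nilEval_mul hx, nilEval_pow hx, nilEval_X hx, hx, zero_mul]

theorem nilEval_pow_eq_zero {n : ℕ} {x : A} (hx : x ^ n = 0) {a : PowerSeries ℝ}
    (ha : PowerSeries.constantCoeff a = 0) : nilEval n x a ^ n = 0 := by
  obtain ⟨b, hb⟩ := PowerSeries.X_dvd_iff.2 ha
  rw [← nilEval_pow hx, hb, mul_pow, nilEval_X_pow_mul hx]

theorem nilEval_subst {n : ℕ} {x : A} (hx : x ^ n = 0) {a : PowerSeries ℝ}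
    (ha : PowerSeries.constantCoeff a = 0) (f : PowerSeries ℝ) :
    nilEval n x (f.subst a) = nilEval n (nilEval n x a) f := by
  have hs : PowerSeries.HasSubst a := PowerSeries.HasSubst.of_constantCoeff_zero' ha
  have hn := nilEval_pow_eq_zero hx ha
  obtain ⟨b, hb⟩ := PowerSeries.X_dvd_iff.2 ha
  have hC : ∀ r : ℝ, nilEval n x ((Polynomial.C r : Polynomial ℝ) : PowerSeries ℝ)
      = algebraMap ℝ A r := by
    intro r
    unfold nilEval
    rw [aeval_trunc_coe hx, Polynomial.aeval_C]
  have key : ∀ p : Polynomial ℝ, nilEval n x (Polynomial.aeval a p)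
      = Polynomial.aeval (nilEval n x a) p := by
    intro p
    induction p using Polynomial.induction_on' with
    | add p q hp hq => rw [map_add, nilEval_add, hp, hq, map_add]
    | monomial k r =>
      rw [Polynomial.aeval_monomial, Polynomial.aeval_monomial, nilEval_mul hx, nilEval_pow hx]
      congr 1
      rw [← hC r]; simp
  conv_lhs => rw [PowerSeries.eq_X_pow_mul_shift_add_trunc n f]
  rw [PowerSeries.subst_add hs, PowerSeries.subst_mul hs, PowerSeries.subst_pow hs,
    PowerSeries.subst_X hs, PowerSeries.subst_coe hs, nilEval_add, key]
  nth_rewrite 1 [hb]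
  rw [mul_pow, mul_assoc, nilEval_X_pow_mul hx, zero_add]
  rfl

theorem nlog_pow_eq_zero {n : ℕ} {x : A} (hx : x ^ n = 0) : nlog n x ^ n = 0 := by
  rw [nlog_eq_nilEval]; exact nilEval_pow_eq_zero hx PowerSeries.constantCoeff_log

theorem nexp_nlog {n : ℕ} {x : A} (hx : x ^ n = 0) : nexp n (nlog n x) = 1 + x := by
  rw [nexp_eq_nilEval, nlog_eq_nilEval, ← nilEval_subst hx PowerSeries.constantCoeff_log,
    exp_subst_log, nilEval_add, nilEval_one hx, nilEval_X hx]

theorem nlog_nexp {n : ℕ} {x : A} (hx : x ^ n = 0) : nlog n (nexp n x - 1) = x := by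
  have h : nexp n x - 1 = nilEval n x (PowerSeries.exp ℝ - 1) := by
    rw [sub_eq_iff_eq_add, ← nilEval_one hx, ← nilEval_add, sub_add_cancel, nexp_eq_nilEval]
  rw [h, nlog_eq_nilEval, ← nilEval_subst hx (by simp), log_subst_exp, nilEval_X hx]

theorem nexp_eq_of_le {n m : ℕ} (h : n ≤ m) {x : A} (hx : x ^ n = 0) : nexp m x = nexp n x := by
  unfold nexp
  symm
  refine Finset.sum_subset (Finset.range_mono h) fun i _ hi => ?_
  rw [pow_eq_zero_of_le (by simpa using hi) hx, smul_zero]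

theorem nexp_eq_exp (n : ℕ) {x : A} (hx : x ^ n = 0) :
    nexp n x = @IsNilpotent.exp A _ (Module.compHom A (algebraMap ℚ ℝ)) x := by
  let _ : Module ℚ A := Module.compHom A (algebraMap ℚ ℝ)
  rw [IsNilpotent.exp_eq_sum hx]
  refine Finset.sum_congr rfl fun i _ => ?_
  change _ = (algebraMap ℚ ℝ (i.factorial : ℚ)⁻¹) • x ^ i
  simp

theorem nexp_add {n : ℕ} {a b : A} (h : Commute a b) (ha : a ^ n = 0) (hb : b ^ n = 0)
    (hab : (a + b) ^ n = 0) : nexp n (a + b) = nexp n a * nexp n b := by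
  let _ : Module ℚ A := Module.compHom A (algebraMap ℚ ℝ)
  rw [nexp_eq_exp n ha, nexp_eq_exp n hb, nexp_eq_exp n hab]
  exact IsNilpotent.exp_add_of_commute h ⟨n, ha⟩ ⟨n, hb⟩

theorem nexp_zero {n : ℕ} (hn : n ≠ 0) : nexp n (0 : A) = 1 := by
  obtain ⟨n, rfl⟩ := Nat.exists_eq_succ_of_ne_zero hn
  simp [nexp, Finset.sum_range_succ']

omit [Algebra ℝ A] in
theorem neg_pow_eq_zero {n : ℕ} {a : A} (ha : a ^ n = 0) : (-a) ^ n = 0 := by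
  rw [neg_pow, ha, mul_zero]

theorem nexp_mul_nexp_neg {n : ℕ} {a : A} (ha : a ^ n = 0) : nexp n a * nexp n (-a) = 1 := by
  rcases eq_or_ne n 0 with rfl | hn
  · rw [pow_zero] at ha
    calc _ = (1 : A) * (nexp 0 a * nexp 0 (-a)) := by rw [one_mul]
      _ = 1 := by rw [ha, zero_mul]
  · rw [← nexp_add (Commute.neg_right (Commute.refl a)) ha (neg_pow_eq_zero ha)
      (by rw [add_neg_cancel]; exact zero_pow hn), add_neg_cancel, nexp_zero hn]

theorem nexp_neg_mul_nexp {n : ℕ} {a : A} (ha : a ^ n = 0) : nexp n (-a) * nexp n a = 1 := by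
  have := nexp_mul_nexp_neg (neg_pow_eq_zero ha); rwa [neg_neg] at this

theorem nexp_injective {n : ℕ} {a b : A} (ha : a ^ n = 0) (hb : b ^ n = 0)
    (h : nexp n a = nexp n b) : a = b := by
  rw [← nlog_nexp ha, h, nlog_nexp hb]

theorem map_nexp {B : Type*} [Ring B] [Algebra ℝ B] (φ : A →ₐ[ℝ] B) (n : ℕ) (x : A) :
    φ (nexp n x) = nexp n (φ x) := by
  simp [nexp]

theorem map_nlog {B : Type*} [Ring B] [Algebra ℝ B] (φ : A →ₐ[ℝ] B) (n : ℕ) (x : A) :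
    φ (nlog n x) = nlog n (φ x) := by
  simp only [nlog, map_sum, map_smul, map_pow]

end nilexp

/-! ### The Baker-Campbell-Hausdorff formula in Dynkin's form -/
section dynkin

theorem map_rightNested {M M' : Type*} [Zero M] [Zero M'] (br : M → M → M) (br' : M' → M' → M')
    (φ : M → M') (h0 : φ 0 = 0) (P : M → Prop)
    (hP : ∀ x y, P x → P y → P (br x y)) (h : ∀ x y, P x → P y → φ (br x y) = br' (φ x) (φ y)) :
    ∀ l : List M, (∀ x ∈ l, P x) → φ (rightNested br l) = rightNested br' (l.map φ) ∧
      (l ≠ [] → P (rightNested br l))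
  | [], _ => ⟨h0, fun h => absurd rfl h⟩
  | [x], hl => ⟨rfl, fun _ => hl x (by simp)⟩
  | x :: y :: l, hl => by
    have ih := map_rightNested br br' φ h0 P hP h (y :: l) fun z hz => hl z (by simp_all)
    have hx := hl x (by simp)
    have hr := ih.2 (by simp)
    exact ⟨by simp only [rightNested, List.map_cons, h _ _ hx hr, ih.1], fun _ => hP _ _ hx hr⟩

/-- The word `x ^ r₁ y ^ s₁ x ^ r₂ y ^ s₂ …`. -/
def bchWord {M : Type*} (x y : M) {k : ℕ} (f : Fin k → ℕ × ℕ) : List M :=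
  (List.ofFn fun i => List.replicate (f i).1 x ++ List.replicate (f i).2 y).flatten

theorem bchWord_map {M M' : Type*} (φ : M → M') (x y : M) {k : ℕ} (f : Fin k → ℕ × ℕ) :
    (bchWord x y f).map φ = bchWord (φ x) (φ y) f := by
  simp [bchWord, List.map_flatten, List.map_ofFn, Function.comp_def]

theorem length_bchWord {M : Type*} (x y : M) {k : ℕ} (f : Fin k → ℕ × ℕ) :
    (bchWord x y f).length = ∑ i, ((f i).1 + (f i).2) := by
  simp [bchWord, List.length_flatten, List.map_ofFn, Function.comp_def, List.sum_ofFn]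

theorem mem_bchWord {M : Type*} {x y z : M} {k : ℕ} {f : Fin k → ℕ × ℕ} (h : z ∈ bchWord x y f) :
    z = x ∨ z = y := by
  simp only [bchWord, List.mem_flatten, List.mem_ofFn] at h
  obtain ⟨l, ⟨i, rfl⟩, h⟩ := h
  rw [List.mem_append, List.mem_replicate, List.mem_replicate] at h
  tauto

def bchExponents (N k : ℕ) : Finset (Fin k → ℕ × ℕ) :=
  Fintype.piFinset fun _ => (Finset.range N ×ˢ Finset.range N).erase (0, 0)

def bchWeight {k : ℕ} (f : Fin k → ℕ × ℕ) : ℝ :=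
  ∏ i, 1 / (((f i).1.factorial : ℝ) * (f i).2.factorial)

theorem nlog_nexp_mul_nexp {A : Type*} [Ring A] [Algebra ℝ A] {N : ℕ} (hN : N ≠ 0) (a b : A) :
    nlog N (nexp N a * nexp N b - 1) = ∑ k ∈ Finset.range N,
      (PowerSeries.coeff k (PowerSeries.log ℝ)) •
        ∑ f ∈ bchExponents N k, bchWeight f • (bchWord a b f).prod := by
  unfold nlog
  refine Finset.sum_congr rfl fun k _ => ?_
  congr 1
  have h0 : (0, 0) ∈ Finset.range N ×ˢ Finset.range N := by
    simp [Nat.pos_of_ne_zero hN]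
  have h1 : nexp N a * nexp N b - 1 = ∑ p ∈ (Finset.range N ×ˢ Finset.range N).erase (0, 0),
      (1 / ((p.1.factorial : ℝ) * p.2.factorial)) • (a ^ p.1 * b ^ p.2) := by
    rw [Finset.sum_erase_eq_sub h0]
    congr 1
    · rw [nexp, nexp, Finset.sum_mul_sum, Finset.sum_product]
      refine Finset.sum_congr rfl fun i _ => Finset.sum_congr rfl fun j _ => ?_
      rw [smul_mul_smul_comm, one_div, mul_inv]
    · simp
  rw [← MultilinearMap.mkPiAlgebraFin_apply_const (R := ℝ), h1]
  rw [MultilinearMap.map_sum_finset]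
  refine Finset.sum_congr rfl fun f _ => ?_
  rw [MultilinearMap.map_smul_univ, MultilinearMap.mkPiAlgebraFin_apply]
  congr 1
  rw [bchWord, List.prod_flatten, List.map_ofFn]
  congr 2
  funext i
  simp [List.prod_replicate]

theorem dynkin_eq {M : Type*} [AddCommGroup M] [Module ℝ M] (br : M → M → M) (x y : M) {m N : ℕ}
    (hm : m < N) :
    (m : ℝ) • dynkin br x y m = ∑ k ∈ Finset.range N, (PowerSeries.coeff k (PowerSeries.log ℝ)) •
      ∑ f ∈ bchExponents N k with ∑ i, ((f i).1 + (f i).2) = m,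
        bchWeight f • rightNested br (bchWord x y f) := by
  rcases eq_or_ne m 0 with rfl | hm0
  · symm
    rw [Nat.cast_zero, zero_smul]
    refine Finset.sum_eq_zero fun k _ => ?_
    rcases eq_or_ne k 0 with rfl | hk
    · simp
    rw [Finset.sum_eq_zero, smul_zero]
    intro f hf
    rw [Finset.mem_filter, bchExponents, Fintype.mem_piFinset] at hf
    exfalso
    have h1 := (Finset.mem_erase.1 (hf.1 ⟨0, Nat.pos_of_ne_zero hk⟩)).1
    have h2 := (Finset.sum_eq_zero_iff.1 hf.2) ⟨0, Nat.pos_of_ne_zero hk⟩ (Finset.mem_univ _)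
    exact h1 (Prod.ext (by simpa using (Nat.add_eq_zero_iff.1 h2).1)
      (by simpa using (Nat.add_eq_zero_iff.1 h2).2))
  have hsub : Finset.Icc 1 m ⊆ Finset.range N := by
    intro k hk; simp at hk ⊢; omega
  rw [dynkin, Finset.smul_sum, ← Finset.sum_subset hsub]
  · refine Finset.sum_congr rfl fun k hk => ?_
    rw [Finset.mem_Icc] at hk
    have hk0 : k ≠ 0 := by omega
    rw [Finset.smul_sum, Finset.smul_sum]
    refine Finset.sum_bij' (fun f _ i => (((f i).1 : ℕ), ((f i).2 : ℕ)))
      (fun f _ i => (Fin.ofNat (m + 1) (f i).1, Fin.ofNat (m + 1) (f i).2)) ?_ ?_ ?_ ?_ ?_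
    · intro f hf
      simp only [Finset.mem_filter, Finset.mem_univ, true_and, bchExponents,
        Fintype.mem_piFinset, Finset.mem_erase, Finset.mem_product, Finset.mem_range] at hf ⊢
      refine ⟨fun i => ⟨fun h => ?_, by have := (f i).1.2; omega, by have := (f i).2.2; omega⟩, hf.2⟩
      have := hf.1 i
      simp only [Prod.mk.injEq] at h
      omega
    · intro f hf
      simp only [Finset.mem_filter, Finset.mem_univ, true_and, bchExponents,
        Fintype.mem_piFinset, Finset.mem_erase, Finset.mem_product, Finset.mem_range] at hf ⊢
      have hle : ∀ i, (f i).1 + (f i).2 ≤ m := fun i => by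
        rw [← hf.2]
        exact Finset.single_le_sum (f := fun i => (f i).1 + (f i).2) (fun _ _ => Nat.zero_le _)
          (Finset.mem_univ i)
      have e1 : ∀ i, (f i).1 % (m + 1) = (f i).1 := fun i =>
        Nat.mod_eq_of_lt (by have := hle i; omega)
      have e2 : ∀ i, (f i).2 % (m + 1) = (f i).2 := fun i =>
        Nat.mod_eq_of_lt (by have := hle i; omega)
      simp only [Fin.ofNat, e1, e2]
      refine ⟨fun i => ?_, hf.2⟩
      by_contra h
      exact (hf.1 i).1 (Prod.ext (by simp; omega) (by simp; omega))
    · intro f _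
      funext i
      exact Prod.ext (Fin.ext (Nat.mod_eq_of_lt (f i).1.2)) (Fin.ext (Nat.mod_eq_of_lt (f i).2.2))
    · intro f hf
      simp only [Finset.mem_filter, bchExponents] at hf
      have hle : ∀ i, (f i).1 + (f i).2 ≤ m := fun i => by
        rw [← hf.2]
        exact Finset.single_le_sum (f := fun i => (f i).1 + (f i).2) (fun _ _ => Nat.zero_le _)
          (Finset.mem_univ i)
      funext i
      have := hle i
      simp only [Fin.ofNat]
      rw [Nat.mod_eq_of_lt (by omega), Nat.mod_eq_of_lt (by omega)]
    · intro f _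
      rw [smul_smul, smul_smul]
      congr 1
      rw [PowerSeries.coeff_log, if_neg hk0, bchWeight]
      have : (m : ℝ) ≠ 0 := by exact_mod_cast hm0
      have hs : (-1 : ℝ) ^ (k + 1) = (-1) ^ (k - 1) := by
        obtain ⟨k, rfl⟩ := Nat.exists_eq_succ_of_ne_zero hk0
        simp [pow_succ]
      simp only [eq_ratCast, Rat.cast_div, Rat.cast_pow, Rat.cast_neg, Rat.cast_one,
        Rat.cast_natCast, hs]
      field_simp
  · intro k hk hk'
    rcases eq_or_ne k 0 with rfl | hk0
    · simp
    rw [Finset.sum_eq_zero, smul_zero]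
    intro f hf
    exfalso
    rw [Finset.mem_filter, bchExponents, Fintype.mem_piFinset] at hf
    have : ∑ _i : Fin k, 1 ≤ ∑ i, ((f i).1 + (f i).2) := Finset.sum_le_sum fun i _ => by
      by_contra h
      exact (Finset.mem_erase.1 (hf.1 i)).1 (Prod.ext (by simp; omega) (by simp; omega))
    rw [hf.2] at this
    simp at this hk'
    omega

/-- Commutator. -/
def comm {A : Type*} [Ring A] (x y : A) : A := x * y - y * x

section ad
variable {S : Type*} [Ring S] [Algebra ℝ S]

def adOp (a : S) : Module.End ℝ S := LinearMap.mulLeft ℝ a - LinearMap.mulRight ℝ a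

theorem adOp_apply (a s : S) : adOp a s = a * s - s * a := by simp [adOp]

theorem adOp_word (D : S) : ∀ l : List S, l ≠ [] → (∀ a ∈ l, D * a - a * D = a) →
    (l.map adOp).prod (-D) = rightNested comm l
  | [], h, _ => absurd rfl h
  | [a], _, h => by
    have := h a (by simp)
    simp only [List.map_cons, List.map_nil, List.prod_cons, List.prod_nil, mul_one, adOp_apply,
      rightNested]
    rw [← sub_eq_zero] at this ⊢
    rw [← this]; noncomm_ring
  | a :: b :: l, _, h => by
    rw [List.map_cons, List.prod_cons, Module.End.mul_apply,
      adOp_word D (b :: l) (by simp) fun c hc => h c (by simp_all), adOp_apply]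
    rfl

theorem commute_mulLeft_mulRight (a b : S) :
    Commute (LinearMap.mulLeft ℝ a) (LinearMap.mulRight ℝ b) := by
  refine LinearMap.ext fun s => ?_
  simp [mul_assoc]

theorem mulRight_pow (a : S) (n : ℕ) : LinearMap.mulRight ℝ a ^ n = LinearMap.mulRight ℝ (a ^ n) :=
  LinearMap.pow_mulRight ℝ S a n

theorem adOp_pow {n : ℕ} {a : S} (ha : a ^ n = 0) : adOp a ^ (2 * n) = 0 := by
  rw [adOp, sub_eq_add_neg]
  rcases eq_or_ne n 0 with rfl | hn
  · rw [pow_zero] at ha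
    refine LinearMap.ext fun s => ?_
    calc _ = (1 : S) * _ := (one_mul _).symm
      _ = _ := by rw [ha, zero_mul]; rfl
  refine Commute.add_pow_eq_zero_of_add_le_succ_of_pow_eq_zero (m := n) (n := n)
    ((commute_mulLeft_mulRight a a).neg_right) ?_ ?_ (by omega)
  · rw [LinearMap.pow_mulLeft, ha, LinearMap.mulLeft_zero_eq_zero]
  · rw [neg_pow, mulRight_pow, ha, LinearMap.mulRight_zero_eq_zero, mul_zero]

theorem nexp_adOp {n : ℕ} {a : S} (ha : a ^ n = 0) (s : S) :
    nexp (2 * n) (adOp a) s = nexp n a * s * nexp n (-a) := by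
  have hL : (LinearMap.mulLeft ℝ a) ^ n = 0 := by
    rw [LinearMap.pow_mulLeft, ha, LinearMap.mulLeft_zero_eq_zero]
  have hR : (LinearMap.mulRight ℝ (-a)) ^ n = 0 := by
    rw [mulRight_pow, neg_pow_eq_zero ha, LinearMap.mulRight_zero_eq_zero]
  have e : adOp a = LinearMap.mulLeft ℝ a + LinearMap.mulRight ℝ (-a) := by
    refine LinearMap.ext fun s => ?_
    simp [adOp_apply, sub_eq_add_neg]
  have hle : n ≤ 2 * n := by omega
  have hs := adOp_pow ha
  rw [e] at hs ⊢
  rw [nexp_add (commute_mulLeft_mulRight _ _) (pow_eq_zero_of_le hle hL)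
    (pow_eq_zero_of_le hle hR) hs, nexp_eq_of_le hle hL, nexp_eq_of_le hle hR]
  have e1 : ∀ t, nexp n (LinearMap.mulLeft ℝ a) t = nexp n a * t := by
    intro t
    simp [nexp, LinearMap.pow_mulLeft, LinearMap.sum_apply, Finset.sum_mul]
  have e2 : ∀ t, nexp n (LinearMap.mulRight ℝ (-a)) t = t * nexp n (-a) := by
    intro t
    simp only [nexp, mulRight_pow, LinearMap.sum_apply, Finset.mul_sum, LinearMap.smul_apply,
      LinearMap.mulRight_apply, mul_smul_comm]
  rw [Module.End.mul_apply, e1, e2, mul_assoc]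

/-- If `D` is an element with `[D, x] = x` and `[D, y] = y`, then `[D, log (exp x exp y)]` is the sum of
the right nested commutators of the words of the logarithmic series. -/
theorem comm_euler_nlog {n : ℕ} (hn : n ≠ 0) {x y D : S} (hx : x ^ n = 0) (hy : y ^ n = 0)
    (hP : (nexp n x * nexp n y - 1) ^ n = 0) (hDx : D * x - x * D = x) (hDy : D * y - y * D = y) :
    D * nlog n (nexp n x * nexp n y - 1) - nlog n (nexp n x * nexp n y - 1) * D
      = ∑ k ∈ Finset.range (2 * n), (PowerSeries.coeff k (PowerSeries.log ℝ)) •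
          ∑ f ∈ bchExponents (2 * n) k, bchWeight f • rightNested comm (bchWord x y f) := by
  set Z := nlog n (nexp n x * nexp n y - 1) with hZ
  have hZn : Z ^ n = 0 := nlog_pow_eq_zero hP
  have hZe : nexp n Z = nexp n x * nexp n y := by rw [hZ, nexp_nlog hP]; abel
  have hZe' : nexp n (-Z) = nexp n (-y) * nexp n (-x) := by
    have h1 : nexp n Z * (nexp n (-y) * nexp n (-x)) = 1 := by
      rw [hZe, mul_assoc, ← mul_assoc (nexp n y), nexp_mul_nexp_neg hy, one_mul,
        nexp_mul_nexp_neg hx]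
    calc nexp n (-Z) = nexp n (-Z) * (nexp n Z * (nexp n (-y) * nexp n (-x))) := by
          rw [h1, mul_one]
      _ = _ := by rw [← mul_assoc, nexp_neg_mul_nexp hZn, one_mul]
  have hexp : nexp (2 * n) (adOp Z) = nexp (2 * n) (adOp x) * nexp (2 * n) (adOp y) := by
    refine LinearMap.ext fun s => ?_
    rw [Module.End.mul_apply, nexp_adOp hZn, nexp_adOp hx, nexp_adOp hy, hZe, hZe']
    simp only [mul_assoc]
  have h := nlog_nexp (adOp_pow hZn)
  rw [hexp, nlog_nexp_mul_nexp (by omega)] at h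
  have h2 := LinearMap.congr_fun h (-D)
  rw [adOp_apply] at h2
  have h3 : D * Z - Z * D = Z * -D - -D * Z := by noncomm_ring
  rw [h3, ← h2, LinearMap.sum_apply]
  refine Finset.sum_congr rfl fun k hk => ?_
  rcases eq_or_ne k 0 with rfl | hk0
  · simp
  rw [LinearMap.smul_apply, LinearMap.sum_apply]
  congr 1
  refine Finset.sum_congr rfl fun f hf => ?_
  rw [LinearMap.smul_apply, ← bchWord_map]
  congr 1
  refine adOp_word D _ ?_ fun a ha => ?_
  · intro h
    have := length_bchWord x y f
    rw [h, List.length_nil] at this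
    rw [bchExponents, Fintype.mem_piFinset] at hf
    have h1 := (Finset.mem_erase.1 (hf ⟨0, Nat.pos_of_ne_zero hk0⟩)).1
    have h2 := (Finset.sum_eq_zero_iff.1 this.symm) ⟨0, Nat.pos_of_ne_zero hk0⟩ (Finset.mem_univ _)
    exact h1 (Prod.ext (by simpa using (Nat.add_eq_zero_iff.1 h2).1)
      (by simpa using (Nat.add_eq_zero_iff.1 h2).2))
  · rcases mem_bchWord ha with rfl | rfl
    exacts [hDx, hDy]

end ad
end dynkin

/-- A multiplicative decreasing filtration that vanishes from step `n` on. -/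
structure NilFiltration {A : Type*} [Ring A] [Algebra ℝ A] (I : ℕ → Submodule ℝ A) (n : ℕ) : Prop where
  one_mem : 1 ∈ I 0
  mul_mem : ∀ i j a b, a ∈ I i → b ∈ I j → a * b ∈ I (i + j)
  anti : Antitone I
  eq_bot : I n = ⊥

namespace NilFiltration
variable {A : Type*} [Ring A] [Algebra ℝ A] {I : ℕ → Submodule ℝ A} {n : ℕ}
  (h : NilFiltration I n)
include h

theorem pow_mem {a : A} (ha : a ∈ I 1) (k : ℕ) : a ^ k ∈ I k := by
  induction k with
  | zero => simpa using h.one_mem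
  | succ k ih => rw [pow_succ]; exact h.mul_mem _ _ _ _ ih ha

theorem pow_eq_zero {a : A} (ha : a ∈ I 1) : a ^ n = 0 := by
  have := h.pow_mem ha n
  rwa [h.eq_bot, Submodule.mem_bot] at this

theorem sum_pow_mem {a : A} (ha : a ∈ I 1) (c : ℕ → ℝ) (N : ℕ) (h0 : c 0 = 0) :
    ∑ i ∈ Finset.range N, c i • a ^ i ∈ I 1 := by
  refine Submodule.sum_mem _ fun i _ => ?_
  rcases Nat.eq_zero_or_pos i with rfl | hi
  · simp [h0]
  · exact Submodule.smul_mem _ _ (h.anti hi (h.pow_mem ha i))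

theorem nexp_sub_one_mem {a : A} (ha : a ∈ I 1) : nexp n a - 1 ∈ I 1 := by
  rcases eq_or_ne n 0 with rfl | hn
  · have : (1 : A) = 0 := by
      have := h.one_mem; rwa [h.eq_bot, Submodule.mem_bot] at this
    simp [nexp, this]
  have : nexp n a - 1
      = ∑ i ∈ Finset.range n, (if i = 0 then 0 else ((i.factorial : ℝ)⁻¹)) • a ^ i := by
    obtain ⟨n, rfl⟩ := Nat.exists_eq_succ_of_ne_zero hn
    rw [nexp, Finset.sum_range_succ', Finset.sum_range_succ']
    simp
  rw [this]
  exact h.sum_pow_mem ha _ n (by simp)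

theorem nlog_mem {a : A} (ha : a ∈ I 1) : nlog n a ∈ I 1 :=
  h.sum_pow_mem ha _ n (by simp)

theorem nexp_mul_nexp_sub_one_mem {a b : A} (ha : a ∈ I 1) (hb : b ∈ I 1) :
    nexp n a * nexp n b - 1 ∈ I 1 := by
  have h1 := h.nexp_sub_one_mem ha
  have h2 := h.nexp_sub_one_mem hb
  have h3 := h.anti (show 1 ≤ 1 + 1 by omega) (h.mul_mem _ _ _ _ h1 h2)
  have : nexp n a * nexp n b - 1
      = (nexp n a - 1) * (nexp n b - 1) + (nexp n a - 1) + (nexp n b - 1) := by noncomm_ring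
  rw [this]
  exact add_mem (add_mem h3 h1) h2

/-- The polynomials whose coefficient at `X ^ m` lies in `I m`, and vanishes for `m < j`. -/
def _root_.GraphCx.polyFiltration {A : Type*} [Ring A] [Algebra ℝ A] (I : ℕ → Submodule ℝ A)
    (j : ℕ) : Submodule ℝ (Polynomial A) where
  carrier := {p | ∀ m, p.coeff m ∈ I m ∧ (m < j → p.coeff m = 0)}
  add_mem' {p q} hp hq m := ⟨by
    rw [Polynomial.coeff_add]; exact add_mem (hp m).1 (hq m).1, fun hm => by
    rw [Polynomial.coeff_add, (hp m).2 hm, (hq m).2 hm, add_zero]⟩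
  zero_mem' m := by simp
  smul_mem' r p hp m := ⟨by
    rw [Polynomial.coeff_smul]; exact Submodule.smul_mem _ _ (hp m).1, fun hm => by
    rw [Polynomial.coeff_smul, (hp m).2 hm, smul_zero]⟩

theorem poly : NilFiltration (polyFiltration I) n where
  one_mem m := ⟨by
    rw [Polynomial.coeff_one]; split_ifs with hm
    · subst hm; exact h.one_mem
    · exact zero_mem _, fun hm => by omega⟩
  mul_mem i j p q hp hq m := ⟨by
    rw [Polynomial.coeff_mul]
    refine Submodule.sum_mem _ fun x hx => ?_
    rw [← Finset.HasAntidiagonal.mem_antidiagonal.1 hx]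
    exact h.mul_mem _ _ _ _ (hp _).1 (hq _).1, fun hm => by
    rw [Polynomial.coeff_mul]
    refine Finset.sum_eq_zero fun x hx => ?_
    have := Finset.HasAntidiagonal.mem_antidiagonal.1 hx
    rcases lt_or_ge x.1 i with h1 | h1
    · rw [(hp _).2 h1, zero_mul]
    · rw [(hq x.2).2 (by omega), mul_zero]⟩
  anti i j hij p hp m := ⟨(hp m).1, fun hm => (hp m).2 (by omega)⟩
  eq_bot := by
    rw [eq_bot_iff]
    intro p hp
    rw [Submodule.mem_bot]
    ext m
    rw [Polynomial.coeff_zero]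
    rcases lt_or_ge m n with hm | hm
    · exact (hp m).2 hm
    · have := h.anti hm (hp m).1
      rwa [h.eq_bot, Submodule.mem_bot] at this

omit h in
theorem poly_X_mem {a : A} (ha : a ∈ I 1) : Polynomial.monomial 1 a ∈ polyFiltration I 1 := by
  intro m
  rw [Polynomial.coeff_monomial]
  split_ifs with hm
  · subst hm; exact ⟨ha, fun h => by omega⟩
  · exact ⟨zero_mem _, fun _ => rfl⟩

omit [Algebra ℝ A] h in
theorem rightNested_monomial (l : List A) :
    rightNested comm (l.map (Polynomial.monomial 1))
      = Polynomial.monomial l.length (rightNested comm l) := by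
  match l with
  | [] => simp [rightNested]
  | [x] => simp [rightNested]
  | x :: y :: l =>
    have ih := rightNested_monomial (y :: l)
    simp only [List.map_cons, rightNested] at ih ⊢
    rw [ih, comm, Polynomial.monomial_mul_monomial, Polynomial.monomial_mul_monomial, comm]
    simp only [List.length_cons, map_sub]
    rw [add_comm 1 (l.length + 1)]

/-- The Euler operator `X d/dX`. -/
def _root_.GraphCx.polyEuler (A : Type*) [Ring A] [Algebra ℝ A] : Module.End ℝ (Polynomial A) :=
  LinearMap.mulLeft ℝ Polynomial.X ∘ₗ (Polynomial.derivative.restrictScalars ℝ)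

omit h in
theorem polyEuler_comm (p : Polynomial A) :
    polyEuler A * LinearMap.mulLeft ℝ p - LinearMap.mulLeft ℝ p * polyEuler A
      = LinearMap.mulLeft ℝ (polyEuler A p) := by
  refine LinearMap.ext fun q => ?_
  simp only [polyEuler, LinearMap.sub_apply, Module.End.mul_apply, LinearMap.comp_apply,
    LinearMap.mulLeft_apply, LinearMap.restrictScalars_apply, Polynomial.derivative_mul]
  have hc := (Polynomial.commute_X p).eq
  rw [mul_add, ← mul_assoc p, ← hc]
  simp only [← mul_assoc, add_sub_cancel_right]

omit h in
theorem coeff_polyEuler (p : Polynomial A) (m : ℕ) :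
    (polyEuler A p).coeff m = (m : ℝ) • p.coeff m := by
  change (Polynomial.X * Polynomial.derivative p).coeff m = _
  cases m with
  | zero => simp
  | succ m =>
    rw [Polynomial.coeff_X_mul, Polynomial.coeff_derivative, ← Nat.cast_succ, Nat.cast_smul_eq_nsmul,
      nsmul_eq_mul, ← Nat.cast_comm]

/-- The Baker-Campbell-Hausdorff formula. -/
theorem nexp_dynkin {x y : A} (hx : x ∈ I 1) (hy : y ∈ I 1) :
    nexp n (∑ m ∈ Finset.range n, dynkin comm x y m) = nexp n x * nexp n y := by
  rcases eq_or_ne n 0 with rfl | hn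
  · have : (1 : A) = 0 := by
      have := h.one_mem; rwa [h.eq_bot, Submodule.mem_bot] at this
    simp [nexp]
  set x' : Polynomial A := Polynomial.monomial 1 x
  set y' : Polynomial A := Polynomial.monomial 1 y
  have hx' := poly_X_mem (I := I) hx
  have hy' := poly_X_mem (I := I) hy
  have hP := h.poly.nexp_mul_nexp_sub_one_mem hx' hy'
  have hPn := h.poly.pow_eq_zero hP
  have hZm := h.poly.nlog_mem hP
  set Z := nlog n (nexp n x' * nexp n y' - 1) with hZ
  have hZe : nexp n Z = nexp n x' * nexp n y' := by
    rw [hZ, nexp_nlog hPn]; abel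
  set L : Polynomial A →ₐ[ℝ] Module.End ℝ (Polynomial A) := Algebra.lmul ℝ (Polynomial A) with hL
  have hLa : ∀ p, L p = LinearMap.mulLeft ℝ p := fun p => rfl
  have hLinj : Function.Injective L := fun p q hpq => by
    have := LinearMap.congr_fun hpq 1
    simpa [hLa] using this
  have eul : ∀ a : A, polyEuler A (Polynomial.monomial 1 a) = Polynomial.monomial 1 a := by
    intro a
    ext m
    rw [coeff_polyEuler, Polynomial.coeff_monomial]
    split_ifs with hm
    · subst hm; simp
    · simp
  have key := comm_euler_nlog (S := Module.End ℝ (Polynomial A)) (D := polyEuler A) hn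
    (x := L x') (y := L y') (by rw [← map_pow, h.poly.pow_eq_zero hx', map_zero])
    (by rw [← map_pow, h.poly.pow_eq_zero hy', map_zero])
    (by rw [← map_nexp, ← map_nexp, ← map_mul, ← map_one L, ← map_sub, ← map_pow, hPn, map_zero])
    (by rw [hLa, polyEuler_comm, eul]) (by rw [hLa, polyEuler_comm, eul])
  have hZL : nlog n (nexp n (L x') * nexp n (L y') - 1) = L Z := by
    rw [← map_nexp, ← map_nexp, ← map_mul, ← map_one L, ← map_sub]
    rw [← map_nlog, hZ]
  rw [hZL, hLa Z, polyEuler_comm, ← hLa] at key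
  have key2 : polyEuler A Z = ∑ k ∈ Finset.range (2 * n),
      (PowerSeries.coeff k (PowerSeries.log ℝ)) • ∑ f ∈ bchExponents (2 * n) k,
        bchWeight f • Polynomial.monomial (∑ i, ((f i).1 + (f i).2))
          (rightNested comm (bchWord x y f)) := by
    refine hLinj (key.trans ?_)
    rw [map_sum]
    refine Finset.sum_congr rfl fun k _ => ?_
    rw [map_smul, map_sum]
    congr 1
    refine Finset.sum_congr rfl fun f _ => ?_
    rw [map_smul, ← length_bchWord x y f, ← rightNested_monomial, bchWord_map, ← bchWord_map L]
    congr 1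
    refine ((map_rightNested comm comm L (map_zero L) (fun _ => True) (by simp) ?_ _ (by simp)).1).symm
    intro a b _ _
    simp [comm]
  have hcoeff : ∀ m < n, Z.coeff m = dynkin comm x y m := by
    intro m hm
    rcases eq_or_ne m 0 with rfl | hm0
    · rw [(hZm 0).2 (by omega)]; simp [dynkin]
    · have h1 := coeff_polyEuler Z m
      have hmr : (m : ℝ) ≠ 0 := by exact_mod_cast hm0
      refine smul_right_injective A hmr ?_
      change (m : ℝ) • _ = (m : ℝ) • _
      rw [← h1, key2, dynkin_eq comm x y (show m < 2 * n by omega), Polynomial.finsetSum_coeff]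
      refine Finset.sum_congr rfl fun k _ => ?_
      rw [Polynomial.coeff_smul, Polynomial.finsetSum_coeff, Finset.sum_filter]
      congr 1
      refine Finset.sum_congr rfl fun f _ => ?_
      rw [Polynomial.coeff_smul, Polynomial.coeff_monomial]
      split_ifs <;> simp
  set ev : Polynomial A →ₐ[ℝ] A := Polynomial.eval₂AlgHom (AlgHom.id ℝ A) 1
    (fun a => Commute.one_right _) with hev
  have hevm : ∀ (m : ℕ) (a : A), ev (Polynomial.monomial m a) = a := by
    intro m a
    simp [hev]
  have hevZ : ev Z = ∑ m ∈ Finset.range n, dynkin comm x y m := by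
    have hdeg : Z.natDegree < n := by
      rw [Nat.lt_iff_le_pred (Nat.pos_of_ne_zero hn), Polynomial.natDegree_le_iff_coeff_eq_zero]
      intro m hm
      have := h.anti (show n ≤ m by omega) (hZm m).1
      rwa [h.eq_bot, Submodule.mem_bot] at this
    rw [Polynomial.as_sum_range' Z n hdeg, map_sum]
    refine Finset.sum_congr rfl fun m hm => ?_
    rw [hevm, hcoeff m (Finset.mem_range.1 hm)]
  rw [← hevZ, ← map_nexp, hZe, map_mul, map_nexp, map_nexp, hevm, hevm]

end NilFiltration

theorem map_dynkin {M M' : Type*} [AddCommGroup M] [Module ℝ M] [AddCommGroup M'] [Module ℝ M']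
    (br : M → M → M) (br' : M' → M' → M') (φ : M →ₗ[ℝ] M') (P : M → Prop)
    (hP : ∀ x y, P x → P y → P (br x y)) (h : ∀ x y, P x → P y → φ (br x y) = br' (φ x) (φ y))
    {x y : M} (hx : P x) (hy : P y) (m : ℕ) :
    φ (dynkin br x y m) = dynkin br' (φ x) (φ y) m := by
  unfold dynkin
  simp only [map_sum, map_smul]
  refine Finset.sum_congr rfl fun k _ => Finset.sum_congr rfl fun f _ => ?_
  congr 1
  have h1 := (map_rightNested br br' φ (map_zero φ) P hP h
    (bchWord x y fun i => (((f i).1 : ℕ), ((f i).2 : ℕ))) (fun z hz => by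
      rcases mem_bchWord hz with rfl | rfl <;> assumption)).1
  rw [bchWord_map] at h1
  exact h1

theorem NilFiltration.nexp_dynkin_op {A : Type*} [Ring A] [Algebra ℝ A] {I : ℕ → Submodule ℝ A}
    {n : ℕ} (h : NilFiltration I n) {x y : A} (hx : x ∈ I 1) (hy : y ∈ I 1) :
    nexp n (∑ m ∈ Finset.range n, dynkin (fun a b => b * a - a * b) x y m)
      = nexp n y * nexp n x := by
  have h' : NilFiltration (A := Aᵐᵒᵖ)
      (fun k => (I k).comap (MulOpposite.opLinearEquiv ℝ).symm.toLinearMap) n :=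
    { one_mem := h.one_mem
      mul_mem := fun i j a b ha hb => by
        have := h.mul_mem _ _ _ _ hb ha
        rw [add_comm] at this
        exact this
      anti := fun i j hij a ha => h.anti hij ha
      eq_bot := by
        rw [eq_bot_iff]
        intro a ha
        have : MulOpposite.unop a ∈ I n := ha
        rw [h.eq_bot, Submodule.mem_bot] at this
        exact MulOpposite.unop_injective this }
  have key := h'.nexp_dynkin (x := MulOpposite.op x) (y := MulOpposite.op y) hx hy
  have hop : ∀ a : A, MulOpposite.op (nexp n a) = nexp n (MulOpposite.op a) := by
    intro a
    unfold nexp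
    rw [← MulOpposite.coe_opLinearEquiv ℝ, map_sum]
    rfl
  refine MulOpposite.op_injective ?_
  rw [MulOpposite.op_mul, hop, hop, hop, ← key, ← MulOpposite.coe_opLinearEquiv ℝ, map_sum]
  congr 1
  refine Finset.sum_congr rfl fun m _ => ?_
  exact map_dynkin (fun a b : A => b * a - a * b) comm (MulOpposite.opLinearEquiv ℝ).toLinearMap
    (fun _ => True) (fun _ _ _ _ => trivial) (fun _ _ _ _ => rfl) trivial trivial m

/-! ### Exponentials of operators that raise a filtration -/

/-- A decreasing separated filtration. -/
structure SepFiltration {C : Type*} [AddCommGroup C] [Module ℝ C] (F : ℕ → Submodule ℝ C) : Prop where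
  zero : F 0 = ⊤
  anti : Antitone F
  sep : ∀ f, (∀ N, f ∈ F N) → f = 0

namespace SepFiltration
variable {C : Type*} [AddCommGroup C] [Module ℝ C] {F : ℕ → Submodule ℝ C}

/-- The operator raises the filtration. -/
def Raises (F : ℕ → Submodule ℝ C) (T : Module.End ℝ C) : Prop := ∀ N, ∀ f ∈ F N, T f ∈ F (N + 1)

/-- `E` is the sum of the exponential series of `T`. -/
def IsExp (F : ℕ → Submodule ℝ C) (T : Module.End ℝ C) (E : C → C) : Prop :=
  ∀ N f, E f - ∑ k ∈ Finset.range N, ((k.factorial : ℝ)⁻¹) • (T ^ k) f ∈ F N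

/-- The operators that preserve the filtration. -/
def preserving (F : ℕ → Submodule ℝ C) : Subalgebra ℝ (Module.End ℝ C) where
  carrier := {T | ∀ N, ∀ f ∈ F N, T f ∈ F N}
  mul_mem' hS hT N f hf := hS N _ (hT N f hf)
  add_mem' hS hT N f hf := add_mem (hS N f hf) (hT N f hf)
  algebraMap_mem' r N f hf := by
    rw [Module.algebraMap_end_apply]; exact Submodule.smul_mem _ _ hf

/-- The operator induced on a quotient. -/
def quot (F : ℕ → Submodule ℝ C) (N : ℕ) : preserving F →ₐ[ℝ] Module.End ℝ (C ⧸ F N) where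
  toFun T := (F N).mapQ (F N) T.1 (T.2 N)
  map_one' := by ext; rfl
  map_mul' _ _ := by ext; rfl
  map_zero' := by ext; rfl
  map_add' _ _ := by ext; rfl
  commutes' _ := by ext; rfl

theorem quot_mk (N : ℕ) (T : preserving F) (f : C) :
    quot F N T ((F N).mkQ f) = (F N).mkQ (T.1 f) := rfl

/-- The filtration of the operators on a quotient. -/
def endFiltration (F : ℕ → Submodule ℝ C) (N k : ℕ) : Submodule ℝ (Module.End ℝ (C ⧸ F N)) where
  carrier := {T | ∀ i, ∀ f ∈ (F i).map (F N).mkQ, T f ∈ (F (i + k)).map (F N).mkQ}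
  add_mem' hS hT i f hf := add_mem (hS i f hf) (hT i f hf)
  zero_mem' _ _ _ := zero_mem _
  smul_mem' _ _ hT i f hf := Submodule.smul_mem _ _ (hT i f hf)

variable (hF : SepFiltration F)
include hF

theorem nilFiltration (N : ℕ) : NilFiltration (endFiltration F N) N where
  one_mem _ _ hf := hf
  mul_mem i j S T hS hT k f hf := by
    have := hS _ _ (hT _ _ hf)
    rw [add_assoc, add_comm j i] at this
    exact this
  anti i j hij T hT k f hf := Submodule.map_mono (hF.anti (by omega)) (hT k f hf)
  eq_bot := by
    rw [eq_bot_iff]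
    intro T hT
    rw [Submodule.mem_bot]
    ext f
    have h := hT 0 ((F N).mkQ f) ⟨f, by rw [hF.zero]; trivial, rfl⟩
    rw [zero_add] at h
    obtain ⟨g, hg, hg'⟩ := h
    rw [LinearMap.comp_apply, ← hg']
    exact (Submodule.Quotient.mk_eq_zero _).2 hg

theorem Raises.mem_preserving {T : Module.End ℝ C} (hT : Raises F T) : T ∈ preserving F :=
  fun N f hf => hF.anti (Nat.le_succ N) (hT N f hf)

theorem Raises.quot_mem {T : Module.End ℝ C} (hT : Raises F T) (N : ℕ) :
    quot F N ⟨T, Raises.mem_preserving hF hT⟩ ∈ endFiltration F N 1 := by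
  rintro i _ ⟨f, hf, rfl⟩
  exact ⟨T f, hT i f hf, rfl⟩

omit hF in
theorem IsExp.mk_eq {T : preserving F} {E : C → C} (hE : IsExp F T.1 E) (N : ℕ) (f : C) :
    (F N).mkQ (E f) = nexp N (quot F N T) ((F N).mkQ f) := by
  have h := (Submodule.Quotient.mk_eq_zero _).2 (hE N f)
  have h2 : (F N).mkQ (E f - ∑ k ∈ Finset.range N, ((k.factorial : ℝ)⁻¹) • (T.1 ^ k) f) = 0 := h
  rw [map_sub, sub_eq_zero] at h2
  rw [h2, map_sum, nexp, LinearMap.sum_apply]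
  refine Finset.sum_congr rfl fun k _ => ?_
  rw [map_smul, LinearMap.smul_apply, ← map_pow, quot_mk]
  rfl

theorem eq_of_mk_eq {f g : C} (h : ∀ N, (F N).mkQ f = (F N).mkQ g) : f = g := by
  rw [← sub_eq_zero]
  refine hF.sep _ fun N => ?_
  rw [← Submodule.Quotient.mk_eq_zero]
  have := h N
  rw [← sub_eq_zero, ← map_sub] at this
  exact this

/-- The exponential of the Baker-Campbell-Hausdorff series, for the opposite commutator. -/
theorem IsExp.bch {x y z : Module.End ℝ C} (hx : Raises F x) (hy : Raises F y) (hz : Raises F z)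
    (hxyz : ∀ N f, z f - ∑ m ∈ Finset.range N, dynkin (fun a b => b * a - a * b) x y m f ∈ F N)
    {Ex Ey Ez : C → C} (hEx : IsExp F x Ex) (hEy : IsExp F y Ey) (hEz : IsExp F z Ez) (f : C) :
    Ez f = Ey (Ex f) := by
  refine eq_of_mk_eq hF fun N => ?_
  rw [IsExp.mk_eq (T := ⟨z, Raises.mem_preserving hF hz⟩) hEz,
    IsExp.mk_eq (T := ⟨y, Raises.mem_preserving hF hy⟩) hEy,
    IsExp.mk_eq (T := ⟨x, Raises.mem_preserving hF hx⟩) hEx, ← Module.End.mul_apply,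
    ← (hF.nilFiltration N).nexp_dynkin_op (Raises.quot_mem hF hx N) (Raises.quot_mem hF hy N)]
  congr 2
  refine LinearMap.ext fun g => ?_
  obtain ⟨g, rfl⟩ := (F N).mkQ_surjective g
  have h2 : (F N).mkQ (z g - ∑ m ∈ Finset.range N,
      dynkin (fun a b => b * a - a * b) x y m g) = 0 :=
    (Submodule.Quotient.mk_eq_zero _).2 (hxyz N g)
  rw [map_sub, sub_eq_zero] at h2
  rw [quot_mk, h2, map_sum, LinearMap.sum_apply]
  refine Finset.sum_congr rfl fun m _ => ?_
  have e1 : quot F N (dynkin (fun a b => b * a - a * b) ⟨x, Raises.mem_preserving hF hx⟩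
      ⟨y, Raises.mem_preserving hF hy⟩ m) = _ :=
    map_dynkin (fun a b : preserving F => b * a - a * b) (fun a b => b * a - a * b)
      (quot F N).toLinearMap (fun _ => True) (fun _ _ _ _ => trivial)
      (fun a b _ _ => by simp) trivial trivial m
  have e2 : (dynkin (fun a b : preserving F => b * a - a * b) ⟨x, Raises.mem_preserving hF hx⟩
      ⟨y, Raises.mem_preserving hF hy⟩ m).1 = _ :=
    map_dynkin (fun a b : preserving F => b * a - a * b) (fun a b => b * a - a * b)
      (preserving F).val.toLinearMap (fun _ => True) (fun _ _ _ _ => trivial)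
      (fun a b _ _ => rfl) trivial trivial m
  have e3 := quot_mk N (dynkin (fun a b : preserving F => b * a - a * b)
    ⟨x, Raises.mem_preserving hF hx⟩ ⟨y, Raises.mem_preserving hF hy⟩ m) g
  rw [e1, e2] at e3
  exact e3.symm

theorem IsExp.injective {x y : Module.End ℝ C} (hx : Raises F x) (hy : Raises F y)
    {E : C → C} (hEx : IsExp F x E) (hEy : IsExp F y E) : x = y := by
  refine LinearMap.ext fun f => eq_of_mk_eq hF fun N => ?_
  have hN := hF.nilFiltration N
  have hxN := hN.pow_eq_zero (Raises.quot_mem hF hx N)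
  have hyN := hN.pow_eq_zero (Raises.quot_mem hF hy N)
  obtain ⟨X, rfl⟩ : ∃ X : preserving F, X.1 = x := ⟨⟨x, Raises.mem_preserving hF hx⟩, rfl⟩
  obtain ⟨Y, rfl⟩ : ∃ Y : preserving F, Y.1 = y := ⟨⟨y, Raises.mem_preserving hF hy⟩, rfl⟩
  have h0 : nexp N (quot F N X) = nexp N (quot F N Y) := by
    refine LinearMap.ext fun g => ?_
    obtain ⟨g, rfl⟩ := (F N).mkQ_surjective g
    rw [← IsExp.mk_eq (T := X) hEx, ← IsExp.mk_eq (T := Y) hEy]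
  have h1 : quot F N X = quot F N Y := nexp_injective hxN hyN h0
  rw [← quot_mk N X, h1, quot_mk]

theorem IsExp.neg {x : Module.End ℝ C} (hx : Raises F x) {E E' : C → C} (hE : IsExp F x E)
    (hE' : IsExp F (-x) E') (f : C) : E (E' f) = f := by
  refine eq_of_mk_eq hF fun N => ?_
  have hxN := (hF.nilFiltration N).pow_eq_zero (Raises.quot_mem hF hx N)
  obtain ⟨X, rfl⟩ : ∃ X : preserving F, X.1 = x := ⟨⟨x, Raises.mem_preserving hF hx⟩, rfl⟩
  have h1 := IsExp.mk_eq (T := X) hE N (E' f)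
  have h2 : (F N).mkQ (E' f) = nexp N (quot F N (-X)) ((F N).mkQ f) :=
    IsExp.mk_eq (T := -X) hE' N f
  rw [h1, h2, ← Module.End.mul_apply, map_neg, nexp_mul_nexp_neg hxN]
  rfl

theorem IsExp.zero {E : C → C} (hE : IsExp F 0 E) (f : C) : E f = f := by
  refine eq_of_mk_eq hF fun N => ?_
  have h0 : (F N).mkQ (E f) = nexp N (quot F N 0) ((F N).mkQ f) := IsExp.mk_eq (T := (0 : preserving F)) hE N f
  rw [h0, map_zero]
  rcases eq_or_ne N 0 with rfl | hN
  · have h1 : ∀ g, (F 0).mkQ g = 0 := fun g =>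
      (Submodule.Quotient.mk_eq_zero (F 0)).2 (by rw [hF.zero]; exact Submodule.mem_top)
    simp only [nexp, Finset.range_zero, Finset.sum_empty, LinearMap.zero_apply, h1]
  · rw [nexp_zero hN]; rfl

theorem IsExp.commute {x T : Module.End ℝ C} {E : C → C}
    (hE : IsExp F x E) (hT : T ∈ preserving F) (h : x * T = T * x) (f : C) : E (T f) = T (E f) := by
  refine eq_of_mk_eq hF fun N => ?_
  have h1 : ∀ g, (F N).mkQ (E g)
      = (F N).mkQ (∑ k ∈ Finset.range N, ((k.factorial : ℝ)⁻¹) • (x ^ k) g) := fun g =>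
    (Submodule.Quotient.eq (F N)).2 (hE N g)
  have h2 : (F N).mkQ (T (E f))
      = (F N).mkQ (T (∑ k ∈ Finset.range N, ((k.factorial : ℝ)⁻¹) • (x ^ k) f)) := by
    refine (Submodule.Quotient.eq (F N)).2 ?_
    rw [← map_sub]; exact hT N _ (hE N f)
  rw [h1, h2]
  congr 1
  rw [map_sum]
  refine Finset.sum_congr rfl fun k _ => ?_
  have h3 : x ^ k * T = T * x ^ k := (Commute.pow_left h k).eq
  rw [LinearMap.map_smul, ← Module.End.mul_apply, h3]
  rfl

omit hF in
theorem IsExp.raises_pow {x : Module.End ℝ C} (hx : Raises F x) (k N : ℕ) (f : C) (hf : f ∈ F N) :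
    (x ^ k) f ∈ F (N + k) := by
  induction k with
  | zero => exact hf
  | succ k ih => rw [pow_succ']; exact hx _ _ ih

end SepFiltration

/-! ### Signs -/

/-- The sign `(-1) ^ e`. -/
def sg (e : ZMod 2) : ℝ := if e = 1 then -1 else 1

theorem sg_add (a b : ZMod 2) : sg (a + b) = sg a * sg b := by
  have key : ∀ a b : ZMod 2, (a + b = 1 ↔ ((a = 1 ∧ b ≠ 1) ∨ (a ≠ 1 ∧ b = 1))) := by decide
  unfold sg
  by_cases ha : a = 1 <;> by_cases hb : b = 1 <;> simp [key, ha, hb]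

@[simp] theorem sg_zero : sg 0 = 1 := by simp [sg]

theorem sg_mul_self (a : ZMod 2) : sg a * sg a = 1 := by
  unfold sg; split_ifs <;> norm_num

theorem sg_natCast (k : ℕ) : sg (k : ZMod 2) = (-1) ^ k := by
  induction k with
  | zero => simp
  | succ k ih => rw [Nat.cast_succ, sg_add, ih, pow_succ]; simp [sg]

theorem sg_intCast (k : ℤ) : sg (k : ZMod 2) = (-1) ^ k := by
  induction k using Int.induction_on with
  | zero => simp
  | succ k ih =>
    rw [Int.cast_add, sg_add, ih, zpow_add₀ (by norm_num)]; simp [sg]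
  | pred k ih =>
    have : ((-(k : ℤ) - 1 : ℤ) : ZMod 2) = ((-(k : ℤ) : ℤ) : ZMod 2) + 1 := by
      push_cast
      have : (-1 : ZMod 2) = 1 := by decide
      linear_combination this
    rw [this, sg_add, ih, zpow_sub₀ (by norm_num)]; simp [sg, div_neg]

theorem sg_sum {ι : Type*} (s : Finset ι) (f : ι → ZMod 2) :
    sg (∑ i ∈ s, f i) = ∏ i ∈ s, sg (f i) := by
  classical
  induction s using Finset.induction_on with
  | empty => simp
  | insert a s ha ih => rw [Finset.sum_insert ha, Finset.prod_insert ha, sg_add, ih]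

/-! ### Shuffles of lists -/
section shuffle
variable {X : Type*} (π : X → ZMod 2) {M : Type*} [AddCommGroup M] [Module ℝ M]

/-- The parity of a list. -/
def lpar (l : List X) : ZMod 2 := (l.map π).sum

@[simp] theorem lpar_nil : lpar π ([] : List X) = 0 := rfl
@[simp] theorem lpar_cons (x : X) (l : List X) : lpar π (x :: l) = π x + lpar π l := by simp [lpar]
theorem lpar_append (l l' : List X) : lpar π (l ++ l') = lpar π l + lpar π l' := by simp [lpar]
theorem lpar_perm {l l' : List X} (h : l.Perm l') : lpar π l = lpar π l' := (h.map π).sum_eq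

/-- The sum over all unshuffles of a list into two sublists, with Koszul signs. -/
def Sh : List X → (List X → List X → M) → M
  | [], F => F [] []
  | x :: l, F => Sh l (fun p q => F (x :: p) q) +
      Sh l (fun p q => sg (π x * lpar π p) • F p (x :: q))

theorem Sh_nil (F : List X → List X → M) : Sh π [] F = F [] [] := rfl

theorem Sh_cons (x : X) (l : List X) (F : List X → List X → M) : Sh π (x :: l) F =
    Sh π l (fun p q => F (x :: p) q) + Sh π l (fun p q => sg (π x * lpar π p) • F p (x :: q)) := rfl

theorem Sh_congr {l : List X} {F G : List X → List X → M}
    (h : ∀ p q, (p ++ q).Perm l → F p q = G p q) : Sh π l F = Sh π l G := by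
  induction l generalizing F G with
  | nil => exact h [] [] (List.Perm.refl _)
  | cons x l ih =>
    rw [Sh_cons, Sh_cons, ih fun p q hpq => h (x :: p) q (hpq.cons x),
      ih fun p q hpq => congrArg _ (h p (x :: q) (List.perm_middle.trans (hpq.cons x)))]

theorem Sh_congr' {l : List X} {F G : List X → List X → M}
    (h : ∀ p q, F p q = G p q) : Sh π l F = Sh π l G := Sh_congr π fun p q _ => h p q

theorem Sh_add (l : List X) (F G : List X → List X → M) :
    Sh π l (fun p q => F p q + G p q) = Sh π l F + Sh π l G := by
  induction l generalizing F G with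
  | nil => rfl
  | cons x l ih => simp only [Sh_cons, smul_add, ih]; abel

theorem Sh_map {M' : Type*} [AddCommGroup M'] [Module ℝ M'] (φ : M →ₗ[ℝ] M') (l : List X)
    (F : List X → List X → M) : φ (Sh π l F) = Sh π l (fun p q => φ (F p q)) := by
  induction l generalizing F with
  | nil => rfl
  | cons x l ih => simp only [Sh_cons, map_add, ih, map_smul]

theorem Sh_smul (r : ℝ) (l : List X) (F : List X → List X → M) :
    Sh π l (fun p q => r • F p q) = r • Sh π l F :=
  (Sh_map π (r • (LinearMap.id : M →ₗ[ℝ] M)) l F).symm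

theorem Sh_zero (l : List X) : Sh π l (fun _ _ => (0 : M)) = 0 := by
  have := Sh_smul π 0 l (fun _ _ => (0 : M)); simpa using this

theorem Sh_sum {ι : Type*} (s : Finset ι) (l : List X) (F : ι → List X → List X → M) :
    Sh π l (fun p q => ∑ i ∈ s, F i p q) = ∑ i ∈ s, Sh π l (F i) := by
  classical
  induction s using Finset.induction_on with
  | empty => simp [Sh_zero]
  | insert a s ha ih => simp only [Finset.sum_insert ha, Sh_add, ih]

theorem Sh_assoc (l : List X) (F : List X → List X → List X → M) :
    Sh π l (fun p r => Sh π p (fun a b => F a b r))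
      = Sh π l (fun a m => Sh π m (fun b r => F a b r)) := by
  induction l generalizing F with
  | nil => rfl
  | cons x l ih =>
    have t1 := ih fun a b r => F (x :: a) b r
    have t2 := ih fun a b r => sg (π x * lpar π a) • F a (x :: b) r
    have t3 := ih fun a b r => sg (π x * lpar π a) • sg (π x * lpar π b) • F a b (x :: r)
    simp only [Sh_cons, Sh_add, smul_add, ← Sh_smul]
    rw [← t1, ← t2, ← t3, add_assoc]
    congr 2
    refine Sh_congr' π fun p r => Sh_congr π fun a b hab => ?_
    rw [smul_smul, ← sg_add, ← lpar_perm π hab, lpar_append, mul_add]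

theorem Sh_comm (l : List X) (F : List X → List X → M) :
    Sh π l F = Sh π l (fun p q => sg (lpar π p * lpar π q) • F q p) := by
  induction l generalizing F with
  | nil => simp [Sh_nil]
  | cons x l ih =>
    rw [Sh_cons, Sh_cons, add_comm, ih, ih (fun p q => F (x :: p) q)]
    congr 1
    · refine Sh_congr' π fun p q => ?_
      rw [smul_smul, ← sg_add, lpar_cons]
      generalize π x = a; generalize lpar π p = b; generalize lpar π q = c
      congr 2; revert a b c; decide
    · refine Sh_congr' π fun p q => ?_
      rw [smul_smul, ← sg_add, lpar_cons]
      generalize π x = a; generalize lpar π p = b; generalize lpar π q = c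
      congr 2; revert a b c; decide

theorem Sh_swap (F : List X → List X → M)
    (h1 : ∀ (l₁ : List X) (x y : X) (l₂ q : List X),
      F (l₁ ++ x :: y :: l₂) q = sg (π x * π y) • F (l₁ ++ y :: x :: l₂) q)
    (h2 : ∀ (p l₁ : List X) (x y : X) (l₂ : List X),
      F p (l₁ ++ x :: y :: l₂) = sg (π x * π y) • F p (l₁ ++ y :: x :: l₂))
    (l₁ : List X) (x y : X) (l₂ : List X) :
    Sh π (l₁ ++ x :: y :: l₂) F = sg (π x * π y) • Sh π (l₁ ++ y :: x :: l₂) F := by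
  induction l₁ generalizing F with
  | nil =>
    simp only [List.nil_append, Sh_cons, smul_add, ← Sh_smul]
    have e1 : Sh π l₂ (fun p q => F (x :: y :: p) q)
        = Sh π l₂ (fun p q => sg (π x * π y) • F (y :: x :: p) q) :=
      Sh_congr' π fun p q => h1 [] x y p q
    have e2 : Sh π l₂ (fun p q => sg (π y * lpar π p) • F (x :: p) (y :: q))
        = Sh π l₂ (fun p q => sg (π x * π y) • sg (π y * lpar π (x :: p)) • F (x :: p) (y :: q)) :=
      Sh_congr' π fun p q => by
        rw [smul_smul, ← sg_add, lpar_cons]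
        generalize π x = a; generalize π y = b; generalize lpar π p = c
        congr 2; revert a b c; decide
    have e3 : Sh π l₂ (fun p q => sg (π x * lpar π (y :: p)) • F (y :: p) (x :: q))
        = Sh π l₂ (fun p q => sg (π x * π y) • sg (π x * lpar π p) • F (y :: p) (x :: q)) :=
      Sh_congr' π fun p q => by rw [smul_smul, ← sg_add, lpar_cons, mul_add]
    have e4 : Sh π l₂ (fun p q => sg (π y * lpar π p) • sg (π x * lpar π p) • F p (x :: y :: q))
        = Sh π l₂ (fun p q => sg (π x * π y) • sg (π x * lpar π p) • sg (π y * lpar π p) •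
          F p (y :: x :: q)) :=
      Sh_congr' π fun p q => by
        rw [show F p (x :: y :: q) = _ from h2 p [] x y q]
        simp only [smul_smul, List.nil_append]
        congr 1; ring
    rw [e1, e2, e3, e4]
    abel
  | cons z l₁ ih =>
    simp only [List.cons_append, Sh_cons, smul_add]
    congr 1
    · exact ih _ (fun l₁ x y l₂ q => h1 (z :: l₁) x y l₂ q) (fun p l₁ x y l₂ => h2 (z :: p) l₁ x y l₂)
    · refine ih _ (fun l₁ x y l₂ q => ?_) (fun p l₁ x y l₂ => ?_)
      · rw [h1, smul_comm]
        congr 3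
        simp only [lpar_append, lpar_cons]; ring
      · rw [show F p (z :: (l₁ ++ x :: y :: l₂)) = _ from h2 p (z :: l₁) x y l₂, smul_comm]
        rfl

/-- The iterated version of `Sh`, with `k` sublists. -/
def Shk : ℕ → List X → (List (List X) → M) → M
  | 0, [], F => F []
  | 0, _ :: _, _ => 0
  | k + 1, l, F => Sh π l (fun p q => Shk k q (fun L => F (p :: L)))

theorem Shk_succ (k : ℕ) (l : List X) (F : List (List X) → M) :
    Shk π (k + 1) l F = Sh π l (fun p q => Shk π k q (fun L => F (p :: L))) := by
  cases l <;> rfl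

theorem Shk_smul (r : ℝ) (k : ℕ) (l : List X) (F : List (List X) → M) :
    Shk π k l (fun L => r • F L) = r • Shk π k l F := by
  induction k generalizing l F with
  | zero => cases l <;> simp [Shk]
  | succ k ih =>
    rw [Shk_succ, Shk_succ, ← Sh_smul]
    exact Sh_congr' π fun p q => ih _ _

theorem Shk_cons (k : ℕ) (x : X) (l : List X) (F : List (List X) → M) :
    Shk π k (x :: l) F = ∑ i : Fin k, Shk π k l (fun L =>
      sg (π x * ((L.take i).map (lpar π)).sum) • F (L.modify i (x :: ·))) := by
  induction k generalizing l F with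
  | zero => simp [Shk]
  | succ k ih =>
    rw [Shk_succ, Sh_cons, Fin.sum_univ_succ]
    congr 1
    · rw [Shk_succ]
      refine Sh_congr' π fun p q => ?_
      congr 1; funext L; simp
    · simp only [ih, Finset.smul_sum, Sh_sum]
      refine Finset.sum_congr rfl fun i _ => ?_
      rw [Shk_succ]
      refine Sh_congr' π fun p q => ?_
      rw [← Shk_smul]
      congr 1; funext L
      rw [smul_smul, ← sg_add]
      simp only [Fin.val_succ, List.take_succ_cons, List.map_cons, List.sum_cons, mul_add,
        List.modify_succ_cons]

theorem Shk_nil (k : ℕ) (F : List (List X) → M) :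
    Shk π k [] F = F (List.replicate k []) := by
  induction k generalizing F with
  | zero => rfl
  | succ k ih => rw [Shk_succ, Sh_nil, ih]; rfl

/-- The entries of `w` at the positions satisfying `P`. -/
def blk {N : ℕ} (P : Fin N → Prop) [DecidablePred P] (w : Fin N → X) : List X :=
  ((List.finRange N).filter P).map w

omit π in
theorem blk_zero (P : Fin 0 → Prop) [DecidablePred P] (w : Fin 0 → X) : blk P w = [] := rfl

theorem blk_succ {N : ℕ} (P : Fin (N + 1) → Prop) [DecidablePred P] (w : Fin (N + 1) → X) :
    blk P w = if P 0 then w 0 :: blk (fun i => P i.succ) (fun i => w i.succ)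
      else blk (fun i => P i.succ) (fun i => w i.succ) := by
  unfold blk
  rw [List.finRange_succ, List.filter_cons]
  split_ifs with h1 h2 h2
  · simp [List.filter_map, Function.comp_def]
  · simp_all
  · simp_all
  · simp [List.filter_map, Function.comp_def]

theorem blk_congr {N : ℕ} {P Q : Fin N → Prop} [DecidablePred P] [DecidablePred Q]
    (h : ∀ i, P i ↔ Q i) (w : Fin N → X) : blk P w = blk Q w := by
  obtain rfl : P = Q := funext fun i => propext (h i)
  congr!

theorem ofFn_orderEmb {N : ℕ} (B : Finset (Fin N)) (w : Fin N → X) :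
    List.ofFn (w ∘ B.orderEmbOfFin rfl) = blk (· ∈ B) w := by
  unfold blk
  rw [← List.map_ofFn]
  congr 1
  have h1 : List.ofFn (B.orderEmbOfFin rfl) = B.sort (· ≤ ·) := by
    refine List.ext_getElem (by simp) fun i h1 h2 => ?_
    simp [Finset.orderEmbOfFin_apply]
  rw [h1]
  refine List.Perm.eq_of_pairwise' (r := (· ≤ ·)) ?_ ?_ ?_
  · exact Finset.pairwise_sort B _
  · exact (List.pairwise_le_finRange N).filter _
  · refine (List.perm_ext_iff_of_nodup (Finset.sort_nodup _ _) ((List.nodup_finRange N).filter _)).2 fun a => ?_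
    simp

theorem lpar_blk {N : ℕ} (P : Fin N → Prop) [DecidablePred P] (w : Fin N → X) :
    lpar π (blk P w) = ∑ i with P i, π (w i) := by
  induction N with
  | zero => simp [blk_zero]
  | succ N ih =>
    rw [blk_succ, Finset.sum_filter, Fin.sum_univ_succ, ← Finset.sum_filter]
    split_ifs <;> simp [ih]

theorem koszul_succ {N : ℕ} (c : Fin (N + 1) → ℕ) (e : Fin (N + 1) → ZMod 2) :
    koszul c e = sg (e 0 * ∑ b : Fin N with c b.succ < c 0, e b.succ)
      * koszul (fun i => c i.succ) (fun i => e i.succ) := by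
  unfold koszul
  rw [Fin.prod_univ_succ]
  congr 1
  · rw [Fin.prod_univ_succ, Finset.mul_sum, sg_sum, Finset.prod_filter]
    simp only [lt_self_iff_false, false_and, if_false, one_mul]
    refine Finset.prod_congr rfl fun b _ => ?_
    have key : ∀ a b : ZMod 2, a * b = 1 ↔ a = 1 ∧ b = 1 := by decide
    simp only [Fin.succ_pos, true_and, sg, key]
    by_cases h : c b.succ < c 0 <;> simp [h]
  · refine Finset.prod_congr rfl fun a _ => ?_
    rw [Fin.prod_univ_succ]
    simp

theorem sum_coloring {N k : ℕ} (w : Fin N → X) (F : List (List X) → M) :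
    ∑ c : Fin N → Fin k, koszul (fun a => (c a : ℕ)) (fun a => π (w a)) •
      F (List.ofFn fun i => blk (c · = i) w) = Shk π k (List.ofFn w) F := by
  induction N generalizing F with
  | zero =>
    rw [Fintype.sum_unique, List.ofFn_zero, Shk_nil]
    simp [koszul, blk_zero, List.ofFn_const]
  | succ N ih =>
    rw [List.ofFn_succ, Shk_cons]
    rw [← (Fin.consEquiv fun _ => Fin k).sum_comp, Fintype.sum_prod_type]
    refine Finset.sum_congr rfl fun i _ => ?_
    rw [← ih]
    refine Finset.sum_congr rfl fun c _ => ?_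
    rw [koszul_succ, smul_smul, mul_comm]
    simp only [Fin.consEquiv_apply, Fin.cons_zero, Fin.cons_succ]
    congr 1
    · congr 2
      congr 1
      rw [List.map_take, List.map_ofFn, List.sum_take_ofFn]
      simp only [Function.comp_apply, lpar_blk, Finset.sum_filter]
      have h1 : ∀ j : Fin k, (if (j : ℕ) < i then ∑ b : Fin N, (if c b = j then π (w b.succ) else 0)
          else 0) = ∑ b : Fin N, if (c b : ℕ) < i then (if c b = j then π (w b.succ) else 0) else 0 := by
        intro j
        split_ifs with h
        · refine Finset.sum_congr rfl fun b _ => ?_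
          by_cases hb : c b = j
          · simp [hb, h]
          · simp [hb]
        · refine (Finset.sum_eq_zero fun b _ => ?_).symm
          by_cases hb : c b = j
          · simp [hb, h]
          · simp [hb]
      rw [Finset.sum_congr rfl fun j _ => h1 j, Finset.sum_comm]
      refine Finset.sum_congr rfl fun b _ => ?_
      split_ifs <;> simp
    · congr 1
      refine List.ext_getElem (by simp) fun j h1 h2 => ?_
      simp only [List.getElem_ofFn, List.getElem_modify]
      rw [blk_succ]
      simp only [Fin.consEquiv_apply, Fin.cons_zero, Fin.cons_succ]
      simp only [Fin.ext_iff]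

theorem sum_subset {N : ℕ} (w : Fin N → X) (F : List X → List X → M) :
    ∑ B : Finset (Fin N), koszul (blockOf B) (fun a => π (w a)) •
      F (blk (· ∈ B) w) (blk (· ∈ Bᶜ) w) = Sh π (List.ofFn w) F := by
  have h2 : Sh π (List.ofFn w) F = Shk π 2 (List.ofFn w) (fun L => F (L.getD 0 []) (L.getD 1 [])) := by
    rw [Shk_succ]
    refine Sh_congr' π fun p q => ?_
    rw [Shk_succ]
    have : ∀ (q : List X) (G : List X → M),
        Sh π q (fun a b => Shk π 0 b (fun _ => G a)) = G q := by
      intro q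
      induction q with
      | nil => intro G; rfl
      | cons x q ih =>
        intro G
        rw [Sh_cons, ih fun a => G (x :: a)]
        simp [Shk, Sh_zero]
    exact (this q (fun a => F p a)).symm
  rw [h2, ← sum_coloring]
  refine Finset.sum_bij' (fun B _ a => if a ∈ B then 0 else 1)
    (fun c _ => Finset.univ.filter fun a => c a = 0) (by simp) (by simp) ?_ ?_ ?_
  · intro B _
    ext a; simp
  · intro c _
    funext a
    by_cases h : c a = 0
    · simp [h]
    · have : c a = 1 := by omega
      simp [this]
  · intro B _
    congr 1
    · congr 1
      funext a
      by_cases h : a ∈ B <;> simp [blockOf, h]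
    · simp only [List.ofFn_succ, List.ofFn_zero, List.getD_cons_zero, List.getD_cons_succ]
      congr 1
      · exact blk_congr (fun i => by simp) w
      · exact blk_congr (fun i => by simp) w

end shuffle

theorem gra_induction {d N k : ℕ} {P : Gra d N k → Prop} (x : Gra d N k)
    (cls : ∀ γ, P (graphClass d γ)) (zero : P 0) (add : ∀ x y, P x → P y → P (x + y))
    (smul : ∀ (r : ℝ) x, P x → P (r • x)) : P x := by
  obtain ⟨y, rfl⟩ := Submodule.mkQ_surjective (edgeRel d N k) x
  induction y using Finsupp.induction_linear with
  | zero => rw [map_zero]; exact zero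
  | add y z hy hz => rw [map_add]; exact add _ _ hy hz
  | single γ r =>
    have h : (edgeRel d N k).mkQ (Finsupp.single γ r) = r • graphClass d γ := by
      rw [graphClass, ← map_smul, Finsupp.smul_single_one]; rfl
    rw [h]; exact smul _ _ (cls γ)

/-! ### Linear substitution of the vertices of a graph -/

/-- The coefficient of `h` in the graph obtained from `γ` by replacing each half-edge at `v` by
`∑ u, M v u • u`. -/
def substCoeff {N L k : ℕ} (M : Fin N → Fin L → ℝ) (γ : LGraph N k) (h : LGraph L k) : ℝ :=
  ∏ e, M (γ e).1 (h e).1 * M (γ e).2 (h e).2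

theorem substCoeff_update {N L k : ℕ} (M : Fin N → Fin L → ℝ) (γ : LGraph N k) (h : LGraph L k)
    (e : Fin k) : substCoeff M (Function.update γ e (γ e).swap) (Function.update h e (h e).swap)
      = substCoeff M γ h := by
  refine Finset.prod_congr rfl fun i _ => ?_
  by_cases hi : i = e
  · subst hi; simp [mul_comm]
  · simp [Function.update_of_ne hi]

theorem substCoeff_perm {N L k : ℕ} (M : Fin N → Fin L → ℝ) (γ : LGraph N k) (h : LGraph L k)
    (σ : Equiv.Perm (Fin k)) : substCoeff M (γ ∘ σ) (h ∘ σ) = substCoeff M γ h :=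
  Equiv.prod_comp σ fun e => M (γ e).1 (h e).1 * M (γ e).2 (h e).2

/-- The reversal of an edge, as an involution on graphs. -/
def flipEquiv {L k : ℕ} (e : Fin k) : Equiv.Perm (LGraph L k) :=
  Function.Involutive.toPerm (fun h => Function.update h e (h e).swap) fun h => by simp

/-- Substitution of linear combinations of vertices for the vertices of a graph. -/
def subst (d : ℕ) {N L k : ℕ} (M : Fin N → Fin L → ℝ) : Gra d N k →ₗ[ℝ] Gra d L k :=
  graLift d (fun γ => ∑ h : LGraph L k, substCoeff M γ h • graphClass d h)
    (fun γ e => by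
      rw [← Equiv.sum_comp (flipEquiv e), Finset.smul_sum]
      refine Finset.sum_congr rfl fun h _ => ?_
      change substCoeff M _ (Function.update h e (h e).swap) •
        graphClass d (Function.update h e (h e).swap) = _
      rw [substCoeff_update, graphClass_update, smul_comm])
    (fun γ σ => by
      rw [← Equiv.sum_comp (Equiv.arrowCongr σ.symm (Equiv.refl (Fin L × Fin L))), Finset.smul_sum]
      refine Finset.sum_congr rfl fun h _ => ?_
      change substCoeff M _ (h ∘ σ) • graphClass d (h ∘ σ) = _
      rw [substCoeff_perm, graphClass_perm, smul_comm])

theorem subst_class (d : ℕ) {N L k : ℕ} (M : Fin N → Fin L → ℝ) (γ : LGraph N k) :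
    subst d M (graphClass d γ) = ∑ h : LGraph L k, substCoeff M γ h • graphClass d h :=
  graLift_class _ _ _ _ _

theorem sum_substCoeff {N L P k : ℕ} (M : Fin N → Fin L → ℝ) (M' : Fin L → Fin P → ℝ)
    (γ : LGraph N k) (g : LGraph P k) :
    ∑ h : LGraph L k, substCoeff M γ h * substCoeff M' h g
      = substCoeff (fun v => ∑ u, M v u • M' u) γ g := by
  unfold substCoeff
  simp only [← Finset.prod_mul_distrib]
  rw [← Fintype.piFinset_univ, ← Finset.prod_univ_sum (fun _ => Finset.univ) (fun e (x : Fin L × Fin L) =>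
    M (γ e).1 x.1 * M (γ e).2 x.2 * (M' x.1 (g e).1 * M' x.2 (g e).2))]
  refine Finset.prod_congr rfl fun e _ => ?_
  rw [Fintype.sum_prod_type]
  simp only [Finset.sum_apply, Pi.smul_apply, smul_eq_mul, Finset.sum_mul_sum]
  refine Finset.sum_congr rfl fun a _ => Finset.sum_congr rfl fun b _ => ?_
  ring

theorem subst_subst (d : ℕ) {N L P k : ℕ} (M : Fin N → Fin L → ℝ) (M' : Fin L → Fin P → ℝ)
    (x : Gra d N k) : subst d M' (subst d M x) = subst d (fun v => ∑ u, M v u • M' u) x := by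
  suffices h : subst d M' ∘ₗ subst d M = subst d (k := k) (fun v => ∑ u, M v u • M' u) from
    LinearMap.congr_fun h x
  refine gra_hom_ext fun γ => ?_
  rw [LinearMap.comp_apply, subst_class, subst_class, map_sum]
  simp only [map_smul, subst_class, Finset.smul_sum, smul_smul]
  rw [Finset.sum_comm]
  simp only [← Finset.sum_smul, sum_substCoeff]

theorem subst_single_class (d : ℕ) {N L k : ℕ} (f : Fin N → Fin L) (γ : LGraph N k) :
    subst d (fun v => Pi.single (f v) 1) (graphClass d γ) = graphClass d (mapVertices f γ) := by
  rw [subst_class, Finset.sum_eq_single (mapVertices f γ)]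
  · simp [substCoeff, mapVertices]
  · intro h _ hh
    have : ∃ e, ¬ (h e = mapVertices f γ e) := by
      by_contra hc; push Not at hc; exact hh (funext hc)
    obtain ⟨e, he⟩ := this
    rw [substCoeff, Finset.prod_eq_zero (Finset.mem_univ e), zero_smul]
    by_contra h0
    apply he
    simp only [Pi.single_apply, mul_ite, mul_one, mul_zero, ite_eq_right_iff, Classical.not_imp] at h0
    rcases h0 with ⟨h1, h2⟩
    refine Prod.ext h2.1 h1 |>.trans rfl
  · simp

theorem relabel_eq_subst (d : ℕ) {N k : ℕ} (σ : Equiv.Perm (Fin N)) (x : Gra d N k) :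
    relabel d σ x = subst d (fun v => Pi.single (σ⁻¹ v) 1) x := by
  suffices h : relabel d (k := k) σ = subst d (fun v => Pi.single (σ⁻¹ v) 1) from
    LinearMap.congr_fun h x
  refine gra_hom_ext fun γ => ?_
  rw [subst_single_class]
  exact graLift_class _ _ _ _ _

theorem subst_one (d : ℕ) {N k : ℕ} (x : Gra d N k) : subst d (fun v => Pi.single v 1) x = x := by
  suffices h : subst d (k := k) (fun v : Fin N => Pi.single v 1) = LinearMap.id from
    LinearMap.congr_fun h x
  exact gra_hom_ext fun γ => subst_single_class d id γ

/-! ### Juxtaposition of edges -/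

/-- The edges of `h` followed by those of `h'`. -/
def juxt {L j k K : ℕ} (hK : j + k = K) (h : LGraph L j) (h' : LGraph L k) : LGraph L K :=
  Fin.append h h' ∘ Fin.cast hK.symm

theorem juxt_perm {L j k K : ℕ} (hK : j + k = K) (h : LGraph L j) (h' : LGraph L k)
    (σ : Equiv.Perm (Fin j)) (τ : Equiv.Perm (Fin k)) :
    juxt hK (h ∘ σ) (h' ∘ τ) = juxt hK h h' ∘ sumPerm hK σ τ := by
  subst hK
  funext i
  refine Fin.addCases (fun i => ?_) (fun i => ?_) i <;> simp [juxt, sumPerm]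

theorem juxt_update_right {L j k K : ℕ} (hK : j + k = K) (h : LGraph L j) (h' : LGraph L k)
    (e : Fin k) : juxt hK h (Function.update h' e (h' e).swap)
      = Function.update (juxt hK h h') (Fin.cast hK (Fin.natAdd j e))
          (juxt hK h h' (Fin.cast hK (Fin.natAdd j e))).swap := by
  subst hK
  funext i
  refine Fin.addCases (fun i => ?_) (fun i => ?_) i
  · have : Fin.castAdd k i ≠ Fin.natAdd j e := by
      intro hh; have := congrArg Fin.val hh; simp at this; omega
    simp [juxt, Function.update_of_ne this]
  · by_cases hi : i = e
    · subst hi; simp [juxt]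
    · have : Fin.natAdd j i ≠ Fin.natAdd j e := by simpa using hi
      simp [juxt, Function.update_of_ne this, Function.update_of_ne hi]

theorem juxt_update_left {L j k K : ℕ} (hK : j + k = K) (h : LGraph L j) (h' : LGraph L k)
    (e : Fin j) : juxt hK (Function.update h e (h e).swap) h'
      = Function.update (juxt hK h h') (Fin.cast hK (Fin.castAdd k e))
          (juxt hK h h' (Fin.cast hK (Fin.castAdd k e))).swap := by
  subst hK
  funext i
  refine Fin.addCases (fun i => ?_) (fun i => ?_) i
  · by_cases hi : i = e
    · subst hi; simp [juxt]
    · have : Fin.castAdd k i ≠ Fin.castAdd k e := by simpa using hi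
      simp [juxt, Function.update_of_ne this, Function.update_of_ne hi]
  · have : Fin.natAdd j i ≠ Fin.castAdd k e := by
      intro hh; have := congrArg Fin.val hh; simp at this; omega
    simp [juxt, Function.update_of_ne this]

/-- The product of graphs with the same vertices: juxtaposition of the edges. -/
def gmul (d : ℕ) {L j k K : ℕ} (hK : j + k = K) : Gra d L j →ₗ[ℝ] Gra d L k →ₗ[ℝ] Gra d L K :=
  graLift d
    (fun h => graLift d (fun h' => graphClass d (juxt hK h h'))
      (fun h' e => by rw [juxt_update_right, graphClass_update])
      (fun h' τ => by
        have := juxt_perm hK h h' 1 τ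
        rw [Equiv.Perm.coe_one, Function.comp_id] at this
        rw [this, graphClass_perm, sign_sumPerm]
        simp))
    (fun h e => gra_hom_ext fun h' => by
      rw [graLift_class, LinearMap.smul_apply, graLift_class, juxt_update_left, graphClass_update])
    (fun h σ => gra_hom_ext fun h' => by
      have := juxt_perm hK h h' σ 1
      rw [Equiv.Perm.coe_one, Function.comp_id] at this
      rw [graLift_class, LinearMap.smul_apply, graLift_class, this, graphClass_perm, sign_sumPerm]
      simp)

theorem gmul_class (d : ℕ) {L j k K : ℕ} (hK : j + k = K) (h : LGraph L j) (h' : LGraph L k) :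
    gmul d hK (graphClass d h) (graphClass d h') = graphClass d (juxt hK h h') := by
  rw [gmul, graLift_class, graLift_class]

theorem substCoeff_juxt {N L j k K : ℕ} (hK : j + k = K) (M : Fin N → Fin L → ℝ)
    (γ : LGraph N j) (γ' : LGraph N k) (h : LGraph L j) (h' : LGraph L k) :
    substCoeff M (juxt hK γ γ') (juxt hK h h') = substCoeff M γ h * substCoeff M γ' h' := by
  subst hK
  unfold substCoeff
  rw [Fin.prod_univ_add]
  simp [juxt]

theorem sum_juxt {L j k K : ℕ} (hK : j + k = K) {M : Type*} [AddCommMonoid M]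
    (F : LGraph L K → M) : ∑ h : LGraph L K, F h = ∑ h : LGraph L j, ∑ h' : LGraph L k,
      F (juxt hK h h') := by
  subst hK
  rw [← (Fin.appendEquiv j k).sum_comp, Fintype.sum_prod_type]
  rfl

theorem subst_gmul (d : ℕ) {N L j k K : ℕ} (hK : j + k = K) (M : Fin N → Fin L → ℝ)
    (x : Gra d N j) (y : Gra d N k) :
    subst d M (gmul d hK x y) = gmul d hK (subst d M x) (subst d M y) := by
  induction x using gra_induction with
  | zero => simp only [map_zero, LinearMap.zero_apply, smul_zero]
  | add x x' hx hx' => simp only [map_add, LinearMap.add_apply, hx, hx']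
  | smul r x hx => simp only [map_smul, LinearMap.smul_apply, hx]
  | cls γ =>
  induction y using gra_induction with
  | zero => simp only [map_zero, LinearMap.zero_apply, smul_zero]
  | add y y' hy hy' => simp only [map_add, hy, hy']
  | smul r y hy => simp only [map_smul, hy]
  | cls γ' =>
  rw [gmul_class, subst_class, subst_class, subst_class, sum_juxt hK, map_sum (gmul d hK), LinearMap.sum_apply]
  refine Finset.sum_congr rfl fun h _ => ?_
  rw [map_smul, LinearMap.smul_apply, map_sum, Finset.smul_sum]
  refine Finset.sum_congr rfl fun h' _ => ?_
  rw [map_smul, gmul_class, substCoeff_juxt, smul_smul]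

theorem juxt_assoc {L a b c ab bc K : ℕ} (h1 : a + b = ab) (h2 : ab + c = K) (h3 : b + c = bc)
    (h4 : a + bc = K) (x : LGraph L a) (y : LGraph L b) (z : LGraph L c) :
    juxt h2 (juxt h1 x y) z = juxt h4 x (juxt h3 y z) := by
  subst h1 h3 h2
  funext i
  have := congrFun (Fin.append_assoc x y z) i
  simpa [juxt] using this

theorem gmul_assoc (d : ℕ) {L a b c ab bc K : ℕ} (h1 : a + b = ab) (h2 : ab + c = K)
    (h3 : b + c = bc) (h4 : a + bc = K) (x : Gra d L a) (y : Gra d L b) (z : Gra d L c) :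
    gmul d h2 (gmul d h1 x y) z = gmul d h4 x (gmul d h3 y z) := by
  induction x using gra_induction with
  | zero => simp only [map_zero, LinearMap.zero_apply, smul_zero]
  | add x x' hx hx' => simp only [map_add, LinearMap.add_apply, hx, hx']
  | smul r x hx => simp only [map_smul, LinearMap.smul_apply, hx]
  | cls γ =>
  induction y using gra_induction with
  | zero => simp only [map_zero, LinearMap.zero_apply, smul_zero]
  | add y y' hy hy' => simp only [map_add, LinearMap.add_apply, hy, hy']
  | smul r y hy => simp only [map_smul, LinearMap.smul_apply, hy]
  | cls γ' =>
  induction z using gra_induction with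
  | zero => simp only [map_zero, LinearMap.zero_apply, smul_zero]
  | add z z' hz hz' => simp only [map_add, hz, hz']
  | smul r z hz => simp only [map_smul, hz]
  | cls γ'' => simp only [gmul_class, juxt_assoc h1 h2 h3 h4]

theorem finRotate_pow_apply (m j : ℕ) (i : Fin (m + 1)) :
    (((finRotate (m + 1)) ^ j) i : ℕ) = (i + j) % (m + 1) := by
  induction j with
  | zero => simp [Nat.mod_eq_of_lt i.2]
  | succ j ih =>
    rw [pow_succ', Equiv.Perm.mul_apply, finRotate_apply, Fin.val_add, ih, Fin.val_one', ← Nat.add_mod,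
      add_assoc]

theorem juxt_comm {L j k K : ℕ} (hK : j + k = K) (hK' : k + j = K) (x : LGraph L j)
    (y : LGraph L k) : juxt hK' y x = juxt hK x y ∘ ((finRotate K) ^ j : Equiv.Perm (Fin K)) := by
  subst hK
  funext i
  obtain ⟨m, hm⟩ : ∃ m, j + k = m + 1 := ⟨j + k - 1, by have := i.2; omega⟩
  have hr : (((finRotate (j + k)) ^ j : Equiv.Perm (Fin (j + k))) i : ℕ) = (i + j) % (j + k) := by
    generalize j + k = K at *
    subst hm
    rw [finRotate_pow_apply]
  generalize hp : ((finRotate (j + k)) ^ j : Equiv.Perm (Fin (j + k))) i = p at hr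
  simp only [Function.comp_apply, hp, juxt]
  by_cases hi : (i : ℕ) < k
  · rw [show Fin.cast hK'.symm i = Fin.castAdd j ⟨i, hi⟩ from rfl, Fin.append_left,
      show Fin.cast rfl p = Fin.natAdd j ⟨i, hi⟩ from Fin.ext (by
        rw [Nat.mod_eq_of_lt (by omega)] at hr; simp [hr, add_comm]), Fin.append_right]
  · have h2 : (i : ℕ) - k < j := by omega
    rw [show Fin.cast hK'.symm i = Fin.natAdd k ⟨i - k, h2⟩ from Fin.ext (by simp; omega),
      Fin.append_right, show Fin.cast rfl p = Fin.castAdd k ⟨i - k, h2⟩ from Fin.ext (by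
        rw [show (i : ℕ) + j = (i - k) + (j + k) by omega, Nat.add_mod_right,
          Nat.mod_eq_of_lt (by omega)] at hr
        simp [hr]), Fin.append_left]

theorem gmul_comm (d : ℕ) {L j k K : ℕ} (hK : j + k = K) (hK' : k + j = K) (x : Gra d L j)
    (y : Gra d L k) : gmul d hK' y x = (-1 : ℝ) ^ ((d + 1) * (j * k)) • gmul d hK x y := by
  induction x using gra_induction with
  | zero => simp only [map_zero, LinearMap.zero_apply, smul_zero]
  | add x x' hx hx' => simp only [map_add, LinearMap.add_apply, hx, hx', smul_add]
  | smul r x hx => simp only [map_smul, LinearMap.smul_apply, hx, smul_comm r]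
  | cls γ =>
  induction y using gra_induction with
  | zero => simp only [map_zero, LinearMap.zero_apply, smul_zero]
  | add y y' hy hy' => simp only [map_add, LinearMap.add_apply, hy, hy', smul_add]
  | smul r y hy => simp only [map_smul, LinearMap.smul_apply, hy, smul_comm r]
  | cls γ' =>
  rw [gmul_class, gmul_class, juxt_comm hK hK', graphClass_perm, map_pow]
  congr 1
  have h1 : ((Equiv.Perm.sign (finRotate K) ^ j : ℤˣ) : ℤ) = (-1) ^ (j * k) := by
    subst hK
    rcases Nat.eq_zero_or_pos (j + k) with h | h
    · obtain rfl : j = 0 := by omega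
      simp
    · obtain ⟨m, hm⟩ : ∃ m, j + k = m + 1 := ⟨j + k - 1, by omega⟩
      rw [hm, sign_finRotate]
      push_cast
      rw [← pow_mul]
      have hm' : m + 1 = j + k := hm.symm
      rcases Nat.even_or_odd j with hj | hj
      · rw [(hj.mul_left _).neg_one_pow, (hj.mul_right _).neg_one_pow]
      · rw [mul_comm, pow_mul, pow_mul, hj.neg_one_pow]
        rcases Nat.even_or_odd k with hk | hk
        · have : Even m := by
            have := hj.add_even hk; rw [← hm'] at this
            exact Nat.not_odd_iff_even.1 fun h => Nat.not_even_iff_odd.2 this h.add_one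
          rw [this.neg_one_pow, hk.neg_one_pow]
        · have : Odd m := by
            have := hj.add_odd hk; rw [← hm'] at this
            exact Nat.not_even_iff_odd.1 fun h => Nat.not_odd_iff_even.2 this h.add_one
          rw [this.neg_one_pow, hk.neg_one_pow]
  rw [h1]; push_cast; rw [← pow_mul, mul_comm]

theorem apply_get_ofFn {X Y : Type*} (Φ : ∀ N : ℕ, (Fin N → X) → Y) {N : ℕ} (w : Fin N → X) :
    Φ (List.ofFn w).length (List.ofFn w).get = Φ N w := by
  have key : ∀ (l : List X) (h : l.length = N), (∀ i : Fin N, l.get (Fin.cast h.symm i) = w i) →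
      Φ l.length l.get = Φ N w := by
    rintro l rfl h
    congr 1
    exact funext h
  exact key _ (by simp) fun i => by simp

/-! ### Graphs with a fixed number of vertices -/

/-- The algebra of graphs with `L` vertices, completed in the number of edges. -/
abbrev EdgeAlg (d L : ℕ) : Type := ∀ k : ℕ, Gra d L k

/-- The component `(j, k) → K` of the product, zero unless `j + k = K`. -/
def gmulAt (d : ℕ) {L : ℕ} (j k K : ℕ) : Gra d L j →ₗ[ℝ] Gra d L k →ₗ[ℝ] Gra d L K :=
  if h : j + k = K then gmul d h else 0

/-- The product of `EdgeAlg`. -/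
def tmul (d : ℕ) {L : ℕ} : EdgeAlg d L →ₗ[ℝ] EdgeAlg d L →ₗ[ℝ] EdgeAlg d L :=
  LinearMap.mk₂ ℝ
    (fun x y K => ∑ j : Fin (K + 1), gmul d (show (j : ℕ) + (K - j) = K by omega) (x j) (y (K - j)))
    (fun x x' y => by funext K; simp [Finset.sum_add_distrib])
    (fun r x y => by funext K; simp [Finset.smul_sum])
    (fun x y y' => by funext K; simp [Finset.sum_add_distrib])
    (fun r x y => by funext K; simp [Finset.smul_sum])

theorem tmul_apply (d : ℕ) {L : ℕ} (x y : EdgeAlg d L) (K : ℕ) : tmul d x y K =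
    ∑ j : Fin (K + 1), gmul d (show (j : ℕ) + (K - j) = K by omega) (x j) (y (K - j)) := rfl

theorem tmul_eq_sum (d : ℕ) {L : ℕ} (x y : EdgeAlg d L) {K n : ℕ} (hn : K < n) :
    tmul d x y K = ∑ j ∈ Finset.range n, ∑ k ∈ Finset.range n, gmulAt d j k K (x j) (y k) := by
  have h1 : ∀ j ∈ Finset.range n, ∑ k ∈ Finset.range n, gmulAt d j k K (x j) (y k)
      = if h : j ≤ K then gmul d (show j + (K - j) = K by omega) (x j) (y (K - j)) else 0 := by
    intro j _
    split_ifs with h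
    · rw [Finset.sum_eq_single_of_mem (K - j) (Finset.mem_range.2 (by omega))]
      · rw [gmulAt, dif_pos]
      · intro k _ hk
        rw [gmulAt, dif_neg (by omega)]; simp
    · refine Finset.sum_eq_zero fun k _ => ?_
      rw [gmulAt, dif_neg (by omega)]; simp
  rw [Finset.sum_congr rfl h1, tmul_apply]
  have h2 : Finset.range (K + 1) ⊆ Finset.range n := Finset.range_subset_range.2 (by omega)
  rw [← Finset.sum_subset h2 fun j _ hj => dif_neg (by simpa using hj), Finset.sum_range]
  refine Finset.sum_congr rfl fun j _ => ?_
  rw [dif_pos (by omega)]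

theorem tmul_assoc (d : ℕ) {L : ℕ} (x y z : EdgeAlg d L) :
    tmul d (tmul d x y) z = tmul d x (tmul d y z) := by
  funext K
  set n := K + 1
  have key : ∀ a b c : ℕ,
      ∑ m ∈ Finset.range n, gmulAt d m c K (gmulAt d a b m (x a) (y b)) (z c)
      = ∑ m ∈ Finset.range n, gmulAt d a m K (x a) (gmulAt d b c m (y b) (z c)) := by
    intro a b c
    by_cases h : a + b + c = K
    · rw [Finset.sum_eq_single_of_mem (a + b) (Finset.mem_range.2 (by omega)),
        Finset.sum_eq_single_of_mem (b + c) (Finset.mem_range.2 (by omega))]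
      · simp only [gmulAt, dif_pos h, dif_pos (show a + (b + c) = K by omega), dif_pos]
        exact gmul_assoc d _ _ _ _ _ _ _
      · intro m _ hm
        simp only [gmulAt, dif_neg (Ne.symm hm)]; simp
      · intro m _ hm
        simp only [gmulAt, dif_neg (Ne.symm hm)]; simp
    · rw [Finset.sum_eq_zero, Finset.sum_eq_zero]
      · intro m _
        by_cases hm : b + c = m
        · simp only [gmulAt, dif_neg (show ¬ a + m = K by omega)]; simp
        · simp only [gmulAt, dif_neg hm]; simp
      · intro m _
        by_cases hm : a + b = m
        · simp only [gmulAt, dif_neg (show ¬ m + c = K by omega)]; simp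
        · simp only [gmulAt, dif_neg hm]; simp
  have h1 : tmul d (tmul d x y) z K = ∑ a ∈ Finset.range n, ∑ b ∈ Finset.range n,
      ∑ c ∈ Finset.range n, ∑ m ∈ Finset.range n,
        gmulAt d m c K (gmulAt d a b m (x a) (y b)) (z c) := by
    rw [tmul_eq_sum d _ _ (Nat.lt_succ_self K)]
    have : ∀ m ∈ Finset.range n, ∀ c ∈ Finset.range n, gmulAt d m c K (tmul d x y m) (z c)
        = ∑ a ∈ Finset.range n, ∑ b ∈ Finset.range n,
          gmulAt d m c K (gmulAt d a b m (x a) (y b)) (z c) := by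
      intro m hm c _
      rw [tmul_eq_sum d x y (Finset.mem_range.1 hm)]
      simp only [map_sum, LinearMap.sum_apply]
    rw [Finset.sum_congr rfl fun m hm => Finset.sum_congr rfl (this m hm), Finset.sum_comm]
    rw [Finset.sum_congr rfl fun c _ => Finset.sum_comm, Finset.sum_comm]
    refine Finset.sum_congr rfl fun a _ => ?_
    rw [Finset.sum_congr rfl fun c _ => Finset.sum_comm, Finset.sum_comm]
  have h2 : tmul d x (tmul d y z) K = ∑ a ∈ Finset.range n, ∑ b ∈ Finset.range n,
      ∑ c ∈ Finset.range n, ∑ m ∈ Finset.range n,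
        gmulAt d a m K (x a) (gmulAt d b c m (y b) (z c)) := by
    rw [tmul_eq_sum d _ _ (Nat.lt_succ_self K)]
    refine Finset.sum_congr rfl fun a _ => ?_
    have : ∀ m ∈ Finset.range n, gmulAt d a m K (x a) (tmul d y z m)
        = ∑ b ∈ Finset.range n, ∑ c ∈ Finset.range n,
          gmulAt d a m K (x a) (gmulAt d b c m (y b) (z c)) := by
      intro m hm
      rw [tmul_eq_sum d y z (Finset.mem_range.1 hm)]
      simp only [map_sum]
    rw [Finset.sum_congr rfl this, Finset.sum_comm]
    refine Finset.sum_congr rfl fun b _ => ?_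
    rw [Finset.sum_comm]
  rw [h1, h2]
  exact Finset.sum_congr rfl fun a _ => Finset.sum_congr rfl fun b _ =>
    Finset.sum_congr rfl fun c _ => key a b c

theorem tmul_comm_of (d : ℕ) {L : ℕ} (x y : EdgeAlg d L) (s : ℝ)
    (h : ∀ j k, x j ≠ 0 → y k ≠ 0 → (-1 : ℝ) ^ ((d + 1) * (j * k)) = s) :
    tmul d y x = s • tmul d x y := by
  funext K
  rw [Pi.smul_apply, tmul_eq_sum d _ _ (Nat.lt_succ_self K), tmul_eq_sum d _ _ (Nat.lt_succ_self K),
    Finset.sum_comm, Finset.smul_sum]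
  refine Finset.sum_congr rfl fun j _ => ?_
  rw [Finset.smul_sum]
  refine Finset.sum_congr rfl fun k _ => ?_
  by_cases hx : x j = 0
  · simp [hx]
  by_cases hy : y k = 0
  · simp [hy]
  by_cases hK : j + k = K
  · simp only [gmulAt, dif_pos hK, dif_pos ((add_comm k j).trans hK)]
    rw [gmul_comm d hK, h j k hx hy]
  · simp only [gmulAt, dif_neg hK, dif_neg (show ¬ k + j = K by omega)]; simp

/-! ### Evaluation of families on lists of vectors -/

/-- The family `c` with the entries of `l` substituted for the vertices. -/
def ev {d : ℕ} (c : Fam d) {L : ℕ} (l : List (Fin L → ℝ)) : EdgeAlg d L :=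
  fun k => subst d l.get (c l.length k)

theorem ev_ofFn {d : ℕ} (c : Fam d) {N L : ℕ} (w : Fin N → Fin L → ℝ) :
    ev c (List.ofFn w) = fun k => subst d w (c N k) :=
  apply_get_ofFn (fun N w k => subst d w (c N k)) w

/-- The standard basis. -/
def stdList (N : ℕ) : List (Fin N → ℝ) := List.ofFn fun v : Fin N => Pi.single v 1

theorem ev_stdList {d : ℕ} (c : Fam d) (N : ℕ) : ev c (stdList N) = c N := by
  rw [stdList, ev_ofFn]
  exact funext fun k => subst_one d _

theorem fam_ext {d : ℕ} {c c' : Fam d} (h : ∀ (L : ℕ) (l : List (Fin L → ℝ)), ev c l = ev c' l) :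
    c = c' := by
  funext N
  rw [← ev_stdList c, h, ev_stdList]

theorem ev_add {d : ℕ} (c c' : Fam d) {L : ℕ} (l : List (Fin L → ℝ)) :
    ev (c + c') l = ev c l + ev c' l := by funext k; simp [ev]

theorem ev_smul {d : ℕ} (r : ℝ) (c : Fam d) {L : ℕ} (l : List (Fin L → ℝ)) :
    ev (r • c) l = r • ev c l := by funext k; simp [ev]

theorem ev_sub {d : ℕ} (c c' : Fam d) {L : ℕ} (l : List (Fin L → ℝ)) :
    ev (c - c') l = ev c l - ev c' l := by funext k; simp [ev]

theorem mapVertices_eq_iff {N L k : ℕ} (f : Fin L → Fin N) (h : LGraph L k) (γ : LGraph N k) :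
    (∏ e, ((if f (h e).1 = (γ e).1 then 1 else 0) * (if f (h e).2 = (γ e).2 then 1 else 0) : ℝ))
      = if mapVertices f h = γ then 1 else 0 := by
  split_ifs with hh
  · subst hh
    simp [mapVertices]
  · have : ∃ e, ¬ (mapVertices f h e = γ e) := by
      by_contra hc; push Not at hc; exact hh (funext hc)
    obtain ⟨e, he⟩ := this
    refine Finset.prod_eq_zero (Finset.mem_univ e) ?_
    by_contra h0
    apply he
    simp only [mul_ite, mul_one, mul_zero, ite_eq_right_iff, Classical.not_imp] at h0
    exact Prod.ext h0.2.1 h0.1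

theorem insertGraph_eq (d : ℕ) {L j k K : ℕ} (B : Finset (Fin L)) (hK : j + k = K)
    (x : Gra d (Bᶜ.card + 1) j) (y : Gra d B.card k) :
    insertGraph d B hK x y = gmul d hK
      (subst d (fun v u => if collapse B u = v then 1 else 0) x)
      (subst d (fun v => Pi.single (B.orderEmbOfFin rfl v) 1) y) := by
  induction x using gra_induction with
  | zero => simp only [map_zero, LinearMap.zero_apply]
  | add x x' hx hx' => simp only [map_add, LinearMap.add_apply, hx, hx']
  | smul r x hx => simp only [map_smul, LinearMap.smul_apply, hx]
  | cls γ =>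
  induction y using gra_induction with
  | zero => simp only [map_zero]
  | add y y' hy hy' => simp only [map_add, hy, hy']
  | smul r y hy => simp only [map_smul, hy]
  | cls γ' =>
  rw [subst_single_class, subst_class, insertGraph, graLift_class, graLift_class, Finset.sum_filter,
    map_sum, LinearMap.sum_apply]
  refine Finset.sum_congr rfl fun h _ => ?_
  rw [map_smul, LinearMap.smul_apply, gmul_class, substCoeff, mapVertices_eq_iff]
  split_ifs
  · rw [one_smul]; rfl
  · rw [zero_smul]

theorem sum_blk {X : Type*} [AddCommMonoid X] {N : ℕ} (P : Fin N → Prop) [DecidablePred P]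
    (w : Fin N → X) : (blk P w).sum = ∑ i with P i, w i := by
  induction N with
  | zero => simp [blk_zero]
  | succ N ih =>
    rw [blk_succ, Finset.sum_filter, Fin.sum_univ_succ, ← Finset.sum_filter]
    split_ifs <;> simp [ih]

theorem collapse_eq_succ_iff {L : ℕ} (B : Finset (Fin L)) (u : Fin L) (i : Fin Bᶜ.card) :
    collapse B u = i.succ ↔ u = Bᶜ.orderEmbOfFin rfl i := by
  unfold collapse
  split_ifs with h
  · refine ⟨fun h' => absurd h'.symm (Fin.succ_ne_zero _), fun h' => ?_⟩
    have := Bᶜ.orderEmbOfFin_mem rfl i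
    rw [← h'] at this
    simp [h] at this
  · rw [Fin.succ_inj, OrderIso.symm_apply_eq]
    exact ⟨fun h' => congrArg Subtype.val h', fun h' => Subtype.ext h'⟩

theorem sum_collapse {L P : ℕ} (B : Finset (Fin L)) (w : Fin L → Fin P → ℝ) :
    (fun v => ∑ u, (if collapse B u = v then (1 : ℝ) else 0) • w u)
      = Fin.cons (blk (· ∈ B) w).sum (w ∘ Bᶜ.orderEmbOfFin rfl) := by
  funext v
  refine Fin.cases ?_ (fun i => ?_) v
  · rw [Fin.cons_zero, sum_blk, Finset.sum_filter]
    refine Finset.sum_congr rfl fun u _ => ?_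
    by_cases hu : u ∈ B <;> simp [collapse, hu]
  · simp [collapse_eq_succ_iff]

theorem ev_nil_of {d : ℕ} {c : Fam d} (h : ∀ k, c 0 k = 0) {L : ℕ} :
    ev c ([] : List (Fin L → ℝ)) = 0 := by
  funext k
  change subst d _ (c 0 k) = 0
  rw [h, map_zero]

theorem ev_preLie {d : ℕ} (c c' : Fam d) (hc' : ∀ k, c' 0 k = 0) {L : ℕ}
    (l : List (Fin L → ℝ)) : ev (preLie d c c') l =
      Sh (fun _ => (d : ZMod 2)) l (fun p q => tmul d (ev c (p.sum :: q)) (ev c' p)) := by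
  rw [← List.ofFn_get l]
  generalize l.get = w
  generalize l.length = N at w
  rw [← sum_subset, ev_ofFn]
  funext K
  change subst d w (∑ B : Finset (Fin N) with B.Nonempty, _) = _
  rw [Finset.sum_filter, map_sum, Finset.sum_apply]
  refine Finset.sum_congr rfl fun B _ => ?_
  split_ifs with hB
  · rw [map_smul, Pi.smul_apply, tmul_apply, map_sum]
    congr 1
    refine Finset.sum_congr rfl fun j _ => ?_
    rw [insertGraph_eq, subst_gmul, subst_subst, subst_subst, sum_collapse, ← ofFn_orderEmb,
      ← ofFn_orderEmb, ev_ofFn]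
    have h1 : ∀ x, x :: List.ofFn (w ∘ Bᶜ.orderEmbOfFin rfl)
        = List.ofFn (Fin.cons x (w ∘ Bᶜ.orderEmbOfFin rfl) : Fin (Bᶜ.card + 1) → _) := by
      intro x; rw [List.ofFn_succ]; simp [Function.comp_def]
    rw [h1, ev_ofFn]
    congr 3
    funext v
    simp [Pi.single_apply]
  · rw [Finset.not_nonempty_iff_eq_empty.1 hB]
    have : blk (· ∈ (∅ : Finset (Fin N))) w = [] := by simp [blk]
    rw [map_zero, this, ev_nil_of hc', map_zero, smul_zero]; rfl

/-! ### Adjacent transpositions -/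

theorem ofFn_comp_swap_succ {X : Type*} {N : ℕ} (w : Fin (N + 2) → X) (i : Fin N) :
    List.ofFn (w ∘ Equiv.swap i.succ.castSucc i.succ.succ)
      = w 0 :: List.ofFn ((fun j => w j.succ) ∘ Equiv.swap i.castSucc i.succ) := by
  have e0 : (w ∘ Equiv.swap i.succ.castSucc i.succ.succ) 0 = w 0 := by
    refine congrArg w (Equiv.swap_apply_of_ne_of_ne ?_ (Fin.succ_ne_zero _).symm)
    intro h; have := congrArg Fin.val h; simp at this
  have e1 : (fun j : Fin (N + 1) => (w ∘ Equiv.swap i.succ.castSucc i.succ.succ) j.succ)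
      = (fun j => w j.succ) ∘ Equiv.swap i.castSucc i.succ := by
    funext j
    simp only [Function.comp_apply]
    congr 1
    rw [← Fin.succ_castSucc]
    exact ((Fin.succ_injective _).map_swap _ _ _).symm
  rw [List.ofFn_succ, e0, e1]

theorem ofFn_comp_swap_zero {X : Type*} {N : ℕ} (w : Fin (N + 2) → X) :
    List.ofFn (w ∘ Equiv.swap (0 : Fin (N + 1)).castSucc (0 : Fin (N + 1)).succ)
      = w 1 :: w 0 :: List.ofFn fun j : Fin N => w j.succ.succ := by
  have h2 : ∀ j : Fin N, Equiv.swap (0 : Fin (N + 2)) (1 : Fin (N + 2)) j.succ.succ = j.succ.succ := by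
    intro j
    apply Equiv.swap_apply_of_ne_of_ne
    · exact Fin.succ_ne_zero _
    · intro h; have := congrArg Fin.val h; simp at this
  simp [List.ofFn_succ, h2]

theorem ofFn_comp_swap {X : Type*} {N : ℕ} (w : Fin (N + 1) → X) (i : Fin N) : ∃ l₁ l₂,
    List.ofFn w = l₁ ++ w i.castSucc :: w i.succ :: l₂ ∧
    List.ofFn (w ∘ Equiv.swap i.castSucc i.succ) = l₁ ++ w i.succ :: w i.castSucc :: l₂ := by
  induction N with
  | zero => exact i.elim0
  | succ N ih =>
    refine Fin.cases ?_ (fun i => ?_) i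
    · exact ⟨[], List.ofFn fun j : Fin N => w j.succ.succ, by simp [List.ofFn_succ],
        ofFn_comp_swap_zero w⟩
    · obtain ⟨l₁, l₂, h1, h2⟩ := ih (fun j => w j.succ) i
      exact ⟨w 0 :: l₁, l₂, by rw [List.ofFn_succ, h1]; rfl, by rw [ofFn_comp_swap_succ, h2]; rfl⟩

theorem exists_ofFn_swap {X : Type*} (l₁ : List X) (x y : X) (l₂ : List X) :
    ∃ (N : ℕ) (w : Fin (N + 1) → X) (i : Fin N), w i.castSucc = x ∧ w i.succ = y ∧
      List.ofFn w = l₁ ++ x :: y :: l₂ ∧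
      List.ofFn (w ∘ Equiv.swap i.castSucc i.succ) = l₁ ++ y :: x :: l₂ := by
  induction l₁ with
  | nil =>
    refine ⟨l₂.length + 1, Fin.cons x (Fin.cons y l₂.get), 0, rfl, rfl, ?_, ?_⟩
    · rw [List.ofFn_succ, List.ofFn_succ]
      simp
    · rw [ofFn_comp_swap_zero]
      simp only [Fin.cons_succ, List.ofFn_get]
      rfl
  | cons z l₁ ih =>
    obtain ⟨N, w, i, hx, hy, h1, h2⟩ := ih
    refine ⟨N + 1, Fin.cons z w, i.succ, ?_, ?_, ?_, ?_⟩
    · rw [← Fin.succ_castSucc, Fin.cons_succ, hx]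
    · rw [Fin.cons_succ, hy]
    · rw [List.ofFn_succ]; simp only [Fin.cons_zero, Fin.cons_succ, h1]; rfl
    · rw [ofFn_comp_swap_succ]; simp only [Fin.cons_zero, Fin.cons_succ, h2]; rfl

theorem perm_induction_swap {N : ℕ} {P : Equiv.Perm (Fin N) → Prop} (σ : Equiv.Perm (Fin N))
    (one : P 1) (mul : ∀ σ τ, P σ → P τ → P (σ * τ))
    (swap : ∀ (m : ℕ) (h : N = m + 1) (i : Fin m), P ((finCongr h).symm.permCongr
      (Equiv.swap i.castSucc i.succ))) : P σ := by
  cases N with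
  | zero => rwa [Subsingleton.elim σ 1]
  | succ k =>
    have hσ : σ ∈ Submonoid.closure (Set.range fun i : Fin k => Equiv.swap i.castSucc i.succ) := by
      rw [Equiv.Perm.mclosure_swap_castSucc_succ]; trivial
    induction hσ using Submonoid.closure_induction with
    | mem σ h => obtain ⟨i, rfl⟩ := h; exact swap k rfl i
    | one => exact one
    | mul σ τ _ _ h h' => exact mul σ τ h h'

/-! ### Symmetric families -/

/-- Graded symmetry, tested on lists of vectors. -/
def EvSymm {d : ℕ} (c : Fam d) : Prop := ∀ (L : ℕ) (l₁ : List (Fin L → ℝ)) (x y : Fin L → ℝ)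
  (l₂ : List (Fin L → ℝ)), ev c (l₁ ++ x :: y :: l₂) = sg d • ev c (l₁ ++ y :: x :: l₂)

theorem subst_comp_perm (d : ℕ) {N L k : ℕ} (σ : Equiv.Perm (Fin N)) (w : Fin N → Fin L → ℝ)
    (x : Gra d N k) : subst d (w ∘ σ) x = subst d w (relabel d σ⁻¹ x) := by
  rw [relabel_eq_subst, subst_subst]
  congr 2
  funext v
  simp [Pi.single_apply]

theorem relabel_one (d : ℕ) {N k : ℕ} (x : Gra d N k) : relabel d 1 x = x := by
  rw [relabel_eq_subst]; exact subst_one d x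

theorem relabel_mul (d : ℕ) {N k : ℕ} (σ τ : Equiv.Perm (Fin N)) (x : Gra d N k) :
    relabel d (σ * τ) x = relabel d τ (relabel d σ x) := by
  rw [relabel_eq_subst, relabel_eq_subst, relabel_eq_subst, subst_subst]
  congr 2
  funext v
  simp [Pi.single_apply]

theorem evSymm_iff {d : ℕ} (c : Fam d) : EvSymm c ↔ ∀ (N k : ℕ) (σ : Equiv.Perm (Fin N)),
    relabel d σ (c N k) = (((Equiv.Perm.sign σ : ℤˣ) : ℤ) : ℝ) ^ d • c N k := by
  constructor
  · intro h N k σ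
    refine perm_induction_swap (P := fun σ => relabel d σ (c N k)
      = (((Equiv.Perm.sign σ : ℤˣ) : ℤ) : ℝ) ^ d • c N k) σ ?_ ?_ ?_
    · simp [relabel_one]
    · intro σ τ hσ hτ
      rw [relabel_mul, hσ, map_smul, hτ, smul_smul, map_mul]
      push_cast; rw [mul_pow]
    · rintro m rfl i
      have he : (finCongr (rfl : m + 1 = m + 1)).symm.permCongr (Equiv.swap i.castSucc i.succ)
          = Equiv.swap i.castSucc i.succ := by ext; simp
      rw [he, Equiv.Perm.sign_swap (Fin.castSucc_lt_succ).ne]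
      obtain ⟨l₁, l₂, h1, h2⟩ := ofFn_comp_swap (fun v : Fin (m + 1) => (Pi.single v 1 : _ → ℝ)) i
      have h3 := h _ l₁ (Pi.single i.succ 1) (Pi.single i.castSucc 1) l₂
      rw [← h1, ← h2, ev_ofFn, ev_ofFn] at h3
      have h4 := congrFun h3 k
      rw [Pi.smul_apply, subst_comp_perm, subst_one, subst_one, Equiv.swap_inv, sg_natCast] at h4
      simpa using h4
  · intro h L l₁ x y l₂
    obtain ⟨N, w, i, -, -, h1, h2⟩ := exists_ofFn_swap l₁ y x l₂
    rw [← h1, ← h2, ev_ofFn, ev_ofFn]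
    funext k
    rw [Pi.smul_apply, subst_comp_perm, Equiv.swap_inv, h,
      Equiv.Perm.sign_swap (Fin.castSucc_lt_succ).ne, sg_natCast]
    simp

theorem ev_perm_parity (d : ℕ) : sg ((d : ZMod 2) * d) = sg d := by
  congr 1; generalize (d : ZMod 2) = a; revert a; decide

theorem EvSymm.preLie {d : ℕ} {c c' : Fam d} (h : EvSymm c) (h' : EvSymm c')
    (h0 : ∀ k, c' 0 k = 0) : EvSymm (preLie d c c') := by
  intro L l₁ x y l₂
  rw [ev_preLie _ _ h0, ev_preLie _ _ h0, ← ev_perm_parity]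
  refine Sh_swap _ _ (fun l₁ x y l₂ q => ?_) (fun p l₁ x y l₂ => ?_) l₁ x y l₂
  · rw [h', map_smul, ev_perm_parity]
    congr 4
    simp only [List.sum_append, List.sum_cons]
    rw [add_left_comm x]
  · have := h _ (p.sum :: l₁) x y l₂
    rw [List.cons_append, List.cons_append] at this
    rw [this, map_smul, LinearMap.smul_apply, ev_perm_parity]

theorem evSymm_of_fGC {d : ℕ} {p : ℤ} {c : Fam d} (h : c ∈ fGC d p) : EvSymm c :=
  (evSymm_iff c).2 h.2.2

theorem preLie_apply {d : ℕ} (c c' : Fam d) (L K : ℕ) : preLie d c c' L K =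
    ∑ B : Finset (Fin L) with B.Nonempty,
      koszul (blockOf B) (fun _ => (d : ZMod 2)) • ∑ j : Fin (K + 1),
        insertGraph d B (show (j : ℕ) + (K - j) = K by omega)
          (c (Bᶜ.card + 1) j) (c' B.card (K - j)) := rfl

theorem preLie_mem_fGC {d : ℕ} {p q : ℤ} {c c' : Fam d} (h : c ∈ fGC d p) (h' : c' ∈ fGC d q) :
    preLie d c c' ∈ fGC d (p + q) := by
  refine ⟨fun k => ?_, fun N k hN => ?_,
    (evSymm_iff _).1 ((evSymm_of_fGC h).preLie (evSymm_of_fGC h') h'.1)⟩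
  · rw [preLie_apply, Finset.filter_false_of_mem, Finset.sum_empty]
    intro B _ hB
    obtain ⟨i, _⟩ := hB
    exact i.elim0
  · rw [preLie_apply] at hN
    obtain ⟨B, -, hB⟩ := Finset.exists_ne_zero_of_sum_ne_zero hN
    obtain ⟨j, -, hj⟩ := Finset.exists_ne_zero_of_sum_ne_zero fun h0 => hB (by rw [h0, smul_zero])
    have h1 := h.2.1 (Bᶜ.card + 1) j fun h0 => hj (by rw [h0]; simp)
    have h2 := h'.2.1 B.card (k - j) fun h0 => hj (by rw [h0]; simp)
    have h3 : (B.card : ℤ) + Bᶜ.card = N := by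
      have := Finset.card_add_card_compl B; rw [Fintype.card_fin] at this; exact_mod_cast this
    have h4 : ((k - (j : ℕ) : ℕ) : ℤ) = k - j := by have := j.2; omega
    rw [h4] at h2
    push_cast at h1
    rw [← h1, ← h2, ← h3]; ring

theorem sg_negOnePow (m : ℤ) : (((Int.negOnePow m : ℤˣ) : ℤ) : ℝ) = sg m := by
  rw [sg_intCast]
  rcases Int.even_or_odd m with h | h
  · rw [Int.negOnePow_even _ h, h.neg_one_zpow]; simp
  · rw [Int.negOnePow_odd _ h, h.neg_one_zpow]; simp

theorem bracket_apply (d : ℕ) (p q : ℤ) (a b : Fam d) :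
    bracket d p q a b = preLie d a b - sg ((p : ZMod 2) * q) • preLie d b a := by
  rw [← Int.cast_mul, ← sg_negOnePow, Int.cast_smul_eq_zsmul]
  rfl

/-! ### The pre-Lie identity -/

/-- The part of `(f ∘ g) ∘ h` in which `g` and `h` are inserted at different vertices. -/
def insertTwo {d : ℕ} (f g h : Fam d) {L : ℕ} (l : List (Fin L → ℝ)) : EdgeAlg d L :=
  Sh (fun _ => (d : ZMod 2)) l fun p m => Sh (fun _ => (d : ZMod 2)) m fun a b =>
    sg (d * lpar (fun _ => (d : ZMod 2)) a) •
      tmul d (tmul d (ev f (a.sum :: p.sum :: b)) (ev g a)) (ev h p)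

theorem preLie_zero_arity {d : ℕ} (c c' : Fam d) (k : ℕ) : preLie d c c' 0 k = 0 := by
  rw [preLie_apply, Finset.filter_false_of_mem, Finset.sum_empty]
  intro B _ hB
  obtain ⟨i, _⟩ := hB
  exact i.elim0

theorem ev_preLie_preLie {d : ℕ} (f g h : Fam d) (hg : ∀ k, g 0 k = 0) (hh : ∀ k, h 0 k = 0)
    {L : ℕ} (l : List (Fin L → ℝ)) :
    ev (preLie d (preLie d f g) h) l = ev (preLie d f (preLie d g h)) l + insertTwo f g h l := by
  rw [ev_preLie _ _ hh, ev_preLie _ _ (preLie_zero_arity g h), insertTwo]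
  have h1 : ∀ p q : List (Fin L → ℝ), tmul d (ev f (p.sum :: q)) (ev (preLie d g h) p)
      = Sh (fun _ => (d : ZMod 2)) p fun a b =>
        tmul d (tmul d (ev f ((a ++ b).sum :: q)) (ev g (a.sum :: b))) (ev h a) := by
    intro p q
    rw [ev_preLie _ _ hh, Sh_map]
    refine Sh_congr _ fun a b hab => ?_
    rw [tmul_assoc, hab.sum_eq]
  rw [Sh_congr' _ h1, Sh_assoc, ← Sh_add]
  refine Sh_congr' _ fun p m => ?_
  rw [ev_preLie _ _ hg, Sh_cons, map_add, LinearMap.add_apply]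
  congr 1
  · refine (Sh_map _ ((tmul d).flip (ev h p)) _ _).trans (Sh_congr' _ fun a b => ?_)
    simp [List.sum_append]
  · refine (Sh_map _ ((tmul d).flip (ev h p)) _ _).trans (Sh_congr' _ fun a b => ?_)
    simp

theorem lpar_const {X : Type*} (e : ZMod 2) (l : List X) : lpar (fun _ => e) l = l.length * e := by
  simp [lpar]

theorem insertTwo_comm {d : ℕ} {f g h : Fam d} {p q : ℤ} (hf : EvSymm f) (hg : g ∈ fGC d p)
    (hh : h ∈ fGC d q) {L : ℕ} (l : List (Fin L → ℝ)) :
    insertTwo f h g l = sg ((p : ZMod 2) * q) • insertTwo f g h l := by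
  rw [insertTwo, insertTwo, ← Sh_smul,
    ← Sh_assoc _ l fun p a b => sg (d * lpar (fun _ => (d : ZMod 2)) a) •
      tmul d (tmul d (ev f (a.sum :: p.sum :: b)) (ev h a)) (ev g p)]
  have h1 := fun r b : List (Fin L → ℝ) => Sh_comm (fun _ => (d : ZMod 2)) r fun p a =>
    sg (d * lpar (fun _ => (d : ZMod 2)) a) •
      tmul d (tmul d (ev f (a.sum :: p.sum :: b)) (ev h a)) (ev g p)
  rw [Sh_congr' _ h1, Sh_assoc]
  refine Sh_congr' _ fun x m => ?_
  rw [← Sh_smul]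
  refine Sh_congr' _ fun a b => ?_
  have h2 : tmul d (ev h x) (ev g a) = sg (d * (1 + a.length) * (1 + x.length) + p * q) •
      tmul d (ev g a) (ev h x) := by
    refine tmul_comm_of d _ _ _ fun j k hj hk => ?_
    have e1 := hg.2.1 a.length j fun h0 => hj (by rw [ev, h0, map_zero])
    have e2 := hh.2.1 x.length k fun h0 => hk (by rw [ev, h0, map_zero])
    rw [← sg_natCast, ← e1, ← e2]
    push_cast
    generalize (a.length : ZMod 2) = A
    generalize (x.length : ZMod 2) = X
    generalize (d : ZMod 2) = D
    generalize (j : ZMod 2) = J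
    generalize (k : ZMod 2) = K
    congr 1; revert A X D J K; decide
  have h3 := hf _ [] x.sum a.sum b
  rw [List.nil_append, List.nil_append] at h3
  rw [tmul_assoc, tmul_assoc, h2, h3, map_smul, map_smul, LinearMap.smul_apply, smul_smul, smul_smul,
    smul_smul, smul_smul, lpar_const, lpar_const]
  congr 1
  simp only [← sg_add]
  generalize (a.length : ZMod 2) = A
  generalize (x.length : ZMod 2) = X
  generalize (d : ZMod 2) = D
  generalize (p : ZMod 2) = P
  generalize (q : ZMod 2) = Q
  congr 1; revert A X D P Q; decide

theorem preLie_identity {d : ℕ} {f g h : Fam d} {p q : ℤ} (hf : EvSymm f) (hg : g ∈ fGC d p)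
    (hh : h ∈ fGC d q) :
    preLie d (preLie d f g) h - sg ((p : ZMod 2) * q) • preLie d (preLie d f h) g
      = preLie d f (bracket d p q g h) := by
  refine fam_ext fun L l => ?_
  rw [bracket_apply, map_sub, map_smul]
  simp only [ev_sub, ev_smul]
  rw [ev_preLie_preLie _ _ _ hg.1 hh.1, ev_preLie_preLie _ _ _ hh.1 hg.1, insertTwo_comm hf hg hh,
    smul_add, smul_smul, sg_mul_self, one_smul]
  abel

/-! ### The unit -/

/-- The graph with one vertex and no edges. -/
def unitGraph (d : ℕ) : Fam d
  | 1, 0 => graphClass d Fin.elim0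
  | _, _ => 0

theorem evSymm_of_arity_one {d : ℕ} {c : Fam d} (h : ∀ N k, N ≠ 1 → c N k = 0) : EvSymm c := by
  rw [evSymm_iff]
  intro N k σ
  by_cases hN : N = 1
  · subst hN
    have : σ = 1 := Subsingleton.elim _ _
    subst this
    simp [relabel_one]
  · rw [h N k hN]; simp

theorem unitGraph_of_ne {d N k : ℕ} (h : N ≠ 1 ∨ k ≠ 0) : unitGraph d N k = 0 := by
  unfold unitGraph
  split
  · rcases h with h | h <;> exact absurd rfl h
  · rfl

theorem evSymm_unitGraph (d : ℕ) : EvSymm (unitGraph d) :=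
  evSymm_of_arity_one fun _ _ h => unitGraph_of_ne (Or.inl h)

theorem Sh_right_nil {X : Type*} (π : X → ZMod 2) {M : Type*} [AddCommGroup M] [Module ℝ M]
    (l : List X) (F : List X → List X → M) (h : ∀ p x q, F p (x :: q) = 0) : Sh π l F = F l [] := by
  induction l generalizing F with
  | nil => rfl
  | cons x l ih =>
    rw [Sh_cons, ih _ fun p y q => h (x :: p) y q, Sh_congr' π fun p q => by rw [h, smul_zero],
      Sh_zero, add_zero]

theorem juxt_zero {L k : ℕ} (h : LGraph L 0) (h' : LGraph L k) (hK : 0 + k = k) : juxt hK h h' = h' := by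
  funext i
  have : Fin.cast hK.symm i = Fin.natAdd 0 i := Fin.ext (by simp)
  rw [juxt, Function.comp_apply, this, Fin.append_right]

theorem ev_unitGraph_zero (d : ℕ) {L : ℕ} (x : Fin L → ℝ) :
    ev (unitGraph d) [x] 0 = graphClass d Fin.elim0 := by
  change subst d _ (graphClass d Fin.elim0) = _
  rw [subst_class, Fintype.sum_unique]
  have : substCoeff (k := 0) [x].get Fin.elim0 default = 1 := rfl
  rw [this, one_smul]
  congr 1

theorem ev_unitGraph_ne (d : ℕ) {L : ℕ} (l : List (Fin L → ℝ)) (k : ℕ) (h : l.length ≠ 1 ∨ k ≠ 0) :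
    ev (unitGraph d) l k = 0 := by
  rw [ev, unitGraph_of_ne h, map_zero]

theorem gmul_unit (d : ℕ) {L k : ℕ} (hK : 0 + k = k) (y : Gra d L k) :
    gmul d hK (graphClass d Fin.elim0) y = y := by
  induction y using gra_induction with
  | zero => rw [map_zero]
  | add y z hy hz => rw [map_add, hy, hz]
  | smul r y hy => rw [map_smul, hy]
  | cls γ => rw [gmul_class, juxt_zero]

theorem tmul_unit {d L : ℕ} (x : Fin L → ℝ) (y : EdgeAlg d L) :
    tmul d (ev (unitGraph d) [x]) y = y := by
  funext K
  rw [tmul_eq_sum d _ _ (Nat.lt_succ_self K),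
    Finset.sum_eq_single_of_mem 0 (Finset.mem_range.2 (by omega)),
    Finset.sum_eq_single_of_mem K (Finset.mem_range.2 (by omega))]
  · rw [ev_unitGraph_zero, gmulAt, dif_pos (zero_add K), gmul_unit]
  · intro k _ hk
    rw [gmulAt, dif_neg (by omega)]; rfl
  · intro j _ hj
    refine Finset.sum_eq_zero fun k _ => ?_
    rw [ev_unitGraph_ne _ _ _ (Or.inr hj), map_zero, LinearMap.zero_apply]

theorem unitGraph_preLie {d : ℕ} (c : Fam d) (hc : ∀ k, c 0 k = 0) : preLie d (unitGraph d) c = c := by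
  refine fam_ext fun L l => ?_
  rw [ev_preLie _ _ hc, Sh_right_nil]
  · exact tmul_unit _ _
  · intro p x q
    have : ev (unitGraph d) (p.sum :: x :: q) = 0 := by
      funext k
      exact ev_unitGraph_ne _ _ _ (Or.inl (by simp))
    rw [this, map_zero, LinearMap.zero_apply]

/-! ### Membership of the Dynkin series in submodules -/
section dynkin
variable {M : Type*} [AddCommGroup M] [Module ℝ M] {br : M → M → M}

theorem dynkin_mem {x y : M} {m : ℕ} (I : Submodule ℝ M)
    (h : ∀ l : List M, l.length = m → (∀ z ∈ l, z = x ∨ z = y) → rightNested br l ∈ I) :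
    dynkin br x y m ∈ I := by
  refine Submodule.sum_mem _ fun k _ => Submodule.sum_mem _ fun f hf => Submodule.smul_mem _ _ ?_
  refine h (bchWord x y fun i => (((f i).1 : ℕ), ((f i).2 : ℕ))) ?_ fun z hz => mem_bchWord hz
  rw [length_bchWord]
  exact (Finset.mem_filter.1 hf).2.2

theorem dynkin_sub_mem {x y x' y' : M} (m : ℕ) (I : Submodule ℝ M)
    (h : ∀ l : List (M × M), (∀ z ∈ l, z = (x, x') ∨ z = (y, y')) →
      rightNested br (l.map Prod.fst) - rightNested br (l.map Prod.snd) ∈ I) :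
    dynkin br x y m - dynkin br x' y' m ∈ I := by
  unfold dynkin
  rw [← Finset.sum_sub_distrib]
  refine Submodule.sum_mem _ fun k _ => ?_
  rw [← Finset.sum_sub_distrib]
  refine Submodule.sum_mem _ fun f _ => ?_
  rw [← smul_sub]
  refine Submodule.smul_mem _ _ ?_
  have := h (bchWord (x, x') (y, y') fun i => (((f i).1 : ℕ), ((f i).2 : ℕ))) fun z hz => mem_bchWord hz
  rw [bchWord_map, bchWord_map] at this
  exact this

theorem rightNested_mem (S : Submodule ℝ M) (hS : ∀ a ∈ S, ∀ b ∈ S, br a b ∈ S) :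
    ∀ l : List M, (∀ z ∈ l, z ∈ S) → rightNested br l ∈ S
  | [], _ => S.zero_mem
  | [x], h => h x (by simp)
  | x :: y :: l, h => hS _ (h x (by simp)) _ (rightNested_mem S hS (y :: l) fun z hz =>
      h z (List.mem_cons_of_mem _ hz))

theorem rightNested_sub_mem (br : M →ₗ[ℝ] M →ₗ[ℝ] M) (S I : Submodule ℝ M)
    (hS : ∀ a ∈ S, ∀ b ∈ S, br a b ∈ S) (hl : ∀ a ∈ I, ∀ b ∈ S, br a b ∈ I)
    (hr : ∀ a ∈ S, ∀ b ∈ I, br a b ∈ I) : ∀ l : List (M × M),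
    (∀ z ∈ l, z.1 ∈ S ∧ z.2 ∈ S ∧ z.1 - z.2 ∈ I) →
      rightNested (fun a b => br a b) (l.map Prod.fst) - rightNested (fun a b => br a b) (l.map Prod.snd) ∈ I
  | [], _ => by simp [rightNested]
  | [x], h => (h x (by simp)).2.2
  | x :: y :: l, h => by
    have ih := rightNested_sub_mem br S I hS hl hr (y :: l) fun z hz => h z (List.mem_cons_of_mem _ hz)
    have h1 : rightNested (fun a b => br a b) ((y :: l).map Prod.fst) ∈ S :=
      rightNested_mem S hS _ fun z hz => by
        obtain ⟨w, hw, rfl⟩ := List.mem_map.1 hz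
        exact (h w (List.mem_cons_of_mem _ hw)).1
    change br x.1 (rightNested (fun a b => br a b) ((y :: l).map Prod.fst)) -
      br x.2 (rightNested (fun a b => br a b) ((y :: l).map Prod.snd)) ∈ I
    have h2 : ∀ u u', br x.1 u - br x.2 u' = br (x.1 - x.2) u + br x.2 (u - u') := by
      intro u u'; simp
    rw [h2]
    exact add_mem (hl _ (h x (by simp)).2.2 _ h1) (hr _ (h x (by simp)).2.1 _ ih)

end dynkin

/-! ### Elements with components in each arity -/
section arity
variable {C : Type*} [AddCommGroup C] [Module ℝ C] {Y : ℕ → Type*} [∀ N, AddCommGroup (Y N)]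
  [∀ N, Module ℝ (Y N)] {π : ∀ N, C →ₗ[ℝ] Y N}

/-- Elements are determined by their components, and components can be combined freely. -/
structure ArityComplete (π : ∀ N, C →ₗ[ℝ] Y N) : Prop where
  sep : ∀ f, (∀ N, π N f = 0) → f = 0
  glue : ∀ g : ℕ → C, ∃ f, ∀ N, π N f = π N (g N)

/-- The elements that vanish in arity less than `N`. -/
def arityFilt (π : ∀ N, C →ₗ[ℝ] Y N) (N : ℕ) : Submodule ℝ C where
  carrier := {f | ∀ M < N, π M f = 0}
  add_mem' hf hg M hM := by rw [map_add, hf M hM, hg M hM, add_zero]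
  zero_mem' _ _ := map_zero _
  smul_mem' r _ hf M hM := by rw [map_smul, hf M hM, smul_zero]

theorem ArityComplete.sepFiltration (h : ArityComplete π) : SepFiltration (arityFilt π) where
  zero := eq_top_iff.2 fun _ _ M hM => absurd hM (Nat.not_lt_zero M)
  anti _ _ hij _ hf M hM := hf M (hM.trans_le hij)
  sep _ hf := h.sep _ fun N => hf (N + 1) N (Nat.lt_succ_self N)

/-- The sum of the exponential series of an operator that raises the arity. -/
def expOn (h : ArityComplete π) (T : Module.End ℝ C) (f : C) : C :=
  (h.glue fun N => ∑ k ∈ Finset.range (N + 1), ((k.factorial : ℝ)⁻¹) • (T ^ k) f).choose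

theorem expOn_apply (h : ArityComplete π) (T : Module.End ℝ C) (f : C) (N : ℕ) :
    π N (expOn h T f)
      = π N (∑ k ∈ Finset.range (N + 1), ((k.factorial : ℝ)⁻¹) • (T ^ k) f) :=
  (h.glue fun N => ∑ k ∈ Finset.range (N + 1), ((k.factorial : ℝ)⁻¹) • (T ^ k) f).choose_spec N

theorem sum_range_eq_of_raises {T : Module.End ℝ C} (hT : SepFiltration.Raises (arityFilt π) T) (f : C)
    (r : ℕ → ℝ) {M n : ℕ} (h : M < n) : π M (∑ k ∈ Finset.range n, r k • (T ^ k) f)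
      = π M (∑ k ∈ Finset.range (M + 1), r k • (T ^ k) f) := by
  rw [map_sum, map_sum]
  refine (Finset.sum_subset (Finset.range_subset_range.2 (by omega)) fun k _ hk => ?_).symm
  have h1 := SepFiltration.IsExp.raises_pow hT k 0 f (fun _ h => absurd h (Nat.not_lt_zero _))
  rw [map_smul, h1 M (by simp at hk; omega), smul_zero]

theorem isExp_expOn (h : ArityComplete π) {T : Module.End ℝ C}
    (hT : SepFiltration.Raises (arityFilt π) T) : SepFiltration.IsExp (arityFilt π) T (expOn h T) := by
  intro N f M hM
  rw [map_sub, expOn_apply, sum_range_eq_of_raises hT f _ hM, sub_self]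

end arity

/-! ### Right multiplications on symmetric families -/

theorem EvSymm.add {d : ℕ} {a b : Fam d} (ha : EvSymm a) (hb : EvSymm b) : EvSymm (a + b) := by
  intro L l₁ x y l₂
  rw [ev_add, ev_add, ha, hb, smul_add]

theorem EvSymm.smul {d : ℕ} {a : Fam d} (r : ℝ) (ha : EvSymm a) : EvSymm (r • a) := by
  intro L l₁ x y l₂
  rw [ev_smul, ev_smul, ha, smul_comm]

/-- The symmetric families without part of arity zero. -/
def symFam (d : ℕ) : Submodule ℝ (Fam d) where
  carrier := {c | (∀ k, c 0 k = 0) ∧ EvSymm c}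
  add_mem' ha hb := ⟨fun k => by simp [ha.1, hb.1], ha.2.add hb.2⟩
  zero_mem' := ⟨fun _ => rfl, fun L l₁ x y l₂ => by
    have : ∀ l : List (Fin L → ℝ), ev (0 : Fam d) l = 0 := fun l => funext fun k => map_zero _
    rw [this, this, smul_zero]⟩
  smul_mem' r a ha := ⟨fun k => by simp [ha.1], ha.2.smul r⟩

/-- The symmetric families without part of arity zero. -/
def SymFam (d : ℕ) : Type := symFam d

instance (d : ℕ) : AddCommGroup (SymFam d) := inferInstanceAs (AddCommGroup (symFam d))
instance (d : ℕ) : Module ℝ (SymFam d) := inferInstanceAs (Module ℝ (symFam d))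

/-- The underlying family. -/
def SymFam.val {d : ℕ} : SymFam d →ₗ[ℝ] Fam d := (symFam d).subtype

/-- Symmetric families as elements of `SymFam`. -/
def SymFam.mk {d : ℕ} (f : Fam d) (hf : f ∈ symFam d) : SymFam d := ⟨f, hf⟩

@[simp] theorem SymFam.val_mk {d : ℕ} (f : Fam d) (hf : f ∈ symFam d) : (SymFam.mk f hf).val = f := rfl

theorem SymFam.val_mem {d : ℕ} (f : SymFam d) : f.val ∈ symFam d := f.2

theorem SymFam.ext {d : ℕ} {f g : SymFam d} (h : f.val = g.val) : f = g := Subtype.ext h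

theorem fGC_le_symFam (d : ℕ) (p : ℤ) : fGC d p ≤ symFam d :=
  fun _ h => ⟨h.1, evSymm_of_fGC h⟩

theorem unitGraph_mem (d : ℕ) : unitGraph d ∈ symFam d :=
  ⟨fun _ => unitGraph_of_ne (Or.inl (by omega)), evSymm_unitGraph d⟩

theorem preLie_mem_symFam {d : ℕ} {a b : Fam d} (ha : a ∈ symFam d) (hb : b ∈ symFam d) :
    preLie d a b ∈ symFam d := ⟨fun k => preLie_zero_arity a b k, ha.2.preLie hb.2 hb.1⟩

/-- `g ↦ (f ↦ f ∘ g)`. -/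
def rightMul (d : ℕ) : SymFam d →ₗ[ℝ] Module.End ℝ (SymFam d) where
  toFun g :=
    { toFun := fun f => .mk (preLie d f.val g.val) (preLie_mem_symFam f.val_mem g.val_mem)
      map_add' := fun _ _ => SymFam.ext (by simp)
      map_smul' := fun _ _ => SymFam.ext (by simp) }
  map_add' _ _ := LinearMap.ext fun _ => SymFam.ext (by simp)
  map_smul' _ _ := LinearMap.ext fun _ => SymFam.ext (by simp)

theorem rightMul_apply {d : ℕ} (g f : SymFam d) :
    (rightMul d g f).val = preLie d f.val g.val := rfl

theorem rightMul_injective (d : ℕ) : Function.Injective (rightMul d) := by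
  intro g g' h
  have := congrArg SymFam.val (LinearMap.congr_fun h (.mk _ (unitGraph_mem d)))
  rw [rightMul_apply, rightMul_apply, SymFam.val_mk, unitGraph_preLie _ g.val_mem.1,
    unitGraph_preLie _ g'.val_mem.1] at this
  exact SymFam.ext this

theorem bracket_mem_fGC {d : ℕ} {p q : ℤ} {a b : Fam d} (ha : a ∈ fGC d p) (hb : b ∈ fGC d q) :
    bracket d p q a b ∈ fGC d (p + q) := by
  rw [bracket_apply]
  refine sub_mem (preLie_mem_fGC ha hb) (Submodule.smul_mem _ _ ?_)
  rw [add_comm]; exact preLie_mem_fGC hb ha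

/-- Elements of `fGC` as symmetric families. -/
def toSym {d : ℕ} {p : ℤ} {a : Fam d} (ha : a ∈ fGC d p) : SymFam d :=
  .mk a (fGC_le_symFam d p ha)

theorem rightMul_bracket {d : ℕ} {p q : ℤ} {a b : Fam d} (ha : a ∈ fGC d p) (hb : b ∈ fGC d q) :
    rightMul d (toSym (bracket_mem_fGC ha hb)) = rightMul d (toSym hb) * rightMul d (toSym ha)
      - sg ((p : ZMod 2) * q) • (rightMul d (toSym ha) * rightMul d (toSym hb)) :=
  LinearMap.ext fun f => SymFam.ext (by
    simp only [rightMul_apply, LinearMap.sub_apply, LinearMap.smul_apply, Module.End.mul_apply,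
      map_sub, map_smul]
    exact (preLie_identity f.val_mem.2 ha hb).symm)

theorem commutator_commute {R : Type*} [Ring R] {A B E : R} (h1 : A * E = E * A)
    (h2 : B * E = E * B) : (B * A - A * B) * E = E * (B * A - A * B) := by
  rw [sub_mul, mul_sub, mul_assoc, mul_assoc, h1, h2, ← mul_assoc, ← mul_assoc, h1, h2, mul_assoc,
    mul_assoc]

theorem commutator_anticommutator {R : Type*} [Ring R] {A B E : R} (h : A * E = E * A) :
    (B * A - A * B) * E + E * (B * A - A * B) = (B * E + E * B) * A - A * (B * E + E * B) := by
  have e1 : B * A * E = B * E * A := by rw [mul_assoc, h, mul_assoc]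
  have e2 : E * (A * B) = A * E * B := by rw [← mul_assoc, h]
  rw [sub_mul, mul_sub, add_mul, mul_add, e1, e2]
  simp only [mul_assoc]
  abel

/-! ### The differential -/

theorem edgeGraph_of_ne {d N k : ℕ} (h : N ≠ 2 ∨ k ≠ 1) : edgeGraph d N k = 0 := by
  unfold edgeGraph
  split
  · rcases h with h | h <;> exact absurd rfl h
  · rfl

theorem edgeGraph_mem (d : ℕ) : edgeGraph d ∈ fGC d 1 := by
  refine ⟨fun k => edgeGraph_of_ne (Or.inl (by omega)), fun N k h => ?_, fun N k σ => ?_⟩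
  · have h1 : N = 2 := by by_contra h'; exact h (edgeGraph_of_ne (Or.inl h'))
    have h2 : k = 1 := by by_contra h'; exact h (edgeGraph_of_ne (Or.inr h'))
    subst h1 h2; push_cast; ring
  · by_cases hN : N = 2 ∧ k = 1
    · obtain ⟨rfl, rfl⟩ := hN
      have h1 : ∀ σ : Equiv.Perm (Fin 2), σ = 1 ∨ σ = Equiv.swap 0 1 := by decide
      have h2 := graphClass_update d (fun _ : Fin 1 => ((0 : Fin 2), (1 : Fin 2))) 0
      change relabel d σ (graphClass d _) = _ • graphClass d _
      rcases h1 σ with rfl | rfl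
      · simp [relabel_one]
      · rw [relabel_eq_subst, subst_single_class, Equiv.Perm.sign_swap (by decide)]
        have h3 : mapVertices (((Equiv.swap 0 1 : Equiv.Perm (Fin 2)))⁻¹ : Equiv.Perm (Fin 2))
            (fun _ : Fin 1 => ((0 : Fin 2), (1 : Fin 2)))
            = Function.update (fun _ : Fin 1 => ((0 : Fin 2), (1 : Fin 2))) 0 ((0 : Fin 2), (1 : Fin 2)).swap := by
          decide
        rw [h3, h2]; simp
    · rw [edgeGraph_of_ne (by omega), map_zero, smul_zero]

/-- The operator of right multiplication by the edge. -/
abbrev edgeMul (d : ℕ) : Module.End ℝ (SymFam d) := rightMul d (toSym (edgeGraph_mem d))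

theorem differential_mem {d : ℕ} {p : ℤ} {a : Fam d} (ha : a ∈ fGC d p) :
    differential d p a ∈ fGC d (1 + p) := bracket_mem_fGC (edgeGraph_mem d) ha

theorem rightMul_differential {d : ℕ} {p : ℤ} {a : Fam d} (ha : a ∈ fGC d p) :
    rightMul d (toSym (differential_mem ha)) = rightMul d (toSym ha) * edgeMul d
      - sg (p : ZMod 2) • (edgeMul d * rightMul d (toSym ha)) := by
  have := rightMul_bracket (edgeGraph_mem d) ha
  rw [Int.cast_one, one_mul] at this
  exact this

theorem cocycle_commute {d : ℕ} {a : Fam d} (ha : a ∈ cocycles d) :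
    rightMul d (toSym ha.1) * edgeMul d = edgeMul d * rightMul d (toSym ha.1) := by
  have h1 := rightMul_differential ha.1
  have h2 : toSym (differential_mem ha.1) = 0 := SymFam.ext (LinearMap.mem_ker.1 ha.2)
  rw [h2, map_zero] at h1
  rw [← sub_eq_zero, h1]
  simp

theorem mem_cocycles_of_commute {d : ℕ} {a : Fam d} (ha : a ∈ fGC d 0)
    (h : rightMul d (toSym ha) * edgeMul d = edgeMul d * rightMul d (toSym ha)) : a ∈ cocycles d := by
  refine ⟨ha, LinearMap.mem_ker.2 ?_⟩
  have h1 := rightMul_differential ha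
  rw [h, Int.cast_zero, sg_zero, one_smul] at h1
  replace h1 := h1.trans ((sub_self _).trans (map_zero (rightMul d)).symm)
  exact congrArg SymFam.val (rightMul_injective d h1)

theorem rightMul_bracket_zero {d : ℕ} {a b : Fam d} (ha : a ∈ fGC d 0) (hb : b ∈ fGC d 0)
    (h : bracket d 0 0 a b ∈ fGC d 0) :
    rightMul d (toSym h) = rightMul d (toSym hb) * rightMul d (toSym ha)
      - rightMul d (toSym ha) * rightMul d (toSym hb) := by
  have := rightMul_bracket ha hb
  rw [Int.cast_zero, mul_zero, sg_zero, one_smul] at this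
  exact this

theorem bracket_mem_fGC_zero {d : ℕ} {a b : Fam d} (ha : a ∈ fGC d 0) (hb : b ∈ fGC d 0) :
    bracket d 0 0 a b ∈ fGC d 0 := by
  have := bracket_mem_fGC ha hb
  rwa [add_zero] at this

theorem bracket_mem_cocycles {d : ℕ} {a b : Fam d} (ha : a ∈ cocycles d) (hb : b ∈ cocycles d) :
    bracket d 0 0 a b ∈ cocycles d := by
  refine mem_cocycles_of_commute (bracket_mem_fGC_zero ha.1 hb.1) ?_
  rw [rightMul_bracket_zero ha.1 hb.1]
  exact commutator_commute (cocycle_commute ha) (cocycle_commute hb)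

theorem differential_mem_zero {d : ℕ} {a : Fam d} (ha : a ∈ fGC d (-1)) :
    differential d (-1) a ∈ fGC d 0 := by
  have := differential_mem ha
  rwa [add_neg_cancel] at this

theorem rightMul_coboundary {d : ℕ} {a : Fam d} (ha : a ∈ fGC d (-1)) :
    rightMul d (toSym (differential_mem_zero ha)) = rightMul d (toSym ha) * edgeMul d
      + edgeMul d * rightMul d (toSym ha) := by
  have := rightMul_differential ha
  have h1 : sg (((-1 : ℤ)) : ZMod 2) = -1 := by rw [sg_intCast]; norm_num
  rw [h1] at this
  refine this.trans ?_
  have : ∀ x y : Module.End ℝ (SymFam d), x - (-1 : ℝ) • y = x + y := fun x y => by module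
  exact this _ _

theorem bracket_coboundary {d : ℕ} {a b : Fam d} (ha : a ∈ cocycles d) (hb : b ∈ coboundaries d) :
    bracket d 0 0 a b ∈ coboundaries d := by
  obtain ⟨η, hη, rfl⟩ := hb
  have h0 : bracket d 0 (-1) a η ∈ fGC d (-1) := by
    have := bracket_mem_fGC ha.1 hη
    rwa [zero_add] at this
  refine ⟨_, h0, ?_⟩
  have h1 : toSym (differential_mem_zero h0)
      = toSym (bracket_mem_fGC_zero ha.1 (differential_mem_zero hη)) := by
    refine rightMul_injective d ?_
    have h2 := rightMul_bracket ha.1 hη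
    rw [Int.cast_zero, zero_mul, sg_zero, one_smul] at h2
    have h3 : rightMul d (toSym h0) = rightMul d (toSym hη) * rightMul d (toSym ha.1)
      - rightMul d (toSym ha.1) * rightMul d (toSym hη) := h2
    rw [rightMul_coboundary h0, rightMul_bracket_zero ha.1 (differential_mem_zero hη),
      rightMul_coboundary hη, h3]
    exact commutator_anticommutator (cocycle_commute ha)
  exact congrArg SymFam.val h1

theorem bracket_zero_swap {d : ℕ} (a b : Fam d) : bracket d 0 0 b a = -bracket d 0 0 a b := by
  rw [bracket_apply, bracket_apply]; simp

/-! ### Cocycles vanish in arity one -/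

theorem gra_one_eq_zero {d k : ℕ} (hd : Odd d) (hk : k ≠ 0) (x : Gra d 1 k) : x = 0 := by
  induction x using gra_induction with
  | zero => rfl
  | add x y hx hy => rw [hx, hy, add_zero]
  | smul r x hx => rw [hx, smul_zero]
  | cls γ =>
    have h := graphClass_update d γ ⟨0, Nat.pos_of_ne_zero hk⟩
    rw [show Function.update γ ⟨0, Nat.pos_of_ne_zero hk⟩ (γ ⟨0, Nat.pos_of_ne_zero hk⟩).swap = γ from
      Subsingleton.elim _ _, hd.neg_one_pow, neg_one_smul] at h
    have h2 : (2 : ℝ) • graphClass d γ = 0 := by rw [two_smul]; nth_rewrite 2 [h]; exact add_neg_cancel _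
    exact (smul_eq_zero.1 h2).resolve_left two_ne_zero

theorem edgeGraph_ne_zero (d : ℕ) : edgeGraph d 2 1 ≠ 0 := by
  let F : LGraph 2 1 → ℝ := fun γ => if γ 0 = (0, 1) then 1 else if γ 0 = (1, 0) then (-1) ^ d else 0
  have hd : ((-1 : ℝ) ^ d) * (-1) ^ d = 1 := by rw [← mul_pow]; simp
  let Φ : Gra d 2 1 →ₗ[ℝ] ℝ := graLift d F
    (fun γ e => by
      obtain rfl : e = 0 := Subsingleton.elim _ _
      simp only [F, Function.update_self]
      generalize γ 0 = p
      obtain ⟨a, b⟩ := p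
      fin_cases a <;> fin_cases b <;> simp [hd])
    (fun γ σ => by
      obtain rfl : σ = 1 := Subsingleton.elim _ _
      simp)
  intro h
  have h1 : Φ (edgeGraph d 2 1) = 1 := (graLift_class _ _ _ _ _).trans (by simp [F])
  rw [h, map_zero] at h1
  exact zero_ne_one h1

theorem ev_edgeGraph_ne (d : ℕ) {L : ℕ} (l : List (Fin L → ℝ)) (h : l.length ≠ 2) :
    ev (edgeGraph d) l = 0 := by
  funext k
  rw [ev, edgeGraph_of_ne (Or.inl h), map_zero]; rfl

theorem cocycle_one {d : ℕ} {c : Fam d} (hc : c ∈ cocycles d) (k : ℕ) : c 1 k = 0 := by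
  have hpos : ∀ k, k ≠ 0 → c 1 k = 0 := by
    intro k hk
    by_contra h
    have := hc.1.2.1 1 k h
    rw [Nat.cast_one, sub_self, mul_zero, zero_add, mul_eq_zero] at this
    have hd : d = 1 := by omega
    subst hd
    exact h (gra_one_eq_zero odd_one hk _)
  by_cases hk : k = 0
  swap
  · exact hpos k hk
  subst hk
  obtain ⟨r, hr⟩ : ∃ r : ℝ, c 1 0 = r • graphClass d Fin.elim0 := by
    generalize c 1 0 = x
    induction x using gra_induction with
    | zero => exact ⟨0, by simp⟩
    | add x y hx hy =>
      obtain ⟨a, rfl⟩ := hx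
      obtain ⟨b, rfl⟩ := hy
      exact ⟨a + b, by rw [add_smul]⟩
    | smul s x hx =>
      obtain ⟨a, rfl⟩ := hx
      exact ⟨s * a, by rw [smul_smul]⟩
    | cls γ => exact ⟨1, by rw [one_smul]; congr 1; exact Subsingleton.elim _ _⟩
  have h1 : ∀ {L : ℕ} (x : Fin L → ℝ), ev c [x] = r • ev (unitGraph d) [x] := by
    intro L x
    funext k
    by_cases hk : k = 0
    · subst hk
      rw [Pi.smul_apply]
      change subst d _ (c 1 0) = r • subst d _ (graphClass d Fin.elim0)
      rw [hr, map_smul]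
    · rw [Pi.smul_apply, ev_unitGraph_ne _ _ _ (Or.inr hk), smul_zero]
      change subst d _ (c 1 k) = 0
      rw [hpos k hk, map_zero]
  have hunit : ∀ {L : ℕ} (x : Fin L → ℝ) (y : EdgeAlg d L), tmul d y (ev (unitGraph d) [x]) = y := by
    intro L x y
    rw [tmul_comm_of d (ev (unitGraph d) [x]) y 1, one_smul, tmul_unit]
    intro j k hj _
    have : j = 0 := by by_contra h; exact hj (ev_unitGraph_ne _ _ _ (Or.inr h))
    subst this
    simp
  have h2 := LinearMap.mem_ker.1 hc.2
  have h3 : ∀ x y : Fin 2 → ℝ, r • ev (edgeGraph d) [x, y] = 0 := by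
    intro x y
    have h4 : ev (differential d 0 c) [x, y] = 0 := by
      rw [h2]; funext k; exact map_zero _
    have hs := evSymm_of_fGC (edgeGraph_mem d) 2 [] x y []
    rw [differential, bracket_apply, Int.cast_zero, mul_zero, sg_zero, one_smul, ev_sub,
      ev_preLie _ _ hc.1.1, ev_preLie _ _ (edgeGraph_mem d).1] at h4
    simp only [Sh_cons, Sh_nil, ev_nil_of hc.1.1, ev_edgeGraph_ne d [_] (by simp),
      ev_edgeGraph_ne d [] (by simp), h1, map_smul, hunit, lpar_cons, lpar_nil, mul_zero, sg_zero,
      add_zero, smul_zero, List.sum_nil, List.sum_cons, LinearMap.smul_apply, tmul_unit, map_zero,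
      LinearMap.zero_apply, one_smul, zero_add] at h4
    rw [List.nil_append, List.nil_append] at hs
    have h5 : sg ((d : ZMod 2) * d) • ev (edgeGraph d) [y, x] = ev (edgeGraph d) [x, y] := by
      rw [ev_perm_parity, hs]
    rw [smul_comm, h5] at h4
    simpa using h4
  have h6 := h3 (Pi.single 0 1) (Pi.single 1 1)
  have h7 : ev (edgeGraph d) [Pi.single 0 1, Pi.single 1 1] = edgeGraph d 2 := by
    rw [← ev_stdList (edgeGraph d) 2]; congr 1
  rw [h7] at h6
  have h8 := congrFun h6 1
  rw [Pi.smul_apply] at h8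
  rw [hr, (smul_eq_zero.1 h8).resolve_right (edgeGraph_ne_zero d), zero_smul]

/-! ### The arity filtration -/

/-- The family vanishes in arities up to `i`. -/
def VanishesTo {d : ℕ} (i : ℕ) (c : Fam d) : Prop := ∀ M ≤ i, c M = 0

theorem VanishesTo.preLie {d i j : ℕ} {a b : Fam d} (ha : VanishesTo i a) (hb : VanishesTo j b) :
    VanishesTo (i + j) (preLie d a b) := by
  intro M hM
  funext K
  rw [preLie_apply]
  refine Finset.sum_eq_zero fun B _ => ?_
  rw [Finset.sum_eq_zero, smul_zero]
  intro e _
  have h3 : B.card + Bᶜ.card = M := by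
    rw [Finset.card_add_card_compl B, Fintype.card_fin]
  by_cases h : B.card ≤ j
  · rw [hb _ h, Pi.zero_apply, map_zero]
  · rw [ha _ (by omega), Pi.zero_apply, map_zero, LinearMap.zero_apply]

theorem VanishesTo.bracket {d i j : ℕ} {p q : ℤ} {a b : Fam d} (ha : VanishesTo i a)
    (hb : VanishesTo j b) : VanishesTo (i + j) (bracket d p q a b) := by
  intro M hM
  rw [bracket_apply, Pi.sub_apply, Pi.smul_apply, ha.preLie hb M hM,
    hb.preLie ha M (by omega), smul_zero, sub_zero]

theorem cocycle_vanishesTo {d : ℕ} {c : Fam d} (hc : c ∈ cocycles d) : VanishesTo 1 c := by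
  intro M hM
  funext k
  interval_cases M
  · exact hc.1.1 k
  · exact cocycle_one hc k

/-- The families that vanish up to arity `i`. -/
def vanishing (d i : ℕ) : Submodule ℝ (Fam d) where
  carrier := {c | VanishesTo i c}
  add_mem' ha hb M hM := by rw [Pi.add_apply, ha M hM, hb M hM, add_zero]
  zero_mem' _ _ := rfl
  smul_mem' r _ ha M hM := by rw [Pi.smul_apply, ha M hM, smul_zero]

theorem rightNested_vanishesTo {d : ℕ} : ∀ l : List (Fam d), (∀ z ∈ l, z ∈ cocycles d) →
    VanishesTo l.length (rightNested (fun x y => bracket d 0 0 x y) l)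
  | [], _ => fun _ _ => rfl
  | [x], h => cocycle_vanishesTo (h x (by simp))
  | x :: y :: l, h => by
    have := (cocycle_vanishesTo (h x (by simp))).bracket (p := 0) (q := 0)
      (rightNested_vanishesTo (y :: l) fun z hz => h z (List.mem_cons_of_mem _ hz))
    rw [add_comm] at this
    exact this

theorem bchTerm_vanishesTo {d : ℕ} {a b : Fam d} (ha : a ∈ cocycles d) (hb : b ∈ cocycles d) (m : ℕ) :
    VanishesTo m (bchTerm d a b m) := by
  refine dynkin_mem (vanishing d m) fun l hl h => ?_
  rw [← hl]
  refine rightNested_vanishesTo l fun z hz => ?_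
  rcases h z hz with rfl | rfl <;> assumption

theorem bchTerm_mem {d : ℕ} {a b : Fam d} (ha : a ∈ cocycles d) (hb : b ∈ cocycles d) (m : ℕ) :
    bchTerm d a b m ∈ cocycles d := by
  refine dynkin_mem _ fun l _ h => ?_
  refine rightNested_mem _ (fun a ha b hb => bracket_mem_cocycles ha hb) l fun z hz => ?_
  rcases h z hz with rfl | rfl <;> assumption

theorem bch_apply {d : ℕ} {a b : Fam d} (ha : a ∈ cocycles d) (hb : b ∈ cocycles d) {N n : ℕ} (h : N ≤ n) :
    bch d a b N = (∑ m ∈ Finset.range n, bchTerm d a b m) N := by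
  funext k
  rw [Finset.sum_apply, Finset.sum_apply]
  refine finsum_eq_finsetSum_of_support_subset _ fun m hm => ?_
  rw [Finset.mem_coe, Finset.mem_range]
  by_contra h'
  exact hm (congrFun (bchTerm_vanishesTo ha hb m N (by omega)) k)

theorem preLie_congr {d : ℕ} {a a' b b' : Fam d} {N : ℕ} (ha : ∀ M ≤ N, a M = a' M)
    (hb : ∀ M ≤ N, b M = b' M) : preLie d a b N = preLie d a' b' N := by
  funext K
  rw [preLie_apply, preLie_apply]
  refine Finset.sum_congr rfl fun B hB => ?_
  have h3 : B.card + Bᶜ.card = N := by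
    rw [Finset.card_add_card_compl B, Fintype.card_fin]
  have h4 := Finset.card_pos.2 (Finset.mem_filter.1 hB).2
  rw [ha _ (by omega), hb _ (by omega)]

theorem bch_mem {d : ℕ} {a b : Fam d} (ha : a ∈ cocycles d) (hb : b ∈ cocycles d) :
    bch d a b ∈ cocycles d := by
  have hS : ∀ n, ∑ m ∈ Finset.range n, bchTerm d a b m ∈ cocycles d := fun n =>
    Submodule.sum_mem _ fun m _ => bchTerm_mem ha hb m
  refine ⟨⟨fun k => ?_, fun N k h => ?_, fun N k σ => ?_⟩, LinearMap.mem_ker.2 (funext fun N => ?_)⟩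
  · rw [bch_apply ha hb le_rfl]; exact (hS 0).1.1 k
  · rw [bch_apply ha hb le_rfl] at h; exact (hS N).1.2.1 N k h
  · rw [bch_apply ha hb le_rfl]; exact (hS N).1.2.2 N k σ
  · have h0 := congrFun (LinearMap.mem_ker.1 (hS N).2) N
    rw [← h0, differential, bracket_apply, bracket_apply]
    simp only [Pi.sub_apply, Pi.smul_apply]
    rw [preLie_congr (N := N) (fun _ _ => rfl) fun M hM => bch_apply ha hb hM,
      preLie_congr (N := N) (fun M hM => bch_apply ha hb hM) fun _ _ => rfl]

/-! ### The exponentials of right multiplications -/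

/-- The component of arity `N`. -/
def SymFam.arity (d N : ℕ) : SymFam d →ₗ[ℝ] (∀ k, Gra d N k) := (LinearMap.proj N) ∘ₗ SymFam.val

theorem symFam_arityComplete (d : ℕ) : ArityComplete (SymFam.arity d) where
  sep _ hf := SymFam.ext (funext hf)
  glue g := by
    refine ⟨.mk (fun N => (g N).val N) ⟨(g 0).val_mem.1, (evSymm_iff _).2 fun N k σ => ?_⟩,
      fun N => rfl⟩
    exact (evSymm_iff _).1 (g N).val_mem.2 N k σ

/-- Cocycles as symmetric families. -/
def coSym {d : ℕ} : cocycles d →ₗ[ℝ] SymFam d where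
  toFun a := toSym a.2.1
  map_add' _ _ := rfl
  map_smul' _ _ := rfl

theorem raises_rightMul {d : ℕ} (g : SymFam d) (hg : VanishesTo 1 g.val) :
    SepFiltration.Raises (arityFilt (SymFam.arity d)) (rightMul d g) := by
  intro N f hf M hM
  change preLie d f.val g.val M = 0
  rcases N with _ | N
  · obtain rfl : M = 0 := by omega
    exact funext fun k => preLie_zero_arity _ _ k
  · exact VanishesTo.preLie (i := N) (j := 1) (fun M hM => hf M (by omega)) hg M (by omega)

/-- Right multiplication by a cocycle. -/
def coMul (d : ℕ) : cocycles d →ₗ[ℝ] Module.End ℝ (SymFam d) := rightMul d ∘ₗ coSym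

theorem coMul_injective (d : ℕ) : Function.Injective (coMul d) := fun _ _ h =>
  Subtype.ext (congrArg SymFam.val (rightMul_injective d h))

theorem raises_coMul {d : ℕ} (a : cocycles d) :
    SepFiltration.Raises (arityFilt (SymFam.arity d)) (coMul d a) :=
  raises_rightMul _ (cocycle_vanishesTo a.2)

/-- The bracket of cocycles. -/
def coBracket {d : ℕ} (a b : cocycles d) : cocycles d := ⟨_, bracket_mem_cocycles a.2 b.2⟩

theorem coMul_coBracket {d : ℕ} (a b : cocycles d) :
    coMul d (coBracket a b) = coMul d b * coMul d a - coMul d a * coMul d b :=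
  rightMul_bracket_zero a.2.1 b.2.1 (bracket_mem_cocycles a.2 b.2).1

theorem coe_dynkin {d : ℕ} (a b : cocycles d) (m : ℕ) :
    (dynkin coBracket a b m : cocycles d).1 = bchTerm d a b m :=
  map_dynkin coBracket _ (cocycles d).subtype (fun _ => True) (fun _ _ _ _ => trivial)
    (fun _ _ _ _ => rfl) trivial trivial m

theorem coMul_dynkin {d : ℕ} (a b : cocycles d) (m : ℕ) :
    coMul d (dynkin coBracket a b m) = dynkin (fun x y => y * x - x * y) (coMul d a) (coMul d b) m :=
  map_dynkin coBracket (fun x y => y * x - x * y) (coMul d) (fun _ => True) (fun _ _ _ _ => trivial)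
    (fun a b _ _ => coMul_coBracket a b) trivial trivial m

/-- The Baker-Campbell-Hausdorff product of cocycles. -/
def coBch {d : ℕ} (a b : cocycles d) : cocycles d := ⟨bch d a b, bch_mem a.2 b.2⟩

/-- The exponential of right multiplication by a cocycle. -/
def coExp {d : ℕ} (a : cocycles d) : SymFam d → SymFam d := expOn (symFam_arityComplete d) (coMul d a)

theorem isExp_coExp {d : ℕ} (a : cocycles d) :
    SepFiltration.IsExp (arityFilt (SymFam.arity d)) (coMul d a) (coExp a) :=
  isExp_expOn _ (raises_coMul a)

theorem coBch_sub_sum {d : ℕ} (a b : cocycles d) (N : ℕ) :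
    VanishesTo N (coBch a b - ∑ m ∈ Finset.range N, dynkin coBracket a b m : cocycles d).1 := by
  intro M hM
  change bch d a b M - (∑ m ∈ Finset.range N, dynkin coBracket a b m : cocycles d).1 M = 0
  rw [bch_apply a.2 b.2 hM, sub_eq_zero]
  have h1 : (∑ m ∈ Finset.range N, dynkin coBracket a b m : cocycles d).1
      = ∑ m ∈ Finset.range N, (dynkin coBracket a b m : cocycles d).1 :=
    map_sum (cocycles d).subtype _ _
  rw [h1]
  exact congrFun (Finset.sum_congr rfl fun m _ => (coe_dynkin a b m).symm) M

theorem coExp_coBch {d : ℕ} (a b : cocycles d) (f : SymFam d) :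
    coExp (coBch a b) f = coExp b (coExp a f) := by
  refine SepFiltration.IsExp.bch (symFam_arityComplete d).sepFiltration (raises_coMul a) (raises_coMul b)
    (raises_coMul (coBch a b)) (fun N f => ?_) (isExp_coExp a) (isExp_coExp b) (isExp_coExp _) f
  simp only [← coMul_dynkin]
  rw [← LinearMap.sum_apply, ← map_sum, ← LinearMap.sub_apply, ← map_sub]
  intro M hM
  have h := coBch_sub_sum a b N
  exact VanishesTo.preLie (i := 0) (fun M hM => by
    obtain rfl : M = 0 := by omega
    exact funext f.val_mem.1) h M (by omega)

theorem coExp_injective {d : ℕ} {a b : cocycles d} (h : ∀ f, coExp a f = coExp b f) : a = b := by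
  have h2 : SepFiltration.IsExp (arityFilt (SymFam.arity d)) (coMul d b) (coExp a) := by
    rw [funext h]; exact isExp_coExp b
  exact coMul_injective d (SepFiltration.IsExp.injective (symFam_arityComplete d).sepFiltration
    (raises_coMul a) (raises_coMul b) (isExp_coExp a) h2)

theorem coExp_zero {d : ℕ} (f : SymFam d) : coExp (0 : cocycles d) f = f := by
  have h := isExp_coExp (0 : cocycles d)
  rw [map_zero] at h
  exact SepFiltration.IsExp.zero (symFam_arityComplete d).sepFiltration h f

theorem coExp_neg {d : ℕ} (a : cocycles d) (f : SymFam d) : coExp a (coExp (-a) f) = f := by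
  have h := isExp_coExp (-a)
  rw [map_neg] at h
  exact SepFiltration.IsExp.neg (symFam_arityComplete d).sepFiltration (raises_coMul a) (isExp_coExp a) h f

theorem coBch_assoc {d : ℕ} (a b c : cocycles d) : coBch (coBch a b) c = coBch a (coBch b c) :=
  coExp_injective fun f => by simp only [coExp_coBch]

theorem coBch_zero_left {d : ℕ} (a : cocycles d) : coBch 0 a = a :=
  coExp_injective fun f => by rw [coExp_coBch, coExp_zero]

theorem coBch_neg_left {d : ℕ} (a : cocycles d) : coBch (-a) a = 0 :=
  coExp_injective fun f => by rw [coExp_coBch, coExp_neg, coExp_zero]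

/-! ### Coboundaries -/

theorem differential_arity {d : ℕ} {p : ℤ} {η η' : Fam d} (h0 : ∀ k, η 0 k = 0) (h0' : ∀ k, η' 0 k = 0)
    {N : ℕ} (h : η N = η' N) : differential d p η (N + 1) = differential d p η' (N + 1) := by
  have key : ∀ ζ : Fam d, (∀ k, ζ 0 k = 0) → ζ N = 0 → differential d p ζ (N + 1) = 0 := by
    intro ζ hζ0 hζ
    have e1 : preLie d (edgeGraph d) ζ (N + 1) = 0 := by
      funext K
      rw [preLie_apply]
      refine Finset.sum_eq_zero fun B _ => ?_
      rw [Finset.sum_eq_zero, smul_zero]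
      intro e _
      have h3 : B.card + Bᶜ.card = N + 1 := by
        rw [Finset.card_add_card_compl B, Fintype.card_fin]
      by_cases h2 : Bᶜ.card + 1 = 2
      · have hz : ζ B.card = 0 := by rw [show B.card = N by omega]; exact hζ
        rw [hz, Pi.zero_apply, map_zero]
      · rw [edgeGraph_of_ne (Or.inl h2), map_zero, LinearMap.zero_apply]
    have e2 : preLie d ζ (edgeGraph d) (N + 1) = 0 := by
      funext K
      rw [preLie_apply]
      refine Finset.sum_eq_zero fun B _ => ?_
      rw [Finset.sum_eq_zero, smul_zero]
      intro e _
      have h3 : B.card + Bᶜ.card = N + 1 := by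
        rw [Finset.card_add_card_compl B, Fintype.card_fin]
      by_cases h2 : B.card = 2
      · have hz : ζ (Bᶜ.card + 1) = 0 := by rw [show Bᶜ.card + 1 = N by omega]; exact hζ
        rw [hz, Pi.zero_apply, map_zero, LinearMap.zero_apply]
      · rw [edgeGraph_of_ne (Or.inl h2), map_zero]
    rw [differential, bracket_apply, Pi.sub_apply, Pi.smul_apply, e1, e2, smul_zero, sub_zero]
  have := key (η - η') (fun k => by rw [Pi.sub_apply, Pi.sub_apply, h0, h0', sub_zero])
    (by rw [Pi.sub_apply, h, sub_self])
  rw [map_sub, Pi.sub_apply, sub_eq_zero] at this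
  exact this

theorem mem_coboundaries_of_arity {d : ℕ} {c : Fam d}
    (h : ∀ N, ∃ g ∈ coboundaries d, g N = c N) : c ∈ coboundaries d := by
  choose g hg hgc using h
  choose η hη hηg using hg
  have h0 : ∀ N k, η N 0 k = 0 := fun N => (hη N).1
  refine ⟨fun N => η (N + 1) N, ⟨fun k => h0 1 k, fun N k h => (hη (N + 1)).2.1 N k h,
    fun N k σ => (hη (N + 1)).2.2 N k σ⟩, funext fun N => ?_⟩
  rw [← hgc, ← hηg]
  rcases N with _ | N
  · funext k
    rw [differential, bracket_apply, bracket_apply]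
    simp only [Pi.sub_apply, Pi.smul_apply, preLie_zero_arity]
  · exact differential_arity (η := fun N => η (N + 1) N) (η' := η (N + 1)) (fun k => h0 1 k)
      (h0 (N + 1)) rfl

theorem coBch_sub_mem {d : ℕ} {a a' b b' : cocycles d} (ha : a.1 - a'.1 ∈ coboundaries d)
    (hb : b.1 - b'.1 ∈ coboundaries d) : (coBch a b).1 - (coBch a' b').1 ∈ coboundaries d := by
  refine mem_coboundaries_of_arity fun N => ?_
  refine ⟨∑ m ∈ Finset.range N, (bchTerm d a b m - bchTerm d a' b' m),
    Submodule.sum_mem _ fun m _ => ?_, ?_⟩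
  · refine dynkin_sub_mem m _ fun l hl => ?_
    refine rightNested_sub_mem (bracket d 0 0) (cocycles d) (coboundaries d)
      (fun a ha b hb => bracket_mem_cocycles ha hb) (fun a ha b hb => ?_)
      (fun a ha b hb => bracket_coboundary ha hb) l fun z hz => ?_
    · rw [bracket_zero_swap]
      exact neg_mem (bracket_coboundary hb ha)
    · rcases hl z hz with rfl | rfl
      · exact ⟨a.2, a'.2, ha⟩
      · exact ⟨b.2, b'.2, hb⟩
  · change _ = bch d a b N - bch d a' b' N
    rw [bch_apply a.2 b.2 le_rfl, bch_apply a'.2 b'.2 le_rfl, ← Pi.sub_apply,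
      Finset.sum_sub_distrib]

theorem H0.mk_eq_iff {d : ℕ} (a b : cocycles d) : H0.mk a = H0.mk b ↔ a.1 - b.1 ∈ coboundaries d :=
  Submodule.Quotient.eq _

theorem H0.mk_surjective {d : ℕ} (g : H0 d) : ∃ a, H0.mk a = g := Submodule.Quotient.mk_surjective _ g

/-- The group structure on `H⁰` given by the Baker-Campbell-Hausdorff product. -/
@[reducible] def bchGroup (d : ℕ) : Group (H0 d) :=
  letI : Mul (H0 d) := ⟨Quotient.map₂ coBch fun a a' ha b b' hb =>
    Quotient.exact ((H0.mk_eq_iff _ _).2 (coBch_sub_mem ((H0.mk_eq_iff a a').1 (Quotient.sound ha))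
      ((H0.mk_eq_iff b b').1 (Quotient.sound hb))))⟩
  letI : Inv (H0 d) := ⟨fun g => -g⟩
  letI : One (H0 d) := ⟨0⟩
  Group.ofLeftAxioms
    (fun a b c => by
      obtain ⟨a, rfl⟩ := H0.mk_surjective a
      obtain ⟨b, rfl⟩ := H0.mk_surjective b
      obtain ⟨c, rfl⟩ := H0.mk_surjective c
      exact congrArg H0.mk (coBch_assoc a b c))
    (fun a => by
      obtain ⟨a, rfl⟩ := H0.mk_surjective a
      exact congrArg H0.mk (coBch_zero_left a))
    (fun a => by
      obtain ⟨a, rfl⟩ := H0.mk_surjective a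
      exact congrArg H0.mk (coBch_neg_left a))

theorem exists_bchGroup (d : ℕ) : ∃ _ : Group (H0 d),
    (∀ a b : cocycles d, H0.mk a * H0.mk b = H0.mk ⟨bch d a b, bch_mem a.2 b.2⟩) ∧
      (1 : H0 d) = 0 ∧ ∀ g : H0 d, g⁻¹ = -g :=
  ⟨bchGroup d, fun _ _ => rfl, rfl, fun _ => rfl⟩

theorem finite_bchTerm {d : ℕ} (a b : cocycles d) (N k : ℕ) :
    {m | bchTerm d a b m N k ≠ 0}.Finite := by
  refine (Finset.range N).finite_toSet.subset fun m hm => ?_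
  rw [Finset.mem_coe, Finset.mem_range]
  by_contra h'
  exact hm (congrFun (bchTerm_vanishesTo a.2 b.2 m N (by omega)) k)

/-! ### Multilinear operations -/
section multi
variable {W : Type*} [AddCommGroup W] [Module ℝ W]

/-- Linearity in each argument. -/
def IsMulti {N : ℕ} (T : (Fin N → W) → W) : Prop :=
  ∀ (w : Fin N → W) (i : Fin N), ∃ L : W →ₗ[ℝ] W, ∀ x, T (Function.update w i x) = L x

theorem IsMulti.exists_multilinearMap {N : ℕ} {T : (Fin N → W) → W} (h : IsMulti T) :
    ∃ F : MultilinearMap ℝ (fun _ : Fin N => W) W, ∀ w, F w = T w := by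
  refine ⟨⟨T, fun {_} w i x y => ?_, fun {_} w i c x => ?_⟩, fun w => rfl⟩
  · obtain ⟨L, hL⟩ := h w i
    have := hL (x + y)
    rw [map_add, ← hL, ← hL] at this
    convert this
  · obtain ⟨L, hL⟩ := h w i
    have := hL (c • x)
    rw [map_smul, ← hL] at this
    convert this

theorem IsMulti.of_multilinearMap {N : ℕ} {T : (Fin N → W) → W}
    (F : MultilinearMap ℝ (fun _ : Fin N => W) W) (h : ∀ w, T w = F w) : IsMulti T :=
  fun w i => ⟨F.toLinearMap w i, fun x => by rw [h]; rfl⟩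

theorem IsMulti.eq_zero {N : ℕ} {T : (Fin N → W) → W} (h : IsMulti T) {w : Fin N → W} {i : Fin N}
    (hw : w i = 0) : T w = 0 := by
  obtain ⟨L, hL⟩ := h w i
  have := hL (w i)
  rw [Function.update_eq_self, hw, map_zero] at this
  exact this

theorem IsMulti.add {N : ℕ} {S T : (Fin N → W) → W} (hS : IsMulti S) (hT : IsMulti T) :
    IsMulti (S + T) := by
  intro w i
  obtain ⟨L, hL⟩ := hS w i
  obtain ⟨L', hL'⟩ := hT w i
  exact ⟨L + L', fun x => by rw [Pi.add_apply, hL, hL']; rfl⟩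

theorem IsMulti.smul {N : ℕ} {T : (Fin N → W) → W} (r : ℝ) (hT : IsMulti T) : IsMulti (r • T) := by
  intro w i
  obtain ⟨L', hL'⟩ := hT w i
  exact ⟨r • L', fun x => by rw [Pi.smul_apply, hL']; rfl⟩

theorem IsMulti.zero {N : ℕ} : IsMulti (0 : (Fin N → W) → W) := fun _ _ => ⟨0, fun _ => rfl⟩

theorem IsMulti.sum {ι : Type*} {N : ℕ} (s : Finset ι) {T : ι → (Fin N → W) → W}
    (h : ∀ i ∈ s, IsMulti (T i)) : IsMulti (fun w => ∑ i ∈ s, T i w) := by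
  classical
  induction s using Finset.induction_on with
  | empty => exact IsMulti.zero
  | insert a s ha ih =>
    have := (h a (by simp)).add (ih fun i hi => h i (Finset.mem_insert_of_mem hi))
    convert this using 1
    funext w
    rw [Finset.sum_insert ha]; rfl

theorem IsMulti.cons {N : ℕ} {T : (Fin (N + 1) → W) → W} (hT : IsMulti T) (z : W) :
    IsMulti (fun w : Fin N → W => T (Fin.cons z w)) := by
  intro w i
  obtain ⟨L, hL⟩ := hT (Fin.cons z w) i.succ
  refine ⟨L, fun x => ?_⟩
  beta_reduce
  rw [← hL, Fin.cons_update]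

end multi

namespace GradedSpace
variable {W : Type*} [AddCommGroup W] [Module ℝ W] (G : GradedSpace W)

/-- The part of a given parity, as a linear map. -/
def componentL (e : ZMod 2) : W →ₗ[ℝ] W :=
  (1 / 2 : ℝ) • (LinearMap.id + (if e = 0 then (1 : ℝ) else -1) • G.par)

theorem componentL_apply (e : ZMod 2) (w : W) : G.componentL e w = G.component e w := rfl

theorem component_of_mem (e : ZMod 2) {k : ℤ} {w : W} (hw : w ∈ G.piece k) :
    G.component e w = if e = (k : ZMod 2) then w else 0 := by
  have h1 : ∀ e : ZMod 2, (if e = 0 then (1 : ℝ) else -1) = sg e := by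
    intro e; unfold sg; revert e; intro e
    have : e = 0 ∨ e = 1 := by revert e; decide
    rcases this with rfl | rfl <;> simp
  rw [component, G.par_apply k w hw, h1, ← sg_intCast, smul_smul, ← sg_add]
  split_ifs with h
  · rw [h, show ((k : ZMod 2) + k) = 0 by generalize (k : ZMod 2) = a; revert a; decide, sg_zero,
      one_smul, ← two_smul ℝ w, smul_smul]
    norm_num
  · rw [show e + (k : ZMod 2) = 1 by
      revert h; generalize (k : ZMod 2) = a; revert e a; decide]
    simp [sg]

theorem parts_update {N : ℕ} (e : Fin N → ZMod 2) (w : Fin N → W) (i : Fin N) (x : W) :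
    G.parts e (Function.update w i x) = Function.update (G.parts e w) i (G.component (e i) x) := by
  funext j
  by_cases h : j = i
  · subst h; simp [parts]
  · simp [parts, h]

end GradedSpace

theorem IsMulti.parts {W : Type*} [AddCommGroup W] [Module ℝ W] (G : GradedSpace W) {N : ℕ}
    {T : (Fin N → W) → W} (hT : IsMulti T) (e : Fin N → ZMod 2) : IsMulti (fun w => T (G.parts e w)) := by
  intro w i
  obtain ⟨L, hL⟩ := hT (G.parts e w) i
  exact ⟨L ∘ₗ G.componentL (e i), fun x => by
    beta_reduce
    rw [G.parts_update, hL, LinearMap.comp_apply, G.componentL_apply]⟩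

/-! ### Homogeneous elements -/

/-- A homogeneous element. -/
structure Homog {W : Type*} [AddCommGroup W] [Module ℝ W] (G : GradedSpace W) where
  val : W
  deg : ℤ
  mem : val ∈ G.piece deg

namespace Homog
variable {W : Type*} [AddCommGroup W] [Module ℝ W] {G : GradedSpace W}

/-- The parity. -/
def par (x : Homog G) : ZMod 2 := x.deg

end Homog

section eval
variable {W : Type*} [AddCommGroup W] [Module ℝ W] {G : GradedSpace W}

/-- The value on a list of arguments. -/
def lap (f : Cochain W) (l : List W) : W := f l.length l.get

/-- The value on a list of homogeneous arguments. -/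
def hap (f : Cochain W) (l : List (Homog G)) : W := lap f (l.map Homog.val)

theorem lap_ofFn (f : Cochain W) {N : ℕ} (w : Fin N → W) : lap f (List.ofFn w) = f N w :=
  apply_get_ofFn f w

theorem hap_ofFn (f : Cochain W) {N : ℕ} (w : Fin N → Homog G) :
    hap f (List.ofFn w) = f N fun i => (w i).val := by
  rw [hap, List.map_ofFn, lap_ofFn]; rfl

theorem lap_cons (f : Cochain W) (x : W) {N : ℕ} (w : Fin N → W) :
    lap f (x :: List.ofFn w) = f (N + 1) (Fin.cons x w) := by
  have : x :: List.ofFn w = List.ofFn (Fin.cons x w : Fin (N + 1) → W) := by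
    rw [List.ofFn_succ]; simp
  rw [this, lap_ofFn]

theorem isMulti_ext_zero {N : ℕ} {T : (Fin N → W) → W} (hT : IsMulti T)
    (h : ∀ w : Fin N → Homog G, T (fun i => (w i).val) = 0) : T = 0 := by
  classical
  have key : ∀ (s : Finset (Fin N)) (w : Fin N → W), (∀ i ∉ s, ∃ k, w i ∈ G.piece k) → T w = 0 := by
    intro s
    induction s using Finset.induction_on with
    | empty =>
      intro w hw
      choose k hk using fun i => hw i (Finset.notMem_empty i)
      exact h fun i => ⟨w i, k i, hk i⟩
    | insert a s ha ih =>
      intro w hw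
      obtain ⟨L, hL⟩ := hT w a
      have hL0 : ∀ k, G.piece k ≤ LinearMap.ker L := by
        intro k x hx
        rw [LinearMap.mem_ker, ← hL]
        refine ih _ fun i hi => ?_
        by_cases hia : i = a
        · subst hia; exact ⟨k, by simpa using hx⟩
        · rw [Function.update_of_ne hia]
          exact hw i (by simp [hia, hi])
      have : L = 0 := LinearMap.ker_eq_top.1 (eq_top_iff.2 (by
        rw [← G.iSup_eq_top]; exact iSup_le hL0))
      have h2 := hL (w a)
      rwa [Function.update_eq_self, this, LinearMap.zero_apply] at h2
  funext w
  exact key Finset.univ w fun i hi => absurd (Finset.mem_univ i) hi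

theorem cochain_ext {f g : Cochain W} (hf : ∀ N, IsMulti (f N)) (hg : ∀ N, IsMulti (g N))
    (h : ∀ l : List (Homog G), hap f l = hap g l) : f = g := by
  funext N
  have h0 : f N - g N = 0 := by
    have hm : IsMulti (f N - g N) := by
      have := (hf N).add ((hg N).smul (-1))
      rwa [neg_one_smul, ← sub_eq_add_neg] at this
    refine isMulti_ext_zero (G := G) hm fun w => ?_
    have := h (List.ofFn w)
    rw [hap_ofFn, hap_ofFn] at this
    rw [Pi.sub_apply, this, sub_self]
  exact sub_eq_zero.1 h0

theorem lap_cons_isLinear {f : Cochain W} (hf : ∀ N, IsMulti (f N)) (l : List W) :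
    ∃ L : W →ₗ[ℝ] W, ∀ x, lap f (x :: l) = L x := by
  obtain ⟨L, hL⟩ := hf (l.length + 1) (Fin.cons 0 l.get) 0
  refine ⟨L, fun x => ?_⟩
  rw [← hL, Fin.update_cons_zero]
  have := lap_cons f x l.get
  rw [List.ofFn_get] at this
  exact this

theorem lap_eq_zero {f : Cochain W} (hf : ∀ N, IsMulti (f N)) {l : List W} (h : (0 : W) ∈ l) :
    lap f l = 0 := by
  obtain ⟨i, hi⟩ := List.mem_iff_get.1 h
  exact (hf _).eq_zero hi

theorem sum_parts_eq {N : ℕ} (w : Fin N → Homog G) (Φ : (Fin N → ZMod 2) → (Fin N → W) → W)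
    (hΦ : ∀ e, IsMulti (Φ e)) : ∑ e : Fin N → ZMod 2, Φ e (G.parts e fun i => (w i).val)
      = Φ (fun i => (w i).par) (fun i => (w i).val) := by
  have h1 : ∀ (e : Fin N → ZMod 2) i, G.parts e (fun i => (w i).val) i
      = if e i = (w i).par then (w i).val else 0 := fun e i => G.component_of_mem _ (w i).mem
  rw [Finset.sum_eq_single (fun i => (w i).par)]
  · congr 1
    funext i
    rw [h1, if_pos rfl]
  · intro e _ he
    obtain ⟨i, hi⟩ := Function.ne_iff.1 he
    exact (hΦ e).eq_zero (i := i) (by rw [h1, if_neg hi])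
  · simp

theorem IsMulti.preLieTerm {f g : Cochain W} (hf : ∀ N, IsMulti (f N)) (hg : ∀ N, IsMulti (g N))
    {N : ℕ} (B : Finset (Fin N)) : IsMulti (fun w : Fin N → W => f (Bᶜ.card + 1)
      (Fin.cons (g B.card (w ∘ B.orderEmbOfFin rfl)) (w ∘ Bᶜ.orderEmbOfFin rfl))) := by
  intro w i
  by_cases hi : i ∈ B
  · obtain ⟨j, rfl⟩ : ∃ j, B.orderEmbOfFin rfl j = i := by
      have : i ∈ Set.range (B.orderEmbOfFin rfl) := by rw [Finset.range_orderEmbOfFin]; exact hi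
      exact this
    obtain ⟨L, hL⟩ := hg B.card (w ∘ B.orderEmbOfFin rfl) j
    obtain ⟨L', hL'⟩ := hf _ (Fin.cons 0 (w ∘ Bᶜ.orderEmbOfFin rfl)) 0
    refine ⟨L' ∘ₗ L, fun x => ?_⟩
    beta_reduce
    rw [LinearMap.comp_apply, ← hL, ← hL', Fin.update_cons_zero,
      Function.update_comp_eq_of_injective _ (B.orderEmbOfFin rfl).injective,
      Function.update_comp_eq_of_notMem_range]
    rw [Finset.range_orderEmbOfFin]; simpa using hi
  · obtain ⟨j, rfl⟩ : ∃ j, Bᶜ.orderEmbOfFin rfl j = i := by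
      have : i ∈ Set.range (Bᶜ.orderEmbOfFin rfl) := by rw [Finset.range_orderEmbOfFin]; simpa using hi
      exact this
    obtain ⟨L', hL'⟩ := hf _ (Fin.cons (g B.card (w ∘ B.orderEmbOfFin rfl))
      (w ∘ Bᶜ.orderEmbOfFin rfl)) j.succ
    refine ⟨L', fun x => ?_⟩
    beta_reduce
    rw [← hL', ← Fin.cons_update,
      Function.update_comp_eq_of_injective _ (Bᶜ.orderEmbOfFin rfl).injective,
      Function.update_comp_eq_of_notMem_range]
    rw [Finset.range_orderEmbOfFin]; simpa using hi

theorem isMulti_preLie {f g : Cochain W} (hf : ∀ N, IsMulti (f N)) (hg : ∀ N, IsMulti (g N)) (N : ℕ) :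
    IsMulti (Cochain.preLie G f g N) :=
  IsMulti.sum _ fun e _ => IsMulti.sum _ fun B _ =>
    (((IsMulti.preLieTerm hf hg B).parts G e).smul (koszul (blockOf B) e))

/-- The Nijenhuis-Richardson product on lists of homogeneous elements. -/
theorem hap_preLie {f g : Cochain W} (hf : ∀ N, IsMulti (f N)) (hg : ∀ N, IsMulti (g N))
    (hg0 : ∀ w, g 0 w = 0) (l : List (Homog G)) : hap (Cochain.preLie G f g) l
      = Sh Homog.par l (fun p q => lap f (hap g p :: q.map Homog.val)) := by
  rw [← List.ofFn_get l]
  generalize l.get = w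
  generalize l.length = N at w
  rw [hap_ofFn, ← sum_subset]
  refine (sum_parts_eq w (fun e v => ∑ B : Finset (Fin N) with B.Nonempty,
    koszul (blockOf B) e • f (Bᶜ.card + 1) (Fin.cons (g B.card (v ∘ B.orderEmbOfFin rfl))
        (v ∘ Bᶜ.orderEmbOfFin rfl))) fun e => IsMulti.sum _ fun B _ =>
        (IsMulti.preLieTerm hf hg B).smul _).trans ?_
  rw [Finset.sum_filter]
  refine Finset.sum_congr rfl fun B _ => ?_
  have h1 : hap g (blk (· ∈ B) w) = g B.card ((fun i => (w i).val) ∘ B.orderEmbOfFin rfl) := by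
    rw [← ofFn_orderEmb, hap_ofFn]; rfl
  have h2 : (blk (· ∈ Bᶜ) w).map Homog.val
      = List.ofFn ((fun i => (w i).val) ∘ Bᶜ.orderEmbOfFin rfl) := by
    rw [← ofFn_orderEmb, List.map_ofFn]; rfl
  split_ifs with hB
  · rw [h1, h2, lap_cons]
  · rw [lap_eq_zero hf, smul_zero]
    rw [Finset.not_nonempty_iff_eq_empty.1 hB]
    have : blk (· ∈ (∅ : Finset (Fin N))) w = [] := by simp [blk]
    rw [this]
    exact List.mem_cons.2 (Or.inl (hg0 _).symm)

end eval

theorem Sh_mem {X : Type*} (π : X → ZMod 2) {M : Type*} [AddCommGroup M] [Module ℝ M]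
    (S : Submodule ℝ M) {l : List X} {F : List X → List X → M}
    (h : ∀ p q, (p ++ q).Perm l → F p q ∈ S) : Sh π l F ∈ S := by
  induction l generalizing F with
  | nil => exact h [] [] (List.Perm.refl _)
  | cons x l ih =>
    rw [Sh_cons]
    exact add_mem (ih fun p q hpq => h (x :: p) q (hpq.cons x))
      (ih fun p q hpq => S.smul_mem _ (h p (x :: q) (List.perm_middle.trans (hpq.cons x))))

section symm
variable {W : Type*} [AddCommGroup W] [Module ℝ W] {G : GradedSpace W}

/-- The value on a list of homogeneous elements, as a linear map. -/
def hapL (l : List (Homog G)) : Cochain W →ₗ[ℝ] W where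
  toFun f := hap f l
  map_add' _ _ := rfl
  map_smul' _ _ := rfl

theorem hap_add (f g : Cochain W) (l : List (Homog G)) : hap (f + g) l = hap f l + hap g l := rfl
theorem hap_sub (f g : Cochain W) (l : List (Homog G)) : hap (f - g) l = hap f l - hap g l := rfl
theorem hap_smul (r : ℝ) (f : Cochain W) (l : List (Homog G)) : hap (r • f) l = r • hap f l := rfl

/-- Graded symmetry, tested on lists. -/
def HapSymm (G : GradedSpace W) (f : Cochain W) : Prop :=
  ∀ (l₁ : List (Homog G)) (x y : Homog G) (l₂ : List (Homog G)),
    hap f (l₁ ++ x :: y :: l₂) = sg (x.par * y.par) • hap f (l₁ ++ y :: x :: l₂)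

/-- Operations of degree `q`. -/
def HasDeg (G : GradedSpace W) (q : ℤ) (f : Cochain W) : Prop :=
  ∀ l : List (Homog G), hap f l ∈ G.piece ((l.map Homog.deg).sum + q)

theorem lpar_homog (l : List (Homog G)) :
    lpar Homog.par l = (((l.map Homog.deg).sum : ℤ) : ZMod 2) := by
  induction l with
  | nil => simp
  | cons x l ih => rw [lpar_cons, ih, List.map_cons, List.sum_cons, Int.cast_add]; rfl

/-- The value of an operation of degree `q`, as a homogeneous element. -/
def Homog.app {q : ℤ} {f : Cochain W} (hf : HasDeg G q f) (l : List (Homog G)) : Homog G :=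
  ⟨hap f l, _, hf l⟩

theorem Homog.app_val {q : ℤ} {f : Cochain W} (hf : HasDeg G q f) (l : List (Homog G)) :
    (Homog.app hf l).val = hap f l := rfl

theorem Homog.app_par {q : ℤ} {f : Cochain W} (hf : HasDeg G q f) (l : List (Homog G)) :
    (Homog.app hf l).par = lpar Homog.par l + q := by
  rw [lpar_homog]; exact Int.cast_add _ _

theorem koszul_swap {N : ℕ} (σ : Equiv.Perm (Fin (N + 1))) (e : Fin (N + 1) → ZMod 2) (i : Fin N) :
    koszul (fun a => (((σ * Equiv.swap i.castSucc i.succ)⁻¹ : Equiv.Perm (Fin (N + 1))) a : Fin _)) e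
      = sg (e (σ i.castSucc) * e (σ i.succ)) * koszul (fun a => ((σ⁻¹ : Equiv.Perm _) a : Fin _)) e := by
  have hs : ∀ p : Fin (N + 1), (Equiv.swap i.castSucc i.succ p : ℕ)
      = if (p : ℕ) = i then (i : ℕ) + 1 else if (p : ℕ) = i + 1 then (i : ℕ) else p := by
    intro p
    rw [Equiv.swap_apply_def]
    simp only [Fin.ext_iff, Fin.val_castSucc, Fin.val_succ]
    split_ifs <;> simp
  set A := σ i.castSucc with hA
  set B := σ i.succ with hB
  have hAi : σ⁻¹ A = i.castSucc := by simp [hA]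
  have hBi : σ⁻¹ B = i.succ := by simp [hB]
  have hAB : A ≠ B := fun h => (Fin.castSucc_lt_succ (i := i)).ne (σ.injective h)
  have key : ∀ a b : Fin (N + 1),
      (if a < b ∧ (((σ * Equiv.swap i.castSucc i.succ)⁻¹ : Equiv.Perm (Fin (N + 1))) b : ℕ)
        < (((σ * Equiv.swap i.castSucc i.succ)⁻¹ : Equiv.Perm (Fin (N + 1))) a : ℕ) ∧ e a = 1 ∧ e b = 1
        then (-1 : ℝ) else 1)
      = (if a = min A B then (if b = max A B then sg (e A * e B) else 1) else 1) *
        (if a < b ∧ ((σ⁻¹ : Equiv.Perm _) b : ℕ) < ((σ⁻¹ : Equiv.Perm _) a : ℕ) ∧ e a = 1 ∧ e b = 1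
        then (-1 : ℝ) else 1) := by
    intro a b
    have e1 : ∀ a, ((σ * Equiv.swap i.castSucc i.succ)⁻¹ : Equiv.Perm (Fin (N + 1))) a
        = Equiv.swap i.castSucc i.succ (σ⁻¹ a) := by
      intro a; rw [mul_inv_rev, Equiv.swap_inv]; rfl
    rw [e1, e1, hs, hs]
    have ha1 : (σ⁻¹ a : ℕ) = i ↔ a = A := by
      rw [← Fin.val_castSucc i, ← Fin.ext_iff, ← hAi]; exact σ⁻¹.injective.eq_iff
    have ha2 : (σ⁻¹ a : ℕ) = i + 1 ↔ a = B := by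
      rw [← Fin.val_succ i, ← Fin.ext_iff, ← hBi]; exact σ⁻¹.injective.eq_iff
    have hb1 : (σ⁻¹ b : ℕ) = i ↔ b = A := by
      rw [← Fin.val_castSucc i, ← Fin.ext_iff, ← hAi]; exact σ⁻¹.injective.eq_iff
    have hb2 : (σ⁻¹ b : ℕ) = i + 1 ↔ b = B := by
      rw [← Fin.val_succ i, ← Fin.ext_iff, ← hBi]; exact σ⁻¹.injective.eq_iff
    have hab : (σ⁻¹ a : ℕ) = σ⁻¹ b ↔ a = b := by
      rw [← Fin.ext_iff]; exact σ⁻¹.injective.eq_iff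
    have hsg : sg (e A * e B) = if e A = 1 ∧ e B = 1 then -1 else 1 := by
      unfold sg
      congr 1
      generalize e A = u; generalize e B = v
      revert u v; decide
    rw [hsg]
    by_cases hc : (a = A ∧ b = B) ∨ (a = B ∧ b = A)
    · rcases hc with ⟨rfl, rfl⟩ | ⟨rfl, rfl⟩
      · rcases lt_or_gt_of_ne hAB with h | h
        · rw [min_eq_left h.le, max_eq_right h.le, hAi, hBi]
          simp [h]
        · rw [min_eq_right h.le, max_eq_left h.le]
          simp [h.not_gt, hAB]
      · rcases lt_or_gt_of_ne hAB with h | h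
        · rw [min_eq_left h.le, max_eq_right h.le]
          simp [h.not_gt, hAB.symm]
        · rw [min_eq_right h.le, max_eq_left h.le, hAi, hBi]
          have : (e B = 1 ∧ e A = 1) ↔ (e A = 1 ∧ e B = 1) := and_comm
          simp only [h, true_and, if_true, Fin.val_castSucc, Fin.val_succ]
          simp only [this]
          by_cases hh : e A = 1 ∧ e B = 1 <;> simp [hh]
    · have h1 : (if a = min A B then (if b = max A B then (if e A = 1 ∧ e B = 1 then (-1 : ℝ) else 1)
          else 1) else 1) = 1 := by
        rcases lt_or_gt_of_ne hAB with h | h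
        · rw [min_eq_left h.le, max_eq_right h.le]
          split_ifs <;> first | rfl | (exfalso; tauto)
        · rw [min_eq_right h.le, max_eq_left h.le]
          split_ifs <;> first | rfl | (exfalso; tauto)
      rw [h1, one_mul]
      have h2 : a < b → (((if (σ⁻¹ b : ℕ) = i then (i : ℕ) + 1 else if (σ⁻¹ b : ℕ) = i + 1 then (i : ℕ)
          else σ⁻¹ b) < (if (σ⁻¹ a : ℕ) = i then (i : ℕ) + 1 else if (σ⁻¹ a : ℕ) = i + 1 then (i : ℕ)
          else σ⁻¹ a)) ↔ (σ⁻¹ b : ℕ) < σ⁻¹ a) := by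
        intro hlt
        have hne : (σ⁻¹ a : ℕ) ≠ σ⁻¹ b := fun h => hlt.ne (hab.1 h)
        have n1 : ¬((σ⁻¹ a : ℕ) = i ∧ (σ⁻¹ b : ℕ) = i + 1) := fun h => hc (Or.inl ⟨ha1.1 h.1, hb2.1 h.2⟩)
        have n2 : ¬((σ⁻¹ a : ℕ) = i + 1 ∧ (σ⁻¹ b : ℕ) = i) := fun h => hc (Or.inr ⟨ha2.1 h.1, hb1.1 h.2⟩)
        generalize (σ⁻¹ a : ℕ) = x at *
        generalize (σ⁻¹ b : ℕ) = y at *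
        split_ifs <;> omega
      by_cases hlt : a < b
      · simp only [hlt, true_and, h2 hlt]
      · simp [hlt]
  unfold koszul
  simp only [key, Finset.prod_mul_distrib]
  congr 1
  rw [Finset.prod_eq_single (min A B), Finset.prod_eq_single (max A B)]
  · simp
  · intro b _ hb; simp [hb]
  · simp
  · intro a _ ha; simp [ha]
  · simp

theorem koszul_one {N : ℕ} (e : Fin N → ZMod 2) :
    koszul (fun a => (((1 : Equiv.Perm (Fin N))⁻¹) a : Fin N)) e = 1 := by
  refine Finset.prod_eq_one fun a _ => Finset.prod_eq_one fun b _ => if_neg ?_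
  rintro ⟨h, h', -⟩
  simp only [inv_one, Equiv.Perm.coe_one, id_eq] at h'
  exact absurd h' (not_lt.2 (le_of_lt h))

theorem HapSymm.apply_perm {f : Cochain W} (hf : HapSymm G f) {N : ℕ} (σ : Equiv.Perm (Fin N))
    (w : Fin N → Homog G) : f N (fun i => (w (σ i)).val)
      = koszul (fun i => (σ⁻¹ i : Fin N)) (fun i => (w i).par) • f N fun i => (w i).val := by
  cases N with
  | zero =>
    rw [Subsingleton.elim σ 1, koszul_one, one_smul]; rfl
  | succ N =>
    have hσ : σ ∈ Submonoid.closure (Set.range fun i : Fin N => Equiv.swap i.castSucc i.succ) := by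
      rw [Equiv.Perm.mclosure_swap_castSucc_succ]; trivial
    induction hσ using Submonoid.closure_induction_right with
    | one => rw [koszul_one, one_smul]; rfl
    | mul_right σ _ s hs ih =>
      obtain ⟨i, rfl⟩ := hs
      obtain ⟨l₁, l₂, h1, h2⟩ := ofFn_comp_swap (w ∘ σ) i
      have h3 := hf l₁ (w (σ i.succ)) (w (σ i.castSucc)) l₂
      have h4 : hap f (List.ofFn ((w ∘ σ) ∘ Equiv.swap i.castSucc i.succ))
          = sg ((w (σ i.succ)).par * (w (σ i.castSucc)).par) • hap f (List.ofFn (w ∘ σ)) := by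
        rw [h1, h2]; exact h3
      rw [hap_ofFn, hap_ofFn] at h4
      refine h4.trans ?_
      rw [koszul_swap, mul_smul, mul_comm (w (σ i.succ)).par]
      exact congrArg _ ih

theorem isCochain_iff {q : ℤ} {f : Cochain W} : Cochain.IsCochain G q f ↔
    (∀ N, IsMulti (f N)) ∧ (∀ w, f 0 w = 0) ∧ HapSymm G f ∧ HasDeg G q f := by
  constructor
  · intro h
    refine ⟨fun N => ?_, h.zero_arity, ?_, ?_⟩
    · obtain ⟨F, hF⟩ := h.multilinear N
      exact IsMulti.of_multilinearMap F fun w => (hF w).symm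
    · intro l₁ x y l₂
      obtain ⟨N, w, i, hx, hy, h1, h2⟩ := exists_ofFn_swap l₁ y x l₂
      rw [← h1, ← h2, hap_ofFn, hap_ofFn]
      have h3 := h.symmetric (N + 1) (Equiv.swap i.castSucc i.succ) (fun j => (w j).deg)
        (fun j => (w j).val) fun j => (w j).mem
      refine h3.trans ?_
      have h4 := koszul_swap 1 (fun j => (((w j).deg : ℤ) : ZMod 2)) i
      rw [koszul_one, mul_one, one_mul] at h4
      rw [h4]
      congr 2
      change (w i.castSucc).par * (w i.succ).par = _
      rw [hx, hy, mul_comm]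
    · intro l
      have := h.degree l.length (fun i => (l.get i).deg) (fun i => (l.get i).val) fun i => (l.get i).mem
      rw [← List.ofFn_get l, hap_ofFn, List.map_ofFn, List.sum_ofFn]
      exact this
  · rintro ⟨h1, h2, h3, h4⟩
    refine ⟨fun N => (h1 N).exists_multilinearMap, h2, fun N σ p w hw => ?_, fun N p w hw => ?_⟩
    · exact h3.apply_perm σ fun i => ⟨w i, p i, hw i⟩
    · have := h4 (List.ofFn fun i => (⟨w i, p i, hw i⟩ : Homog G))
      rwa [hap_ofFn, List.map_ofFn, List.sum_ofFn] at this

theorem HapSymm.add {f g : Cochain W} (hf : HapSymm G f) (hg : HapSymm G g) : HapSymm G (f + g) := by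
  intro l₁ x y l₂
  rw [hap_add, hap_add, hf, hg, smul_add]

theorem HapSymm.smul {f : Cochain W} (r : ℝ) (hf : HapSymm G f) : HapSymm G (r • f) := by
  intro l₁ x y l₂
  rw [hap_smul, hap_smul, hf, smul_comm]

theorem HapSymm.zero : HapSymm G (0 : Cochain W) := fun _ _ _ _ => (smul_zero _).symm

theorem HasDeg.add {q : ℤ} {f g : Cochain W} (hf : HasDeg G q f) (hg : HasDeg G q g) :
    HasDeg G q (f + g) := fun l => add_mem (hf l) (hg l)

theorem HasDeg.smul {q : ℤ} {f : Cochain W} (r : ℝ) (hf : HasDeg G q f) :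
    HasDeg G q (r • f) := fun l => Submodule.smul_mem _ _ (hf l)

theorem HasDeg.zero {q : ℤ} : HasDeg G q (0 : Cochain W) := fun _ => Submodule.zero_mem _

/-- Taylor coefficients of coderivations of degree `q`. -/
structure IsCoder (G : GradedSpace W) (q : ℤ) (D : Cochain W) : Prop where
  multi : ∀ N, IsMulti (D N)
  zero_arity : ∀ w, D 0 w = 0
  symm : HapSymm G D
  deg : HasDeg G q D

theorem isCoder_iff {q : ℤ} {f : Cochain W} : Cochain.IsCochain G q f ↔ IsCoder G q f :=
  isCochain_iff.trans ⟨fun h => ⟨h.1, h.2.1, h.2.2.1, h.2.2.2⟩, fun h => ⟨h.1, h.2, h.3, h.4⟩⟩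

theorem IsCoder.add {q : ℤ} {f g : Cochain W} (hf : IsCoder G q f) (hg : IsCoder G q g) :
    IsCoder G q (f + g) :=
  ⟨fun N => (hf.multi N).add (hg.multi N), fun w => by rw [Pi.add_apply, Pi.add_apply, hf.zero_arity,
    hg.zero_arity, add_zero], hf.symm.add hg.symm, hf.deg.add hg.deg⟩

theorem IsCoder.smul {q : ℤ} {f : Cochain W} (r : ℝ) (hf : IsCoder G q f) :
    IsCoder G q (r • f) :=
  ⟨fun N => (hf.multi N).smul r, fun w => by rw [Pi.smul_apply, Pi.smul_apply, hf.zero_arity,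
    smul_zero], hf.symm.smul r, hf.deg.smul r⟩

theorem IsCoder.zero {q : ℤ} : IsCoder G q (0 : Cochain W) :=
  ⟨fun _ => IsMulti.zero, fun _ => rfl, HapSymm.zero, HasDeg.zero⟩

theorem IsCoder.hap_nil {q : ℤ} {D : Cochain W} (hD : IsCoder G q D) : hap D ([] : List (Homog G)) = 0 :=
  hD.zero_arity _

theorem IsCoder.hap_preLie {q : ℤ} {f D : Cochain W} (hD : IsCoder G q D) (hf : ∀ N, IsMulti (f N))
    (l : List (Homog G)) : hap (Cochain.preLie G f D) l
      = Sh Homog.par l (fun a b => hap f (Homog.app hD.deg a :: b)) :=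
  GraphCx.hap_preLie hf hD.multi hD.zero_arity l

theorem preLie_zero_arity' (f g : Cochain W) (w : Fin 0 → W) : Cochain.preLie G f g 0 w = 0 := by
  refine Finset.sum_eq_zero fun e _ => ?_
  rw [Finset.filter_false_of_mem, Finset.sum_empty]
  rintro B _ ⟨i, _⟩
  exact i.elim0

theorem IsCoder.symm_preLie {q : ℤ} {f D : Cochain W} (hD : IsCoder G q D)
    (hf : ∀ N, IsMulti (f N)) (hs : HapSymm G f) : HapSymm G (Cochain.preLie G f D) := by
  intro l₁ x y l₂
  rw [hD.hap_preLie hf, hD.hap_preLie hf]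
  refine Sh_swap _ _ (fun l₁ x y l₂ q => ?_) (fun p l₁ x y l₂ => hs (_ :: l₁) x y l₂) l₁ x y l₂
  obtain ⟨L, hL⟩ := lap_cons_isLinear hf (q.map Homog.val)
  have h : ∀ z : Homog G, hap f (z :: q) = L z.val := fun z => hL z.val
  rw [h, h, Homog.app_val, Homog.app_val, hD.symm, map_smul]

theorem IsCoder.deg_preLie {p q : ℤ} {f D : Cochain W} (hD : IsCoder G q D)
    (hf : ∀ N, IsMulti (f N)) (hd : HasDeg G p f) : HasDeg G (p + q) (Cochain.preLie G f D) := by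
  intro l
  rw [hD.hap_preLie hf]
  refine Sh_mem _ _ fun a b hab => ?_
  have h1 : ((Homog.app hD.deg a :: b).map Homog.deg).sum + p = (l.map Homog.deg).sum + (p + q) := by
    rw [← (hab.map Homog.deg).sum_eq, List.map_append, List.sum_append, List.map_cons, List.sum_cons]
    change (a.map Homog.deg).sum + q + _ + p = _
    ring
  rw [← h1]
  exact hd _

theorem IsCoder.preLie {p q : ℤ} {f D : Cochain W} (hf : IsCoder G p f) (hD : IsCoder G q D) :
    IsCoder G (p + q) (Cochain.preLie G f D) :=
  ⟨isMulti_preLie hf.multi hD.multi, preLie_zero_arity' f D, hD.symm_preLie hf.multi hf.symm,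
    hD.deg_preLie hf.multi hf.deg⟩

theorem IsCoder.hap_preLie_cons {q : ℤ} {f D : Cochain W} (hD : IsCoder G q D)
    (hf : ∀ N, IsMulti (f N)) (x : Homog G) (l : List (Homog G)) :
    hap (Cochain.preLie G f D) (x :: l)
      = Sh Homog.par l (fun a b => hap f (Homog.app hD.deg (x :: a) :: b)) +
        Sh Homog.par l (fun a b => sg (x.par * lpar Homog.par a) • hap f (Homog.app hD.deg a :: x :: b)) := by
  rw [hD.hap_preLie hf, Sh_cons]

/-- `(f ∘ D) ∘ E` minus `f ∘ (D ∘ E)`. -/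
def nestTwo {d e : ℤ} (f : Cochain W) {D E : Cochain W} (hD : HasDeg G d D) (hE : HasDeg G e E)
    (l : List (Homog G)) : W :=
  Sh Homog.par l fun p m => Sh Homog.par m fun a b =>
    sg ((lpar Homog.par p + e) * lpar Homog.par a) • hap f (Homog.app hD a :: Homog.app hE p :: b)

theorem hap_preLie_preLie {d e : ℤ} {f D E : Cochain W} (hf : ∀ N, IsMulti (f N))
    (hD : IsCoder G d D) (hE : IsCoder G e E) (l : List (Homog G)) :
    hap (Cochain.preLie G (Cochain.preLie G f D) E) l
      = hap (Cochain.preLie G f (Cochain.preLie G D E)) l + nestTwo f hD.deg hE.deg l := by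
  rw [hE.hap_preLie (isMulti_preLie hf hD.multi), (hD.preLie hE).hap_preLie hf, nestTwo]
  have h1 : ∀ r b : List (Homog G), hap f (Homog.app (hD.preLie hE).deg r :: b)
      = Sh Homog.par r fun p a => hap f (Homog.app hD.deg (Homog.app hE.deg p :: a) :: b) := by
    intro r b
    obtain ⟨L, hL⟩ := lap_cons_isLinear hf (b.map Homog.val)
    have h : ∀ z : Homog G, hap f (z :: b) = L z.val := fun z => hL z.val
    rw [h, Homog.app_val, hE.hap_preLie hD.multi, Sh_map]
    refine Sh_congr' _ fun p a => ?_
    rw [h, Homog.app_val]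
  rw [Sh_congr' _ h1, Sh_assoc, ← Sh_add]
  refine Sh_congr' _ fun p m => ?_
  rw [hD.hap_preLie_cons hf, Homog.app_par]

theorem nestTwo_comm {d e : ℤ} {f D E : Cochain W} (hs : HapSymm G f)
    (hD : HasDeg G d D) (hE : HasDeg G e E) (l : List (Homog G)) :
    nestTwo f hE hD l = sg ((d : ZMod 2) * e) • nestTwo f hD hE l := by
  rw [nestTwo, nestTwo, ← Sh_smul, ← Sh_assoc _ l fun p a b =>
    sg ((lpar Homog.par p + d) * lpar Homog.par a) • hap f (Homog.app hE a :: Homog.app hD p :: b)]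
  have h1 := fun r b : List (Homog G) => Sh_comm Homog.par r fun p a =>
    sg ((lpar Homog.par p + d) * lpar Homog.par a) • hap f (Homog.app hE a :: Homog.app hD p :: b)
  rw [Sh_congr' _ h1, Sh_assoc]
  refine Sh_congr' _ fun p m => ?_
  rw [← Sh_smul]
  refine Sh_congr' _ fun a b => ?_
  have h3 := hs [] (Homog.app hE p) (Homog.app hD a) b
  rw [List.nil_append, List.nil_append, Homog.app_par, Homog.app_par] at h3
  rw [h3, smul_smul, smul_smul, smul_smul]
  congr 1
  simp only [← sg_add]
  generalize lpar Homog.par a = A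
  generalize lpar Homog.par p = P
  generalize (d : ZMod 2) = D
  generalize (e : ZMod 2) = E
  congr 1; revert A P D E; decide

/-- The graded commutator. -/
theorem coder_identity {d e : ℤ} {f D E : Cochain W} (hf : ∀ N, IsMulti (f N)) (hs : HapSymm G f)
    (hD : IsCoder G d D) (hE : IsCoder G e E) (l : List (Homog G)) :
    hap (Cochain.preLie G (Cochain.preLie G f D) E) l
      - sg ((d : ZMod 2) * e) • hap (Cochain.preLie G (Cochain.preLie G f E) D) l
    = hap (Cochain.preLie G f (Cochain.preLie G D E)) l
      - sg ((d : ZMod 2) * e) • hap (Cochain.preLie G f (Cochain.preLie G E D)) l := by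
  rw [hap_preLie_preLie hf hD hE, hap_preLie_preLie hf hE hD, nestTwo_comm hs hD.deg hE.deg, smul_add,
    smul_smul, sg_mul_self, one_smul]
  abel

end symm

section shuffle
variable {X : Type*} (π : X → ZMod 2) {M : Type*} [AddCommGroup M] [Module ℝ M]

theorem Sh_exchange (l : List X) (H : List X → List X → List X → M) :
    Sh π l (fun p m => Sh π m fun r s => sg (lpar π p * lpar π r) • H r p s)
      = Sh π l (fun r m => Sh π m fun p s => H r p s) := by
  rw [← Sh_assoc π l H, ← Sh_assoc π l fun p r s => sg (lpar π p * lpar π r) • H r p s]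
  exact Sh_congr' π fun u s => (Sh_comm π u fun r p => H r p s).symm

theorem Sh_left_nil (l : List X) (F : List X → List X → M) (h : ∀ x p q, F (x :: p) q = 0) :
    Sh π l F = F [] l := by
  rw [Sh_comm, Sh_right_nil _ _ _ fun p x q => by rw [h, smul_zero]]
  simp

theorem Shk_star (k : ℕ) (x : X) (l : List X) (F : List (List X) → M)
    (hF : ∀ L₁ p q L₂, F (L₁ ++ p :: q :: L₂) = sg (lpar π p * lpar π q) • F (L₁ ++ q :: p :: L₂)) :
    Shk π (k + 1) (x :: l) F
      = ((k : ℝ) + 1) • Sh π l (fun p q => Shk π k q fun L => F ((x :: p) :: L)) := by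
  induction k generalizing x l F with
  | zero =>
    rw [Shk_succ, Sh_cons]
    simp [Shk, Sh_zero]
  | succ k ih =>
    rw [Shk_succ, Sh_cons, Nat.cast_succ, add_comm ((k : ℝ) + 1) 1, add_smul, one_smul]
    congr 1
    have h1 : ∀ p q : List X, sg (π x * lpar π p) • Shk π (k + 1) (x :: q) (fun L => F (p :: L))
        = Sh π q fun r s => sg (lpar π p * lpar π r) • ((k : ℝ) + 1) •
          Shk π k s fun L => F ((x :: r) :: p :: L) := by
      intro p q
      rw [ih x q (fun L => F (p :: L)) fun L₁ a b L₂ => hF (p :: L₁) a b L₂, ← Sh_smul, ← Sh_smul]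
      refine Sh_congr' π fun r s => ?_
      have h2 : (fun L => F (p :: (x :: r) :: L)) = fun L => sg (lpar π p * lpar π (x :: r)) •
          F ((x :: r) :: p :: L) := funext fun L => hF [] p (x :: r) L
      rw [h2, Shk_smul, smul_comm ((k : ℝ) + 1), smul_smul, ← sg_add, lpar_cons]
      congr 2
      generalize π x = a; generalize lpar π p = b; generalize lpar π r = c
      revert a b c; decide
    rw [Sh_congr' π h1, Sh_exchange π l fun r p s => ((k : ℝ) + 1) •
          Shk π k s fun L => F ((x :: r) :: p :: L), ← Sh_smul]
    refine Sh_congr' π fun r m => ?_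
    rw [Shk_succ, Sh_smul]

theorem Shk_zero (k : ℕ) (l : List X) : Shk π k l (fun _ => (0 : M)) = 0 := by
  have := Shk_smul π 0 k l (fun _ => (0 : M)); simpa using this

theorem Shk_eq_zero {k : ℕ} {l : List X} (hk : l.length < k) (F : List (List X) → M)
    (hF : ∀ L, [] ∈ L → F L = 0) : Shk π k l F = 0 := by
  induction k generalizing l F with
  | zero => omega
  | succ k ih =>
    rw [Shk_succ, ← Sh_zero π l (M := M)]
    refine Sh_congr π fun p q hpq => ?_
    cases p with
    | nil =>
      have : (fun L : List (List X) => F ([] :: L)) = fun _ => 0 := funext fun L => hF _ (by simp)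
      rw [this, Shk_zero]
    | cons y p =>
      have h := hpq.length_eq
      simp only [List.cons_append, List.length_cons, List.length_append] at h
      exact ih (by omega) _ fun L hL => hF _ (List.mem_cons_of_mem _ hL)

end shuffle

section comp
variable {W : Type*} [AddCommGroup W] [Module ℝ W] {G : GradedSpace W}

theorem IsMulti.compTerm {f u : Cochain W} (hf : ∀ N, IsMulti (f N)) (hu : ∀ N, IsMulti (u N))
    {N k : ℕ} (c : Fin N → Fin k) : IsMulti (fun w : Fin N → W => f k (fun i =>
        u (Finset.univ.filter fun a => c a = i).card
          (w ∘ (Finset.univ.filter fun a => c a = i).orderEmbOfFin rfl))) := by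
  intro w a
  obtain ⟨j, hj⟩ : ∃ j, (Finset.univ.filter fun b => c b = c a).orderEmbOfFin rfl j = a := by
    have : a ∈ Set.range ((Finset.univ.filter fun b => c b = c a).orderEmbOfFin rfl) := by
      rw [Finset.range_orderEmbOfFin]; simp
    exact this
  obtain ⟨L, hL⟩ := hu _ (w ∘ (Finset.univ.filter fun b => c b = c a).orderEmbOfFin rfl) j
  obtain ⟨L', hL'⟩ := hf k (fun i =>
        u (Finset.univ.filter fun a => c a = i).card
          (w ∘ (Finset.univ.filter fun a => c a = i).orderEmbOfFin rfl)) (c a)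
  refine ⟨L' ∘ₗ L, fun x => ?_⟩
  beta_reduce
  rw [LinearMap.comp_apply, ← hL, ← hL']
  congr 1
  funext i
  by_cases hi : i = c a
  · subst hi
    rw [Function.update_self]
    have h2 := Function.update_comp_eq_of_injective w
      ((Finset.univ.filter fun b => c b = c a).orderEmbOfFin rfl).injective j x
    rw [hj] at h2
    exact congrArg _ h2
  · rw [Function.update_of_ne hi, Function.update_comp_eq_of_notMem_range]
    rw [Finset.range_orderEmbOfFin]
    simpa using fun h => hi h.symm

theorem isMulti_comp {f u : Cochain W} (hf : ∀ N, IsMulti (f N)) (hu : ∀ N, IsMulti (u N)) (N : ℕ) :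
    IsMulti (Cochain.comp G f u N) :=
  IsMulti.sum _ fun e _ => IsMulti.sum _ fun k _ => IsMulti.sum _ fun c _ =>
    (((IsMulti.compTerm hf hu c).parts G e).smul _)

theorem hap_comp {f u : Cochain W} (hf : ∀ N, IsMulti (f N)) (hu : IsCoder G 0 u)
    (l : List (Homog G)) : hap (Cochain.comp G f u) l
      = ∑ k ∈ Finset.range (l.length + 1), ((k.factorial : ℝ)⁻¹) •
        Shk Homog.par k l fun L => hap f (L.map (Homog.app hu.deg)) := by
  obtain ⟨N, w, rfl⟩ : ∃ (N : ℕ) (w : Fin N → Homog G), l = List.ofFn w :=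
    ⟨_, l.get, (List.ofFn_get l).symm⟩
  rw [hap_ofFn, List.length_ofFn]
  refine (sum_parts_eq w (fun e v => ∑ k ∈ Finset.range (N + 1),
    ∑ c : Fin N → Fin k with Function.Surjective c,
      (koszul (fun a => (c a : ℕ)) e / (k.factorial : ℝ)) • f k (fun i =>
        u (Finset.univ.filter fun a => c a = i).card
          (v ∘ (Finset.univ.filter fun a => c a = i).orderEmbOfFin rfl))) fun e =>
    IsMulti.sum _ fun k _ => IsMulti.sum _ fun c _ => (IsMulti.compTerm hf hu.multi c).smul _).trans ?_
  refine Finset.sum_congr rfl fun k _ => ?_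
  rw [← sum_coloring, Finset.smul_sum, Finset.sum_filter]
  refine Finset.sum_congr rfl fun c _ => ?_
  have h1 : ∀ i, hap u (blk (c · = i) w) = u (Finset.univ.filter fun a => c a = i).card
      ((fun a => (w a).val) ∘ (Finset.univ.filter fun a => c a = i).orderEmbOfFin rfl) := by
    intro i
    have : blk (c · = i) w = blk (· ∈ Finset.univ.filter fun a => c a = i) w :=
      blk_congr (fun a => by simp) w
    rw [this, ← ofFn_orderEmb, hap_ofFn]; rfl
  have h2 : hap f ((List.ofFn fun i => blk (c · = i) w).map (Homog.app hu.deg))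
      = f k fun i => hap u (blk (c · = i) w) := by
    rw [List.map_ofFn, hap_ofFn]; rfl
  simp only [h2, h1]
  rw [smul_smul, mul_comm]
  split_ifs with hc
  · rfl
  · obtain ⟨i, hi⟩ := not_forall.1 hc
    rw [(hf k).eq_zero (i := i), smul_zero]
    have he : (Finset.univ.filter fun a => c a = i) = ∅ := by
      rw [Finset.filter_eq_empty_iff]
      intro a _ h
      exact hi ⟨a, h⟩
    rw [← h1]
    have : blk (c · = i) w = [] := by
      rw [blk_congr (Q := (· ∈ (∅ : Finset (Fin N)))) (fun a => by rw [← he]; simp) w]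
      simp [blk]
    rw [this, hu.hap_nil]

/-- The operation with the first argument fixed. -/
def insertFirst {f : Cochain W} (hf : ∀ N, IsMulti (f N)) : W →ₗ[ℝ] Cochain W where
  toFun z N w := f (N + 1) (Fin.cons z w)
  map_add' a b := by
    funext N w
    obtain ⟨L, hL⟩ := hf (N + 1) (Fin.cons 0 w) 0
    have h : ∀ z, f (N + 1) (Fin.cons z w) = L z := fun z => by rw [← hL, Fin.update_cons_zero]
    simp only [Pi.add_apply, h, map_add]
  map_smul' r a := by
    funext N w
    obtain ⟨L, hL⟩ := hf (N + 1) (Fin.cons 0 w) 0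
    have h : ∀ z, f (N + 1) (Fin.cons z w) = L z := fun z => by rw [← hL, Fin.update_cons_zero]
    simp only [Pi.smul_apply, h, map_smul, RingHom.id_apply]

theorem insertFirst_multi {f : Cochain W} (hf : ∀ N, IsMulti (f N)) (z : W) (N : ℕ) :
    IsMulti (insertFirst hf z N) := (hf (N + 1)).cons z

theorem hap_insertFirst {f : Cochain W} (hf : ∀ N, IsMulti (f N)) (z : W) (l : List (Homog G)) :
    hap (insertFirst hf z) l = lap f (z :: l.map Homog.val) := by
  have := lap_cons f z (l.map Homog.val).get
  rw [List.ofFn_get] at this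
  exact this.symm

theorem insertFirst_symm {f : Cochain W} (hf : ∀ N, IsMulti (f N)) (hs : HapSymm G f) (z : Homog G) :
    HapSymm G (insertFirst hf z.val) := by
  intro l₁ x y l₂
  rw [hap_insertFirst, hap_insertFirst]
  exact hs (z :: l₁) x y l₂

theorem hap_comp_nil {f u : Cochain W} (hf : ∀ N, IsMulti (f N)) (hu : IsCoder G 0 u) :
    hap (Cochain.comp G f u) ([] : List (Homog G)) = hap f ([] : List (Homog G)) := by
  rw [hap_comp hf hu]
  simp [Shk]

theorem hap_comp_cons {f u : Cochain W} (hf : ∀ N, IsMulti (f N)) (hs : HapSymm G f)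
    (hu : IsCoder G 0 u) (x : Homog G) (l : List (Homog G)) :
    hap (Cochain.comp G f u) (x :: l)
      = Sh Homog.par l fun p q => hap (Cochain.comp G (insertFirst hf (hap u (x :: p))) u) q := by
  rw [hap_comp hf hu, Finset.sum_range_succ', List.length_cons]
  have h0 : Shk Homog.par 0 (x :: l) (fun L => hap f (L.map (Homog.app hu.deg))) = 0 := rfl
  rw [h0, smul_zero, add_zero]
  have h1 : ∀ k : ℕ, (((k + 1).factorial : ℝ)⁻¹) • Shk Homog.par (k + 1) (x :: l)
      (fun L => hap f (L.map (Homog.app hu.deg)))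
      = Sh Homog.par l fun p q => ((k.factorial : ℝ)⁻¹) • Shk Homog.par k q
        fun L => hap (insertFirst hf (hap u (x :: p))) (L.map (Homog.app hu.deg)) := by
    intro k
    rw [Shk_star, smul_smul, Sh_smul]
    · congr 1
      · rw [Nat.factorial_succ]; push_cast
        have : (k : ℝ) + 1 ≠ 0 := by positivity
        field_simp
      · refine Sh_congr' _ fun p q => ?_
        congr 1; funext L
        rw [hap_insertFirst]; rfl
    · intro L₁ p q L₂
      have := hs (L₁.map (Homog.app hu.deg)) (Homog.app hu.deg p) (Homog.app hu.deg q)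
        (L₂.map (Homog.app hu.deg))
      simpa [Homog.app_par] using this
  rw [Finset.sum_congr rfl fun k _ => h1 k, ← Sh_sum]
  refine Sh_congr _ fun p q hpq => ?_
  rw [hap_comp (insertFirst_multi hf _) hu]
  refine (Finset.sum_subset (Finset.range_subset_range.2 ?_) fun k _ hk => ?_).symm
  · have := hpq.length_eq
    simp only [List.length_append] at this
    omega
  · rw [Shk_eq_zero, smul_zero]
    · simp at hk; omega
    · intro L hL
      refine lap_eq_zero (insertFirst_multi hf _) ?_
      rw [List.mem_map]
      exact ⟨Homog.app hu.deg [], List.mem_map_of_mem hL, hu.hap_nil⟩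

end comp

section exp
variable {W : Type*} [AddCommGroup W] [Module ℝ W] (G : GradedSpace W)

/-- `f ↦ f ∘ D`. -/
def precompD (D : Cochain W) : Module.End ℝ (Cochain W) where
  toFun f := Cochain.preLie G f D
  map_add' f g := by
    funext N w
    simp only [Cochain.preLie, Pi.add_apply, smul_add, Finset.sum_add_distrib]
  map_smul' r f := by
    funext N w
    simp only [Cochain.preLie, Pi.smul_apply, Finset.smul_sum, smul_comm r, RingHom.id_apply]

variable {G}

theorem IsCoder.multi_pow {d : ℤ} {D : Cochain W} (hD : IsCoder G d D) {f : Cochain W} (hf : ∀ N, IsMulti (f N)) (k : ℕ) :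
    ∀ N, IsMulti ((precompD G D ^ k) f N) := by
  induction k with
  | zero => exact hf
  | succ k ih => rw [pow_succ']; exact isMulti_preLie ih hD.multi

theorem IsCoder.symm_pow {d : ℤ} {D : Cochain W} (hD : IsCoder G d D) {f : Cochain W} (hf : ∀ N, IsMulti (f N))
    (hs : HapSymm G f) (k : ℕ) : HapSymm G ((precompD G D ^ k) f) := by
  induction k with
  | zero => exact hs
  | succ k ih => rw [pow_succ']; exact hD.symm_preLie (hD.multi_pow hf k) ih

theorem raises_preLie {D f : Cochain W} (hf : ∀ N, IsMulti (f N)) (hD1 : D 1 = 0) {N : ℕ}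
    (h : ∀ M < N, f M = 0) : ∀ M < N + 1, Cochain.preLie G f D M = 0 := by
  intro M hM
  funext w
  refine Finset.sum_eq_zero fun e _ => Finset.sum_eq_zero fun B hB => ?_
  have hB' : 0 < B.card := Finset.card_pos.2 (Finset.mem_filter.1 hB).2
  have hc := Finset.card_add_card_compl B
  rw [Fintype.card_fin] at hc
  by_cases h1 : B.card = 1
  · have hz : D B.card = 0 := by rw [h1, hD1]
    rw [(hf _).eq_zero (i := 0), smul_zero]
    rw [Fin.cons_zero, hz]; rfl
  · rw [h _ (by omega)]; exact smul_zero _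

theorem raises_pow_preLie {d : ℤ} {D f : Cochain W} (hD : IsCoder G d D) (hf : ∀ N, IsMulti (f N)) (hD1 : D 1 = 0) {N : ℕ}
    (h : ∀ M < N, f M = 0) (k : ℕ) : ∀ M < N + k, (precompD G D ^ k) f M = 0 := by
  induction k with
  | zero => exact h
  | succ k ih =>
    rw [pow_succ']
    exact raises_preLie (hD.multi_pow hf k) hD1 ih

/-- The effect of a coderivation of even degree on functions of a nonempty list. -/
def coderOp {D : Cochain W} (hD : IsCoder G 0 D) :
    (Homog G → List (Homog G) → W) →ₗ[ℝ] (Homog G → List (Homog G) → W) where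
  toFun S x l := Sh Homog.par l (fun p q => S (Homog.app hD.deg (x :: p)) q)
    + Sh Homog.par l (fun a b => S x (Homog.app hD.deg a :: b))
  map_add' S T := by
    funext x l
    simp only [Pi.add_apply, Sh_add]; abel
  map_smul' r S := by
    funext x l
    simp only [Pi.smul_apply, Sh_smul, smul_add, RingHom.id_apply]

theorem hap_preLie_coderOp {D f : Cochain W} (hD : IsCoder G 0 D) (hf : ∀ N, IsMulti (f N))
    (hs : HapSymm G f) : (fun x l => hap (Cochain.preLie G f D) (x :: l))
      = coderOp hD fun x l => hap f (x :: l) := by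
  funext x l
  rw [hD.hap_preLie_cons hf]
  refine congrArg₂ (· + ·) rfl (Sh_congr' _ fun a b => ?_)
  have := hs [] x (Homog.app hD.deg a) b
  rw [List.nil_append, List.nil_append, Homog.app_par] at this
  beta_reduce
  rw [this]
  simp

/-- The part of a composition in which `v` takes the first argument. -/
def starOp (h : W →ₗ[ℝ] Cochain W) (v : Cochain W) (x : Homog G) (l : List (Homog G)) : W :=
  Sh Homog.par l fun p q => hap (h (hap v (x :: p))) q

theorem coderOp_starOp {D : Cochain W} (hD : IsCoder G 0 D) {h : W →ₗ[ℝ] Cochain W}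
    (hh : ∀ z N, IsMulti (h z N)) {v : Cochain W} (hv : ∀ N, IsMulti (v N)) (hs : HapSymm G v) :
    coderOp hD (starOp h v) = starOp h (Cochain.preLie G v D) + starOp (precompD G D ∘ₗ h) v := by
  funext x l
  change Sh _ l (fun p q => Sh _ q fun a b => hap (h (hap v (Homog.app hD.deg (x :: p) :: a))) b)
    + Sh _ l (fun a b => Sh _ (Homog.app hD.deg a :: b) fun p q => hap (h (hap v (x :: p))) q)
    = Sh _ l (fun p q => hap (h (hap (Cochain.preLie G v D) (x :: p))) q)
    + Sh _ l (fun p q => hap (Cochain.preLie G (h (hap v (x :: p))) D) q)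
  have h1 : ∀ p q : List (Homog G), hap (h (hap (Cochain.preLie G v D) (x :: p))) q
      = Sh Homog.par p (fun a b => hap (h (hap v (Homog.app hD.deg (x :: a) :: b))) q)
      + Sh Homog.par p (fun a b => hap (h (hap v (x :: Homog.app hD.deg a :: b))) q) := by
    intro p q
    have := congrFun (congrFun (hap_preLie_coderOp hD hv hs) x) p
    rw [show hap (Cochain.preLie G v D) (x :: p) = _ from this]
    change (hapL q ∘ₗ h) (_ + _) = _
    rw [map_add, Sh_map, Sh_map]
    rfl
  have h2 : ∀ p q : List (Homog G), hap (Cochain.preLie G (h (hap v (x :: p))) D) q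
      = Sh Homog.par q fun a b => hap (h (hap v (x :: p))) (Homog.app hD.deg a :: b) :=
    fun p q => hD.hap_preLie (hh _) q
  simp only [h1, h2, Sh_add, Sh_cons, Homog.app_par]
  rw [Sh_assoc, Sh_assoc _ l fun a b q => hap (h (hap v (x :: Homog.app hD.deg a :: b))) q, add_assoc]
  congr 2
  rw [← Sh_exchange]
  refine Sh_congr' _ fun p m => Sh_congr' _ fun a b => ?_
  rw [Int.cast_zero, add_zero, mul_comm (lpar _ a), smul_smul, sg_mul_self, one_smul]

theorem isMulti_identity (N : ℕ) : IsMulti (Cochain.identity (W := W) N) := by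
  intro w i
  match N with
  | 0 => exact i.elim0
  | 1 =>
    refine ⟨LinearMap.id, fun x => ?_⟩
    have : i = 0 := Subsingleton.elim _ _
    subst this
    simp [Cochain.identity]
  | _ + 2 => exact ⟨0, fun x => rfl⟩

theorem identity_of_ne {N : ℕ} (h : N ≠ 1) : Cochain.identity (W := W) N = 0 := by
  match N with
  | 0 => rfl
  | 1 => exact absurd rfl h
  | _ + 2 => rfl

theorem isCoder_identity : IsCoder G 0 (Cochain.identity (W := W)) := by
  refine ⟨isMulti_identity, fun _ => rfl, fun l₁ x y l₂ => ?_, fun l => ?_⟩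
  · have : ∀ (x y : Homog G) l₂, hap (Cochain.identity (W := W)) (l₁ ++ x :: y :: l₂) = 0 := by
      intro x y l₂
      rw [hap, lap, identity_of_ne (by simp; omega)]; rfl
    rw [this, this, smul_zero]
  · match l with
    | [] => exact Submodule.zero_mem _
    | [x] =>
      rw [List.map_singleton, List.sum_singleton, add_zero]
      exact x.mem
    | _ :: _ :: _ => exact Submodule.zero_mem _

theorem starOp_identity {f : Cochain W} (hf : ∀ N, IsMulti (f N)) :
    starOp (G := G) (insertFirst hf) Cochain.identity = fun x l => hap f (x :: l) := by
  funext x l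
  rw [starOp, Sh_left_nil]
  · exact hap_insertFirst hf _ _
  · intro y p q
    have : hap (Cochain.identity (W := W)) (x :: y :: p) = 0 := rfl
    rw [this, map_zero]; rfl

theorem hap_pow_preLie {D f : Cochain W} (hD : IsCoder G 0 D) (hf : ∀ N, IsMulti (f N))
    (hs : HapSymm G f) (k : ℕ) : (fun (x : Homog G) l => hap ((precompD G D ^ k) f) (x :: l))
      = ∑ ij ∈ Finset.HasAntidiagonal.antidiagonal k, (k.choose ij.1) •
        starOp ((precompD G D ^ ij.1) ∘ₗ insertFirst hf) ((precompD G D ^ ij.2) Cochain.identity) := by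
  induction k with
  | zero =>
    rw [Finset.Nat.antidiagonal_zero, Finset.sum_singleton, Nat.choose_self, one_smul]
    exact (starOp_identity hf).symm
  | succ k ih =>
    rw [Finset.sum_antidiagonal_choose_succ_nsmul (fun i j =>
      starOp (G := G) ((precompD G D ^ i) ∘ₗ insertFirst hf) ((precompD G D ^ j) Cochain.identity)), pow_succ']
    refine (hap_preLie_coderOp hD (hD.multi_pow hf k) (hD.symm_pow hf hs k)).trans ?_
    rw [ih, map_sum, ← Finset.sum_add_distrib]
    refine Finset.sum_congr rfl fun ij hij => ?_
    rw [map_nsmul, coderOp_starOp hD (fun z => hD.multi_pow (insertFirst_multi hf z) _)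
      (hD.multi_pow isMulti_identity _) (hD.symm_pow isMulti_identity isCoder_identity.symm _), smul_add,
      Nat.choose_symm_of_eq_add (Finset.HasAntidiagonal.mem_antidiagonal.1 hij).symm]
    congr 2
    · rw [pow_succ']; rfl
    · rw [pow_succ']; rfl

end exp

section symCo
variable {W : Type*} [AddCommGroup W] [Module ℝ W] (G : GradedSpace W)

/-- The multilinear graded symmetric operations. -/
def symCo : Submodule ℝ (Cochain W) where
  carrier := {f | (∀ N, IsMulti (f N)) ∧ HapSymm G f}
  add_mem' ha hb := ⟨fun N => (ha.1 N).add (hb.1 N), ha.2.add hb.2⟩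
  zero_mem' := ⟨fun _ => IsMulti.zero, HapSymm.zero⟩
  smul_mem' r _ ha := ⟨fun N => (ha.1 N).smul r, ha.2.smul r⟩

/-- The multilinear graded symmetric operations. -/
def SymCo : Type _ := symCo G

instance : AddCommGroup (SymCo G) := inferInstanceAs (AddCommGroup (symCo G))
instance : Module ℝ (SymCo G) := inferInstanceAs (Module ℝ (symCo G))

variable {G}

/-- The underlying operations. -/
def SymCo.val : SymCo G →ₗ[ℝ] Cochain W := (symCo G).subtype

/-- Multilinear symmetric operations as elements of `SymCo`. -/
def SymCo.mk (f : Cochain W) (hf : f ∈ symCo G) : SymCo G := ⟨f, hf⟩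

@[simp] theorem SymCo.val_mk (f : Cochain W) (hf : f ∈ symCo G) : (SymCo.mk f hf).val = f := rfl

theorem SymCo.ext {f g : SymCo G} (h : f.val = g.val) : f = g := Subtype.ext h

theorem SymCo.multi (f : SymCo G) : ∀ N, IsMulti (f.val N) := f.2.1

theorem SymCo.symm (f : SymCo G) : HapSymm G f.val := f.2.2

theorem SymCo.ext_hap {f g : SymCo G} (h : ∀ l : List (Homog G), hap f.val l = hap g.val l) : f = g :=
  SymCo.ext (cochain_ext f.multi g.multi h)

theorem IsCoder.mem {q : ℤ} {D : Cochain W} (hD : IsCoder G q D) : D ∈ symCo G := ⟨hD.multi, hD.symm⟩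

/-- Coderivations as elements of `SymCo`. -/
def IsCoder.toSym {q : ℤ} {D : Cochain W} (hD : IsCoder G q D) : SymCo G := .mk D hD.mem

variable (G) in
/-- The Taylor coefficients of the identity. -/
def idCo : SymCo G := isCoder_identity.toSym

/-- Composition with a coderivation. -/
def coEnd {q : ℤ} {D : Cochain W} (hD : IsCoder G q D) : Module.End ℝ (SymCo G) where
  toFun f := .mk (Cochain.preLie G f.val D) ⟨isMulti_preLie f.multi hD.multi, hD.symm_preLie f.multi f.symm⟩
  map_add' f g := SymCo.ext (by
    simp only [map_add, SymCo.val_mk]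
    exact map_add (precompD G D) f.val g.val)
  map_smul' r f := SymCo.ext (by
    simp only [map_smul, SymCo.val_mk]
    exact map_smul (precompD G D) r f.val)

theorem coEnd_val {q : ℤ} {D : Cochain W} (hD : IsCoder G q D) (f : SymCo G) :
    (coEnd hD f).val = Cochain.preLie G f.val D := rfl

theorem coEnd_pow_val {q : ℤ} {D : Cochain W} (hD : IsCoder G q D) (f : SymCo G) (k : ℕ) :
    ((coEnd hD ^ k) f).val = (precompD G D ^ k) f.val := by
  induction k with
  | zero => rfl
  | succ k ih =>
    rw [pow_succ', pow_succ', Module.End.mul_apply, Module.End.mul_apply, coEnd_val, ih]; rfl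

theorem preLie_identity_left {q : ℤ} {D : Cochain W} (hD : IsCoder G q D) :
    Cochain.preLie G Cochain.identity D = D := by
  refine cochain_ext (G := G) (isMulti_preLie isMulti_identity hD.multi) hD.multi fun l => ?_
  rw [hD.hap_preLie isMulti_identity, Sh_right_nil]
  · rfl
  · intro p x q; rfl

theorem coEnd_idCo {q : ℤ} {D : Cochain W} (hD : IsCoder G q D) : coEnd hD (idCo G) = hD.toSym :=
  SymCo.ext (preLie_identity_left hD)

theorem coEnd_congr {q q' : ℤ} {D D' : Cochain W} (hD : IsCoder G q D) (hD' : IsCoder G q' D')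
    (h : D = D') : coEnd hD = coEnd hD' := by
  subst h; rfl

theorem coEnd_hap {q : ℤ} {D : Cochain W} (hD : IsCoder G q D) (f : SymCo G) (l : List (Homog G)) :
    hap (coEnd hD f).val l = Sh Homog.par l fun a b => hap f.val (Homog.app hD.deg a :: b) :=
  hD.hap_preLie f.multi l

theorem preLie_add_right {q : ℤ} {D E : Cochain W} (hD : IsCoder G q D) (hE : IsCoder G q E)
    (f : SymCo G) (l : List (Homog G)) : hap (Cochain.preLie G f.val (D + E)) l
      = hap (Cochain.preLie G f.val D) l + hap (Cochain.preLie G f.val E) l := by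
  rw [(hD.add hE).hap_preLie f.multi, hD.hap_preLie f.multi, hE.hap_preLie f.multi, ← Sh_add]
  refine Sh_congr' _ fun a b => ?_
  obtain ⟨L, hL⟩ := lap_cons_isLinear f.multi (b.map Homog.val)
  have h : ∀ z : Homog G, hap f.val (z :: b) = L z.val := fun z => hL z.val
  rw [h, h, h, Homog.app_val, Homog.app_val, Homog.app_val, hap_add, map_add]

theorem preLie_smul_right {q : ℤ} {D : Cochain W} (hD : IsCoder G q D) (r : ℝ)
    (f : SymCo G) (l : List (Homog G)) : hap (Cochain.preLie G f.val (r • D)) l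
      = r • hap (Cochain.preLie G f.val D) l := by
  rw [(hD.smul r).hap_preLie f.multi, hD.hap_preLie f.multi, ← Sh_smul]
  refine Sh_congr' _ fun a b => ?_
  obtain ⟨L, hL⟩ := lap_cons_isLinear f.multi (b.map Homog.val)
  have h : ∀ z : Homog G, hap f.val (z :: b) = L z.val := fun z => hL z.val
  rw [h, h, Homog.app_val, Homog.app_val, hap_smul, map_smul]

theorem coEnd_add {q : ℤ} {D E : Cochain W} (hD : IsCoder G q D) (hE : IsCoder G q E) :
    coEnd (hD.add hE) = coEnd hD + coEnd hE :=
  LinearMap.ext fun f => SymCo.ext_hap fun l => by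
    rw [LinearMap.add_apply, map_add, hap_add]
    exact preLie_add_right hD hE f l

theorem coEnd_smul {q : ℤ} {D : Cochain W} (hD : IsCoder G q D) (r : ℝ) :
    coEnd (hD.smul r) = r • coEnd hD :=
  LinearMap.ext fun f => SymCo.ext_hap fun l => by
    rw [LinearMap.smul_apply, map_smul, hap_smul]
    exact preLie_smul_right hD r f l

/-- The graded commutator of coderivations. -/
theorem coEnd_commutator {d e : ℤ} {D E : Cochain W} (hD : IsCoder G d D) (hE : IsCoder G e E) :
    coEnd hE * coEnd hD - sg ((d : ZMod 2) * e) • (coEnd hD * coEnd hE)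
      = coEnd (hD.preLie hE) - sg ((d : ZMod 2) * e) • coEnd (hE.preLie hD) :=
  LinearMap.ext fun f => SymCo.ext_hap fun l => by
    simp only [LinearMap.sub_apply, LinearMap.smul_apply, map_sub, map_smul, hap_sub, hap_smul]
    exact coder_identity f.multi f.symm hD hE l

variable (G) in
/-- The part of a given arity. -/
def SymCo.arity (N : ℕ) : SymCo G →ₗ[ℝ] ((Fin N → W) → W) :=
  (LinearMap.proj N : Cochain W →ₗ[ℝ] _) ∘ₗ SymCo.val

theorem SymCo.arity_apply (N : ℕ) (f : SymCo G) : SymCo.arity G N f = f.val N := rfl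

theorem symCo_arityComplete : ArityComplete (SymCo.arity G) where
  sep f h := SymCo.ext (funext fun N => h N)
  glue g := by
    have h : ∀ l : List (Homog G), hap (fun N => (g N).val N) l = hap (g l.length).val l := by
      intro l
      simp [hap, lap]
    refine ⟨.mk (fun N => (g N).val N) ⟨fun N => (g N).multi N, fun l₁ x y l₂ => ?_⟩, fun N => rfl⟩
    rw [h, h, (g _).symm]
    simp

theorem mem_arityFilt {f : SymCo G} {N : ℕ} : f ∈ arityFilt (SymCo.arity G) N ↔ ∀ M < N, f.val M = 0 :=
  Iff.rfl

theorem coEnd_raises {q : ℤ} {D : Cochain W} (hD : IsCoder G q D) (hD1 : D 1 = 0) :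
    SepFiltration.Raises (arityFilt (SymCo.arity G)) (coEnd hD) := fun _ f hf =>
  mem_arityFilt.2 (raises_preLie f.multi hD1 (mem_arityFilt.1 hf))

theorem coEnd_preserving {q : ℤ} {D : Cochain W} (hD : IsCoder G q D) (hD1 : D 1 = 0) :
    coEnd hD ∈ SepFiltration.preserving (arityFilt (SymCo.arity G)) :=
  SepFiltration.Raises.mem_preserving symCo_arityComplete.sepFiltration (coEnd_raises hD hD1)

/-- The operator `exp D`. -/
def coExpOn {q : ℤ} {D : Cochain W} (hD : IsCoder G q D) : SymCo G → SymCo G :=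
  expOn symCo_arityComplete (coEnd hD)

theorem coExpOn_isExp {q : ℤ} {D : Cochain W} (hD : IsCoder G q D) (hD1 : D 1 = 0) :
    SepFiltration.IsExp (arityFilt (SymCo.arity G)) (coEnd hD) (coExpOn hD) :=
  isExp_expOn symCo_arityComplete (coEnd_raises hD hD1)

theorem coExpOn_apply {q : ℤ} {D : Cochain W} (hD : IsCoder G q D) (hD1 : D 1 = 0) (f : SymCo G)
    {N n : ℕ} (h : N < n) : (coExpOn hD f).val N
      = ∑ k ∈ Finset.range n, ((k.factorial : ℝ)⁻¹) • (precompD G D ^ k) f.val N := by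
  have h1 := (expOn_apply symCo_arityComplete (coEnd hD) f N).trans
    (sum_range_eq_of_raises (coEnd_raises hD hD1) f (fun k => (k.factorial : ℝ)⁻¹) h).symm
  refine h1.trans ?_
  rw [map_sum]
  refine Finset.sum_congr rfl fun k _ => ?_
  rw [map_smul, SymCo.arity_apply, coEnd_pow_val]

theorem coExpOn_hap {q : ℤ} {D : Cochain W} (hD : IsCoder G q D) (hD1 : D 1 = 0) (f : SymCo G)
    (l : List (Homog G)) {n : ℕ} (h : l.length < n) : hap (coExpOn hD f).val l
      = ∑ k ∈ Finset.range n, ((k.factorial : ℝ)⁻¹) • hap ((precompD G D ^ k) f.val) l := by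
  have h1 : (l.map Homog.val).length < n := by simpa using h
  rw [hap, lap, coExpOn_apply hD hD1 f h1, Finset.sum_apply]
  rfl

/-! ### Exponentials of coderivations of degree zero -/

theorem IsCoder.pow {q : ℤ} {D f : Cochain W} (hD : IsCoder G 0 D) (hf : IsCoder G q f) (k : ℕ) :
    IsCoder G q ((precompD G D ^ k) f) := by
  induction k with
  | zero => exact hf
  | succ k ih =>
    have := ih.preLie hD
    rw [add_zero] at this
    rw [pow_succ']; exact this

theorem IsCoder.coExpOn {q : ℤ} {D f : Cochain W} (hD : IsCoder G 0 D) (hD1 : D 1 = 0)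
    (hf : IsCoder G q f) : IsCoder G q (coExpOn hD hf.toSym).val := by
  refine ⟨(GraphCx.coExpOn hD hf.toSym).multi, fun w => ?_, (GraphCx.coExpOn hD hf.toSym).symm, fun l => ?_⟩
  · rw [coExpOn_apply hD hD1 _ zero_lt_one, Finset.sum_range_one, Pi.smul_apply]
    exact (congrArg _ (hf.zero_arity w)).trans (smul_zero _)
  · rw [coExpOn_hap hD hD1 _ l (Nat.lt_succ_self _)]
    exact Submodule.sum_mem _ fun k _ => Submodule.smul_mem _ _ ((hD.pow hf k).deg l)

theorem expTerm_eq (D : Cochain W) (k : ℕ) :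
    Cochain.expTerm G D k = (precompD G D ^ k) Cochain.identity := by
  rw [Module.End.pow_apply]; rfl

theorem expTerm_eq_zero {q : ℤ} {D : Cochain W} (hD : IsCoder G q D) (hD1 : D 1 = 0) {k N : ℕ} (h : N < k) :
    Cochain.expTerm G D k N = 0 := by
  rw [expTerm_eq]
  exact raises_pow_preLie hD isMulti_identity hD1 (N := 0) (fun _ h => absurd h (Nat.not_lt_zero _)) k N
    (by omega)

theorem exp_eq {q : ℤ} {D : Cochain W} (hD : IsCoder G q D) (hD1 : D 1 = 0) :
    Cochain.exp G D = (coExpOn hD (idCo G)).val := by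
  funext N w
  rw [coExpOn_apply hD hD1 _ (Nat.lt_succ_self N), Finset.sum_apply, Cochain.exp,
    finsum_eq_sum_of_support_subset (s := Finset.range (N + 1))]
  · refine Finset.sum_congr rfl fun k _ => ?_
    rw [expTerm_eq, one_div]; rfl
  · intro k hk
    by_contra hk'
    refine hk ?_
    beta_reduce
    rw [expTerm_eq_zero hD hD1 (by simpa using hk')]
    exact smul_zero _

theorem isCoder_exp {D : Cochain W} (hD : IsCoder G 0 D) (hD1 : D 1 = 0) :
    IsCoder G 0 (Cochain.exp G D) := by
  rw [exp_eq hD hD1]; exact hD.coExpOn hD1 isCoder_identity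

theorem sum_range_sum_antidiagonal {n : ℕ} (a : ℕ → ℕ → W) (ha : ∀ i j, n ≤ i + j → a i j = 0) :
    ∑ k ∈ Finset.range n, ((k.factorial : ℝ)⁻¹) •
      ∑ ij ∈ Finset.HasAntidiagonal.antidiagonal k, (k.choose ij.1) • a ij.1 ij.2
    = ∑ j ∈ Finset.range n, ((j.factorial : ℝ)⁻¹) • ∑ i ∈ Finset.range n, ((i.factorial : ℝ)⁻¹) • a i j := by
  have h1 : ∀ k, ((k.factorial : ℝ)⁻¹) •
      ∑ ij ∈ Finset.HasAntidiagonal.antidiagonal k, (k.choose ij.1) • a ij.1 ij.2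
      = ∑ i ∈ Finset.range (k + 1), ((i.factorial : ℝ)⁻¹ * ((k - i).factorial : ℝ)⁻¹) • a i (k - i) := by
    intro k
    rw [Finset.Nat.sum_antidiagonal_eq_sum_range_succ fun i j => (k.choose i) • a i j, Finset.smul_sum]
    refine Finset.sum_congr rfl fun i hi => ?_
    have hik : i ≤ k := by simp at hi; omega
    rw [← Nat.cast_smul_eq_nsmul ℝ, smul_smul, Nat.cast_choose ℝ hik]
    congr 1
    have := Nat.factorial_ne_zero k
    field_simp
  rw [Finset.sum_congr rfl fun k _ => h1 k, Finset.sum_range_diag_flip n fun i j =>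
    ((i.factorial : ℝ)⁻¹ * (j.factorial : ℝ)⁻¹) • a i j]
  simp only [Finset.smul_sum]
  rw [Finset.sum_comm]
  refine Finset.sum_congr rfl fun i _ => ?_
  refine (Finset.sum_subset (Finset.range_subset_range.2 (Nat.sub_le n i)) fun j _ hj => ?_).trans
    (Finset.sum_congr rfl fun j _ => by rw [smul_smul, mul_comm])
  rw [ha i j (by simp at hj; omega), smul_zero]

theorem hap_eq_zero_of_arity {f : Cochain W} {l : List (Homog G)} (h : f l.length = 0) : hap f l = 0 := by
  have h1 : ∀ m, m = l.length → f m = 0 := by rintro _ rfl; exact h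
  have h' := h1 _ (List.length_map (as := l) Homog.val)
  rw [hap, lap, h']; rfl

theorem comp_exp {D : Cochain W} (hD : IsCoder G 0 D) (hD1 : D 1 = 0) (f : SymCo G) :
    Cochain.comp G f.val (Cochain.exp G D) = (coExpOn hD f).val := by
  have hu := isCoder_exp hD hD1
  refine cochain_ext (G := G) (isMulti_comp f.multi hu.multi) (coExpOn hD f).multi fun l => ?_
  obtain ⟨n, hn⟩ : ∃ n, l.length = n := ⟨_, rfl⟩
  induction n using Nat.strong_induction_on generalizing f l with
  | _ n ih =>
    cases l with
    | nil =>
      rw [hap_comp_nil f.multi hu, coExpOn_hap hD hD1 f [] (n := 1) (by simp)]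
      simp
    | cons x l =>
      rw [hap_comp_cons f.multi f.symm hu]
      have h1 : ∀ p q, (p ++ q).Perm l →
          hap (Cochain.comp G (insertFirst f.multi (hap (Cochain.exp G D) (x :: p))) (Cochain.exp G D)) q
          = ∑ j ∈ Finset.range (l.length + 2), ((j.factorial : ℝ)⁻¹) •
            ∑ i ∈ Finset.range (l.length + 2), ((i.factorial : ℝ)⁻¹) •
              hap ((precompD G D ^ i) (insertFirst f.multi
                (hap ((precompD G D ^ j) Cochain.identity) (x :: p)))) q := by
        intro p q hpq
        have hlen := hpq.length_eq
        rw [List.length_append] at hlen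
        have hsym : HapSymm G (insertFirst f.multi (hap (Cochain.exp G D) (x :: p))) :=
          insertFirst_symm f.multi f.symm (Homog.app hu.deg (x :: p))
        have e1 := ih q.length (by simp at hn; omega) (.mk (insertFirst f.multi (hap (Cochain.exp G D) (x :: p)))
          ⟨insertFirst_multi f.multi _, hsym⟩) q rfl
        refine e1.trans ?_
        rw [coExpOn_hap hD hD1 _ q (n := l.length + 2) (by omega)]
        have e2 : hap (Cochain.exp G D) (x :: p) = ∑ j ∈ Finset.range (l.length + 2),
            ((j.factorial : ℝ)⁻¹) • hap ((precompD G D ^ j) Cochain.identity) (x :: p) := by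
          rw [exp_eq hD hD1, coExpOn_hap hD hD1 _ _ (n := l.length + 2) (by simp; omega)]; rfl
        change ∑ k ∈ Finset.range (l.length + 2), ((k.factorial : ℝ)⁻¹) • hap ((precompD G D ^ k)
          (insertFirst f.multi (hap (Cochain.exp G D) (x :: p)))) q = _
        rw [e2]
        have e3 : ∀ i, hap ((precompD G D ^ i) (insertFirst f.multi (∑ j ∈ Finset.range (l.length + 2),
            ((j.factorial : ℝ)⁻¹) • hap ((precompD G D ^ j) Cochain.identity) (x :: p)))) q
            = ∑ j ∈ Finset.range (l.length + 2), ((j.factorial : ℝ)⁻¹) •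
              hap ((precompD G D ^ i) (insertFirst f.multi
                (hap ((precompD G D ^ j) Cochain.identity) (x :: p)))) q := by
          intro i
          change (hapL q ∘ₗ (precompD G D ^ i) ∘ₗ insertFirst f.multi) _ = _
          rw [map_sum]
          simp only [map_smul]
          rfl
        simp only [e3, Finset.smul_sum]
        rw [Finset.sum_comm]
        exact Finset.sum_congr rfl fun j _ => Finset.sum_congr rfl fun i _ => smul_comm _ _ _
      rw [Sh_congr _ h1, coExpOn_hap hD hD1 f (x :: l) (n := l.length + 2) (by simp)]
      have h2 : ∀ k, hap ((precompD G D ^ k) f.val) (x :: l)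
          = Sh Homog.par l fun p q => ∑ ij ∈ Finset.HasAntidiagonal.antidiagonal k, (k.choose ij.1) •
            hap ((precompD G D ^ ij.1) (insertFirst f.multi
                (hap ((precompD G D ^ ij.2) Cochain.identity) (x :: p)))) q := by
        intro k
        have := congrFun (congrFun (hap_pow_preLie hD f.multi f.symm k) x) l
        refine this.trans ?_
        rw [Finset.sum_apply, Finset.sum_apply, Sh_sum]
        refine Finset.sum_congr rfl fun ij _ => ?_
        simp only [← Nat.cast_smul_eq_nsmul ℝ]
        rw [Sh_smul]; rfl
      simp only [h2, ← Sh_smul]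
      rw [← Sh_sum]
      refine Sh_congr _ fun p q hpq => (sum_range_sum_antidiagonal _ fun i j hij => ?_).symm
      have hlen := hpq.length_eq
      rw [List.length_append] at hlen
      by_cases hj : p.length + 1 < j
      · have : hap ((precompD G D ^ j) Cochain.identity) (x :: p) = 0 :=
          hap_eq_zero_of_arity (raises_pow_preLie hD isMulti_identity hD1 (N := 0)
            (fun _ h => absurd h (Nat.not_lt_zero _)) j _ (by simp; omega))
        rw [this, map_zero, map_zero]; rfl
      · have hN : j = p.length + 1 ∨ q.length < i := by omega
        rcases hN with rfl | hi
        · have : hap ((precompD G D ^ (p.length + 1)) Cochain.identity) (x :: p) = 0 :=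
            hap_eq_zero_of_arity (raises_pow_preLie hD isMulti_identity hD1 (N := 1)
              (fun M h => identity_of_ne (by omega)) _ _ (by simp))
          rw [this, map_zero, map_zero]; rfl
        · exact hap_eq_zero_of_arity (raises_pow_preLie hD (insertFirst_multi f.multi _) hD1 (N := 0)
            (fun _ h => absurd h (Nat.not_lt_zero _)) i _ (by omega))

end symCo

/-! ### Automorphisms -/
section aut
variable {W : Type*} [AddCommGroup W] [Module ℝ W] {G : GradedSpace W}

theorem isMorphism_exp {D Q : Cochain W} (hD : IsCoder G 0 D) (hD1 : D 1 = 0) (hQ : IsCoder G 1 Q)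
    (hQ1 : Q 1 = 0) (h : coEnd hD * coEnd hQ = coEnd hQ * coEnd hD) :
    Cochain.IsMorphism G Q (Cochain.exp G D) := by
  refine ⟨isCoder_iff.2 (isCoder_exp hD hD1), ?_⟩
  have h1 := SepFiltration.IsExp.commute symCo_arityComplete.sepFiltration (coExpOn_isExp hD hD1)
    (coEnd_preserving hQ hQ1) h (idCo G)
  rw [coEnd_idCo] at h1
  rw [exp_eq hD hD1, ← coEnd_val hQ, ← h1, ← exp_eq hD hD1]
  exact (comp_exp hD hD1 hQ.toSym).symm

theorem comp_exp_exp {D E : Cochain W} (hD : IsCoder G 0 D) (hD1 : D 1 = 0) (hE : IsCoder G 0 E)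
    (hE1 : E 1 = 0) : Cochain.comp G (Cochain.exp G D) (Cochain.exp G E)
      = (coExpOn hE (coExpOn hD (idCo G))).val := by
  rw [← comp_exp hE hE1, ← exp_eq hD hD1]

theorem coEnd_neg {q : ℤ} {D : Cochain W} (hD : IsCoder G q D) : coEnd (hD.smul (-1)) = -coEnd hD := by
  rw [coEnd_smul, neg_one_smul]

theorem comp_exp_neg {D E : Cochain W} (hD : IsCoder G 0 D) (hD1 : D 1 = 0) (hE : IsCoder G 0 E)
    (hE1 : E 1 = 0) (h : coEnd hE = -coEnd hD) :
    Cochain.comp G (Cochain.exp G D) (Cochain.exp G E) = Cochain.identity := by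
  rw [comp_exp_exp hD hD1 hE hE1]
  have h1 := coExpOn_isExp hD hD1
  have h2 : coEnd hD = -coEnd hE := by rw [h, neg_neg]
  rw [h2] at h1
  rw [SepFiltration.IsExp.neg symCo_arityComplete.sepFiltration (coEnd_raises hE hE1)
    (coExpOn_isExp hE hE1) h1]
  rfl

theorem isAut_exp {D Q : Cochain W} (hD : IsCoder G 0 D) (hD1 : D 1 = 0) (hQ : IsCoder G 1 Q)
    (hQ1 : Q 1 = 0) (h : coEnd hD * coEnd hQ = coEnd hQ * coEnd hD) :
    Cochain.IsAut G Q (Cochain.exp G D) := by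
  have hE1 : ((-1 : ℝ) • D) 1 = 0 := by rw [Pi.smul_apply, hD1, smul_zero]
  refine ⟨isMorphism_exp hD hD1 hQ hQ1 h, Cochain.exp G ((-1 : ℝ) • D),
    isMorphism_exp (hD.smul (-1)) hE1 hQ hQ1 (by rw [coEnd_neg, neg_mul, mul_neg, h]),
    comp_exp_neg hD hD1 _ hE1 (coEnd_neg hD), comp_exp_neg (hD.smul (-1)) hE1 hD hD1 ?_⟩
  rw [coEnd_neg, neg_neg]

end aut

/-! ### Binary brackets of operations -/
section bracket
variable {W : Type*} [AddCommGroup W] [Module ℝ W] {G : GradedSpace W}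

/-- The bracket of two operations, evaluated on a list. -/
def starQ (Q g g' : Cochain W) (l : List (Homog G)) : W :=
  Sh Homog.par l fun p q => lap Q [hap g p, hap g' q]

theorem lap_pair_left {Q : Cochain W} (hQ : ∀ N, IsMulti (Q N)) (y : W) :
    ∃ L : W →ₗ[ℝ] W, ∀ x, lap Q [x, y] = L x := lap_cons_isLinear hQ [y]

theorem lap_pair (Q : Cochain W) (x y : W) : lap Q [x, y] = Q 2 ![x, y] := by
  have : [x, y] = List.ofFn ![x, y] := by simp
  rw [this, lap_ofFn]

theorem lap_pair_right {Q : Cochain W} (hQ : ∀ N, IsMulti (Q N)) (x : W) :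
    ∃ L : W →ₗ[ℝ] W, ∀ y, lap Q [x, y] = L y := by
  obtain ⟨L, hL⟩ := hQ 2 ![x, 0] 1
  refine ⟨L, fun y => ?_⟩
  rw [lap_pair, ← hL]
  congr 1
  funext i
  fin_cases i <;> rfl

theorem IsMulti.bracketTerm {Q h u : Cochain W} (hQ : ∀ N, IsMulti (Q N)) (hh : ∀ N, IsMulti (h N))
    (hu : ∀ N, IsMulti (u N)) {N : ℕ} (B : Finset (Fin N)) : IsMulti (fun w : Fin N → W =>
      Q 2 ![h B.card (w ∘ B.orderEmbOfFin rfl), u Bᶜ.card (w ∘ Bᶜ.orderEmbOfFin rfl)]) := by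
  intro w i
  by_cases hi : i ∈ B
  · obtain ⟨j, rfl⟩ : ∃ j, B.orderEmbOfFin rfl j = i := by
      have : i ∈ Set.range (B.orderEmbOfFin rfl) := by rw [Finset.range_orderEmbOfFin]; exact hi
      exact this
    obtain ⟨L, hL⟩ := hh B.card (w ∘ B.orderEmbOfFin rfl) j
    obtain ⟨L', hL'⟩ := lap_pair_left hQ (u Bᶜ.card (w ∘ Bᶜ.orderEmbOfFin rfl))
    refine ⟨L' ∘ₗ L, fun x => ?_⟩
    beta_reduce
    rw [LinearMap.comp_apply, ← hL, ← hL', lap_pair,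
      Function.update_comp_eq_of_injective _ (B.orderEmbOfFin rfl).injective,
      Function.update_comp_eq_of_notMem_range]
    rw [Finset.range_orderEmbOfFin]; simpa using hi
  · obtain ⟨j, rfl⟩ : ∃ j, Bᶜ.orderEmbOfFin rfl j = i := by
      have : i ∈ Set.range (Bᶜ.orderEmbOfFin rfl) := by rw [Finset.range_orderEmbOfFin]; simpa using hi
      exact this
    obtain ⟨L, hL⟩ := hu Bᶜ.card (w ∘ Bᶜ.orderEmbOfFin rfl) j
    obtain ⟨L', hL'⟩ := lap_pair_right hQ (h B.card (w ∘ B.orderEmbOfFin rfl))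
    refine ⟨L' ∘ₗ L, fun x => ?_⟩
    beta_reduce
    rw [LinearMap.comp_apply, ← hL, ← hL', lap_pair,
      Function.update_comp_eq_of_injective _ (Bᶜ.orderEmbOfFin rfl).injective,
      Function.update_comp_eq_of_notMem_range]
    rw [Finset.range_orderEmbOfFin]; simpa using hi

theorem isMulti_bracketAlong {Q h u : Cochain W} (hQ : ∀ N, IsMulti (Q N)) (hh : ∀ N, IsMulti (h N))
    (hu : ∀ N, IsMulti (u N)) (N : ℕ) : IsMulti (Cochain.bracketAlong G Q h u N) :=
  IsMulti.sum _ fun e _ => IsMulti.sum _ fun B _ => ((IsMulti.bracketTerm hQ hh hu B).parts G e).smul _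

theorem hap_bracketAlong {Q h u : Cochain W} (hQ : ∀ N, IsMulti (Q N)) (hh : ∀ N, IsMulti (h N))
    (hu : ∀ N, IsMulti (u N)) (hh0 : ∀ w, h 0 w = 0) (hu0 : ∀ w, u 0 w = 0) (l : List (Homog G)) :
    hap (Cochain.bracketAlong G Q h u) l = starQ Q h u l := by
  obtain ⟨N, w, rfl⟩ : ∃ (N : ℕ) (w : Fin N → Homog G), l = List.ofFn w :=
    ⟨_, l.get, (List.ofFn_get l).symm⟩
  rw [hap_ofFn, starQ, ← sum_subset]
  refine (sum_parts_eq w (fun e v => ∑ B : Finset (Fin N) with B.Nonempty ∧ Bᶜ.Nonempty,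
    koszul (blockOf B) e • Q 2 ![h B.card (v ∘ B.orderEmbOfFin rfl),
      u Bᶜ.card (v ∘ Bᶜ.orderEmbOfFin rfl)]) fun e =>
    IsMulti.sum _ fun B _ => (IsMulti.bracketTerm hQ hh hu B).smul _).trans ?_
  rw [Finset.sum_filter]
  refine Finset.sum_congr rfl fun B _ => ?_
  have h1 : ∀ (g : Cochain W) (B : Finset (Fin N)), hap g (blk (· ∈ B) w)
      = g B.card ((fun i => (w i).val) ∘ B.orderEmbOfFin rfl) := by
    intro g B; rw [← ofFn_orderEmb, hap_ofFn]; rfl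
  have h2 : ∀ (g : Cochain W), (∀ w, g 0 w = 0) → ∀ B : Finset (Fin N), ¬B.Nonempty →
      hap g (blk (· ∈ B) w) = 0 := by
    intro g hg B hB
    rw [Finset.not_nonempty_iff_eq_empty.1 hB]
    have : blk (· ∈ (∅ : Finset (Fin N))) w = [] := by simp [blk]
    rw [this]
    exact hg _
  split_ifs with hB
  · rw [h1, h1, lap_pair]
  · rcases not_and_or.1 hB with hB | hB
    · rw [lap_eq_zero hQ, smul_zero]; simp [h2 h hh0 B hB]
    · rw [lap_eq_zero hQ, smul_zero]
      exact List.mem_cons_of_mem _ (List.mem_singleton.2 (h2 u hu0 _ hB).symm)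

theorem starQ_derivation {d : ℤ} {Q g g' D : Cochain W} (hD : IsCoder G d D) (hQ : ∀ N, IsMulti (Q N))
    (hg : ∀ N, IsMulti (g N)) (hg' : ∀ N, IsMulti (g' N)) (l : List (Homog G)) :
    Sh Homog.par l (fun a b => starQ Q g g' (Homog.app hD.deg a :: b))
      = starQ Q (Cochain.preLie G g D) g' l + Sh Homog.par l fun p q =>
        sg (d * lpar Homog.par p) • lap Q [hap g p, hap (Cochain.preLie G g' D) q] := by
  have h1 : ∀ p q : List (Homog G), lap Q [hap (Cochain.preLie G g D) p, hap g' q]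
      = Sh Homog.par p fun a b => lap Q [hap g (Homog.app hD.deg a :: b), hap g' q] := by
    intro p q
    obtain ⟨L, hL⟩ := lap_pair_left hQ (hap g' q)
    simp only [hL, hD.hap_preLie hg, Sh_map]
  have h2 : ∀ p q : List (Homog G), sg (d * lpar Homog.par p) • lap Q [hap g p, hap (Cochain.preLie G g' D) q]
      = Sh Homog.par q fun a b => sg (d * lpar Homog.par p) • lap Q [hap g p, hap g' (Homog.app hD.deg a :: b)] := by
    intro p q
    obtain ⟨L, hL⟩ := lap_pair_right hQ (hap g p)
    simp only [hL, hD.hap_preLie hg', Sh_map, Sh_smul]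
  simp only [starQ, h1, h2, Sh_cons, Sh_add, Homog.app_par]
  rw [Sh_assoc]
  congr 1
  rw [← Sh_exchange]
  refine Sh_congr' _ fun a m => Sh_congr' _ fun p q => ?_
  rw [smul_smul, ← sg_add]
  congr 2
  generalize lpar Homog.par a = A; generalize lpar Homog.par p = P; generalize (d : ZMod 2) = D
  revert A P D; decide

theorem starQ_even {Q g g' D : Cochain W} (hD : IsCoder G 0 D) (hQ : ∀ N, IsMulti (Q N))
    (hg : ∀ N, IsMulti (g N)) (hg' : ∀ N, IsMulti (g' N)) (l : List (Homog G)) :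
    Sh Homog.par l (fun a b => starQ Q g g' (Homog.app hD.deg a :: b))
      = starQ Q (Cochain.preLie G g D) g' l + starQ Q g (Cochain.preLie G g' D) l := by
  rw [starQ_derivation hD hQ hg hg', starQ, starQ]
  congr 1
  exact Sh_congr' _ fun p q => by simp

theorem starQ_odd {Q g g' D : Cochain W} (hD : IsCoder G (-1) D) (hQ : IsCoder G 1 Q)
    (hg : IsCoder G 0 g) (hg' : IsCoder G 0 g') (l : List (Homog G)) :
    Sh Homog.par l (fun a b => starQ Q g g' (Homog.app hD.deg a :: b))
      = starQ Q (Cochain.preLie G g D) g' l + starQ Q (Cochain.preLie G g' D) g l := by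
  rw [starQ_derivation hD hQ.multi hg.multi hg'.multi]
  congr 1
  rw [starQ, Sh_comm]
  refine Sh_congr' _ fun p q => ?_
  have h := hQ.symm [] (Homog.app hg.deg q) (Homog.app (hg'.preLie hD).deg p) []
  rw [Homog.app_par, Homog.app_par] at h
  have h' : lap Q [hap g q, hap (Cochain.preLie G g' D) p] = _ := h
  rw [h', smul_smul, smul_smul, ← sg_add, ← sg_add]
  have e : lpar Homog.par p * lpar Homog.par q + ((-1 : ℤ) : ZMod 2) * lpar Homog.par q
      + (lpar Homog.par q + ((0 : ℤ) : ZMod 2)) * (lpar Homog.par p + ((0 + -1 : ℤ) : ZMod 2)) = 0 := by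
    generalize lpar Homog.par p = a; generalize lpar Homog.par q = b
    revert a b; decide
  rw [e, sg_zero, one_smul]
  rfl

theorem starQ_identity {Q : Cochain W} (hQ : IsCoder G 1 Q) (hQ2 : ∀ N, N ≠ 2 → Q N = 0)
    (l : List (Homog G)) : starQ Q Cochain.identity Cochain.identity l = (2 : ℝ) • hap Q l := by
  have h0 : ∀ x : W, lap Q [x, 0] = 0 := fun x => lap_eq_zero hQ.multi (by simp)
  have h0' : ∀ x : W, lap Q [0, x] = 0 := fun x => lap_eq_zero hQ.multi (by simp)
  have i0 : hap (G := G) Cochain.identity [] = 0 := rfl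
  have i1 : ∀ x : Homog G, hap Cochain.identity [x] = x.val := fun x => rfl
  have i2 : ∀ (x y : Homog G) l, hap Cochain.identity (x :: y :: l) = 0 := fun x y l => rfl
  match l with
  | [] =>
    rw [starQ, Sh_nil, i0, h0, hap_eq_zero_of_arity (hQ2 _ (by simp)), smul_zero]
  | [x] =>
    rw [starQ, Sh_cons, Sh_nil, Sh_nil, i0, h0, h0', hap_eq_zero_of_arity (hQ2 _ (by simp))]
    simp
  | [x, y] =>
    simp only [starQ, Sh_cons, Sh_nil, i1, i2, h0, h0', lpar_nil, lpar_cons]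
    have h : lap Q [y.val, x.val] = sg (y.par * x.par) • lap Q [x.val, y.val] := hQ.symm [] y x []
    have h' : hap Q [x, y] = lap Q [x.val, y.val] := rfl
    rw [h', h, two_smul]
    simp only [mul_zero, add_zero, sg_zero, smul_zero, zero_add, one_smul]
    rw [smul_smul, mul_comm x.par, sg_mul_self, one_smul]
  | x :: y :: z :: l =>
    rw [hap_eq_zero_of_arity (hQ2 _ (by simp)), smul_zero, starQ, ← Sh_zero Homog.par (x :: y :: z :: l) (M := W)]
    refine Sh_congr _ fun p q hpq => ?_
    have hlen := hpq.length_eq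
    simp only [List.length_append, List.length_cons] at hlen
    match p, q with
    | [], q => rw [i0, h0']
    | _ :: _ :: _, q => rw [i2, h0']
    | [_], [] => rw [i0, h0]
    | [_], _ :: _ :: _ => rw [i2, h0]
    | [_], [_] => simp at hlen

end bracket

/-! ### The contracting sequence -/

/-- The sequence `∑_{i + j = k - 1} x^i e x^j`. -/
def hSeq {R : Type*} [Ring R] (x e : R) : ℕ → R
  | 0 => 0
  | k + 1 => x * hSeq x e k + e * x ^ k

theorem map_hSeq {R S : Type*} [Ring R] [Ring S] (φ : R →+* S) (x e : R) (k : ℕ) :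
    φ (hSeq x e k) = hSeq (φ x) (φ e) k := by
  induction k with
  | zero => exact map_zero φ
  | succ k ih => rw [hSeq, hSeq, map_add, map_mul, map_mul, map_pow, ih]

theorem derivative_pow_hSeq {R : Type*} [Ring R] (X Y e q : R) (hX : X * q = q * X) (hY : Y * q = q * Y)
    (hYe : Y = q * e + e * q) (k : ℕ) :
    Polynomial.derivative ((Polynomial.C X + Polynomial.C Y * Polynomial.X) ^ k)
      = Polynomial.C q * hSeq (Polynomial.C X + Polynomial.C Y * Polynomial.X) (Polynomial.C e) k
        + hSeq (Polynomial.C X + Polynomial.C Y * Polynomial.X) (Polynomial.C e) k * Polynomial.C q := by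
  set x : Polynomial R := Polynomial.C X + Polynomial.C Y * Polynomial.X with hx
  have hxq : x * Polynomial.C q = Polynomial.C q * x := by
    have h1 : Polynomial.C X * Polynomial.C q = Polynomial.C q * Polynomial.C X := by
      rw [← Polynomial.C_mul, hX, Polynomial.C_mul]
    have h2 : Polynomial.C Y * Polynomial.C q = Polynomial.C q * Polynomial.C Y := by
      rw [← Polynomial.C_mul, hY, Polynomial.C_mul]
    rw [hx, add_mul, mul_add, h1, mul_assoc, Polynomial.X_mul_C, ← mul_assoc, h2, mul_assoc]
  have hxk : ∀ k, x ^ k * Polynomial.C q = Polynomial.C q * x ^ k := fun k =>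
    (Commute.pow_left (show Commute x (Polynomial.C q) from hxq) k).eq
  have hdx : Polynomial.derivative x = Polynomial.C q * Polynomial.C e + Polynomial.C e * Polynomial.C q := by
    rw [← Polynomial.C_mul, ← Polynomial.C_mul, ← Polynomial.C_add, ← hYe, hx]
    simp
  induction k with
  | zero => simp [hSeq]
  | succ k ih =>
    rw [pow_succ', Polynomial.derivative_mul, ih, hdx, hSeq]
    have e1 : Polynomial.C q * (x * hSeq x (Polynomial.C e) k) = x * (Polynomial.C q * hSeq x (Polynomial.C e) k) := by
      rw [← mul_assoc, ← mul_assoc, hxq]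
    have e2 : Polynomial.C e * x ^ k * Polynomial.C q = Polynomial.C e * Polynomial.C q * x ^ k := by
      rw [mul_assoc, hxk, mul_assoc]
    rw [mul_add (Polynomial.C q), add_mul _ _ (Polynomial.C q), e1, e2]
    simp only [add_mul, mul_add, mul_assoc]
    abel

/-! ### Homotopies -/
section homotopy
variable {W : Type*} [AddCommGroup W] [Module ℝ W] {G : GradedSpace W}

theorem preserve_preLie {D f : Cochain W} {N : ℕ}
    (h : ∀ M < N, f M = 0) : ∀ M < N, Cochain.preLie G f D M = 0 := by
  intro M hM
  funext w
  refine Finset.sum_eq_zero fun e _ => Finset.sum_eq_zero fun B hB => ?_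
  have hB' : 0 < B.card := Finset.card_pos.2 (Finset.mem_filter.1 hB).2
  have hc := Finset.card_add_card_compl B
  rw [Fintype.card_fin] at hc
  rw [h _ (by omega)]; exact smul_zero _

theorem coEnd_preserves {q : ℤ} {D : Cochain W} (hD : IsCoder G q D) {N : ℕ} {f : SymCo G}
    (hf : f ∈ arityFilt (SymCo.arity G) N) : coEnd hD f ∈ arityFilt (SymCo.arity G) N :=
  mem_arityFilt.2 (preserve_preLie (mem_arityFilt.1 hf))

theorem coEnd_pow_mem {q : ℤ} {D : Cochain W} (hD : IsCoder G q D) (hD1 : D 1 = 0) (k : ℕ) {N : ℕ}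
    {f : SymCo G} (hf : f ∈ arityFilt (SymCo.arity G) N) :
    (coEnd hD ^ k) f ∈ arityFilt (SymCo.arity G) (N + k) :=
  SepFiltration.IsExp.raises_pow (coEnd_raises hD hD1) k N f hf

theorem idCo_mem : idCo G ∈ arityFilt (SymCo.arity G) 1 :=
  mem_arityFilt.2 fun _ hM => identity_of_ne (by omega)

theorem hSeq_mem {D E : Cochain W} (hD : IsCoder G 0 D) (hD1 : D 1 = 0) (hE : IsCoder G (-1) E) (k : ℕ)
    {f : SymCo G} (hf : f ∈ arityFilt (SymCo.arity G) 1) :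
    hSeq (coEnd hD) (coEnd hE) k f ∈ arityFilt (SymCo.arity G) k := by
  induction k with
  | zero => exact fun _ h => absurd h (Nat.not_lt_zero _)
  | succ k ih =>
    refine Submodule.add_mem _ (coEnd_raises hD hD1 k _ ih) (coEnd_preserves hE ?_)
    rw [add_comm]
    exact coEnd_pow_mem hD hD1 k hf

theorem isCoder_coEnd_pow {q : ℤ} {D : Cochain W} (hD : IsCoder G 0 D) (k : ℕ) {f : SymCo G}
    (hf : IsCoder G q f.val) : IsCoder G q ((coEnd hD ^ k) f).val := by
  rw [coEnd_pow_val]; exact hD.pow hf k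

theorem isCoder_hSeq {D E : Cochain W} (hD : IsCoder G 0 D) (hE : IsCoder G (-1) E) (k : ℕ) :
    IsCoder G (-1) (hSeq (coEnd hD) (coEnd hE) k (idCo G)).val := by
  induction k with
  | zero => exact IsCoder.zero
  | succ k ih =>
    have h1 := ih.preLie hD
    have h2 := (isCoder_coEnd_pow hD k (f := idCo G) isCoder_identity).preLie hE
    rw [add_zero] at h1
    rw [zero_add] at h2
    exact h1.add h2

variable {Q : Cochain W}

theorem hap_coEnd_pow_bracket {D : Cochain W} (hD : IsCoder G 0 D) (hQ : IsCoder G 1 Q)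
    (hQ2 : ∀ N, N ≠ 2 → Q N = 0) (k : ℕ) : (fun l => hap ((coEnd hD ^ k) hQ.toSym).val l)
      = ∑ ij ∈ Finset.HasAntidiagonal.antidiagonal k, k.choose ij.1 • (1 / 2 : ℝ) •
        starQ (G := G) Q ((coEnd hD ^ ij.1) (idCo G)).val ((coEnd hD ^ ij.2) (idCo G)).val := by
  induction k with
  | zero =>
    rw [Finset.Nat.antidiagonal_zero, Finset.sum_singleton, Nat.choose_self, one_smul]
    funext l
    rw [Pi.smul_apply]
    change _ = (1 / 2 : ℝ) • starQ Q Cochain.identity Cochain.identity l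
    rw [starQ_identity hQ hQ2, smul_smul]
    norm_num
    rfl
  | succ k ih =>
    rw [Finset.sum_antidiagonal_choose_succ_nsmul (fun i j => (1 / 2 : ℝ) •
      starQ (G := G) Q ((coEnd hD ^ i) (idCo G)).val ((coEnd hD ^ j) (idCo G)).val), ← Finset.sum_add_distrib]
    funext l
    rw [pow_succ', Module.End.mul_apply, coEnd_hap]
    simp only [fun l => congrFun ih l, Finset.sum_apply, Pi.add_apply, Sh_sum]
    refine Finset.sum_congr rfl fun ij hij => ?_
    rw [Nat.choose_symm_of_eq_add (Finset.HasAntidiagonal.mem_antidiagonal.1 hij).symm]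
    simp only [Pi.smul_apply, ← Nat.cast_smul_eq_nsmul ℝ, Sh_smul]
    rw [starQ_even hD hQ.multi (SymCo.multi _) (SymCo.multi _), smul_add, smul_add, add_comm]
    simp only [pow_succ', Module.End.mul_apply, coEnd_val]

theorem sum_choose_symm {M : Type*} [AddCommMonoid M] (k : ℕ) (f : ℕ → ℕ → M) :
    ∑ ij ∈ Finset.HasAntidiagonal.antidiagonal k, k.choose ij.1 • f ij.2 ij.1
      = ∑ ij ∈ Finset.HasAntidiagonal.antidiagonal k, k.choose ij.1 • f ij.1 ij.2 := by
  rw [← Finset.Nat.sum_antidiagonal_swap]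
  refine Finset.sum_congr rfl fun ij hij => ?_
  rw [Prod.fst_swap, Prod.snd_swap,
    Nat.choose_symm_of_eq_add (Finset.HasAntidiagonal.mem_antidiagonal.1 hij).symm]

theorem hap_hSeq_bracket {D E : Cochain W} (hD : IsCoder G 0 D) (hE : IsCoder G (-1) E) (hQ : IsCoder G 1 Q)
    (hQ2 : ∀ N, N ≠ 2 → Q N = 0) (k : ℕ) :
    (fun l => hap (hSeq (coEnd hD) (coEnd hE) k hQ.toSym).val l)
      = ∑ ij ∈ Finset.HasAntidiagonal.antidiagonal k, k.choose ij.1 •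
        starQ (G := G) Q (hSeq (coEnd hD) (coEnd hE) ij.1 (idCo G)).val
          ((coEnd hD ^ ij.2) (idCo G)).val := by
  have hz : ∀ (g : Cochain W) (l : List (Homog G)), starQ Q (0 : Cochain W) g l = 0 := by
    intro g l
    rw [starQ, ← Sh_zero Homog.par l (M := W)]
    refine Sh_congr' _ fun p q => lap_eq_zero hQ.multi ?_
    exact List.mem_cons.2 (Or.inl rfl)
  have hadd : ∀ (f f' g : Cochain W) (l : List (Homog G)),
      starQ Q (f + f') g l = starQ Q f g l + starQ Q f' g l := by
    intro f f' g l
    rw [starQ, starQ, starQ, ← Sh_add]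
    refine Sh_congr' _ fun p q => ?_
    obtain ⟨L, hL⟩ := lap_pair_left hQ.multi (hap g q)
    rw [hL, hL, hL, hap_add, map_add]
  induction k with
  | zero =>
    rw [Finset.Nat.antidiagonal_zero, Finset.sum_singleton, Nat.choose_self, one_smul]
    funext l
    exact (hz _ l).symm
  | succ k ih =>
    rw [Finset.sum_antidiagonal_choose_succ_nsmul (fun i j => 
      starQ (G := G) Q (hSeq (coEnd hD) (coEnd hE) i (idCo G)).val ((coEnd hD ^ j) (idCo G)).val),
      ← Finset.sum_add_distrib]
    funext l
    have h1 : hap (coEnd hD (hSeq (coEnd hD) (coEnd hE) k hQ.toSym)).val l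
        = ∑ ij ∈ Finset.HasAntidiagonal.antidiagonal k, k.choose ij.1 •
          (starQ Q (Cochain.preLie G (hSeq (coEnd hD) (coEnd hE) ij.1 (idCo G)).val D)
              ((coEnd hD ^ ij.2) (idCo G)).val l +
            starQ Q (hSeq (coEnd hD) (coEnd hE) ij.1 (idCo G)).val
              ((coEnd hD ^ (ij.2 + 1)) (idCo G)).val l) := by
      rw [coEnd_hap]
      simp only [fun l => congrFun ih l, Finset.sum_apply, Sh_sum]
      refine Finset.sum_congr rfl fun ij hij => ?_
      simp only [Pi.smul_apply, ← Nat.cast_smul_eq_nsmul ℝ, Sh_smul]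
      rw [starQ_even hD hQ.multi (SymCo.multi _) (SymCo.multi _)]
      simp only [pow_succ', Module.End.mul_apply, coEnd_val]
    have h2 : hap (coEnd hE ((coEnd hD ^ k) hQ.toSym)).val l
        = ∑ ij ∈ Finset.HasAntidiagonal.antidiagonal k, k.choose ij.1 •
          starQ Q (Cochain.preLie G ((coEnd hD ^ ij.1) (idCo G)).val E)
              ((coEnd hD ^ ij.2) (idCo G)).val l := by
      rw [coEnd_hap]
      simp only [fun l => congrFun (hap_coEnd_pow_bracket hD hQ hQ2 k) l, Finset.sum_apply, Sh_sum]
      have h3 : ∀ i j, Sh Homog.par l (fun a b => ((1 / 2 : ℝ) • starQ (G := G) Q ((coEnd hD ^ i) (idCo G)).val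
          ((coEnd hD ^ j) (idCo G)).val) (Homog.app hE.deg a :: b))
          = (1 / 2 : ℝ) • (starQ Q (Cochain.preLie G ((coEnd hD ^ i) (idCo G)).val E)
              ((coEnd hD ^ j) (idCo G)).val l + starQ Q (Cochain.preLie G ((coEnd hD ^ j) (idCo G)).val E)
              ((coEnd hD ^ i) (idCo G)).val l) := by
        intro i j
        simp only [Pi.smul_apply, Sh_smul]
        rw [starQ_odd hE hQ (isCoder_coEnd_pow hD _ isCoder_identity)
          (isCoder_coEnd_pow hD _ isCoder_identity)]
      have h4 : ∀ (i j n : ℕ), Sh Homog.par l (fun a b => (n • (1 / 2 : ℝ) •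
          starQ (G := G) Q ((coEnd hD ^ i) (idCo G)).val
          ((coEnd hD ^ j) (idCo G)).val) (Homog.app hE.deg a :: b))
          = n • ((1 / 2 : ℝ) • starQ Q (Cochain.preLie G ((coEnd hD ^ i) (idCo G)).val E)
              ((coEnd hD ^ j) (idCo G)).val l) + n • ((1 / 2 : ℝ) •
              starQ Q (Cochain.preLie G ((coEnd hD ^ j) (idCo G)).val E)
              ((coEnd hD ^ i) (idCo G)).val l) := by
        intro i j n
        rw [← smul_add, ← smul_add, ← h3]
        simp only [Pi.smul_apply, ← Nat.cast_smul_eq_nsmul ℝ, Sh_smul]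
      rw [Finset.sum_congr rfl fun ij _ => h4 ij.1 ij.2 _, Finset.sum_add_distrib,
        sum_choose_symm k fun i j => (1 / 2 : ℝ) • starQ Q
          (Cochain.preLie G ((coEnd hD ^ i) (idCo G)).val E) ((coEnd hD ^ j) (idCo G)).val l,
        ← Finset.sum_add_distrib]
      refine Finset.sum_congr rfl fun ij _ => ?_
      rw [← smul_add, ← add_smul]
      norm_num
    change hap (coEnd hD (hSeq (coEnd hD) (coEnd hE) k hQ.toSym)).val l
      + hap (coEnd hE ((coEnd hD ^ k) hQ.toSym)).val l = _
    rw [h1, h2, Finset.sum_apply, ← Finset.sum_add_distrib]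
    refine Finset.sum_congr rfl fun ij hij => ?_
    rw [Nat.choose_symm_of_eq_add (Finset.HasAntidiagonal.mem_antidiagonal.1 hij).symm, ← smul_add,
      ← smul_add, Pi.smul_apply, Pi.add_apply]
    congr 1
    rw [hSeq, LinearMap.add_apply, map_add, hadd]
    change _ = _ + (starQ Q (Cochain.preLie G (hSeq (coEnd hD) (coEnd hE) ij.1 (idCo G)).val D)
              ((coEnd hD ^ ij.2) (idCo G)).val l + starQ Q (Cochain.preLie G ((coEnd hD ^ ij.1) (idCo G)).val E)
              ((coEnd hD ^ ij.2) (idCo G)).val l)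
    abel

end homotopy

section poly
variable {W : Type*} [AddCommGroup W] [Module ℝ W] {G : GradedSpace W}

/-- Evaluation of polynomials with coefficients in an algebra at a real number. -/
def evReal {R : Type*} [Ring R] [Algebra ℝ R] (t : ℝ) : Polynomial R →+* R :=
  Polynomial.eval₂RingHom' (RingHom.id R) (algebraMap ℝ R t) fun a => (Algebra.commutes t a).symm

theorem evReal_C {R : Type*} [Ring R] [Algebra ℝ R] (t : ℝ) (a : R) : evReal t (Polynomial.C a) = a :=
  Polynomial.eval₂_C _ _

theorem evReal_X {R : Type*} [Ring R] [Algebra ℝ R] (t : ℝ) :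
    evReal t (Polynomial.X : Polynomial R) = algebraMap ℝ R t :=
  Polynomial.eval₂_X _ _

theorem evReal_eq_sum {R : Type*} [Ring R] [Algebra ℝ R] (t : ℝ) (p : Polynomial R) {n : ℕ}
    (h : p.natDegree < n) : evReal t p = ∑ j ∈ Finset.range n, t ^ j • p.coeff j := by
  refine (Polynomial.eval₂_eq_sum_range' _ h _).trans (Finset.sum_congr rfl fun j _ => ?_)
  rw [RingHom.id_apply, ← map_pow, ← Algebra.commutes, ← Algebra.smul_def]

/-- The coefficients of `∑ P_k / k!` applied to the identity. -/
def polyCo (P : ℕ → Polynomial (Module.End ℝ (SymCo G))) (j : ℕ) : Cochain W := fun N w =>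
  ∑ k ∈ Finset.range (N + 1), ((k.factorial : ℝ)⁻¹) • ((P k).coeff j (idCo G)).val N w

theorem polyCo_eq_zero (P : ℕ → Polynomial (Module.End ℝ (SymCo G))) {j N : ℕ}
    (h : ∀ k < N + 1, (P k).natDegree < j) (w : Fin N → W) : polyCo P j N w = 0 := by
  refine Finset.sum_eq_zero fun k hk => ?_
  rw [Polynomial.coeff_eq_zero_of_natDegree_lt (h k (Finset.mem_range.1 hk)), LinearMap.zero_apply, map_zero]
  exact smul_zero _

theorem exists_bound (P : ℕ → Polynomial (Module.End ℝ (SymCo G))) (N : ℕ) :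
    ∃ n, ∀ k < N + 1, (P k).natDegree < n :=
  ⟨∑ k ∈ Finset.range (N + 1), (P k).natDegree + 1, fun _ hk => Nat.lt_succ_of_le
    (Finset.single_le_sum (f := fun k => (P k).natDegree) (fun _ _ => Nat.zero_le _) (Finset.mem_range.2 hk))⟩

theorem polyCo_finite (P : ℕ → Polynomial (Module.End ℝ (SymCo G))) (N : ℕ) :
    {j | polyCo P j N ≠ 0}.Finite := by
  obtain ⟨n, hn⟩ := exists_bound P N
  refine (Set.finite_Iio n).subset fun j hj => ?_
  by_contra h
  exact hj (funext fun w => polyCo_eq_zero P (fun k hk => (hn k hk).trans_le (not_lt.1 h)) w)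

theorem evalAt_polyCo (P : ℕ → Polynomial (Module.End ℝ (SymCo G))) (t : ℝ) (N : ℕ) :
    Cochain.evalAt (polyCo P) t N
      = ∑ k ∈ Finset.range (N + 1), ((k.factorial : ℝ)⁻¹) • (evReal t (P k) (idCo G)).val N := by
  obtain ⟨n, hn⟩ := exists_bound P N
  funext w
  rw [Cochain.evalAt, finsum_eq_sum_of_support_subset (s := Finset.range n)]
  · simp only [polyCo, Finset.smul_sum]
    rw [Finset.sum_comm, Finset.sum_apply]
    refine Finset.sum_congr rfl fun k hk => ?_
    rw [evReal_eq_sum t _ (hn k (Finset.mem_range.1 hk)), LinearMap.sum_apply, map_sum, Finset.sum_apply,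
      Pi.smul_apply, Finset.sum_apply, Finset.smul_sum]
    refine Finset.sum_congr rfl fun j _ => ?_
    rw [smul_comm, LinearMap.smul_apply, map_smul]; rfl
  · intro j hj
    by_contra h
    refine hj ?_
    beta_reduce
    rw [polyCo_eq_zero P (fun k hk => (hn k hk).trans_le (by simpa using h)), smul_zero]

theorem polyCo_derivative (P : ℕ → Polynomial (Module.End ℝ (SymCo G))) :
    (fun j : ℕ => ((j : ℝ) + 1) • polyCo P (j + 1)) = polyCo fun k => Polynomial.derivative (P k) := by
  funext j N w
  rw [Pi.smul_apply, Pi.smul_apply, polyCo, polyCo, Finset.smul_sum]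
  refine Finset.sum_congr rfl fun k _ => ?_
  have h : (Polynomial.derivative (P k)).coeff j = ((j : ℝ) + 1) • (P k).coeff (j + 1) := by
    rw [Polynomial.coeff_derivative, Algebra.smul_def, Algebra.commutes]
    congr 1
    rw [map_add, map_natCast, map_one]
  rw [h, LinearMap.smul_apply, map_smul, smul_comm]; rfl

variable {Q A B E : Cochain W}

/-- The path from `A` to `B`. -/
theorem isCoder_path (hA : IsCoder G 0 A) (hB : IsCoder G 0 B) (t : ℝ) :
    IsCoder G 0 (A + t • (B + (-1 : ℝ) • A)) := hA.add ((hB.add (hA.smul _)).smul _)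

theorem path_one (hA1 : A 1 = 0) (hB1 : B 1 = 0) (t : ℝ) : (A + t • (B + (-1 : ℝ) • A)) 1 = 0 := by
  rw [Pi.add_apply, Pi.smul_apply, Pi.add_apply, Pi.smul_apply, hA1, hB1]; simp

theorem coEnd_path (hA : IsCoder G 0 A) (hB : IsCoder G 0 B) (t : ℝ) :
    evReal t (Polynomial.C (coEnd hA) + Polynomial.C (coEnd hB - coEnd hA) * Polynomial.X)
      = coEnd (isCoder_path hA hB t) := by
  have h : coEnd (isCoder_path hA hB t) = coEnd hA + t • (coEnd hB + (-1 : ℝ) • coEnd hA) := by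
    rw [← coEnd_smul hA, ← coEnd_add, ← coEnd_smul, ← coEnd_add]
  rw [h, map_add, map_mul, evReal_C, evReal_C, evReal_X, ← Algebra.commutes, ← Algebra.smul_def,
    neg_one_smul, ← sub_eq_add_neg]

/-- The sum of `H_k / k!` applied to the identity. -/
theorem hap_sum_hSeq {D : Cochain W} (hD : IsCoder G 0 D) (hD1 : D 1 = 0) (hE : IsCoder G (-1) E)
    {h : Cochain W} (hh : ∀ N, h N = ∑ k ∈ Finset.range (N + 1), ((k.factorial : ℝ)⁻¹) •
      (hSeq (coEnd hD) (coEnd hE) k (idCo G)).val N) {n : ℕ} {l : List (Homog G)} (hl : l.length < n) :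
    hap h l = ∑ k ∈ Finset.range n, ((k.factorial : ℝ)⁻¹) •
      hap (hSeq (coEnd hD) (coEnd hE) k (idCo G)).val l := by
  have hlen := List.length_map (as := l) Homog.val
  rw [hap, lap, hh, Finset.sum_apply]
  refine (Finset.sum_subset (Finset.range_subset_range.2 (by omega)) fun k _ hk => ?_).trans
    (Finset.sum_congr rfl fun k _ => rfl)
  rw [Pi.smul_apply, mem_arityFilt.1 (hSeq_mem hD hD1 hE k idCo_mem) _ (by simp at hk ⊢; omega)]
  exact smul_zero _

theorem isCoder_sum_hSeq {D : Cochain W} (hD : IsCoder G 0 D) (hD1 : D 1 = 0) (hE : IsCoder G (-1) E)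
    {h : Cochain W} (hh : ∀ N, h N = ∑ k ∈ Finset.range (N + 1), ((k.factorial : ℝ)⁻¹) •
      (hSeq (coEnd hD) (coEnd hE) k (idCo G)).val N) : IsCoder G (-1) h := by
  refine ⟨fun N => ?_, fun w => ?_, fun l₁ x y l₂ => ?_, fun l => ?_⟩
  · have := IsMulti.sum (Finset.range (N + 1)) (T := fun k => ((k.factorial : ℝ)⁻¹) •
      (hSeq (coEnd hD) (coEnd hE) k (idCo G)).val N) fun k _ => (SymCo.multi _ N).smul _
    rw [hh]
    convert this using 1
    funext w
    rw [Finset.sum_apply]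
  · rw [hh, Finset.sum_range_one, Pi.smul_apply, (isCoder_hSeq hD hE 0).zero_arity, smul_zero]
  · have hlt : (l₁ ++ y :: x :: l₂).length < (l₁ ++ x :: y :: l₂).length + 1 := by simp
    rw [hap_sum_hSeq hD hD1 hE hh (Nat.lt_succ_self _), hap_sum_hSeq hD hD1 hE hh hlt, Finset.smul_sum]
    refine Finset.sum_congr rfl fun k _ => ?_
    rw [SymCo.symm, smul_comm]
  · rw [hap_sum_hSeq hD hD1 hE hh (Nat.lt_succ_self _)]
    exact Submodule.sum_mem _ fun k _ => Submodule.smul_mem _ _ ((isCoder_hSeq hD hE k).deg l)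

theorem starQ_sum_hSeq {D : Cochain W} (hD : IsCoder G 0 D) (hD1 : D 1 = 0) (hE : IsCoder G (-1) E)
    (hQ : IsCoder G 1 Q) (hQ2 : ∀ N, N ≠ 2 → Q N = 0)
    {h : Cochain W} (hh : ∀ N, h N = ∑ k ∈ Finset.range (N + 1), ((k.factorial : ℝ)⁻¹) •
      (hSeq (coEnd hD) (coEnd hE) k (idCo G)).val N) {n : ℕ} {l : List (Homog G)} (hl : l.length < n) :
    starQ Q h (Cochain.exp G D) l = ∑ k ∈ Finset.range n, ((k.factorial : ℝ)⁻¹) •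
      hap (hSeq (coEnd hD) (coEnd hE) k hQ.toSym).val l := by
  have h1 : ∀ k, hap (hSeq (coEnd hD) (coEnd hE) k hQ.toSym).val l
      = Sh Homog.par l fun p q => ∑ ij ∈ Finset.HasAntidiagonal.antidiagonal k, k.choose ij.1 •
        lap Q [hap (hSeq (coEnd hD) (coEnd hE) ij.1 (idCo G)).val p, hap ((coEnd hD ^ ij.2) (idCo G)).val q] := by
    intro k
    refine (congrFun (hap_hSeq_bracket hD hE hQ hQ2 k) l).trans ?_
    rw [Finset.sum_apply, Sh_sum]
    refine Finset.sum_congr rfl fun ij _ => ?_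
    simp only [← Nat.cast_smul_eq_nsmul ℝ]
    rw [Pi.smul_apply, Sh_smul]; rfl
  simp only [h1, ← Sh_smul]
  rw [← Sh_sum, starQ]
  refine Sh_congr _ fun p q hpq => ?_
  have hlen := hpq.length_eq
  rw [List.length_append] at hlen
  rw [sum_range_sum_antidiagonal (fun i j => lap Q [hap (hSeq (coEnd hD) (coEnd hE) i (idCo G)).val p,
    hap ((coEnd hD ^ j) (idCo G)).val q])]
  · obtain ⟨L, hL⟩ := lap_pair_right hQ.multi (hap h p)
    have e1 : hap (Cochain.exp G D) q
        = ∑ j ∈ Finset.range n, ((j.factorial : ℝ)⁻¹) • hap ((coEnd hD ^ j) (idCo G)).val q := by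
      rw [exp_eq hD hD1, coExpOn_hap hD hD1 _ _ (n := n) (by omega)]
      simp only [coEnd_pow_val]
    rw [hL, e1, map_sum]
    refine Finset.sum_congr rfl fun j _ => ?_
    obtain ⟨L', hL'⟩ := lap_pair_left hQ.multi (hap ((coEnd hD ^ j) (idCo G)).val q)
    rw [map_smul, ← hL, hL', hap_sum_hSeq hD hD1 hE hh (n := n) (by omega), map_sum]
    congr 1
    refine Finset.sum_congr rfl fun i _ => ?_
    rw [map_smul, ← hL']
  · intro i j hij
    refine lap_eq_zero hQ.multi ?_
    by_cases hi : p.length < i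
    · refine List.mem_cons.2 (Or.inl (hap_eq_zero_of_arity ?_).symm)
      exact hSeq_mem hD hD1 hE i idCo_mem _ hi
    · refine List.mem_cons.2 (Or.inr (List.mem_singleton.2 (hap_eq_zero_of_arity ?_).symm))
      exact coEnd_pow_mem hD hD1 j idCo_mem _ (by omega)

theorem homotopic_exp (hA : IsCoder G 0 A) (hA1 : A 1 = 0) (hB : IsCoder G 0 B) (hB1 : B 1 = 0)
    (hE : IsCoder G (-1) E) (hQ : IsCoder G 1 Q) (hQ2 : ∀ N, N ≠ 2 → Q N = 0)
    (hAQ : coEnd hA * coEnd hQ = coEnd hQ * coEnd hA) (hBQ : coEnd hB * coEnd hQ = coEnd hQ * coEnd hB)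
    (hAB : coEnd hB - coEnd hA = coEnd hQ * coEnd hE + coEnd hE * coEnd hQ) :
    Cochain.Homotopic G Q (Cochain.exp G A) (Cochain.exp G B) := by
  have hQ1 : Q 1 = 0 := hQ2 1 (by norm_num)
  set x : Polynomial (Module.End ℝ (SymCo G)) :=
    Polynomial.C (coEnd hA) + Polynomial.C (coEnd hB - coEnd hA) * Polynomial.X with hx
  have hYQ : (coEnd hB - coEnd hA) * coEnd hQ = coEnd hQ * (coEnd hB - coEnd hA) := by
    rw [sub_mul, mul_sub, hAQ, hBQ]
  have hev : ∀ t, evReal t x = coEnd (isCoder_path hA hB t) := coEnd_path hA hB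
  have hexp : ∀ t, Cochain.evalAt (polyCo fun k => x ^ k) t
      = Cochain.exp G (A + t • (B + (-1 : ℝ) • A)) := by
    intro t
    funext N
    rw [evalAt_polyCo, exp_eq (isCoder_path hA hB t) (path_one hA1 hB1 t),
      coExpOn_apply _ (path_one hA1 hB1 t) _ (Nat.lt_succ_self N)]
    refine Finset.sum_congr rfl fun k _ => ?_
    rw [map_pow, hev, coEnd_pow_val]
  have hh : ∀ t N, Cochain.evalAt (polyCo fun k => hSeq x (Polynomial.C (coEnd hE)) k) t N
      = ∑ k ∈ Finset.range (N + 1), ((k.factorial : ℝ)⁻¹) •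
        (hSeq (coEnd (isCoder_path hA hB t)) (coEnd hE) k (idCo G)).val N := by
    intro t N
    rw [evalAt_polyCo]
    refine Finset.sum_congr rfl fun k _ => ?_
    rw [map_hSeq, hev, evReal_C]
  refine ⟨polyCo fun k => x ^ k, polyCo fun k => hSeq x (Polynomial.C (coEnd hE)) k, polyCo_finite _,
    polyCo_finite _, ?_, ?_, fun t => ?_⟩
  · rw [hexp, zero_smul, add_zero]
  · rw [hexp, one_smul, neg_one_smul, add_comm B, add_neg_cancel_left]
  · have hD := isCoder_path hA hB t
    have hD1 : (A + t • (B + (-1 : ℝ) • A)) 1 = 0 := path_one hA1 hB1 t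
    have hDQ : coEnd hD * coEnd hQ = coEnd hQ * coEnd hD := by
      rw [← hev, hx]
      simp only [map_add, map_mul, evReal_C, evReal_X]
      rw [add_mul, mul_add, hAQ, mul_assoc, Algebra.commutes, ← mul_assoc, hYQ, mul_assoc]
    have hH := isCoder_sum_hSeq hD hD1 hE (hh t)
    have hU := isCoder_exp hD hD1
    refine ⟨by rw [hexp]; exact isMorphism_exp hD hD1 hQ hQ1 hDQ, isCoder_iff.2 hH, ?_⟩
    rw [polyCo_derivative, hexp]
    have hder : ∀ N, Cochain.evalAt (polyCo fun k => Polynomial.derivative (x ^ k)) t N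
        = ∑ k ∈ Finset.range (N + 1), ((k.factorial : ℝ)⁻¹) •
          ((coEnd hQ (hSeq (coEnd hD) (coEnd hE) k (idCo G))).val N
            + (hSeq (coEnd hD) (coEnd hE) k hQ.toSym).val N) := by
      intro N
      rw [evalAt_polyCo]
      refine Finset.sum_congr rfl fun k _ => ?_
      rw [derivative_pow_hSeq _ _ _ _ hAQ hYQ hAB, map_add, map_mul, map_mul, map_hSeq, evReal_C, evReal_C,
        ← hx, hev, LinearMap.add_apply, map_add, Module.End.mul_apply, Module.End.mul_apply, coEnd_idCo]
      rfl
    refine cochain_ext (G := G) (fun N => ?_) (fun N =>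
      (isMulti_bracketAlong hQ.multi hH.multi hU.multi N).add (isMulti_preLie hH.multi hQ.multi N)) fun l => ?_
    · rw [hder]
      have := IsMulti.sum (Finset.range (N + 1)) (T := fun k => ((k.factorial : ℝ)⁻¹) •
          ((coEnd hQ (hSeq (coEnd hD) (coEnd hE) k (idCo G))).val N
            + (hSeq (coEnd hD) (coEnd hE) k hQ.toSym).val N)) fun k _ =>
        ((SymCo.multi _ N).add (SymCo.multi _ N)).smul _
      convert this using 1
      funext w
      rw [Finset.sum_apply]
    · rw [hap_add, hap_bracketAlong hQ.multi hH.multi hU.multi hH.zero_arity hU.zero_arity,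
        starQ_sum_hSeq hD hD1 hE hQ hQ2 (hh t) (n := l.length + 2) (by omega), hQ.hap_preLie hH.multi]
      have h1 : ∀ a b, (a ++ b).Perm l →
          hap (Cochain.evalAt (polyCo fun k => hSeq x (Polynomial.C (coEnd hE)) k) t)
            (Homog.app hQ.deg a :: b) = ∑ k ∈ Finset.range (l.length + 2), ((k.factorial : ℝ)⁻¹) •
            hap (hSeq (coEnd hD) (coEnd hE) k (idCo G)).val (Homog.app hQ.deg a :: b) := by
        intro a b hab
        refine hap_sum_hSeq hD hD1 hE (hh t) ?_
        have := hab.length_eq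
        simp only [List.length_append, List.length_cons] at this ⊢
        omega
      rw [Sh_congr _ h1, Sh_sum, ← Finset.sum_add_distrib]
      have h2 : hap (Cochain.evalAt (polyCo fun k => Polynomial.derivative (x ^ k)) t) l
          = ∑ k ∈ Finset.range (l.length + 1), ((k.factorial : ℝ)⁻¹) •
          (hap (coEnd hQ (hSeq (coEnd hD) (coEnd hE) k (idCo G))).val l
            + hap (hSeq (coEnd hD) (coEnd hE) k hQ.toSym).val l) := by
        rw [hap, lap, hder, Finset.sum_apply]
        exact Finset.sum_congr (by rw [List.length_map]) fun k _ => rfl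
      rw [h2, Finset.sum_range_succ _ (l.length + 1)]
      have hz1 := hap_eq_zero_of_arity (G := G) (l := l)
        (mem_arityFilt.1 (hSeq_mem hD hD1 hE (l.length + 1) (f := hQ.toSym)
          (mem_arityFilt.2 fun M hM => hQ2 M (by omega))) l.length (Nat.lt_succ_self _))
      have hz2 := hap_eq_zero_of_arity (G := G) (l := l)
        (mem_arityFilt.1 (coEnd_preserves hQ (hSeq_mem hD hD1 hE (l.length + 1) idCo_mem)) l.length
          (Nat.lt_succ_self _))
      have hz3 : ∀ k, Sh Homog.par l (fun a b => ((k.factorial : ℝ)⁻¹) •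
          hap (hSeq (coEnd hD) (coEnd hE) k (idCo G)).val (Homog.app hQ.deg a :: b))
          = ((k.factorial : ℝ)⁻¹) • hap (coEnd hQ (hSeq (coEnd hD) (coEnd hE) k (idCo G))).val l := by
        intro k
        rw [Sh_smul, coEnd_hap]
      rw [hz3, hz2, hz1, smul_zero, add_zero, add_zero]
      refine Finset.sum_congr rfl fun k _ => ?_
      rw [hz3, smul_add, add_comm]

end poly

theorem smoothDeriv_mul {E : Type*} [NormedAddCommGroup E] [NormedSpace ℝ E]
    {U : TopologicalSpace.Opens E} (v : E) (f g : smoothFun U) :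
    smoothDeriv v (f * g) = smoothDeriv v f * g + f * smoothDeriv v g := by
  ext u
  have hf := (extZero_contDiffAt f u).differentiableAt (by simp)
  have hg := (extZero_contDiffAt g u).differentiableAt (by simp)
  have h : extZero ((f * g : smoothFun U) : U → ℝ)
      = extZero (f : U → ℝ) * extZero (g : U → ℝ) := by
    funext y
    simp only [extZero, Function.extend, Pi.mul_apply]
    split_ifs <;> simp
  change fderiv ℝ (extZero ((f * g : smoothFun U) : U → ℝ)) u v
    = fderiv ℝ (extZero (f : U → ℝ)) u v * (g : U → ℝ) u
      + (f : U → ℝ) u * fderiv ℝ (extZero (g : U → ℝ)) u v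
  rw [h, fderiv_mul hf hg]
  simp only [_root_.add_apply, _root_.smul_apply, extZero_apply,
    smul_eq_mul]
  ring

section exterior
variable {M : Type*} [AddCommGroup M] [Module ℝ M]

theorem contractLeft_mul (φ : Module.Dual ℝ M) (η θ : ExteriorAlgebra ℝ M) :
    CliffordAlgebra.contractLeft (Q := (0 : QuadraticForm ℝ M)) φ (η * θ)
      = CliffordAlgebra.contractLeft (Q := (0 : QuadraticForm ℝ M)) φ η * θ
        + CliffordAlgebra.involute η * CliffordAlgebra.contractLeft (Q := (0 : QuadraticForm ℝ M)) φ θ := by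
  induction η using CliffordAlgebra.left_induction with
  | algebraMap r =>
    simp [CliffordAlgebra.contractLeft_algebraMap, ← Algebra.smul_def]
  | add x y hx hy => simp only [map_add, add_mul, hx, hy]; abel
  | ι_mul x v hx =>
    rw [mul_assoc, CliffordAlgebra.contractLeft_ι_mul, CliffordAlgebra.contractLeft_ι_mul, hx,
      map_mul, CliffordAlgebra.involute_ι]
    simp only [mul_add, sub_mul, smul_mul_assoc, mul_assoc, neg_mul]
    abel

theorem ι_mul_eq (v : M) (θ : ExteriorAlgebra ℝ M) :
    ExteriorAlgebra.ι ℝ v * θ = CliffordAlgebra.involute θ * ExteriorAlgebra.ι ℝ v := by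
  induction θ using CliffordAlgebra.left_induction with
  | algebraMap r => rw [AlgHom.commutes, Algebra.commutes]
  | add x y hx hy => rw [mul_add, map_add, add_mul, hx, hy]
  | ι_mul x w hx =>
    rw [map_mul, CliffordAlgebra.involute_ι, mul_assoc, ← hx, ← mul_assoc, ← mul_assoc, neg_mul]
    congr 1
    exact eq_neg_of_add_eq_zero_left (ExteriorAlgebra.ι_add_mul_swap _ _)

theorem exterior_mul_comm (η θ : ExteriorAlgebra ℝ M) :
    (2 : ℝ) • (η * θ) = θ * η + θ * CliffordAlgebra.involute η + CliffordAlgebra.involute θ * η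
      - CliffordAlgebra.involute θ * CliffordAlgebra.involute η := by
  induction η using CliffordAlgebra.left_induction with
  | algebraMap r =>
    simp only [AlgHom.commutes, ← Algebra.commutes r, two_smul]
    abel
  | add x y hx hy => rw [add_mul, smul_add, hx, hy]; simp only [map_add, mul_add]; abel
  | ι_mul x v hx =>
    have h1 : ∀ z y : ExteriorAlgebra ℝ M, CliffordAlgebra.ι (0 : QuadraticForm ℝ M) v * (z * y)
        = CliffordAlgebra.involute z * (CliffordAlgebra.ι (0 : QuadraticForm ℝ M) v * y) := by
      intro z y
      rw [← mul_assoc, ← mul_assoc]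
      exact congrArg (· * y) (ι_mul_eq v z)
    rw [mul_assoc, ← mul_smul_comm, hx, map_mul, CliffordAlgebra.involute_ι]
    simp only [mul_add, mul_sub, h1, CliffordAlgebra.involute_involute, neg_mul, mul_neg]
    abel

end exterior

namespace NPDomain
variable {n : ℕ} (V : NPDomain n)

theorem pureFn_mul (f f' P P' η η') :
    V.pureFn f P η * V.pureFn f' P' η' = V.pureFn (f * f') (P * P') (η * η') := by
  refine (Algebra.TensorProduct.tmul_mul_tmul (A := smoothFun V.U) f f' (P ⊗ₜ[ℝ] η)
    (P' ⊗ₜ[ℝ] η')).trans ?_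
  rw [Algebra.TensorProduct.tmul_mul_tmul]
  rfl

theorem pureFn_one : V.pureFn 1 1 1 = 1 := rfl

theorem pureFn_add (f P η η') : V.pureFn f P (η + η') = V.pureFn f P η + V.pureFn f P η' :=
  map_add ((TensorProduct.mk ℝ _ _ f).comp (TensorProduct.mk ℝ _ _ P)) _ _

theorem pureFn_smul (f P) (r : ℝ) (η) : V.pureFn f P (r • η) = r • V.pureFn f P η :=
  map_smul ((TensorProduct.mk ℝ _ _ f).comp (TensorProduct.mk ℝ _ _ P)) _ _

theorem pureFn_add_mid (f P P' η) : V.pureFn f (P + P') η = V.pureFn f P η + V.pureFn f P' η :=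
  map_add ((TensorProduct.mk ℝ _ _ f).comp ((TensorProduct.mk ℝ _ _).flip η)) _ _

theorem pureFn_smul_mid (f) (r : ℝ) (P η) : V.pureFn f (r • P) η = r • V.pureFn f P η :=
  map_smul ((TensorProduct.mk ℝ _ _ f).comp ((TensorProduct.mk ℝ _ _).flip η)) _ _

theorem pureFn_add_left (f f' P η) : V.pureFn (f + f') P η = V.pureFn f P η + V.pureFn f' P η :=
  TensorProduct.add_tmul _ _ _

/-- Bilinear maps agree if they agree on products of functions of the separate coordinates. -/
theorem bilin_ext {M : Type*} [AddCommGroup M] [Module ℝ M] {F G : V.Fn →ₗ[ℝ] V.Fn →ₗ[ℝ] M}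
    (h : ∀ f P η f' P' η', F (V.pureFn f P η) (V.pureFn f' P' η')
      = G (V.pureFn f P η) (V.pureFn f' P' η')) : F = G :=
  V.end_ext fun f P η => V.end_ext fun f' P' η' => h f P η f' P' η'

theorem par_mul (f g : V.Fn) : V.par (f * g) = V.par f * V.par g := by
  have h := V.bilin_ext (F := (LinearMap.mul ℝ V.Fn).compr₂ V.par)
    (G := (LinearMap.mul ℝ V.Fn).compl₁₂ V.par V.par) fun f P η f' P' η' => by
      simp only [LinearMap.compr₂_apply, LinearMap.compl₁₂_apply, LinearMap.mul_apply',
        pureFn_mul, par_pureFn, map_mul]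
  exact LinearMap.congr_fun₂ h f g

theorem par_one : V.par 1 = 1 := by
  rw [← pureFn_one, par_pureFn, map_one]

theorem par_pow_mul (f g : V.Fn) (k : ℕ) : (V.par ^ k) (f * g) = (V.par ^ k) f * (V.par ^ k) g := by
  induction k with
  | zero => rfl
  | succ k ih => rw [pow_succ', Module.End.mul_apply, ih, par_mul]; rfl

theorem par_pow_one (k : ℕ) : (V.par ^ k) 1 = 1 := by
  induction k with
  | zero => rfl
  | succ k ih => rw [pow_succ', Module.End.mul_apply, ih, par_one]

theorem deriv_one (I : V.Crd) : V.deriv I 1 = 0 := by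
  have h3 : ∀ f P, V.pureFn f P 0 = 0 := fun f P =>
    map_zero ((TensorProduct.mk ℝ _ _ f).comp (TensorProduct.mk ℝ _ _ P))
  rw [← pureFn_one, deriv]
  split_ifs with h0 h1
  · have h2 := smoothDeriv_mul (Pi.single ⟨I, h0⟩ 1) (1 : smoothFun V.U) 1
    simp only [mul_one, one_mul, left_eq_add] at h2
    rw [tensorMap_pureFn, h2]
    exact TensorProduct.zero_tmul _ _
  · rw [tensorMap_pureFn, CliffordAlgebra.contractLeft_one, h3]
  · rw [tensorMap_pureFn]
    refine (congrArg (fun P => V.pureFn _ P _) (MvPolynomial.pderiv_one)).trans ?_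
    exact map_zero ((TensorProduct.mk ℝ _ _ _).comp ((TensorProduct.mk ℝ _ _).flip _))

theorem deriv_mul (I : V.Crd) (f g : V.Fn) :
    V.deriv I (f * g) = V.deriv I f * g + (V.par ^ I.deg) f * V.deriv I g := by
  have hodd : Odd I.deg → V.par ^ I.deg = V.par := fun ⟨k, hk⟩ => by
    rw [hk, pow_succ, pow_mul, pow_two, par_mul_par, one_pow, one_mul]
  have heven : ¬ Odd I.deg → V.par ^ I.deg = 1 := fun h => by
    obtain ⟨k, hk⟩ := Nat.not_odd_iff_even.1 h
    rw [hk, ← two_mul, pow_mul, pow_two, par_mul_par, one_pow]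
  have h := V.bilin_ext (F := (LinearMap.mul ℝ V.Fn).compr₂ (V.deriv I))
    (G := (LinearMap.mul ℝ V.Fn).compl₁₂ (V.deriv I) LinearMap.id
      + (LinearMap.mul ℝ V.Fn).compl₁₂ (V.par ^ I.deg) (V.deriv I)) fun f P η f' P' η' => by
      simp only [LinearMap.compr₂_apply, LinearMap.compl₁₂_apply, LinearMap.mul_apply',
        LinearMap.add_apply, LinearMap.id_apply]
      by_cases h0 : I.deg = 0
      · rw [heven (by simp [h0])]
        simp only [deriv, h0, dif_pos, pureFn_mul, tensorMap_pureFn, smoothDeriv_mul,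
          pureFn_add_left, Module.End.one_apply, LinearMap.id_apply]
      by_cases h1 : Odd I.deg
      · rw [hodd h1]
        simp only [deriv, h0, h1, dif_pos, dif_neg, not_false_eq_true, pureFn_mul,
          tensorMap_pureFn, contractLeft_mul, pureFn_add, par_pureFn, LinearMap.id_apply]
      · rw [heven h1]
        simp only [deriv, h0, h1, dif_neg, not_false_eq_true, pureFn_mul, tensorMap_pureFn,
          Module.End.one_apply, LinearMap.id_apply]
        rw [← pureFn_add_mid]
        congr 1
        refine (Derivation.leibniz _ P P').trans ?_
        simp only [smul_eq_mul]
        rw [add_comm, mul_comm P']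
        rfl
  exact LinearMap.congr_fun₂ h f g

theorem mul_comm_two (f g : V.Fn) :
    (2 : ℝ) • (f * g) = g * f + g * V.par f + V.par g * f - V.par g * V.par f := by
  have h := V.bilin_ext (F := (2 : ℝ) • LinearMap.mul ℝ V.Fn)
    (G := (LinearMap.mul ℝ V.Fn).flip + (LinearMap.mul ℝ V.Fn).flip.compl₁₂ V.par LinearMap.id
      + (LinearMap.mul ℝ V.Fn).flip.compl₁₂ LinearMap.id V.par
      - (LinearMap.mul ℝ V.Fn).flip.compl₁₂ V.par V.par) fun f P η f' P' η' => by
      simp only [LinearMap.compl₁₂_apply, LinearMap.mul_apply', LinearMap.flip_apply,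
        LinearMap.add_apply, LinearMap.sub_apply, LinearMap.smul_apply, LinearMap.id_apply,
        par_pureFn, pureFn_mul]
      rw [← pureFn_smul, exterior_mul_comm, mul_comm f, mul_comm P, sub_eq_add_neg, pureFn_add,
        pureFn_add, pureFn_add, pureFn_neg, ← sub_eq_add_neg]
  exact LinearMap.congr_fun₂ h f g

/-- Homogeneity with respect to the parity operator. -/
def HasPar (a : ZMod 2) (f : V.Fn) : Prop := V.par f = sg a • f

variable {V}

theorem HasPar.mul_eq {a : ZMod 2} {f : V.Fn} (hf : V.HasPar a f) (g : V.Fn) :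
    f * g = (V.par ^ a.val) g * f := by
  have h := V.mul_comm_two f g
  have h2 : (2 : ℝ) ≠ 0 := two_ne_zero
  refine smul_right_injective V.Fn h2 (h.trans ?_)
  change _ = (2 : ℝ) • _
  have ha := (by decide : ∀ a : ZMod 2, a = 0 ∨ a = 1) a
  rw [hf, two_smul]
  rcases ha with rfl | rfl
  · rw [sg_zero, one_smul, ZMod.val_zero, pow_zero, Module.End.one_apply]
    abel
  · have : sg 1 = -1 := by simp [sg]
    rw [this, neg_one_smul, ZMod.val_one, pow_one, mul_neg, mul_neg]
    abel

protected theorem HasPar.mul_comm {a b : ZMod 2} {f g : V.Fn} (hf : V.HasPar a f) (hg : V.HasPar b g) :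
    f * g = sg (a * b) • (g * f) := by
  rw [hf.mul_eq, ← smul_mul_assoc]
  congr 1
  have ha := (by decide : ∀ a : ZMod 2, a = 0 ∨ a = 1) a
  rcases ha with rfl | rfl
  · rw [ZMod.val_zero, zero_mul, sg_zero, one_smul, pow_zero, Module.End.one_apply]
  · rw [ZMod.val_one, pow_one, hg, one_mul]

protected theorem HasPar.mul {a b : ZMod 2} {f g : V.Fn} (hf : V.HasPar a f) (hg : V.HasPar b g) :
    V.HasPar (a + b) (f * g) := by
  rw [HasPar, par_mul, hf, hg, smul_mul_smul_comm, sg_add]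

theorem HasPar.par_pow {a : ZMod 2} {f : V.Fn} (hf : V.HasPar a f) (k : ℕ) :
    (V.par ^ k) f = sg (k * a) • f := by
  induction k with
  | zero => simp
  | succ k ih =>
    rw [pow_succ', Module.End.mul_apply, ih, map_smul, hf, smul_smul, ← sg_add]
    congr 2
    push_cast
    ring

theorem HasPar.deriv {a : ZMod 2} {f : V.Fn} (hf : V.HasPar a f) (I : V.Crd) :
    V.HasPar ((I.deg : ZMod 2) + a) (V.deriv I f) := by
  have h := LinearMap.congr_fun (V.deriv_mul_par I) f
  rw [LinearMap.smul_apply, Module.End.mul_apply, Module.End.mul_apply, hf, map_smul] at h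
  rw [HasPar, sg_add, mul_smul, h, smul_smul, sg_natCast, ← mul_pow]
  simp

theorem hasPar_of_piece {k : ℤ} {f : V.Fn} (hf : f ∈ V.piece k) : V.HasPar (k : ZMod 2) f := by
  rw [HasPar, V.par_piece k f hf, sg_intCast]

variable (V)

/-- A linear map is determined by its values on elements of definite parity. -/
theorem par_ext {M : Type*} [AddCommGroup M] [Module ℝ M] {F G : V.Fn →ₗ[ℝ] M}
    (h : ∀ a f, V.HasPar a f → F f = G f) : F = G := by
  have h1 : ∀ f : V.Fn, V.HasPar 0 (f + V.par f) ∧ V.HasPar 1 (f - V.par f) := by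
    intro f
    have h2 : V.par (V.par f) = f := LinearMap.congr_fun V.par_mul_par f
    have h3 : sg 1 = -1 := by simp [sg]
    constructor
    · rw [HasPar, map_add, h2, sg_zero, one_smul, add_comm]
    · rw [HasPar, map_sub, h2, h3, neg_one_smul, neg_sub]
  ext f
  have e : f = (1 / 2 : ℝ) • ((f + V.par f) + (f - V.par f)) := by
    rw [add_add_sub_cancel, ← two_smul ℝ f, smul_smul]; norm_num
  have e2 : ∀ H : V.Fn →ₗ[ℝ] M, H f = (1 / 2 : ℝ) • (H (f + V.par f) + H (f - V.par f)) :=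
    fun H => by rw [← map_add, ← map_smul, ← e]
  rw [e2 F, e2 G, h _ _ (h1 f).1, h _ _ (h1 f).2]

end NPDomain

/-- Moving a factor to its place in an ordered product. -/
theorem mul_ofFn_prod {A : Type*} [Monoid A] {L : ℕ} (y y' : Fin L → A) (F z : A) (i : Fin L)
    (h : ∀ j < i, F * y j = y' j * F) (hi : F * y i = z) :
    F * (List.ofFn y).prod
      = (List.ofFn fun j => if j < i then y' j else if j = i then z else y j).prod := by
  induction L with
  | zero => exact i.elim0
  | succ L ih =>
    rw [List.ofFn_succ, List.ofFn_succ, List.prod_cons, List.prod_cons, ← mul_assoc]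
    cases i using Fin.cases with
    | zero => simp [hi, Fin.succ_ne_zero]
    | succ i =>
      rw [h 0 (Fin.succ_pos i), mul_assoc,
        ih (fun j => y j.succ) (fun j => y' j.succ) i
          (fun j hj => h _ (Fin.succ_lt_succ_iff.2 hj)) hi]
      simp

namespace NPDomain
variable {n : ℕ} (V : NPDomain n)

/-- The tensor powers of the algebra of functions. -/
abbrev Tens (N : ℕ) : Type := ⨂[ℝ] _ : Fin N, V.Fn

theorem par_pow_congr {p q : ℕ} (h : (p : ZMod 2) = q) : V.par ^ p = V.par ^ q := by
  have key : ∀ p : ℕ, V.par ^ p = V.par ^ (p % 2) := fun p => by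
    conv_lhs => rw [← Nat.div_add_mod p 2, pow_add, pow_mul, pow_two, par_mul_par, one_pow, one_mul]
  rw [key p, key q, (ZMod.natCast_eq_natCast_iff' p q 2).1 h]

/-- The operator `X` of parity `p` in the tensor factor `k`, with its Koszul sign. -/
def slotOp {N : ℕ} (p : ℕ) (k : Fin N) : Module.End ℝ V.Fn →ₗ[ℝ] Module.End ℝ (V.Tens N) :=
  (PiTensorProduct.mapMultilinear ℝ (fun _ : Fin N => V.Fn) fun _ => V.Fn).toLinearMap
    (fun u => if u < k then V.par ^ p else LinearMap.id) k

theorem slotOp_apply {N : ℕ} (p : ℕ) (k : Fin N) (X : Module.End ℝ V.Fn) :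
    V.slotOp p k X = PiTensorProduct.map fun u =>
      if u < k then V.par ^ p else if u = k then X else LinearMap.id := by
  rw [slotOp, MultilinearMap.toLinearMap_apply, PiTensorProduct.mapMultilinear_apply]
  congr 1
  funext u
  by_cases h : u = k
  · subst h; simp
  · simp [h]

theorem slotDeriv_eq {N : ℕ} (I : V.Crd) (k : Fin N) :
    V.slotDeriv I k = V.slotOp I.deg k (V.deriv I) := (V.slotOp_apply _ _ _).symm

theorem slotOp_tprod {N : ℕ} (p : ℕ) (k : Fin N) (X : Module.End ℝ V.Fn) (w : Fin N → V.Fn) :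
    V.slotOp p k X (PiTensorProduct.tprod ℝ w) = PiTensorProduct.tprod ℝ fun u =>
      if u < k then (V.par ^ p) (w u) else if u = k then X (w u) else w u := by
  rw [slotOp_apply, PiTensorProduct.map_tprod]
  congr 1
  funext u
  split_ifs <;> rfl

theorem slotOp_congr {N : ℕ} {p q : ℕ} (h : (p : ZMod 2) = q) (k : Fin N) :
    V.slotOp p k = V.slotOp q k := by
  unfold slotOp
  rw [V.par_pow_congr h]

theorem slotOp_mul_self {N : ℕ} (p q : ℕ) (k : Fin N) (X Y : Module.End ℝ V.Fn) :
    V.slotOp p k X * V.slotOp q k Y = V.slotOp (p + q) k (X * Y) := by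
  rw [slotOp_apply, slotOp_apply, slotOp_apply, ← PiTensorProduct.map_mul]
  congr 1
  funext u
  split_ifs
  · rw [pow_add]
  · rfl
  · rfl

theorem slotOp_mul_of_lt {N : ℕ} (p q : ℕ) {k l : Fin N} (hkl : k < l) (X Y : Module.End ℝ V.Fn)
    {s : ℝ} (hX : X * V.par ^ q = s • (V.par ^ q * X)) :
    V.slotOp p k X * V.slotOp q l Y = s • (V.slotOp q l Y * V.slotOp p k X) := by
  rw [slotOp_apply, slotOp_apply, ← PiTensorProduct.map_mul, ← PiTensorProduct.map_mul]
  refine V.map_smul_slot _ _ k _ ?_ ?_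
  · simp only [lt_self_iff_false, if_false, if_true, hkl]
    exact hX
  · intro u hu
    by_cases h1 : u < k
    · simp [h1, h1.trans hkl, ← pow_add, add_comm]
    · simp only [h1, hu, if_false]
      exact (one_mul _).trans (mul_one _).symm

theorem slotOp_comm {N : ℕ} (p q : ℕ) {k l : Fin N} (hkl : k ≠ l) (X Y : Module.End ℝ V.Fn)
    (hX : X * V.par ^ q = sg (p * q) • (V.par ^ q * X))
    (hY : Y * V.par ^ p = sg (p * q) • (V.par ^ p * Y)) :
    V.slotOp p k X * V.slotOp q l Y = sg (p * q) • (V.slotOp q l Y * V.slotOp p k X) := by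
  rcases hkl.lt_or_gt with h | h
  · exact V.slotOp_mul_of_lt p q h X Y hX
  · rw [V.slotOp_mul_of_lt q p h Y X hY, smul_smul, sg_mul_self, one_smul]

/-- Multiplication in the tensor factor `k`. -/
def slotMul {N : ℕ} (k : Fin N) : V.Fn →ₗ[ℝ] Module.End ℝ (V.Tens N) :=
  ∑ e : ZMod 2, V.slotOp e.val k ∘ₗ LinearMap.mul ℝ V.Fn ∘ₗ V.grading.componentL e

variable {V}

theorem HasPar.component {a : ZMod 2} {f : V.Fn} (hf : V.HasPar a f) (e : ZMod 2) :
    V.grading.componentL e f = if a = e then f else 0 := by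
  have h1 : (if e = 0 then (1 : ℝ) else -1) = sg e := by
    have he := (by decide : ∀ a : ZMod 2, a = 0 ∨ a = 1) e
    rcases he with rfl | rfl <;> simp [sg]
  change (1 / 2 : ℝ) • (f + (if e = 0 then (1 : ℝ) else -1) • V.par f) = _
  rw [h1, hf, smul_smul, ← sg_add]
  split_ifs with h
  · rw [h, (by decide : ∀ e : ZMod 2, e + e = 0) e, sg_zero, one_smul, ← two_smul ℝ f, smul_smul]
    norm_num
  · rw [(by decide : ∀ a e : ZMod 2, a ≠ e → e + a = 1) a e h]
    simp [sg]

theorem HasPar.slotMul_eq {N : ℕ} {a : ZMod 2} {f : V.Fn} (hf : V.HasPar a f) (k : Fin N) :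
    V.slotMul k f = V.slotOp a.val k (LinearMap.mulLeft ℝ f) := by
  simp only [slotMul, LinearMap.sum_apply, LinearMap.comp_apply, hf.component, apply_ite, map_zero]
  rw [Finset.sum_ite_eq Finset.univ a, if_pos (Finset.mem_univ a)]
  rfl

theorem HasPar.mulLeft_par_pow {a : ZMod 2} {f : V.Fn} (hf : V.HasPar a f) (q : ℕ) :
    LinearMap.mulLeft ℝ f * V.par ^ q = sg (a * q) • (V.par ^ q * LinearMap.mulLeft ℝ f) := by
  ext g
  simp only [Module.End.mul_apply, LinearMap.mulLeft_apply, LinearMap.smul_apply]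
  rw [par_pow_mul, hf.par_pow, smul_mul_assoc, smul_smul, mul_comm (q : ZMod 2), sg_mul_self,
    one_smul]

theorem val_cast (a : ZMod 2) : ((a.val : ℕ) : ZMod 2) = a := ZMod.natCast_zmod_val a

theorem HasPar.slotMul_comm_of_ne {N : ℕ} {a b : ZMod 2} {f g : V.Fn} (hf : V.HasPar a f)
    (hg : V.HasPar b g) {k l : Fin N} (hkl : k ≠ l) :
    V.slotMul k f * V.slotMul l g = sg (a * b) • (V.slotMul l g * V.slotMul k f) := by
  have h := V.slotOp_comm a.val b.val hkl (LinearMap.mulLeft ℝ f) (LinearMap.mulLeft ℝ g)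
  rw [hf.slotMul_eq, hg.slotMul_eq]
  simp only [val_cast] at h
  refine h ?_ ?_
  · rw [hf.mulLeft_par_pow, val_cast]
  · rw [hg.mulLeft_par_pow, val_cast, mul_comm]

variable (V)

theorem slotMul_mul_self {N : ℕ} (k : Fin N) (f g : V.Fn) :
    V.slotMul k f * V.slotMul k g = V.slotMul k (f * g) := by
  have h : (LinearMap.mul ℝ (Module.End ℝ (V.Tens N))).compl₁₂ (V.slotMul k) (V.slotMul k)
      = (LinearMap.mul ℝ V.Fn).compr₂ (V.slotMul k) := by
    refine V.par_ext fun a f hf => V.par_ext fun b g hg => ?_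
    simp only [LinearMap.compr₂_apply, LinearMap.compl₁₂_apply, LinearMap.mul_apply']
    rw [hf.slotMul_eq, hg.slotMul_eq, (hf.mul hg).slotMul_eq, slotOp_mul_self]
    rw [V.slotOp_congr (p := a.val + b.val) (q := (a + b).val)
      (by rw [Nat.cast_add, val_cast, val_cast, val_cast])]
    congr 1
    ext z
    exact (mul_assoc f g z).symm
  exact LinearMap.congr_fun₂ h f g

variable {V} in
theorem HasPar.slotMul_comm {N : ℕ} {a b : ZMod 2} {f g : V.Fn} (hf : V.HasPar a f)
    (hg : V.HasPar b g) (k l : Fin N) :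
    V.slotMul k f * V.slotMul l g = sg (a * b) • (V.slotMul l g * V.slotMul k f) := by
  by_cases h : k = l
  · subst h
    rw [slotMul_mul_self, slotMul_mul_self, hf.mul_comm hg, map_smul]
  · exact hf.slotMul_comm_of_ne hg h

variable {V} in
theorem HasPar.slotMul_mul {N : ℕ} {a : ZMod 2} {f : V.Fn} (hf : V.HasPar a f) (g : V.Fn)
    (k l : Fin N) :
    V.slotMul k f * V.slotMul l g = V.slotMul l ((V.par ^ a.val) g) * V.slotMul k f := by
  have h : LinearMap.mulLeft ℝ (V.slotMul k f) ∘ₗ V.slotMul l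
      = LinearMap.mulRight ℝ (V.slotMul k f) ∘ₗ V.slotMul l ∘ₗ (V.par ^ a.val) := by
    refine V.par_ext fun b g hg => ?_
    simp only [LinearMap.comp_apply, LinearMap.mulLeft_apply, LinearMap.mulRight_apply]
    rw [hf.slotMul_comm hg, hg.par_pow, val_cast, map_smul, smul_mul_assoc]
  exact LinearMap.congr_fun h g

theorem slotMul_one {N : ℕ} (k : Fin N) : V.slotMul k 1 = 1 := by
  have h : V.HasPar 0 1 := by rw [HasPar, par_one, sg_zero, one_smul]
  rw [h.slotMul_eq, slotOp_apply]
  have : (fun u => if u < k then V.par ^ (ZMod.val (0 : ZMod 2)) else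
      if u = k then LinearMap.mulLeft ℝ (1 : V.Fn) else LinearMap.id) = fun _ => LinearMap.id := by
    funext u
    rw [ZMod.val_zero, pow_zero, LinearMap.mulLeft_one]
    split_ifs <;> rfl
  rw [this]
  exact PiTensorProduct.map_id

theorem slotDeriv_slotMul {N : ℕ} (I : V.Crd) (k l : Fin N) (f : V.Fn) :
    V.slotDeriv I k * V.slotMul l f = (if l = k then V.slotMul l (V.deriv I f) else 0)
      + V.slotMul l ((V.par ^ I.deg) f) * V.slotDeriv I k := by
  have h : LinearMap.mulLeft ℝ (V.slotDeriv I k) ∘ₗ V.slotMul l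
      = (if l = k then V.slotMul l ∘ₗ V.deriv I else 0)
        + LinearMap.mulRight ℝ (V.slotDeriv I k) ∘ₗ V.slotMul l ∘ₗ (V.par ^ I.deg) := by
    refine V.par_ext fun a f hf => ?_
    simp only [LinearMap.comp_apply, LinearMap.mulLeft_apply, LinearMap.mulRight_apply,
      LinearMap.add_apply]
    rw [hf.par_pow, map_smul, smul_mul_assoc, slotDeriv_eq, hf.slotMul_eq]
    split_ifs with hkl
    · subst hkl
      rw [LinearMap.comp_apply, (hf.deriv I).slotMul_eq, slotOp_mul_self, slotOp_mul_self,
        add_comm a.val, V.slotOp_congr (p := ZMod.val ((I.deg : ZMod 2) + a)) (q := I.deg + a.val)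
          (by rw [Nat.cast_add, val_cast, val_cast]), ← map_smul, ← map_add]
      congr 1
      ext g
      simp only [Module.End.mul_apply, LinearMap.mulLeft_apply, LinearMap.add_apply,
        LinearMap.smul_apply]
      rw [deriv_mul, hf.par_pow, smul_mul_assoc]
    · rw [LinearMap.zero_apply, zero_add]
      have h2 := V.slotOp_comm I.deg a.val (Ne.symm hkl) (V.deriv I) (LinearMap.mulLeft ℝ f)
      rw [val_cast] at h2
      refine h2 ?_ ?_
      · rw [deriv_mul_par_pow, ← sg_natCast, Nat.cast_mul, val_cast]
      · rw [hf.mulLeft_par_pow, mul_comm a]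
  have h3 := LinearMap.congr_fun h f
  simp only [LinearMap.comp_apply, LinearMap.mulLeft_apply, LinearMap.mulRight_apply,
      LinearMap.add_apply] at h3
  rw [h3]
  split_ifs <;> rfl

/-- The unit of the tensor power. -/
def tensOne (N : ℕ) : V.Tens N := PiTensorProduct.tprod ℝ fun _ => 1

theorem slotDeriv_tensOne {N : ℕ} (I : V.Crd) (k : Fin N) : V.slotDeriv I k (V.tensOne N) = 0 := by
  rw [slotDeriv_eq, tensOne, slotOp_tprod]
  exact (PiTensorProduct.tprod ℝ).map_coord_zero k (by simp [deriv_one])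

theorem slotMul_tprod_one {N : ℕ} (k : Fin N) (f : V.Fn) (w : Fin N → V.Fn) (hw : ∀ u ≤ k, w u = 1) :
    V.slotMul k f (PiTensorProduct.tprod ℝ w) = PiTensorProduct.tprod ℝ (Function.update w k f) := by
  have h : LinearMap.applyₗ (PiTensorProduct.tprod ℝ w) ∘ₗ V.slotMul k
      = (PiTensorProduct.tprod ℝ).toLinearMap w k := by
    refine V.par_ext fun a f hf => ?_
    simp only [LinearMap.comp_apply, LinearMap.applyₗ_apply_apply, MultilinearMap.toLinearMap_apply]
    rw [hf.slotMul_eq, slotOp_tprod]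
    congr 1
    funext u
    split_ifs with h1 h2
    · rw [Function.update_of_ne h1.ne, hw u h1.le, par_pow_one]
    · subst h2
      rw [Function.update_self, hw u le_rfl, LinearMap.mulLeft_apply, mul_one]
    · rw [Function.update_of_ne h2]
  exact LinearMap.congr_fun h f

theorem tprod_eq_slotMul {N : ℕ} (w : Fin N → V.Fn) :
    (List.ofFn fun i => V.slotMul i (w i)).prod (V.tensOne N) = PiTensorProduct.tprod ℝ w := by
  have key : ∀ i ≤ N, ((List.ofFn fun i => V.slotMul i (w i)).drop i).prod (V.tensOne N)
      = PiTensorProduct.tprod ℝ fun u : Fin N => if (u : ℕ) < i then 1 else w u := by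
    intro i hi
    induction hi using Nat.decreasingInduction with
    | self =>
      rw [List.drop_of_length_le (by simp), List.prod_nil]
      simp [tensOne]
    | of_succ i hi ih =>
      have hi' : i < N := hi
      rw [List.drop_eq_getElem_cons (by simpa using hi'), List.prod_cons, Module.End.mul_apply, ih,
        List.getElem_ofFn, slotMul_tprod_one]
      · congr 1
        funext u
        by_cases hu : u = ⟨i, hi'⟩
        · subst hu; simp
        · have : (u : ℕ) ≠ i := fun h => hu (Fin.ext h)
          have h2 : (u : ℕ) < i + 1 ↔ (u : ℕ) < i := by omega
          simp only [Function.update_of_ne hu, h2]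
      · intro u hu
        rw [if_pos (Nat.lt_succ_of_le hu)]
  simpa using key 0 (Nat.zero_le N)

theorem mulN_tprod {N : ℕ} (w : Fin N → V.Fn) :
    V.mulN N (PiTensorProduct.tprod ℝ w) = (List.ofFn w).prod := by
  rw [mulN, PiTensorProduct.lift.tprod, MultilinearMap.mkPiAlgebraFin_apply]

theorem mulN_slotMul {N : ℕ} (k : Fin N) (f : V.Fn) (x : V.Tens N) :
    V.mulN N (V.slotMul k f x) = f * V.mulN N x := by
  have h : (V.slotMul k).compr₂ (V.mulN N) = (LinearMap.mul ℝ V.Fn).compl₂ (V.mulN N) := by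
    refine V.par_ext fun a f hf => PiTensorProduct.ext (MultilinearMap.ext fun w => ?_)
    simp only [LinearMap.compMultilinearMap_apply, LinearMap.compr₂_apply, LinearMap.compl₂_apply,
      LinearMap.mul_apply']
    rw [hf.slotMul_eq, slotOp_tprod, mulN_tprod, mulN_tprod,
      mul_ofFn_prod w (fun j => (V.par ^ a.val) (w j)) f (f * w k) k (fun j _ => hf.mul_eq (w j)) rfl]
    congr 2
    funext u
    split_ifs with h1 h2
    · rfl
    · subst h2; rfl
    · rfl
  exact LinearMap.congr_fun₂ h f x

end NPDomain

/-- Reordering an ordered product of elements that commute up to signs. -/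
theorem ofFn_prod_eq_koszul {A : Type*} [Ring A] [Algebra ℝ A] {L : ℕ} (x : Fin L → A)
    (a : Fin L → ZMod 2) (h : ∀ i j, x i * x j = sg (a i * a j) • (x j * x i)) (P : Fin L → Prop)
    [DecidablePred P] :
    (List.ofFn x).prod = koszul (fun i => if P i then 0 else 1) a •
      ((blk P x).prod * (blk (fun i => ¬ P i) x).prod) := by
  induction L with
  | zero => simp [koszul, blk_zero]
  | succ L ih =>
    have key : ∀ l : List (Fin L), x 0 * (l.map fun i => x i.succ).prod
        = sg (a 0 * (l.map fun i => a i.succ).sum) • ((l.map fun i => x i.succ).prod * x 0) := by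
      intro l
      induction l with
      | nil => simp
      | cons i l ihl =>
        simp only [List.map_cons, List.prod_cons, List.sum_cons]
        rw [← mul_assoc, h, smul_mul_assoc, mul_assoc, ihl, mul_smul_comm, smul_smul, ← sg_add,
          mul_add, mul_assoc]
    rw [List.ofFn_succ, List.prod_cons,
      ih (fun i => x i.succ) (fun i => a i.succ) (fun i j => h _ _) (fun i => P i.succ),
      koszul_succ, blk_succ, blk_succ (fun i => ¬ P i)]
    by_cases h0 : P 0
    · simp [h0, mul_assoc]
    · have h1 := key ((List.finRange L).filter fun i => P i.succ)
      have h2 : sg (a 0 * ∑ b : Fin L with (if P b.succ then 0 else 1) < (if P 0 then 0 else 1), a b.succ)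
          = sg (a 0 * (((List.finRange L).filter fun i => P i.succ).map fun i => a i.succ).sum) := by
        have h3 := lpar_blk (X := ZMod 2) id (fun i : Fin L => P i.succ) (fun i => a i.succ)
        rw [lpar, List.map_id, blk] at h3
        rw [h3]
        congr 2
        refine Finset.sum_congr (Finset.filter_congr fun i _ => ?_) fun _ _ => rfl
        by_cases hi : P i.succ <;> simp [h0, hi]
      rw [h2]
      simp only [h0, if_false, not_false_eq_true, if_true, List.prod_cons]
      rw [mul_smul_comm, ← mul_assoc, show (blk (fun i => P i.succ) fun i => x i.succ)
        = ((List.finRange L).filter fun i => P i.succ).map fun i => x i.succ from rfl, h1,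
        smul_mul_assoc, smul_smul, mul_comm (koszul _ _), mul_assoc]

namespace NPDomain
variable {n : ℕ} (V : NPDomain n)

/-- `w_0 ⊗ … ⊗ w_{L-1}` multiplied into `z`, the `i`-th function into the tensor factor `c i`. -/
def slotProd {L M : ℕ} (c : Fin L → Fin M) (z : V.Tens M) : V.Tens L →ₗ[ℝ] V.Tens M :=
  LinearMap.applyₗ z ∘ₗ PiTensorProduct.lift
    ((MultilinearMap.mkPiAlgebraFin ℝ L (Module.End ℝ (V.Tens M))).compLinearMap
      fun i => V.slotMul (c i))

theorem slotProd_tprod {L M : ℕ} (c : Fin L → Fin M) (z : V.Tens M) (w : Fin L → V.Fn) :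
    V.slotProd c z (PiTensorProduct.tprod ℝ w)
      = (List.ofFn fun i => V.slotMul (c i) (w i)).prod z := by
  rw [slotProd, LinearMap.comp_apply, PiTensorProduct.lift.tprod,
    MultilinearMap.compLinearMap_apply, MultilinearMap.mkPiAlgebraFin_apply]
  rfl

theorem slotProd_id {M : ℕ} (x : V.Tens M) : V.slotProd (fun i => i) (V.tensOne M) x = x := by
  have h : V.slotProd (fun i => i) (V.tensOne M) = LinearMap.id :=
    PiTensorProduct.ext (MultilinearMap.ext fun w => by
      simp only [LinearMap.compMultilinearMap_apply, LinearMap.id_apply]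
      rw [slotProd_tprod, tprod_eq_slotMul])
  rw [h, LinearMap.id_apply]

theorem slotProd_const {L M : ℕ} (k : Fin M) (z : V.Tens M) (x : V.Tens L) :
    V.slotProd (fun _ => k) z x = V.slotMul k (V.mulN L x) z := by
  have h1 : ∀ l : List V.Fn, (l.map (V.slotMul k)).prod = V.slotMul k l.prod := by
    intro l
    induction l with
    | nil => rw [List.map_nil, List.prod_nil, List.prod_nil, slotMul_one]
    | cons f l ih => rw [List.map_cons, List.prod_cons, List.prod_cons, ih, slotMul_mul_self]
  have h : V.slotProd (fun _ => k) z = LinearMap.applyₗ z ∘ₗ V.slotMul k ∘ₗ V.mulN L :=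
    PiTensorProduct.ext (MultilinearMap.ext fun w => by
      simp only [LinearMap.compMultilinearMap_apply, LinearMap.comp_apply,
        LinearMap.applyₗ_apply_apply]
      rw [slotProd_tprod, mulN_tprod, ← h1, List.map_ofFn]
      rfl)
  rw [h]; rfl

theorem mulN_slotProd {L M : ℕ} (c : Fin L → Fin M) (x : V.Tens L) :
    V.mulN M (V.slotProd c (V.tensOne M) x) = V.mulN L x := by
  have h1 : ∀ l : List (Fin M × V.Fn), V.mulN M ((l.map fun p => V.slotMul p.1 p.2).prod (V.tensOne M))
      = (l.map Prod.snd).prod := by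
    intro l
    induction l with
    | nil => simp [tensOne, mulN_tprod]
    | cons p l ih =>
      rw [List.map_cons, List.prod_cons, List.map_cons, List.prod_cons, Module.End.mul_apply,
        mulN_slotMul, ih]
  have h : V.mulN M ∘ₗ V.slotProd c (V.tensOne M) = V.mulN L :=
    PiTensorProduct.ext (MultilinearMap.ext fun w => by
      simp only [LinearMap.compMultilinearMap_apply, LinearMap.comp_apply]
      have h2 := h1 (List.ofFn fun i => (c i, w i))
      rw [List.map_ofFn, List.map_ofFn] at h2
      rw [slotProd_tprod, mulN_tprod]
      exact h2)
  exact LinearMap.congr_fun h x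

theorem slotProd_slotMul {L M : ℕ} (c : Fin L → Fin M) (z : V.Tens M) (i : Fin L) (f : V.Fn)
    (x : V.Tens L) :
    V.slotProd c z (V.slotMul i f x) = V.slotMul (c i) f (V.slotProd c z x) := by
  have h : (V.slotMul i).compr₂ (V.slotProd c z)
      = (V.slotMul (c i) : V.Fn →ₗ[ℝ] Module.End ℝ (V.Tens M)).compl₂ (V.slotProd c z) := by
    refine V.par_ext fun a f hf => PiTensorProduct.ext (MultilinearMap.ext fun w => ?_)
    simp only [LinearMap.compMultilinearMap_apply, LinearMap.compr₂_apply, LinearMap.compl₂_apply]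
    rw [hf.slotMul_eq i, slotOp_tprod, slotProd_tprod, slotProd_tprod, ← Module.End.mul_apply,
      mul_ofFn_prod _ (fun j => V.slotMul (c j) ((V.par ^ a.val) (w j))) (V.slotMul (c i) f)
        (V.slotMul (c i) (f * w i)) i (fun j _ => hf.slotMul_mul _ _ _) (V.slotMul_mul_self _ _ _)]
    congr 3
    funext u
    split_ifs with h1 h2
    · rfl
    · subst h2; rfl
    · rfl
  exact LinearMap.congr_fun₂ h f x

theorem slotProd_slotProd {L M K : ℕ} (c : Fin M → Fin K) (z : V.Tens K) (p : Fin L → Fin M)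
    (y : V.Tens M) (x : V.Tens L) :
    V.slotProd c z (V.slotProd p y x) = V.slotProd (fun i => c (p i)) (V.slotProd c z y) x := by
  have h1 : ∀ l : List (Fin M × V.Fn), V.slotProd c z ((l.map fun p => V.slotMul p.1 p.2).prod y)
      = (l.map fun p => V.slotMul (c p.1) p.2).prod (V.slotProd c z y) := by
    intro l
    induction l with
    | nil => rfl
    | cons p l ih =>
      rw [List.map_cons, List.prod_cons, List.map_cons, List.prod_cons, Module.End.mul_apply,
        Module.End.mul_apply, slotProd_slotMul, ih]
  have h : V.slotProd c z ∘ₗ V.slotProd p y = V.slotProd (fun i => c (p i)) (V.slotProd c z y) :=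
    PiTensorProduct.ext (MultilinearMap.ext fun w => by
      simp only [LinearMap.compMultilinearMap_apply, LinearMap.comp_apply]
      have h2 := h1 (List.ofFn fun i => (p i, w i))
      rw [List.map_ofFn, List.map_ofFn] at h2
      rw [slotProd_tprod, slotProd_tprod]
      exact h2)
  exact LinearMap.congr_fun h x

/-- Derivatives act on ordered products of slot multiplications by the Leibniz rule. -/
theorem slotDeriv_ofFn_prod {L M : ℕ} (c : Fin L → Fin M) (w : Fin L → V.Fn) (I : V.Crd) (k : Fin M)
    (z : V.Tens M) (hz : V.slotDeriv I k z = 0) :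
    V.slotDeriv I k ((List.ofFn fun i => V.slotMul (c i) (w i)).prod z)
      = ∑ i : Fin L, if c i = k then (List.ofFn fun j => V.slotMul (c j)
          (if j < i then (V.par ^ I.deg) (w j) else if j = i then V.deriv I (w j) else w j)).prod z
        else 0 := by
  induction L with
  | zero => simpa using hz
  | succ L ih =>
    rw [List.ofFn_succ, List.prod_cons, ← Module.End.mul_apply, ← mul_assoc, slotDeriv_slotMul,
      add_mul, LinearMap.add_apply, mul_assoc, Module.End.mul_apply, Module.End.mul_apply,
      Module.End.mul_apply, ih (fun i => c i.succ) (fun i => w i.succ), Fin.sum_univ_succ, map_sum]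
    congr 1
    · split_ifs with h
      · rw [List.ofFn_succ, List.prod_cons, Module.End.mul_apply]
        simp [Fin.succ_ne_zero]
      · rfl
    · refine Finset.sum_congr rfl fun i _ => ?_
      split_ifs with h
      · rw [List.ofFn_succ, List.prod_cons, Module.End.mul_apply]
        simp
      · rw [map_zero]

theorem slotDeriv_slotProd {L M : ℕ} (c : Fin L → Fin M) (I : V.Crd) (k : Fin M) (z : V.Tens M)
    (hz : V.slotDeriv I k z = 0) :
    V.slotDeriv I k ∘ₗ V.slotProd c z
      = V.slotProd c z ∘ₗ ∑ i : Fin L with c i = k, V.slotDeriv I i := by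
  refine PiTensorProduct.ext (MultilinearMap.ext fun w => ?_)
  simp only [LinearMap.compMultilinearMap_apply, LinearMap.comp_apply, LinearMap.sum_apply, map_sum]
  rw [slotProd_tprod, V.slotDeriv_ofFn_prod c w I k z hz, Finset.sum_filter]
  refine Finset.sum_congr rfl fun i _ => ?_
  split_ifs with h
  · rw [slotDeriv_eq, slotOp_tprod, slotProd_tprod]
  · rfl

theorem edgeOp_slotProd {L M : ℕ} (c : Fin L → Fin M) (k l : Fin M) (z : V.Tens M)
    (hk : ∀ I, V.slotDeriv I k z = 0) (hl : ∀ I, V.slotDeriv I l z = 0) :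
    V.edgeOp k l ∘ₗ V.slotProd c z = V.slotProd c z ∘ₗ
      ∑ p : Fin L × Fin L with c p.1 = k ∧ c p.2 = l, V.edgeOp p.1 p.2 := by
  have h1 : ∀ I J, (V.slotDeriv I k * V.slotDeriv J l : Module.End ℝ (V.Tens M)) ∘ₗ V.slotProd c z
      = V.slotProd c z ∘ₗ ∑ p : Fin L × Fin L with c p.1 = k ∧ c p.2 = l,
        V.slotDeriv I p.1 * V.slotDeriv J p.2 := by
    intro I J
    rw [Module.End.mul_eq_comp, LinearMap.comp_assoc, V.slotDeriv_slotProd c J l z (hl J),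
      ← LinearMap.comp_assoc, V.slotDeriv_slotProd c I k z (hk I), LinearMap.comp_assoc,
      ← Module.End.mul_eq_comp, Finset.sum_mul_sum]
    rw [← Finset.sum_product']
    congr 1
    refine Finset.sum_congr ?_ fun _ _ => rfl
    ext p
    simp
  simp only [edgeOp]
  ext1
  ext w
  simp only [LinearMap.compMultilinearMap_apply, LinearMap.comp_apply, LinearMap.sum_apply,
    LinearMap.smul_apply, map_sum, map_smul]
  rw [Finset.sum_comm (s := Finset.univ.filter _)]
  refine Finset.sum_congr rfl fun I _ => ?_
  rw [Finset.sum_comm (s := Finset.univ.filter _)]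
  refine Finset.sum_congr rfl fun J _ => ?_
  rw [← Finset.smul_sum]
  congr 1
  have := LinearMap.congr_fun (h1 I J) (PiTensorProduct.tprod ℝ w)
  simpa only [LinearMap.comp_apply, LinearMap.sum_apply, map_sum] using this

/-- The product of the edge operators of a graph. -/
def edgesOp {N k : ℕ} (γ : LGraph N k) : Module.End ℝ (V.Tens N) :=
  (List.ofFn fun e => V.edgeOp (γ e).1 (γ e).2).prod

theorem rep_graphClass {N k : ℕ} (γ : LGraph N k) :
    V.rep N k (graphClass (n + 1) γ) = V.mulN N ∘ₗ V.edgesOp γ := graLift_class _ _ _ _ _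

theorem list_prod_comp {X Y : Type*} [AddCommGroup X] [Module ℝ X] [AddCommGroup Y] [Module ℝ Y]
    (φ : X →ₗ[ℝ] Y) {k : ℕ} (a : Fin k → Module.End ℝ Y) (b : Fin k → Module.End ℝ X)
    (h : ∀ e, a e ∘ₗ φ = φ ∘ₗ b e) : (List.ofFn a).prod ∘ₗ φ = φ ∘ₗ (List.ofFn b).prod := by
  induction k with
  | zero => simp [Module.End.one_eq_id]
  | succ k ih =>
    rw [List.ofFn_succ, List.ofFn_succ, List.prod_cons, List.prod_cons, Module.End.mul_eq_comp,
      Module.End.mul_eq_comp, LinearMap.comp_assoc, ih _ _ fun e => h e.succ,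
      ← LinearMap.comp_assoc, h 0, LinearMap.comp_assoc]

theorem edgesOp_slotProd {L M k : ℕ} (c : Fin L → Fin M) (γ : LGraph M k) (z : V.Tens M)
    (hz : ∀ e I, V.slotDeriv I (γ e).1 z = 0 ∧ V.slotDeriv I (γ e).2 z = 0) :
    V.edgesOp γ ∘ₗ V.slotProd c z = V.slotProd c z ∘ₗ
      ∑ h : LGraph L k with mapVertices c h = γ, V.edgesOp h := by
  rw [edgesOp, list_prod_comp _ _ _ fun e =>
    V.edgeOp_slotProd c (γ e).1 (γ e).2 z (fun I => (hz e I).1) fun I => (hz e I).2]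
  congr 1
  have h1 := (MultilinearMap.mkPiAlgebraFin ℝ k (Module.End ℝ (V.Tens L))).map_sum_finset
    (fun _ p => V.edgeOp p.1 p.2)
    (fun e => (Finset.univ.filter fun p : Fin L × Fin L => c p.1 = (γ e).1 ∧ c p.2 = (γ e).2))
  simp only [MultilinearMap.mkPiAlgebraFin_apply] at h1
  rw [h1]
  refine Finset.sum_congr ?_ fun _ _ => rfl
  ext h
  simp only [Fintype.mem_piFinset, Finset.mem_filter, Finset.mem_univ, true_and, mapVertices,
    funext_iff, Prod.ext_iff]

end NPDomain

theorem collapse_orderEmb {L : ℕ} (B : Finset (Fin L)) (v : Fin B.card) :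
    collapse B (B.orderEmbOfFin rfl v) = 0 := by
  rw [collapse, dif_pos (Finset.orderEmbOfFin_mem B rfl v)]

theorem collapse_compl_orderEmb {L : ℕ} (B : Finset (Fin L)) (v : Fin Bᶜ.card) :
    collapse B (Bᶜ.orderEmbOfFin rfl v) = v.succ := by
  have h : Bᶜ.orderEmbOfFin rfl v ∈ Bᶜ := Finset.orderEmbOfFin_mem Bᶜ rfl v
  rw [collapse, dif_neg (Finset.mem_compl.1 h)]
  congr 1
  rw [OrderIso.symm_apply_eq]
  rfl

theorem insertGraph_class (d : ℕ) {L j k K : ℕ} (B : Finset (Fin L)) (hK : j + k = K)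
    (γ : LGraph (Bᶜ.card + 1) j) (γ' : LGraph B.card k) :
    insertGraph d B hK (graphClass d γ) (graphClass d γ')
      = ∑ h : LGraph L j with mapVertices (collapse B) h = γ, graphClass d (glue B hK h γ') := by
  rw [insertGraph, graLift_class, graLift_class]

theorem relabel_class (d : ℕ) {N k : ℕ} (σ : Equiv.Perm (Fin N)) (γ : LGraph N k) :
    relabel d σ (graphClass d γ) = graphClass d (mapVertices (σ⁻¹ : Equiv.Perm (Fin N)) γ) := by
  rw [relabel, graLift_class]

theorem mapVertices_injective {N M k : ℕ} {f : Fin N → Fin M} (hf : Function.Injective f) :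
    Function.Injective (mapVertices f : LGraph N k → LGraph M k) := fun γ γ' h => by
  funext e
  have := congrFun h e
  simp only [mapVertices, Prod.ext_iff] at this
  exact Prod.ext (hf this.1) (hf this.2)

namespace NPDomain
variable {n : ℕ} (V : NPDomain n)

theorem slotProd_tensOne {L M : ℕ} (c : Fin L → Fin M) :
    V.slotProd c (V.tensOne M) (V.tensOne L) = V.tensOne M := by
  refine (V.slotProd_tprod c _ _).trans ?_
  simp [slotMul_one]

theorem slotMul_slotProd_succ {m : ℕ} (f : V.Fn) (w : Fin m → V.Fn) :
    V.slotMul 0 f (V.slotProd Fin.succ (V.tensOne (m + 1)) (PiTensorProduct.tprod ℝ w))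
      = PiTensorProduct.tprod ℝ (Fin.cons f w : Fin (m + 1) → V.Fn) := by
  rw [← V.tprod_eq_slotMul (Fin.cons f w), List.ofFn_succ, List.prod_cons, Module.End.mul_apply,
    slotProd_tprod]
  simp

theorem slotDeriv_slotProd_of_ne {L M : ℕ} (c : Fin L → Fin M) (I : V.Crd) (k : Fin M)
    (h : ∀ i, c i ≠ k) (x : V.Tens L) : V.slotDeriv I k (V.slotProd c (V.tensOne M) x) = 0 := by
  have h1 := LinearMap.congr_fun
    (V.slotDeriv_slotProd c I k (V.tensOne M) (V.slotDeriv_tensOne I k)) x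
  rw [Finset.filter_eq_empty_iff.2 fun i _ => h i] at h1
  simpa using h1

theorem rep_slotProd_perm {N k : ℕ} (σ : Equiv.Perm (Fin N)) (γ : Gra (n + 1) N k) (x : V.Tens N) :
    V.rep N k γ (V.slotProd σ (V.tensOne N) x) = V.rep N k (relabel (n + 1) σ γ) x := by
  have h : V.rep N k = (LinearMap.lcomp ℝ V.Fn (V.slotProd (σ⁻¹ : Equiv.Perm (Fin N)) (V.tensOne N)))
      ∘ₗ V.rep N k ∘ₗ relabel (n + 1) σ := by
    refine gra_hom_ext fun γ => ?_
    rw [LinearMap.comp_apply, LinearMap.comp_apply, relabel_class, LinearMap.lcomp_apply']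
    have h1 := V.edgesOp_slotProd (σ⁻¹ : Equiv.Perm (Fin N))
      (mapVertices (σ⁻¹ : Equiv.Perm (Fin N)) γ) (V.tensOne N)
      fun e I => ⟨V.slotDeriv_tensOne _ _, V.slotDeriv_tensOne _ _⟩
    have h2 : (Finset.univ.filter fun h : LGraph N k => mapVertices (σ⁻¹ : Equiv.Perm (Fin N)) h
        = mapVertices (σ⁻¹ : Equiv.Perm (Fin N)) γ) = {γ} := by
      ext h
      rw [Finset.mem_filter, Finset.mem_singleton,
        (mapVertices_injective (k := k) (σ⁻¹ : Equiv.Perm (Fin N)).injective).eq_iff]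
      simp
    rw [h2, Finset.sum_singleton] at h1
    rw [rep_graphClass, rep_graphClass, LinearMap.comp_assoc, h1]
    ext1
    ext w
    exact (V.mulN_slotProd _ _).symm
  conv_lhs => rw [h]
  simp only [LinearMap.comp_apply, LinearMap.lcomp_apply']
  rw [slotProd_slotProd, slotProd_tensOne]
  have : (fun i => σ⁻¹ (σ i)) = fun i => i := by funext i; simp
  rw [this, slotProd_id]

/-- Exchanging two neighbouring arguments. -/
theorem rep_swap {N k : ℕ} (γ : Gra (n + 1) (N + 1) k) (i : Fin N) {a : Fin (N + 1) → ZMod 2}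
    {w : Fin (N + 1) → V.Fn} (hw : ∀ i, V.HasPar (a i) (w i)) :
    V.rep (N + 1) k γ (PiTensorProduct.tprod ℝ (w ∘ Equiv.swap i.castSucc i.succ))
      = sg (a i.castSucc * a i.succ) • V.rep (N + 1) k
        (relabel (n + 1) (Equiv.swap i.castSucc i.succ) γ) (PiTensorProduct.tprod ℝ w) := by
  set σ : Equiv.Perm (Fin (N + 1)) := Equiv.swap i.castSucc i.succ with hσ
  rw [← rep_slotProd_perm, ← map_smul]
  congr 1
  rw [slotProd_tprod, ← tprod_eq_slotMul]
  obtain ⟨l₁, l₂, h1, h2⟩ := ofFn_comp_swap (fun j => V.slotMul j ((w ∘ σ) j)) i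
  have h3 : (fun j => V.slotMul (σ j) (w j)) = (fun j => V.slotMul j ((w ∘ σ) j)) ∘ σ := by
    funext j; simp [hσ]
  rw [h3, h1, h2]
  simp only [List.prod_append, List.prod_cons, Function.comp_apply]
  have h4 : V.HasPar (a i.succ) (w (σ i.castSucc)) := by simpa [hσ] using hw i.succ
  have h5 : V.HasPar (a i.castSucc) (w (σ i.succ)) := by simpa [hσ] using hw i.castSucc
  rw [← mul_assoc (V.slotMul i.castSucc _), h4.slotMul_comm h5, smul_mul_assoc, mul_smul_comm,
    LinearMap.smul_apply, mul_assoc, mul_comm (a i.succ)]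

theorem edgesOp_glue {L j k K : ℕ} (B : Finset (Fin L)) (hK : j + k = K) (h : LGraph L j)
    (γ' : LGraph B.card k) :
    V.edgesOp (glue B hK h γ') = V.edgesOp h * V.edgesOp (mapVertices (B.orderEmbOfFin rfl) γ') := by
  subst hK
  rw [edgesOp, edgesOp, edgesOp, ← List.prod_append, ← List.ofFn_fin_append]
  congr 2
  funext e
  refine Fin.addCases (fun i => ?_) (fun i => ?_) e <;> simp [glue, mapVertices]

theorem tprod_eq_slotProd {L : ℕ} (B : Finset (Fin L)) {a : Fin L → ZMod 2} {w : Fin L → V.Fn}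
    (hw : ∀ i, V.HasPar (a i) (w i)) :
    PiTensorProduct.tprod ℝ w = koszul (blockOf B) a • V.slotProd (B.orderEmbOfFin rfl)
      (V.slotProd (Bᶜ.orderEmbOfFin rfl) (V.tensOne L)
        (PiTensorProduct.tprod ℝ (w ∘ Bᶜ.orderEmbOfFin rfl)))
      (PiTensorProduct.tprod ℝ (w ∘ B.orderEmbOfFin rfl)) := by
  have h1 : ∀ C : Finset (Fin L), (List.ofFn fun i => V.slotMul (C.orderEmbOfFin rfl i)
      ((w ∘ C.orderEmbOfFin rfl) i)) = blk (· ∈ C) fun i => V.slotMul i (w i) := fun C =>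
    ofFn_orderEmb C fun i => V.slotMul i (w i)
  rw [slotProd_tprod, slotProd_tprod, h1, h1, ← tprod_eq_slotMul,
    ofFn_prod_eq_koszul (fun i => V.slotMul i (w i)) a
      (fun i j => (hw i).slotMul_comm (hw j) i j) (· ∈ B), LinearMap.smul_apply,
    Module.End.mul_apply, blk_congr (fun i => (Finset.mem_compl (s := B) (a := i)).symm)]
  rfl

/-- The operadic insertion becomes the insertion of operations. -/
theorem rep_insertGraph {L j k K : ℕ} (B : Finset (Fin L)) (hK : j + k = K)
    (γ : Gra (n + 1) (Bᶜ.card + 1) j) (γ' : Gra (n + 1) B.card k) {a : Fin L → ZMod 2}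
    {w : Fin L → V.Fn} (hw : ∀ i, V.HasPar (a i) (w i)) :
    V.rep L K (insertGraph (n + 1) B hK γ γ') (PiTensorProduct.tprod ℝ w)
      = koszul (blockOf B) a • V.rep (Bᶜ.card + 1) j γ (PiTensorProduct.tprod ℝ
        (Fin.cons (V.rep B.card k γ' (PiTensorProduct.tprod ℝ (w ∘ B.orderEmbOfFin rfl)))
          (w ∘ Bᶜ.orderEmbOfFin rfl) : Fin (Bᶜ.card + 1) → V.Fn)) := by
  have h : (insertGraph (n + 1) B hK).compr₂
        (LinearMap.applyₗ (PiTensorProduct.tprod ℝ w) ∘ₗ V.rep L K)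
      = koszul (blockOf B) a • (V.rep (Bᶜ.card + 1) j).compl₂
        ((PiTensorProduct.tprod ℝ).toLinearMap (Fin.cons 0 (w ∘ Bᶜ.orderEmbOfFin rfl)) 0 ∘ₗ
          LinearMap.applyₗ (PiTensorProduct.tprod ℝ (w ∘ B.orderEmbOfFin rfl)) ∘ₗ V.rep B.card k) := by
    refine gra_hom_ext fun γ => gra_hom_ext fun γ' => ?_
    simp only [LinearMap.compr₂_apply, LinearMap.smul_apply, LinearMap.compl₂_apply,
      LinearMap.comp_apply, LinearMap.applyₗ_apply_apply, MultilinearMap.toLinearMap_apply,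
      Fin.update_cons_zero]
    rw [insertGraph_class, map_sum, LinearMap.sum_apply]
    simp only [rep_graphClass, LinearMap.comp_apply, edgesOp_glue, Module.End.mul_apply]
    set z := V.slotProd (Bᶜ.orderEmbOfFin rfl) (V.tensOne L)
      (PiTensorProduct.tprod ℝ (w ∘ Bᶜ.orderEmbOfFin rfl)) with hz
    have h0 : ∀ (v : Fin B.card) I, V.slotDeriv I (B.orderEmbOfFin rfl v) z = 0 := fun v I =>
      V.slotDeriv_slotProd_of_ne _ I _ (fun i hi => by
        have h1 := Finset.orderEmbOfFin_mem Bᶜ rfl i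
        rw [hi] at h1
        exact Finset.mem_compl.1 h1 (Finset.orderEmbOfFin_mem B rfl v)) _
    have h1 := LinearMap.congr_fun (V.edgesOp_slotProd (B.orderEmbOfFin rfl)
      (mapVertices (B.orderEmbOfFin rfl) γ') z fun e I => ⟨h0 _ I, h0 _ I⟩)
      (PiTensorProduct.tprod ℝ (w ∘ B.orderEmbOfFin rfl))
    have h2 : (Finset.univ.filter fun h : LGraph B.card k => mapVertices (B.orderEmbOfFin rfl) h
        = mapVertices (B.orderEmbOfFin rfl) γ') = {γ'} := by
      ext h
      simp [(mapVertices_injective (k := k) (B.orderEmbOfFin rfl).injective).eq_iff]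
    rw [h2, Finset.sum_singleton] at h1
    simp only [LinearMap.comp_apply] at h1
    rw [V.tprod_eq_slotProd B hw, ← hz, map_smul, h1]
    simp only [map_smul, ← Finset.smul_sum]
    congr 1
    have h3 := LinearMap.congr_fun (V.edgesOp_slotProd (collapse B) γ (V.tensOne _)
      fun e I => ⟨V.slotDeriv_tensOne _ _, V.slotDeriv_tensOne _ _⟩)
      (V.slotProd (B.orderEmbOfFin rfl) z
        (V.edgesOp γ' (PiTensorProduct.tprod ℝ (w ∘ B.orderEmbOfFin rfl))))
    simp only [LinearMap.comp_apply] at h3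
    rw [← map_sum, ← LinearMap.sum_apply, ← V.mulN_slotProd (collapse B), ← h3, slotProd_slotProd]
    simp only [collapse_orderEmb]
    rw [slotProd_const, hz, slotProd_slotProd]
    simp only [collapse_compl_orderEmb]
    rw [slotProd_tensOne, slotMul_slotProd_succ]
  have h5 := LinearMap.congr_fun₂ h γ γ'
  simpa only [LinearMap.compr₂_apply, LinearMap.smul_apply, LinearMap.compl₂_apply,
      LinearMap.comp_apply, LinearMap.applyₗ_apply_apply, MultilinearMap.toLinearMap_apply,
      Fin.update_cons_zero] using h5

end NPDomain

namespace NPDomain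
variable {n : ℕ} (V : NPDomain n)

theorem pureFn_mem_piece (f) (m : V.EvenCrd →₀ ℕ) (L : List V.OddCrd) {k : ℤ}
    (h : (V.monDeg m L : ℤ) = k) :
    V.pureFn f (MvPolynomial.monomial m 1) (V.oddProd L) ∈ V.piece k :=
  Submodule.subset_span ⟨f, m, L, h, rfl⟩

theorem monDeg_add (m m' : V.EvenCrd →₀ ℕ) (L L' : List V.OddCrd) :
    V.monDeg (m + m') (L ++ L') = V.monDeg m L + V.monDeg m' L' := by
  rw [monDeg, Finsupp.sum_add_index' (by simp) (by intros; ring), List.map_append,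
    List.sum_append, monDeg, monDeg]
  ring

theorem mul_mem_piece {k l : ℤ} {f g : V.Fn} (hf : f ∈ V.piece k) (hg : g ∈ V.piece l) :
    f * g ∈ V.piece (k + l) := by
  have h : V.piece k ≤ (V.piece (k + l)).comap (LinearMap.mulRight ℝ g) := by
    refine Submodule.span_le.2 ?_
    rintro y ⟨f, m, L, rfl, rfl⟩
    have h2 : V.piece l ≤ (V.piece ((V.monDeg m L : ℤ) + l)).comap (LinearMap.mulLeft ℝ
        (V.pureFn f (MvPolynomial.monomial m 1) (V.oddProd L))) := by
      refine Submodule.span_le.2 ?_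
      rintro y ⟨f', m', L', rfl, rfl⟩
      change _ * _ ∈ V.piece _
      have h3 : V.oddProd L * V.oddProd L' = V.oddProd (L ++ L') := by
        rw [oddProd, oddProd, oddProd, List.map_append, List.prod_append]
      rw [pureFn_mul, MvPolynomial.monomial_mul, one_mul, h3]
      exact V.pureFn_mem_piece _ _ _ (by rw [monDeg_add]; push_cast; rfl)
    exact h2 hg
  exact h hf

theorem one_mem_piece : (1 : V.Fn) ∈ V.piece 0 :=
  V.pureFn_mem_piece 1 0 [] (by simp [monDeg])

theorem par_mem_piece {k : ℤ} {f : V.Fn} (hf : f ∈ V.piece k) (p : ℕ) :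
    (V.par ^ p) f ∈ V.piece k := by
  rw [(hasPar_of_piece hf).par_pow]
  exact Submodule.smul_mem _ _ hf

theorem contractLeft_oddProd (i : V.OddCrd) (L : List V.OddCrd) :
    CliffordAlgebra.contractLeft (Q := (0 : QuadraticForm ℝ (V.OddCrd → ℝ))) (LinearMap.proj i)
        (V.oddProd L)
      ∈ Submodule.span ℝ {η | ∃ L' : List V.OddCrd, (L'.map fun j => j.1.deg).sum + i.1.deg
          = (L.map fun j => j.1.deg).sum ∧ η = V.oddProd L'} := by
  induction L with
  | nil => simp [oddProd, CliffordAlgebra.contractLeft_one]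
  | cons j L ih =>
    have hc : ∀ L, V.oddProd (j :: L) = CliffordAlgebra.ι 0 (Pi.single j 1) * V.oddProd L := by
      intro L; rw [oddProd, List.map_cons, List.prod_cons]; rfl
    rw [hc, CliffordAlgebra.contractLeft_ι_mul]
    refine Submodule.sub_mem _ ?_ ?_
    · by_cases h : i = j
      · subst h
        exact Submodule.smul_mem _ _ (Submodule.subset_span ⟨L, by simp [add_comm], rfl⟩)
      · simp [h]
    · refine Submodule.span_induction (p := fun y _ => CliffordAlgebra.ι 0 (Pi.single j 1) * y ∈ _)
        ?_ ?_ ?_ ?_ ih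
      · rintro y ⟨L', h, rfl⟩
        exact Submodule.subset_span ⟨j :: L', by
          rw [List.map_cons, List.map_cons, List.sum_cons, List.sum_cons, add_assoc, h],
          (hc L').symm⟩
      · rw [mul_zero]; exact Submodule.zero_mem _
      · intro x y _ _ hx hy; rw [mul_add]; exact Submodule.add_mem _ hx hy
      · intro r x _ hx; rw [mul_smul_comm]; exact Submodule.smul_mem _ _ hx

theorem deriv_mem_piece (I : V.Crd) {k : ℤ} {f : V.Fn} (hf : f ∈ V.piece k) :
    V.deriv I f ∈ V.piece (k - I.deg) := by
  have h : V.piece k ≤ (V.piece (k - I.deg)).comap (V.deriv I) := by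
    refine Submodule.span_le.2 ?_
    rintro y ⟨f, m, L, rfl, rfl⟩
    change V.deriv I _ ∈ V.piece _
    rw [deriv]
    split_ifs with h0 h1
    · rw [tensorMap_pureFn]
      exact V.pureFn_mem_piece _ _ _ (by simp [h0])
    · rw [tensorMap_pureFn, LinearMap.id_apply, LinearMap.id_apply]
      refine Submodule.span_induction (p := fun y _ => V.pureFn f (MvPolynomial.monomial m 1) y ∈ _)
        ?_ ?_ ?_ ?_ (V.contractLeft_oddProd ⟨I, h1⟩ L)
      · rintro y ⟨L', h, rfl⟩
        refine V.pureFn_mem_piece _ _ _ ?_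
        rw [monDeg, monDeg, ← h]
        push_cast; ring
      · have := V.pureFn_smul f (MvPolynomial.monomial m 1) 0 0
        rw [zero_smul, zero_smul] at this
        rw [this]; exact Submodule.zero_mem _
      · intro x y _ _ hx hy; rw [pureFn_add]; exact Submodule.add_mem _ hx hy
      · intro r x _ hx; rw [pureFn_smul]; exact Submodule.smul_mem _ _ hx
    · rw [tensorMap_pureFn]
      set i : V.EvenCrd := ⟨I, Nat.pos_of_ne_zero h0, Nat.not_odd_iff_even.1 h1⟩ with hi
      have h2 : MvPolynomial.pderiv i (MvPolynomial.monomial m (1 : ℝ))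
          = (m i : ℝ) • MvPolynomial.monomial (m - Finsupp.single i 1) (1 : ℝ) := by
        rw [MvPolynomial.pderiv_monomial, MvPolynomial.smul_monomial]
        simp
      refine (congrArg (fun P => V.pureFn _ P _ ∈ V.piece _) h2).mpr ?_
      rw [pureFn_smul_mid]
      by_cases hm : m i = 0
      · rw [hm, Nat.cast_zero, zero_smul]; exact Submodule.zero_mem _
      · refine Submodule.smul_mem _ _ (V.pureFn_mem_piece _ _ _ ?_)
        have h3 : m = (m - Finsupp.single i 1) + Finsupp.single i 1 :=
          (tsub_add_cancel_of_le (Finsupp.single_le_iff.2 (Nat.one_le_iff_ne_zero.2 hm))).symm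
        have h4 := V.monDeg_add (m - Finsupp.single i 1) (Finsupp.single i 1) L []
        rw [← h3, List.append_nil] at h4
        rw [h4]
        have h5 : V.monDeg (Finsupp.single i 1) [] = I.deg := by
          simp [monDeg, hi]
        rw [h5]; push_cast; ring
  exact h hf

/-- The tensors of a given total degree. -/
def tensPiece (N : ℕ) (k : ℤ) : Submodule ℝ (V.Tens N) :=
  Submodule.span ℝ {y | ∃ (p : Fin N → ℤ) (w : Fin N → V.Fn), (∀ i, w i ∈ V.piece (p i)) ∧
    ∑ i, p i = k ∧ y = PiTensorProduct.tprod ℝ w}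

theorem tprod_mem_tensPiece {N : ℕ} {p : Fin N → ℤ} {w : Fin N → V.Fn}
    (h : ∀ i, w i ∈ V.piece (p i)) : PiTensorProduct.tprod ℝ w ∈ V.tensPiece N (∑ i, p i) :=
  Submodule.subset_span ⟨p, w, h, rfl, rfl⟩

theorem slotDeriv_mem {N : ℕ} (I : V.Crd) (v : Fin N) {k : ℤ} {x : V.Tens N}
    (hx : x ∈ V.tensPiece N k) : V.slotDeriv I v x ∈ V.tensPiece N (k - I.deg) := by
  have h : V.tensPiece N k ≤ (V.tensPiece N (k - I.deg)).comap (V.slotDeriv I v) := by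
    refine Submodule.span_le.2 ?_
    rintro y ⟨p, w, hw, rfl, rfl⟩
    change V.slotDeriv I v _ ∈ V.tensPiece N _
    rw [slotDeriv_eq, slotOp_tprod]
    have h2 : ∑ i, p i - (I.deg : ℤ) = ∑ i, (if i = v then p i - I.deg else p i) := by
      have : ∀ i, (if i = v then p i - (I.deg : ℤ) else p i) = p i - if i = v then (I.deg : ℤ) else 0 := by
        intro i; split_ifs <;> simp
      simp [this]
    rw [h2]
    refine V.tprod_mem_tensPiece fun i => ?_
    by_cases h1 : i = v
    · subst h1
      simpa using V.deriv_mem_piece I (hw i)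
    · simp only [h1, if_false]
      split_ifs
      · exact V.par_mem_piece (hw i) _
      · exact hw i
  exact h hx

theorem edgeOp_mem {N : ℕ} (u v : Fin N) {k : ℤ} {x : V.Tens N}
    (hx : x ∈ V.tensPiece N k) : V.edgeOp u v x ∈ V.tensPiece N (k - n) := by
  rw [edgeOp, LinearMap.sum_apply]
  refine Submodule.sum_mem _ fun I _ => ?_
  rw [LinearMap.sum_apply]
  refine Submodule.sum_mem _ fun J _ => ?_
  rw [LinearMap.smul_apply]
  by_cases h : V.poissonTensor I J = 0
  · rw [h, zero_smul]; exact Submodule.zero_mem _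
  · have h1 := V.slotDeriv_mem I u (V.slotDeriv_mem J v hx)
    have h2 : k - (J.deg : ℤ) - I.deg = k - n := by
      have := V.deg_add_deg h
      omega
    rw [h2] at h1
    exact Submodule.smul_mem _ _ h1

theorem mulN_mem {N : ℕ} {k : ℤ} {x : V.Tens N} (hx : x ∈ V.tensPiece N k) :
    V.mulN N x ∈ V.piece k := by
  have h1 : ∀ l : List (V.Fn × ℤ), (∀ y ∈ l, y.1 ∈ V.piece y.2) →
      (l.map Prod.fst).prod ∈ V.piece (l.map Prod.snd).sum := by
    intro l
    induction l with
    | nil => intro _; exact V.one_mem_piece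
    | cons y l ih =>
      intro h
      rw [List.map_cons, List.map_cons, List.prod_cons, List.sum_cons]
      exact V.mul_mem_piece (h y (by simp)) (ih fun z hz => h z (by simp [hz]))
  have h : V.tensPiece N k ≤ (V.piece k).comap (V.mulN N) := by
    refine Submodule.span_le.2 ?_
    rintro y ⟨p, w, hw, rfl, rfl⟩
    change V.mulN N _ ∈ V.piece _
    rw [mulN_tprod, ← List.sum_ofFn]
    have h2 := h1 (List.ofFn fun i => (w i, p i)) (by
      intro y hy
      obtain ⟨i, rfl⟩ := (List.mem_ofFn' _ _).1 hy
      exact hw i)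
    rw [List.map_ofFn, List.map_ofFn] at h2
    exact h2
  exact h hx

/-- A graph with `k` edges lowers the degree by `n k`. -/
theorem rep_mem {N k : ℕ} (γ : Gra (n + 1) N k) {p : Fin N → ℤ} {w : Fin N → V.Fn}
    (hw : ∀ i, w i ∈ V.piece (p i)) :
    V.rep N k γ (PiTensorProduct.tprod ℝ w) ∈ V.piece (∑ i, p i - n * k) := by
  have h1 : ∀ (l : List (Fin N × Fin N)) (x : V.Tens N) (d : ℤ), x ∈ V.tensPiece N d →
      (l.map fun e => V.edgeOp e.1 e.2).prod x ∈ V.tensPiece N (d - n * l.length) := by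
    intro l x d hx
    induction l with
    | nil => simpa using hx
    | cons e l ih =>
      rw [List.map_cons, List.prod_cons, Module.End.mul_apply]
      have h2 := V.edgeOp_mem e.1 e.2 ih
      have h3 : d - n * (l.length : ℤ) - n = d - n * ((e :: l).length : ℤ) := by
        rw [List.length_cons]; push_cast; ring
      rwa [h3] at h2
  refine gra_induction (P := fun γ => V.rep N k γ (PiTensorProduct.tprod ℝ w) ∈ _) γ ?_ ?_ ?_ ?_
  · intro γ
    rw [rep_graphClass]
    have h2 := h1 (List.ofFn γ) _ _ (V.tprod_mem_tensPiece hw)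
    rw [List.map_ofFn, List.length_ofFn] at h2
    exact V.mulN_mem h2
  · rw [map_zero, LinearMap.zero_apply]; exact Submodule.zero_mem _
  · intro a b ha hb
    rw [map_add, LinearMap.add_apply]; exact Submodule.add_mem _ ha hb
  · intro r a ha
    rw [map_smul, LinearMap.smul_apply]; exact Submodule.smul_mem _ _ ha

end NPDomain

/-! ### The sign of a suspension -/

/-- The exponent `∑ (N - 1 - i) a_i` of the sign for moving suspensions past `N` letters. -/
def lsusp : List (ZMod 2) → ZMod 2
  | [] => 0
  | a :: l => l.length * a + lsusp l

theorem prod_eq_lsusp (m : ℕ) {N : ℕ} (e : Fin N → ZMod 2) :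
    (∏ i : Fin N, if e i = 1 then (-1 : ℝ) ^ (m * (N - 1 - (i : ℕ))) else 1)
      = sg (m * lsusp (List.ofFn e)) := by
  induction N with
  | zero => simp [lsusp]
  | succ N ih =>
    rw [Fin.prod_univ_succ, List.ofFn_succ, lsusp, mul_add, sg_add, ← ih fun i => e i.succ]
    congr 1
    · have he := (by decide : ∀ a : ZMod 2, a = 0 ∨ a = 1) (e 0)
      rcases he with h | h
      · simp [h]
      · rw [if_pos h, h, List.length_ofFn, mul_one, ← Nat.cast_mul, sg_natCast]
        rfl
    · refine Finset.prod_congr rfl fun i _ => ?_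
      have : N + 1 - 1 - ((i.succ : Fin (N + 1)) : ℕ) = N - 1 - i := by
        rw [Fin.val_succ]; omega
      rw [this]

theorem lsusp_swap (l₁ l₂ : List (ZMod 2)) (x y : ZMod 2) :
    lsusp (l₁ ++ y :: x :: l₂) = lsusp (l₁ ++ x :: y :: l₂) + (x + y) := by
  induction l₁ with
  | nil =>
    simp only [List.nil_append, lsusp, List.length_cons]
    push_cast
    generalize (l₂.length : ZMod 2) = c
    generalize lsusp l₂ = e
    revert c e x y
    decide
  | cons z l ih =>
    simp only [List.cons_append, lsusp, ih, List.length_append, List.length_cons]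
    ring

theorem mul_lsusp_congr (d : ZMod 2) {X : Type*} (f g : X → ZMod 2) (l : List X)
    (h : ∀ x ∈ l, d * f x = d * g x) : d * lsusp (l.map f) = d * lsusp (l.map g) := by
  induction l with
  | nil => rfl
  | cons x l ih =>
    rw [List.map_cons, List.map_cons, lsusp, lsusp, mul_add, mul_add,
      ih fun y hy => h y (List.mem_cons_of_mem _ hy), mul_left_comm, h x (by simp), mul_left_comm,
      List.length_map, List.length_map]

/-- Compatibility of the Koszul signs before and after a suspension. -/
theorem koszul_lsusp (d : ZMod 2) {L : ℕ} (a : Fin L → ZMod 2) (P : Fin L → Prop) [DecidablePred P] :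
    koszul (fun i => if P i then 0 else 1) (fun _ => d)
        * koszul (fun i => if P i then 0 else 1) a * sg (d * lsusp (List.ofFn a))
      = koszul (fun i => if P i then 0 else 1) (fun i => a i + d)
        * sg (d * (lsusp (blk P a) + lsusp (blk (fun i => ¬ P i) a)
          + (blk (fun i => ¬ P i) a).length * (blk P a).sum)) := by
  induction L with
  | zero => simp [koszul, blk_zero, lsusp]
  | succ L ih =>
    have h1 := ih (fun i => a i.succ) fun i => P i.succ
    have hlen : ∀ Q : Fin L → Prop, ∀ [DecidablePred Q], ((List.finRange L).filter Q).length
        = (blk Q fun i => a i.succ).length := fun Q _ => by rw [blk, List.length_map]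
    have htot : (L : ZMod 2) = (blk (fun i => P i.succ) fun i => a i.succ).length
        + (blk (fun i => ¬ P i.succ) fun i => a i.succ).length := by
      rw [← hlen, ← hlen, ← Nat.cast_add]
      congr 1
      have h2 := List.length_eq_length_filter_add (l := List.finRange L) (fun i => decide (P i.succ))
      rw [List.length_finRange] at h2
      simpa using h2
    rw [koszul_succ, koszul_succ, koszul_succ _ fun i => a i + d, blk_succ,
      blk_succ fun i => ¬ P i, List.ofFn_succ, lsusp, List.length_ofFn]
    by_cases h0 : P 0
    · simp only [h0, if_true, not_lt_zero, Finset.filter_false, Finset.sum_empty, mul_zero, sg_zero,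
        one_mul, not_true_eq_false, if_false, lsusp, List.sum_cons]
      rw [mul_add d, sg_add, mul_left_comm, h1, mul_left_comm, ← sg_add]
      congr 2
      rw [htot]
      ring
    · have hs : ∀ g : ZMod 2 → ZMod 2, (∑ b : Fin L with (if P b.succ then 0 else 1)
          < (if P 0 then 0 else 1), g (a b.succ))
          = ((blk (fun i => P i.succ) fun i => a i.succ).map g).sum := by
        intro g
        have h3 := lpar_blk (X := ZMod 2) g (fun i : Fin L => P i.succ) (fun i => a i.succ)
        rw [lpar] at h3
        rw [h3]
        refine Finset.sum_congr (Finset.filter_congr fun i _ => ?_) fun _ _ => rfl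
        by_cases hi : P i.succ <;> simp [h0, hi]
      have hd : ∀ l : List (ZMod 2), (l.map fun _ => d).sum = l.length * d := fun l => by
        rw [List.map_const', List.sum_replicate, nsmul_eq_mul]
      have had : ∀ l : List (ZMod 2), (l.map fun x => x + d).sum = l.sum + l.length * d := fun l => by
        rw [List.sum_map_add, List.map_id', hd]
      rw [hs fun _ => d, hs fun x => x, hs fun x => x + d]
      simp only [h0, if_false, not_false_eq_true, if_true, lsusp, List.length_cons, List.map_id', hd, had]
      rw [mul_add d, sg_add]
      set K1 := koszul (fun i : Fin L => if P i.succ then 0 else 1) fun _ => d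
      set K2 := koszul (fun i : Fin L => if P i.succ then 0 else 1) fun i => a i.succ
      set K3 := koszul (fun i : Fin L => if P i.succ then 0 else 1) fun i => a i.succ + d
      set lP := blk (fun i => P i.succ) fun i => a i.succ
      set lQ := blk (fun i => ¬ P i.succ) fun i => a i.succ
      set E := sg (d * lsusp (List.ofFn fun i => a i.succ))
      have e1 : ∀ s1 s2 s3 : ℝ, s1 * K1 * (s2 * K2) * (s3 * E) = s1 * s2 * s3 * (K1 * K2 * E) := by
        intros; ring
      rw [e1, h1]
      have h2 : (2 : ZMod 2) = 0 := rfl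
      have e3 : sg (d * (lP.length * d)) * sg (a 0 * lP.sum) * sg (d * (L * a 0))
          * sg (d * (lsusp lP + lsusp lQ + lQ.length * lP.sum))
          = sg ((a 0 + d) * (lP.sum + lP.length * d))
            * sg (d * (lsusp lP + (lQ.length * a 0 + lsusp lQ)
              + ((lQ.length + 1 : ℕ) : ZMod 2) * lP.sum)) := by
        rw [← sg_add, ← sg_add, ← sg_add, ← sg_add, htot]
        congr 1
        push_cast
        linear_combination (-(d * lP.sum)) * h2
      linear_combination K3 * e3

/-- In each number of vertices, only finitely many numbers of edges occur. -/
def EdgeFinite {d : ℕ} (c : Fam d) : Prop := ∀ N, ∃ R, ∀ k, R ≤ k → c N k = 0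

theorem EdgeFinite.add {d : ℕ} {a b : Fam d} (ha : EdgeFinite a) (hb : EdgeFinite b) :
    EdgeFinite (a + b) := fun N => by
  obtain ⟨R, hR⟩ := ha N
  obtain ⟨S, hS⟩ := hb N
  refine ⟨max R S, fun k hk => ?_⟩
  rw [Pi.add_apply, Pi.add_apply, hR k (le_of_max_le_left hk), hS k (le_of_max_le_right hk), add_zero]

theorem EdgeFinite.smul {d : ℕ} {a : Fam d} (r : ℝ) (ha : EdgeFinite a) : EdgeFinite (r • a) :=
  fun N => by
    obtain ⟨R, hR⟩ := ha N
    refine ⟨R, fun k hk => ?_⟩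
    rw [Pi.smul_apply, Pi.smul_apply, hR k hk, smul_zero]

theorem EdgeFinite.exists_bound {d : ℕ} {a : Fam d} (ha : EdgeFinite a) (L : ℕ) :
    ∃ R, ∀ N ≤ L, ∀ k, R ≤ k → a N k = 0 := by
  choose R hR using ha
  refine ⟨(Finset.range (L + 1)).sup R, fun N hN k hk => hR N k (le_trans ?_ hk)⟩
  exact Finset.le_sup (f := R) (Finset.mem_range.2 (Nat.lt_succ_of_le hN))

theorem edgeFinite_edgeGraph (d : ℕ) : EdgeFinite (edgeGraph d) := fun N =>
  ⟨2, fun k hk => edgeGraph_of_ne (Or.inr (by omega))⟩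

theorem edgeFinite_of_mem {d : ℕ} (hd : 2 ≤ d) {p : ℤ} {c : Fam d} (hc : c ∈ fGC d p) :
    EdgeFinite c := fun N => by
  refine ⟨((d : ℤ) * (N - 1) - p).toNat + 1, fun k hk => ?_⟩
  by_contra h
  have h1 := hc.2.1 N k h
  have h2 : (k : ℤ) * 1 ≤ k * (d - 1) := mul_le_mul_of_nonneg_left (by omega) (by omega)
  have h3 : (d : ℤ) * (N - 1) - p ≤ ((d : ℤ) * (N - 1) - p).toNat := Int.self_le_toNat _
  have h4 : (k : ℤ) * (d - 1) = d * (N - 1) - p := by linear_combination -h1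
  omega

theorem edgeFinite_cocycle {d : ℕ} {c : Fam d} (hd : 1 ≤ d) (hc : c ∈ cocycles d) :
    EdgeFinite c := by
  rcases hd.lt_or_eq with h | rfl
  · exact edgeFinite_of_mem h hc.1
  · refine fun N => ⟨0, fun k _ => ?_⟩
    by_contra h
    have h1 := hc.1.2.1 N k h
    obtain rfl : N = 1 := by push_cast at h1; omega
    exact h (cocycle_one hc k)

theorem edgeFinite_neg_one {d : ℕ} {c : Fam d} (hd : 1 ≤ d) (hc : c ∈ fGC d (-1)) :
    EdgeFinite c := by
  rcases hd.lt_or_eq with h | rfl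
  · exact edgeFinite_of_mem h hc
  · refine fun N => ⟨0, fun k _ => ?_⟩
    by_contra h
    have h1 := hc.2.1 N k h
    obtain rfl : N = 0 := by push_cast at h1; omega
    exact h (hc.1 k)

namespace NPDomain
variable {n : ℕ} (V : NPDomain n)

theorem repCochain_eq_sum (c : Fam (n + 1)) {N R : ℕ} (h : ∀ k, R ≤ k → c N k = 0)
    (w : Fin N → V.Fn) :
    V.repCochain c N w = ∑ k ∈ Finset.range R, V.rep N k (c N k) (PiTensorProduct.tprod ℝ w) := by
  refine finsum_eq_sum_of_support_subset _ fun k hk => ?_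
  by_contra h'
  rw [Finset.coe_range, Set.mem_Iio, not_lt] at h'
  exact hk (by beta_reduce; rw [h k h', map_zero, LinearMap.zero_apply])

theorem isMulti_repCochain {c : Fam (n + 1)} (hc : EdgeFinite c) (N : ℕ) :
    IsMulti (V.repCochain c N) := by
  obtain ⟨R, hR⟩ := hc N
  rw [funext (V.repCochain_eq_sum c hR)]
  exact IsMulti.sum _ fun k _ => IsMulti.of_multilinearMap
    ((V.rep N k (c N k)).compMultilinearMap (PiTensorProduct.tprod ℝ)) fun _ => rfl

theorem isMulti_suspend {W : Type*} [AddCommGroup W] [Module ℝ W] (G : GradedSpace W) (m : ℕ)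
    {f : Cochain W} {N : ℕ} (hf : IsMulti (f N)) : IsMulti (Cochain.suspend G m f N) :=
  IsMulti.sum _ fun e _ => (hf.parts G e).smul _

theorem isMulti_decalage {W : Type*} [AddCommGroup W] [Module ℝ W] (G : GradedSpace W)
    {f : Cochain W} {N : ℕ} (hf : IsMulti (f N)) : IsMulti (Cochain.decalage G f N) :=
  IsMulti.sum _ fun e _ => (hf.parts G e).smul _

theorem isMulti_sRep {c : Fam (n + 1)} (hc : EdgeFinite c) (N : ℕ) : IsMulti (V.sRep c N) :=
  isMulti_decalage _ (isMulti_suspend _ _ (V.isMulti_repCochain hc N))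

/-- The parity of an element of `T[1]` as a function. -/
def fnPar (x : Homog V.barGrading) : ZMod 2 := ((x.deg + 1 + n : ℤ) : ZMod 2)

theorem fnPar_eq (x : Homog V.barGrading) : V.fnPar x = x.par + ((n + 1 : ℕ) : ZMod 2) := by
  rw [fnPar, Homog.par]; push_cast; ring

variable {V} in
theorem mem_piece (x : Homog V.barGrading) : x.val ∈ V.piece (x.deg + 1 + n) := x.mem

theorem hasPar_fnPar (x : Homog V.barGrading) : V.HasPar (V.fnPar x) x.val := hasPar_of_piece x.mem

/-- The suspension and decalage of an operation, on homogeneous arguments. -/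
theorem decalage_suspend_apply {f : Cochain V.Fn} {N : ℕ} (hf : IsMulti (f N))
    (w : Fin N → Homog V.barGrading) :
    Cochain.decalage V.schoutenGrading (Cochain.suspend V.schoutenGrading n f) N
        (fun i => (w i).val)
      = sg (((n + 1 : ℕ) : ZMod 2) * lsusp (List.ofFn fun i => V.fnPar (w i)))
        • f N fun i => (w i).val := by
  let u : Fin N → Homog V.schoutenGrading := fun i => ⟨(w i).val, (w i).deg + 1, (w i).mem⟩
  have h1 := sum_parts_eq u (fun e v => (∏ i : Fin N, if e i = 1 then
    (-1 : ℝ) ^ (n * (N - 1 - (i : ℕ))) else 1) • f N v) fun e => hf.smul _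
  have h2 := sum_parts_eq u (fun e v => (∏ i : Fin N, if e i = 1 then
    (-1 : ℝ) ^ (N - 1 - (i : ℕ)) else 1) • Cochain.suspend V.schoutenGrading n f N v)
    fun e => (isMulti_suspend _ n hf).smul _
  refine h2.trans ?_
  have h3 := prod_eq_lsusp 1 fun i => (u i).par
  simp only [one_mul] at h3
  refine (congrArg₂ (· • ·) h3 h1).trans ?_
  rw [prod_eq_lsusp]
  rw [smul_smul, ← sg_add]
  congr 2
  rw [Nat.cast_one, one_mul]
  have h4 := mul_lsusp_congr ((n + 1 : ℕ) : ZMod 2) (fun i => (u i).par) (fun i => V.fnPar (w i))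
    (List.finRange N) fun i _ => by
      change ((n + 1 : ℕ) : ZMod 2) * (((w i).deg + 1 : ℤ) : ZMod 2) = _ * (((w i).deg + 1 + n : ℤ) : ZMod 2)
      rw [Int.cast_add ((w i).deg + 1)]
      generalize (((w i).deg + 1 : ℤ) : ZMod 2) = x
      push_cast
      generalize (n : ZMod 2) = y
      revert x y; decide
  rw [← List.ofFn_eq_map, ← List.ofFn_eq_map] at h4
  rw [← h4]
  push_cast
  ring

theorem sRep_apply {c : Fam (n + 1)} (hc : EdgeFinite c) {N : ℕ} (w : Fin N → Homog V.barGrading) :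
    V.sRep c N (fun i => (w i).val)
      = sg (((n + 1 : ℕ) : ZMod 2) * lsusp (List.ofFn fun i => V.fnPar (w i)))
        • V.repCochain c N fun i => (w i).val :=
  V.decalage_suspend_apply (V.isMulti_repCochain hc N) w

theorem sRep_add {a b : Fam (n + 1)} (ha : EdgeFinite a) (hb : EdgeFinite b) :
    V.sRep (a + b) = V.sRep a + V.sRep b := by
  refine cochain_ext (G := V.barGrading) (V.isMulti_sRep (ha.add hb))
    (fun N => (V.isMulti_sRep ha N).add (V.isMulti_sRep hb N)) fun l => ?_
  rw [← List.ofFn_get l, hap_add, hap_ofFn, hap_ofFn, hap_ofFn, sRep_apply V (ha.add hb),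
    sRep_apply V ha, sRep_apply V hb, ← smul_add]
  congr 1
  obtain ⟨R, hR⟩ := ha l.length
  obtain ⟨S, hS⟩ := hb l.length
  have hR' : ∀ k, max R S ≤ k → a l.length k = 0 := fun k hk => hR k (le_of_max_le_left hk)
  have hS' : ∀ k, max R S ≤ k → b l.length k = 0 := fun k hk => hS k (le_of_max_le_right hk)
  rw [V.repCochain_eq_sum a hR', V.repCochain_eq_sum b hS', V.repCochain_eq_sum (a + b) (R := max R S)
    fun k hk => by rw [Pi.add_apply, Pi.add_apply, hR' k hk, hS' k hk, add_zero],
    ← Finset.sum_add_distrib]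
  refine Finset.sum_congr rfl fun k _ => ?_
  rw [Pi.add_apply, Pi.add_apply, map_add, LinearMap.add_apply]

theorem sRep_smul (r : ℝ) {a : Fam (n + 1)} (ha : EdgeFinite a) :
    V.sRep (r • a) = r • V.sRep a := by
  refine cochain_ext (G := V.barGrading) (V.isMulti_sRep (ha.smul r))
    (fun N => (V.isMulti_sRep ha N).smul r) fun l => ?_
  rw [← List.ofFn_get l, hap_smul, hap_ofFn, hap_ofFn, sRep_apply V (ha.smul r), sRep_apply V ha,
    smul_comm r]
  congr 1
  obtain ⟨R, hR⟩ := ha l.length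
  rw [V.repCochain_eq_sum a hR, V.repCochain_eq_sum (r • a) (R := R)
    fun k hk => by rw [Pi.smul_apply, Pi.smul_apply, hR k hk, smul_zero], Finset.smul_sum]
  refine Finset.sum_congr rfl fun k _ => ?_
  rw [Pi.smul_apply, Pi.smul_apply, map_smul, LinearMap.smul_apply]

theorem sRep_eq_zero {a : Fam (n + 1)} {N : ℕ} (h : ∀ k, a N k = 0) : V.sRep a N = 0 := by
  have h1 : V.repCochain a N = 0 := by
    funext w
    rw [V.repCochain_eq_sum a (R := 0) fun k _ => h k]
    rfl
  have h2 : Cochain.suspend V.schoutenGrading n (V.repCochain a) N = 0 := by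
    funext w
    simp only [Cochain.suspend, h1, Pi.zero_apply, smul_zero, Finset.sum_const_zero]
  funext w
  simp only [sRep, Cochain.decalage, h2, Pi.zero_apply, smul_zero, Finset.sum_const_zero]

theorem sRep_isCoder {p : ℤ} {c : Fam (n + 1)} (hc : c ∈ fGC (n + 1) p) (hf : EdgeFinite c) :
    IsCoder V.barGrading p (V.sRep c) where
  multi := V.isMulti_sRep hf
  zero_arity w := by rw [V.sRep_eq_zero hc.1]; rfl
  symm l₁ x y l₂ := by
    obtain ⟨N, w, i, hx, hy, h1, h2⟩ := exists_ofFn_swap l₁ x y l₂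
    rw [← h1, ← h2, hap_ofFn, hap_ofFn, sRep_apply V hf, sRep_apply V hf]
    obtain ⟨R, hR⟩ := hf (N + 1)
    rw [V.repCochain_eq_sum c hR, V.repCochain_eq_sum c hR, Finset.smul_sum, Finset.smul_sum,
      Finset.smul_sum]
    refine Finset.sum_congr rfl fun k _ => ?_
    have h3 := V.rep_swap (c (N + 1) k) i (fun j => V.hasPar_fnPar (w j))
    rw [hc.2.2] at h3
    have h4 : (fun j => ((w ∘ Equiv.swap i.castSucc i.succ) j).val)
        = (fun j => (w j).val) ∘ Equiv.swap i.castSucc i.succ := rfl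
    have h5 : (((Equiv.Perm.sign (Equiv.swap i.castSucc i.succ) : ℤˣ) : ℤ) : ℝ) ^ (n + 1)
        = sg ((n + 1 : ℕ) : ZMod 2) := by
      rw [Equiv.Perm.sign_swap (Fin.castSucc_lt_succ).ne, sg_natCast]; simp
    have h6 : ∀ v : Fin (N + 1) → Homog V.barGrading, (List.ofFn fun j => V.fnPar (v j))
        = (List.ofFn v).map V.fnPar := fun v => by rw [List.map_ofFn]; rfl
    rw [h4, h3, h5, map_smul, LinearMap.smul_apply, smul_smul, smul_smul, smul_smul, h6, h6, h1, h2,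
      hx, hy, List.map_append, List.map_append]
    simp only [List.map_cons]
    rw [lsusp_swap]
    congr 1
    simp only [← sg_add]
    congr 1
    have hx' : x.par = V.fnPar x + ((n + 1 : ℕ) : ZMod 2) := by
      rw [fnPar_eq]; generalize ((n + 1 : ℕ) : ZMod 2) = d; generalize x.par = z; revert d z; decide
    have hy' : y.par = V.fnPar y + ((n + 1 : ℕ) : ZMod 2) := by
      rw [fnPar_eq]; generalize ((n + 1 : ℕ) : ZMod 2) = d; generalize y.par = z; revert d z; decide
    rw [hx', hy']
    generalize ((n + 1 : ℕ) : ZMod 2) = d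
    generalize lsusp _ = e
    generalize V.fnPar x = x
    generalize V.fnPar y = y
    revert d e x y
    decide
  deg l := by
    obtain ⟨R, hR⟩ := hf l.length
    rw [← List.ofFn_get l, hap_ofFn, sRep_apply V hf, V.repCochain_eq_sum c hR]
    refine Submodule.smul_mem _ _ (Submodule.sum_mem _ fun k _ => ?_)
    by_cases h0 : c l.length k = 0
    · rw [h0, map_zero]; exact Submodule.zero_mem _
    have h1 := V.rep_mem (c l.length k) fun i => mem_piece (l.get i)
    have h2 := hc.2.1 _ _ h0
    have h3 : (List.map Homog.deg (List.ofFn l.get)).sum = ∑ i, (l.get i).deg := by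
      rw [List.map_ofFn, List.sum_ofFn]; rfl
    change _ ∈ V.piece (_ + 1 + n)
    rw [h3]
    have h4 : ∑ i, ((l.get i).deg + 1 + (n : ℤ)) - n * k = ∑ i, (l.get i).deg + p + 1 + n := by
      rw [Finset.sum_add_distrib, Finset.sum_add_distrib]
      simp only [Finset.sum_const, Finset.card_univ, Fintype.card_fin, nsmul_eq_mul]
      rw [← h2]; push_cast; ring
    rwa [h4] at h1

end NPDomain

theorem sum_range_antidiagonal {M : Type*} [AddCommMonoid M] (X : ℕ → ℕ → M) {R S : ℕ}
    (hR : ∀ j k, R ≤ j → X j k = 0) (hS : ∀ j k, S ≤ k → X j k = 0) :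
    ∑ K ∈ Finset.range (R + S), ∑ j : Fin (K + 1), X j (K - j)
      = ∑ j ∈ Finset.range R, ∑ k ∈ Finset.range S, X j k := by
  have h1 : ∀ K, ∑ j : Fin (K + 1), X j (K - j) = ∑ j ∈ Finset.range (K + 1), X j (K - j) :=
    fun K => (Finset.sum_range fun j => X j (K - j)).symm
  simp only [h1]
  rw [Finset.sum_range_diag_flip]
  symm
  refine Finset.sum_subset_zero_on_sdiff (Finset.range_mono (Nat.le_add_right R S)) ?_ ?_
  · intro j hj
    rw [Finset.mem_sdiff, Finset.mem_range, Finset.mem_range, not_lt] at hj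
    exact Finset.sum_eq_zero fun k _ => hR j k hj.2
  · intro j hj
    rw [Finset.mem_range] at hj
    refine Finset.sum_subset_zero_on_sdiff (Finset.range_mono (by omega)) ?_ fun _ _ => rfl
    intro k hk
    rw [Finset.mem_sdiff, Finset.mem_range, Finset.mem_range, not_lt] at hk
    exact hS j k hk.2

theorem EdgeFinite.preLie {d : ℕ} {a b : Fam d} (ha : EdgeFinite a) (hb : EdgeFinite b) :
    EdgeFinite (preLie d a b) := fun L => by
  obtain ⟨R, hR⟩ := ha.exists_bound (L + 1)
  obtain ⟨S, hS⟩ := hb.exists_bound L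
  refine ⟨R + S, fun K hK => ?_⟩
  rw [preLie_apply]
  refine Finset.sum_eq_zero fun B _ => ?_
  rw [Finset.sum_eq_zero, smul_zero]
  intro j _
  have h1 : B.card ≤ L := by simpa using B.card_le_univ
  have h2 : Bᶜ.card ≤ L := by simpa using Bᶜ.card_le_univ
  by_cases hj : R ≤ (j : ℕ)
  · rw [hR _ (by omega) _ hj, map_zero, LinearMap.zero_apply]
  · rw [hS _ h1 (K - j) (by omega), map_zero]

namespace NPDomain
variable {n : ℕ} (V : NPDomain n)

/-- The value of a graph on homogeneous functions, as an element of `T[1]`. -/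
def repHomog {N k : ℕ} (γ : Gra (n + 1) N k) (w : Fin N → Homog V.barGrading) :
    Homog V.barGrading :=
  ⟨V.rep N k γ (PiTensorProduct.tprod ℝ fun i => (w i).val),
    ∑ i, ((w i).deg + 1 + n) - n * k - n - 1, by
      have h1 := V.rep_mem γ fun i => mem_piece (w i)
      have h2 : ∑ i, ((w i).deg + 1 + (n : ℤ)) - n * k - n - 1 + 1 + n
          = ∑ i, ((w i).deg + 1 + (n : ℤ)) - n * k := by ring
      rw [← h2] at h1
      exact h1⟩

theorem mul_fnPar_repHomog {N k : ℕ} (γ : Gra (n + 1) N k) (w : Fin N → Homog V.barGrading) :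
    ((n + 1 : ℕ) : ZMod 2) * V.fnPar (V.repHomog γ w)
      = ((n + 1 : ℕ) : ZMod 2) * (List.ofFn fun i => V.fnPar (w i)).sum := by
  have h1 : V.fnPar (V.repHomog γ w) = ∑ i, V.fnPar (w i) + (n : ZMod 2) * k := by
    change ((∑ i, ((w i).deg + 1 + (n : ℤ)) - n * k - n - 1 + 1 + n : ℤ) : ZMod 2) = _
    have h2 : ∑ i, ((w i).deg + 1 + (n : ℤ)) - n * k - n - 1 + 1 + n
        = ∑ i, ((w i).deg + 1 + (n : ℤ)) - n * k := by ring
    rw [h2, Int.cast_sub, Int.cast_sum, sub_eq_add_neg, ZMod.neg_eq_self_mod_two]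
    push_cast
    congr 1
    exact Finset.sum_congr rfl fun i _ => by rw [fnPar]; push_cast; rfl
  have h3 : ((n + 1 : ℕ) : ZMod 2) * (n : ZMod 2) = 0 := by
    push_cast; generalize (n : ZMod 2) = x; revert x; decide
  rw [h1, mul_add, ← mul_assoc, h3, zero_mul, add_zero, List.sum_ofFn]

/-- A term of the Nijenhuis-Richardson product of two operations given by graphs. -/
theorem sRep_preLie_term {a b : Fam (n + 1)} (ha : EdgeFinite a) (hb : EdgeFinite b) {L R S : ℕ}
    (hR : ∀ N ≤ L + 1, ∀ k, R ≤ k → a N k = 0) (hS : ∀ N ≤ L, ∀ k, S ≤ k → b N k = 0)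
    (w : Fin L → Homog V.barGrading) (B : Finset (Fin L)) :
    koszul (blockOf B) (fun i => (w i).par) • V.sRep a (Bᶜ.card + 1)
        (Fin.cons (V.sRep b B.card ((fun i => (w i).val) ∘ B.orderEmbOfFin rfl))
          ((fun i => (w i).val) ∘ Bᶜ.orderEmbOfFin rfl))
      = sg (((n + 1 : ℕ) : ZMod 2) * lsusp (List.ofFn fun i => V.fnPar (w i))) •
        koszul (blockOf B) (fun _ => ((n + 1 : ℕ) : ZMod 2)) •
        ∑ j ∈ Finset.range R, ∑ k ∈ Finset.range S, koszul (blockOf B) (fun i => V.fnPar (w i)) •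
          V.rep (Bᶜ.card + 1) j (a (Bᶜ.card + 1) j) (PiTensorProduct.tprod ℝ
            (Fin.cons (V.rep B.card k (b B.card k) (PiTensorProduct.tprod ℝ
              ((fun i => (w i).val) ∘ B.orderEmbOfFin rfl)))
            ((fun i => (w i).val) ∘ Bᶜ.orderEmbOfFin rfl) : Fin (Bᶜ.card + 1) → V.Fn)) := by
  have hB : B.card ≤ L := by simpa using B.card_le_univ
  have hBc : Bᶜ.card + 1 ≤ L + 1 := by simpa using Bᶜ.card_le_univ
  obtain ⟨T, hT⟩ := V.isMulti_sRep ha (Bᶜ.card + 1)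
    (Fin.cons 0 ((fun i => (w i).val) ∘ Bᶜ.orderEmbOfFin rfl)) 0
  simp only [Fin.update_cons_zero] at hT
  have h1 : V.sRep b B.card ((fun i => (w i).val) ∘ B.orderEmbOfFin rfl)
      = sg (((n + 1 : ℕ) : ZMod 2) * lsusp (List.ofFn fun i => V.fnPar ((w ∘ B.orderEmbOfFin rfl) i)))
        • ∑ k ∈ Finset.range S, V.rep B.card k (b B.card k) (PiTensorProduct.tprod ℝ
          ((fun i => (w i).val) ∘ B.orderEmbOfFin rfl)) := by
    rw [← V.repCochain_eq_sum b (hS _ hB)]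
    exact sRep_apply V hb (w ∘ B.orderEmbOfFin rfl)
  have h2 : ∀ k, T (V.rep B.card k (b B.card k) (PiTensorProduct.tprod ℝ
        ((fun i => (w i).val) ∘ B.orderEmbOfFin rfl)))
      = sg (((n + 1 : ℕ) : ZMod 2) * (Bᶜ.card * (List.ofFn fun i => V.fnPar ((w ∘ B.orderEmbOfFin rfl) i)).sum
          + lsusp (List.ofFn fun i => V.fnPar ((w ∘ Bᶜ.orderEmbOfFin rfl) i)))) •
        ∑ j ∈ Finset.range R, V.rep (Bᶜ.card + 1) j (a (Bᶜ.card + 1) j) (PiTensorProduct.tprod ℝ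
            (Fin.cons (V.rep B.card k (b B.card k) (PiTensorProduct.tprod ℝ
              ((fun i => (w i).val) ∘ B.orderEmbOfFin rfl)))
            ((fun i => (w i).val) ∘ Bᶜ.orderEmbOfFin rfl) : Fin (Bᶜ.card + 1) → V.Fn)) := by
    intro k
    have h3 := sRep_apply V ha (Fin.cons (V.repHomog (b B.card k) (w ∘ B.orderEmbOfFin rfl))
      (w ∘ Bᶜ.orderEmbOfFin rfl) : Fin (Bᶜ.card + 1) → Homog V.barGrading)
    have e2 : (fun i => ((Fin.cons (V.repHomog (b B.card k) (w ∘ B.orderEmbOfFin rfl))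
      (w ∘ Bᶜ.orderEmbOfFin rfl) : Fin (Bᶜ.card + 1) → Homog V.barGrading) i).val)
        = Fin.cons (V.rep B.card k (b B.card k) (PiTensorProduct.tprod ℝ
              ((fun i => (w i).val) ∘ B.orderEmbOfFin rfl)))
            ((fun i => (w i).val) ∘ Bᶜ.orderEmbOfFin rfl) := by
      funext i
      refine Fin.cases rfl (fun i => rfl) i
    rw [e2, V.repCochain_eq_sum a (hR _ hBc)] at h3
    rw [← hT, h3]
    congr 2
    rw [List.ofFn_succ, lsusp, List.length_ofFn, Fin.cons_zero, mul_add, mul_left_comm,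
      mul_fnPar_repHomog, mul_left_comm, ← mul_add]
    rfl
  rw [hT, h1, map_smul, map_sum, Finset.sum_congr rfl fun k _ => h2 k, ← Finset.smul_sum,
    Finset.sum_comm, smul_smul, smul_smul]
  simp only [← Finset.smul_sum]
  rw [smul_smul, smul_smul]
  congr 1
  have h4 := koszul_lsusp ((n + 1 : ℕ) : ZMod 2) (fun i => V.fnPar (w i)) (· ∈ B)
  have h5 : (fun i => V.fnPar (w i) + ((n + 1 : ℕ) : ZMod 2)) = fun i => (w i).par := by
    funext i
    rw [fnPar_eq]; generalize ((n + 1 : ℕ) : ZMod 2) = d; generalize (w i).par = z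
    revert d z; decide
  have h6 : ∀ C : Finset (Fin L), (List.ofFn fun i => V.fnPar ((w ∘ C.orderEmbOfFin rfl) i))
      = blk (· ∈ C) fun i => V.fnPar (w i) := fun C => ofFn_orderEmb C fun i => V.fnPar (w i)
  have h7 : blk (fun i => ¬ i ∈ B) (fun i => V.fnPar (w i))
      = blk (· ∈ Bᶜ) fun i => V.fnPar (w i) := blk_congr (fun i => Finset.mem_compl.symm) _
  have h8 : (blk (· ∈ Bᶜ) fun i => V.fnPar (w i)).length = Bᶜ.card := by
    rw [← h6, List.length_ofFn]
  rw [h5, h7, h8] at h4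
  rw [h6, h6, mul_assoc, ← sg_add, ← mul_add]
  have h9 : ∀ x y z : ZMod 2, x + (z + y) = x + y + z := by decide
  rw [h9]
  refine h4.symm.trans ?_
  rw [mul_comm, mul_assoc]
  rfl

theorem sRep_preLie {a b : Fam (n + 1)} (ha : EdgeFinite a) (hb : EdgeFinite b) :
    V.sRep (preLie (n + 1) a b) = Cochain.preLie V.barGrading (V.sRep a) (V.sRep b) := by
  refine cochain_ext (G := V.barGrading) (V.isMulti_sRep (ha.preLie hb))
    (isMulti_preLie (V.isMulti_sRep ha) (V.isMulti_sRep hb)) fun l => ?_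
  rw [← List.ofFn_get l]
  generalize l.get = w
  generalize l.length = L at w
  obtain ⟨R, hR⟩ := ha.exists_bound (L + 1)
  obtain ⟨S, hS⟩ := hb.exists_bound L
  rw [hap_ofFn, hap_ofFn, sRep_apply V (ha.preLie hb)]
  refine Eq.trans ?_ (sum_parts_eq w (fun e v => ∑ B : Finset (Fin L) with B.Nonempty,
    koszul (blockOf B) e • V.sRep a (Bᶜ.card + 1) (Fin.cons (V.sRep b B.card
      (v ∘ B.orderEmbOfFin rfl)) (v ∘ Bᶜ.orderEmbOfFin rfl))) fun e => IsMulti.sum _ fun B _ =>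
        (IsMulti.preLieTerm (V.isMulti_sRep ha) (V.isMulti_sRep hb) B).smul _).symm
  have h0 : ∀ K, R + S ≤ K → preLie (n + 1) a b L K = 0 := by
    intro K hK
    rw [preLie_apply]
    refine Finset.sum_eq_zero fun B _ => ?_
    rw [Finset.sum_eq_zero, smul_zero]
    intro j _
    have h1 : B.card ≤ L := by simpa using B.card_le_univ
    have h2 : Bᶜ.card ≤ L := by simpa using Bᶜ.card_le_univ
    by_cases hj : R ≤ (j : ℕ)
    · rw [hR _ (by omega) _ hj, map_zero, LinearMap.zero_apply]
    · rw [hS _ h1 (K - j) (by omega), map_zero]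
  rw [V.repCochain_eq_sum _ h0, Finset.sum_congr rfl fun B _ => V.sRep_preLie_term ha hb hR hS w B,
    ← Finset.smul_sum]
  congr 1
  simp only [preLie_apply, map_sum, map_smul, LinearMap.sum_apply, LinearMap.smul_apply]
  rw [Finset.sum_comm]
  refine Finset.sum_congr rfl fun B _ => ?_
  rw [← Finset.smul_sum]
  congr 1
  have hB : B.card ≤ L := by simpa using B.card_le_univ
  have hBc : Bᶜ.card + 1 ≤ L + 1 := by simpa using Bᶜ.card_le_univ
  rw [← sum_range_antidiagonal]
  · refine Finset.sum_congr rfl fun K _ => Finset.sum_congr rfl fun j _ => ?_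
    exact V.rep_insertGraph B _ _ _ fun i => V.hasPar_fnPar (w i)
  · intro j k hj
    rw [hR _ hBc j hj, map_zero, LinearMap.zero_apply, smul_zero]
  · intro j k hk
    rw [hS _ hB k hk, map_zero, LinearMap.zero_apply]
    rw [MultilinearMap.map_coord_zero _ 0 rfl, map_zero, smul_zero]

end NPDomain

namespace NPDomain
variable {n : ℕ} (V : NPDomain n)

theorem rep_edge (f : Fin 2 → V.Fn) :
    V.rep 2 1 (graphClass (n + 1) fun _ => (0, 1)) (PiTensorProduct.tprod ℝ f)
      = V.poisson (f 0) (f 1) := by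
  rw [rep_graphClass, LinearMap.comp_apply, edgesOp]
  simp only [List.ofFn_succ, List.ofFn_zero, List.prod_cons, List.prod_nil, mul_one, edgeOp,
    LinearMap.sum_apply, map_sum, LinearMap.smul_apply, map_smul, Module.End.mul_apply, poisson]
  refine Finset.sum_congr rfl fun I _ => Finset.sum_congr rfl fun J _ => ?_
  rw [slotDeriv_eq, slotDeriv_eq, slotOp_tprod, slotOp_tprod, mulN_tprod]
  simp [List.ofFn_succ]

theorem repCochain_edgeGraph : V.repCochain (edgeGraph (n + 1)) = V.poissonCochain := by
  funext N f
  have h : ∀ k, 2 ≤ k → edgeGraph (n + 1) N k = 0 := fun k hk => edgeGraph_of_ne (Or.inr (by omega))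
  rw [V.repCochain_eq_sum _ h, Finset.sum_range_succ, Finset.sum_range_one,
    edgeGraph_of_ne (Or.inr (by omega)), map_zero, LinearMap.zero_apply, zero_add]
  by_cases hN : N = 2
  · subst hN
    exact V.rep_edge f
  · rw [edgeGraph_of_ne (Or.inl hN), map_zero, LinearMap.zero_apply]
    unfold poissonCochain
    split
    · exact absurd rfl hN
    · rfl

theorem Q_eq_sRep : V.Q = V.sRep (edgeGraph (n + 1)) := by
  rw [Q, schouten, sRep, repCochain_edgeGraph]

end NPDomain

theorem preLie_arity_eq_zero {W : Type*} [AddCommGroup W] [Module ℝ W] (G : GradedSpace W)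
    {f D : Cochain W} (hf : ∀ N, IsMulti (f N)) {M : ℕ} (hD : ∀ N ≤ M, D N = 0) :
    Cochain.preLie G f D M = 0 := by
  funext w
  refine Finset.sum_eq_zero fun e _ => Finset.sum_eq_zero fun B _ => ?_
  have hB : B.card ≤ M := by simpa using B.card_le_univ
  rw [hD _ hB, (hf _).eq_zero (i := 0) rfl, smul_zero]

namespace NPDomain
variable {n : ℕ} (V : NPDomain n)

/-- Graphs act by coderivations compatibly with the brackets. -/
theorem coEnd_sRep_bracket {p q r : ℤ} {a b : Fam (n + 1)} (ha : EdgeFinite a) (hb : EdgeFinite b)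
    (hA : IsCoder V.barGrading p (V.sRep a)) (hB : IsCoder V.barGrading q (V.sRep b))
    (h : IsCoder V.barGrading r (V.sRep (bracket (n + 1) p q a b))) :
    coEnd h = coEnd hB * coEnd hA - sg ((p : ZMod 2) * q) • (coEnd hA * coEnd hB) := by
  have hBA : IsCoder V.barGrading (p + q) (Cochain.preLie V.barGrading (V.sRep b) (V.sRep a)) := by
    rw [add_comm]; exact hB.preLie hA
  have h1 : V.sRep (bracket (n + 1) p q a b)
      = Cochain.preLie V.barGrading (V.sRep a) (V.sRep b)
        + (-sg ((p : ZMod 2) * q)) • Cochain.preLie V.barGrading (V.sRep b) (V.sRep a) := by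
    rw [bracket_apply, sub_eq_add_neg, ← neg_smul,
      sRep_add V (ha.preLie hb) ((hb.preLie ha).smul _), sRep_smul V _ (hb.preLie ha),
      sRep_preLie V ha hb, sRep_preLie V hb ha]
  rw [coEnd_commutator hA hB, coEnd_congr h ((hA.preLie hB).add (hBA.smul _)) h1,
    coEnd_add (hA.preLie hB) (hBA.smul _), coEnd_smul hBA, neg_smul, ← sub_eq_add_neg, coEnd_congr hBA (hB.preLie hA) rfl]

theorem edgeFinite_coe (a : cocycles (n + 1)) : EdgeFinite (a : Fam (n + 1)) :=
  edgeFinite_cocycle (by omega) a.2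

theorem isCoder_cocycle (a : cocycles (n + 1)) : IsCoder V.barGrading 0 (V.sRep a) :=
  V.sRep_isCoder a.2.1 (edgeFinite_coe a)

theorem sRep_cocycle_one (a : cocycles (n + 1)) : V.sRep a 1 = 0 :=
  V.sRep_eq_zero fun k => cocycle_one a.2 k

theorem isCoder_edgeGraph : IsCoder V.barGrading 1 (V.sRep (edgeGraph (n + 1))) :=
  V.sRep_isCoder (edgeGraph_mem _) (edgeFinite_edgeGraph _)

theorem isCoder_Q : IsCoder V.barGrading 1 V.Q := by
  rw [Q_eq_sRep]; exact V.isCoder_edgeGraph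

theorem Q_of_ne {N : ℕ} (hN : N ≠ 2) : V.Q N = 0 := by
  rw [Q_eq_sRep]
  exact V.sRep_eq_zero fun k => edgeGraph_of_ne (Or.inl hN)

/-- Cocycles act by coderivations. -/
def coRep : cocycles (n + 1) →ₗ[ℝ] Module.End ℝ (SymCo V.barGrading) where
  toFun a := coEnd (V.isCoder_cocycle a)
  map_add' a b := by
    rw [← coEnd_add]
    exact coEnd_congr _ _ (V.sRep_add (edgeFinite_coe a) (edgeFinite_coe b))
  map_smul' r a := by
    rw [RingHom.id_apply, ← coEnd_smul]
    exact coEnd_congr _ _ (V.sRep_smul r (edgeFinite_coe a))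

theorem coRep_coBracket (a b : cocycles (n + 1)) :
    V.coRep (coBracket a b) = V.coRep b * V.coRep a - V.coRep a * V.coRep b := by
  have h := V.coEnd_sRep_bracket (edgeFinite_coe a) (edgeFinite_coe b) (V.isCoder_cocycle a)
    (V.isCoder_cocycle b) (V.isCoder_cocycle (coBracket a b))
  rw [Int.cast_zero, zero_mul, sg_zero, one_smul] at h
  exact h

theorem coRep_commute (a : cocycles (n + 1)) :
    coEnd (V.isCoder_cocycle a) * coEnd V.isCoder_Q = coEnd V.isCoder_Q * coEnd (V.isCoder_cocycle a) := by
  have h0 : bracket (n + 1) 1 0 (edgeGraph (n + 1)) a = 0 := LinearMap.mem_ker.1 a.2.2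
  have h1 : IsCoder V.barGrading 0 (V.sRep (bracket (n + 1) 1 0 (edgeGraph (n + 1)) a)) := by
    rw [h0]; exact V.isCoder_cocycle 0
  have h := V.coEnd_sRep_bracket (edgeFinite_edgeGraph _) (edgeFinite_coe a) V.isCoder_edgeGraph
    (V.isCoder_cocycle a) h1
  have h2 : coEnd h1 = 0 := by
    rw [coEnd_congr h1 (V.isCoder_cocycle 0) (by rw [h0]; rfl)]
    exact map_zero V.coRep
  rw [h2, Int.cast_zero, mul_zero, sg_zero, one_smul] at h
  rw [coEnd_congr V.isCoder_Q V.isCoder_edgeGraph V.Q_eq_sRep]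
  exact (sub_eq_zero.1 h.symm)

theorem expRep_zero : V.expRep 0 = Cochain.identity := by
  have h1 := coExpOn_isExp (V.isCoder_cocycle 0) (V.sRep_cocycle_one 0)
  have h2 : coEnd (V.isCoder_cocycle 0) = 0 := map_zero V.coRep
  rw [h2] at h1
  have h3 := exp_eq (V.isCoder_cocycle 0) (V.sRep_cocycle_one 0)
  rw [SepFiltration.IsExp.zero symCo_arityComplete.sepFiltration h1] at h3
  exact h3

theorem expRep_bch (a b : cocycles (n + 1)) :
    V.expRep (bch (n + 1) a b) = Cochain.comp V.barGrading (V.expRep a) (V.expRep b) := by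
  have hc := V.isCoder_cocycle (coBch a b)
  have hc1 := V.sRep_cocycle_one (coBch a b)
  refine (exp_eq hc hc1).trans ?_
  rw [expRep, expRep, comp_exp_exp (V.isCoder_cocycle a) (V.sRep_cocycle_one a)
    (V.isCoder_cocycle b) (V.sRep_cocycle_one b)]
  refine congrArg SymCo.val ?_
  refine SepFiltration.IsExp.bch symCo_arityComplete.sepFiltration
    (coEnd_raises _ (V.sRep_cocycle_one a)) (coEnd_raises _ (V.sRep_cocycle_one b))
    (coEnd_raises hc hc1) (fun N f => ?_) (coExpOn_isExp _ (V.sRep_cocycle_one a))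
    (coExpOn_isExp _ (V.sRep_cocycle_one b)) (coExpOn_isExp hc hc1) _
  have h1 : ∀ m, dynkin (fun x y => y * x - x * y) (V.coRep a) (V.coRep b) m
      = V.coRep (dynkin coBracket a b m) := fun m =>
    (map_dynkin coBracket _ V.coRep (fun _ => True) (fun _ _ _ _ => trivial)
      (fun x y _ _ => V.coRep_coBracket x y) trivial trivial m).symm
  have h2 : V.coRep (coBch a b) f - ∑ m ∈ Finset.range N,
      dynkin (fun x y => y * x - x * y) (V.coRep a) (V.coRep b) m f
      = V.coRep (coBch a b - ∑ m ∈ Finset.range N, dynkin coBracket a b m) f := by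
    simp only [h1]
    rw [← LinearMap.sum_apply, ← map_sum, ← LinearMap.sub_apply, ← map_sub]
  refine h2.symm ▸ ?_
  rw [mem_arityFilt]
  intro M hM
  have h3 := coEnd_val (V.isCoder_cocycle (coBch a b - ∑ m ∈ Finset.range N, dynkin coBracket a b m)) f
  refine (congrFun h3 M).trans (preLie_arity_eq_zero _ f.multi fun K hK => ?_)
  exact V.sRep_eq_zero fun k => congrFun (coBch_sub_sum a b N K (hK.trans hM.le)) k

theorem homotopic_of_mk_eq {a b : cocycles (n + 1)} (h : H0.mk a = H0.mk b) :
    Cochain.Homotopic V.barGrading V.Q (V.expRep a) (V.expRep b) := by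
  obtain ⟨η, hη, h1⟩ := (H0.mk_eq_iff b a).1 h.symm
  have hf : EdgeFinite η := edgeFinite_neg_one (by omega) hη
  have hE := V.sRep_isCoder hη hf
  refine homotopic_exp (V.isCoder_cocycle a) (V.sRep_cocycle_one a) (V.isCoder_cocycle b)
    (V.sRep_cocycle_one b) hE V.isCoder_Q (fun N hN => V.Q_of_ne hN) (V.coRep_commute a)
    (V.coRep_commute b) ?_
  have h2 : bracket (n + 1) 1 (-1) (edgeGraph (n + 1)) η = (b - a : cocycles (n + 1)) := h1
  have h3 : IsCoder V.barGrading 0 (V.sRep (bracket (n + 1) 1 (-1) (edgeGraph (n + 1)) η)) := by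
    rw [h2]; exact V.isCoder_cocycle (b - a)
  have h4 := V.coEnd_sRep_bracket (edgeFinite_edgeGraph _) hf V.isCoder_edgeGraph hE h3
  have h5 : coEnd h3 = coEnd (V.isCoder_cocycle b) - coEnd (V.isCoder_cocycle a) := by
    rw [coEnd_congr h3 (V.isCoder_cocycle (b - a)) (by rw [h2])]
    exact map_sub V.coRep b a
  have h6 : sg (((1 : ℤ) : ZMod 2) * ((-1 : ℤ) : ZMod 2)) = -1 := by
    rw [← Int.cast_mul, sg_intCast]; norm_num
  rw [coEnd_congr V.isCoder_Q V.isCoder_edgeGraph V.Q_eq_sRep, ← h5, h4, h6, neg_one_smul,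
    sub_neg_eq_add, add_comm]

end NPDomain
end GraphCx

end

theorem mainTheorem5 (n : ℕ) :
    ∃ hB : ∀ a b : cocycles (n + 1), bch (n + 1) a b ∈ cocycles (n + 1),
      (∀ (a b : cocycles (n + 1)) (N k : ℕ), {m | bchTerm (n + 1) a b m N k ≠ 0}.Finite) ∧
      (∃ _ : Group (H0 (n + 1)),
        (∀ a b : cocycles (n + 1), H0.mk a * H0.mk b = H0.mk ⟨bch (n + 1) a b, hB a b⟩) ∧
        (1 : H0 (n + 1)) = 0 ∧ ∀ g : H0 (n + 1), g⁻¹ = -g) ∧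
      ∀ V : NPDomain n,
        (∀ (a : cocycles (n + 1)) (N : ℕ),
          {j | Cochain.expTerm V.barGrading (V.sRep a) j N ≠ 0}.Finite) ∧
        (∀ a : cocycles (n + 1), Cochain.IsAut V.barGrading V.Q (V.expRep a)) ∧
        V.expRep 0 = Cochain.identity ∧
        (∀ a b : cocycles (n + 1),
          V.expRep (bch (n + 1) a b) = Cochain.comp V.barGrading (V.expRep a) (V.expRep b)) ∧
        ∀ a b : cocycles (n + 1), H0.mk a = H0.mk b →
          Cochain.Homotopic V.barGrading V.Q (V.expRep a) (V.expRep b) := by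
  refine ⟨fun a b => bch_mem a.2 b.2, finite_bchTerm, exists_bchGroup _, fun V => ⟨fun a N => ?_,
    fun a => isAut_exp (V.isCoder_cocycle a) (V.sRep_cocycle_one a) V.isCoder_Q
      (V.Q_of_ne (by norm_num)) (V.coRep_commute a), V.expRep_zero, V.expRep_bch,
    fun a b => V.homotopic_of_mk_eq⟩⟩
  refine (Set.finite_Iic N).subset fun j hj => ?_
  by_contra h
  exact hj (expTerm_eq_zero (V.isCoder_cocycle a) (V.sRep_cocycle_one a) (not_le.1 h))
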